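/- **Noetherian invariant completeness.** *Term language.* Let $h_1,\dots,h_r:\mathbb R^k\to\mathbb R$ be a Noetherian chain: each $h_j$ is real analytic on $\mathbb R^k$ and $\partial h_j/\partial y_i(y)=q_{ij}(y,h_1(y),\dots,h_r(y))$ for polynomials $q_{ij}$ whose coefficients are denoted by closed terms of the language. Extended terms are built from variables, rational constants, $+$, $\cdot$, the function symbols $h_j$ and differentials $(e)'$. Terms $e$, right-hand sides $f$, and formulas $P,Q$ below are differential-free (without $(\cdot)'$ and without differential variables $x'$). A *semianalytic* formula is a Boolean combination of comparisons $=,\ge,>$ of terms; it is *analytic* if it is built from equations with $\wedge,\vee$ only. For a system $x'=f$ (distinct variables $x_1,\dots,x_n$) and a semianalytic domain $Q$, $[x'=f\,\&\,Q]\varphi$ says that $\varphi$ holds at the end of all solutions on $[0,T]$, $T\ge 0$, that stay in $Q$, and $P$ is an *invariant* of $x'=f\,\&\,Q$ if $P\to[x'=f\,\&\,Q]P$ is valid. *Calculus.* $\vdash$ is provability in the sequent calculus of differential dynamic logic for assignments and differential equations: classical first-order rules, the substitution instances of valid formulas of first-order real arithmetic, congruence of equality for the $h_j$, the axioms $\langle\cdot\rangle$,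 K, V, assignment, the ODE Barcan axiom and the rule G, the differential axioms for constants, variables, sums, products and $h_j$ (with $(h_j(e_1,\dots,e_k))'=\sum_i q_{ij}(e,h(e))\cdot(e_i)'$), differential effect, weakening, skip, modus ponens, invariants, cuts and ghosts (DE, DW, DX, DMP, DI, DC, DG), uniqueness (Uniq), continuous existence (Cont), differential adjoints (Dadj), and real induction with domain constraint (RI&); Cont and RI& apply only to systems that contain a clock $x_1'=c$, $c\ne0$. *Notation.* $\mathcal L$ is the syntactic Lie derivative along $x'=f$. A number $N\ge1$ is a *rank* of $e$ along $x'=f$ if $\vdash\mathcal L^Ne=\sum_{i<N}g_i\,\mathcal L^ie$ for some terms $g_i$. For $e$ with rank $N$ put $$\mathrm{rad}(e)\equiv\bigwedge_{i<N}\mathcal L^ie=0,\qquad \mathrm{prog}_>(e)\equiv\bigwedge_{i<N-1}\Big(\bigwedge_{j<i}\mathcal L^je=0\to\mathcal L^ie\ge0\Big)\wedge\Big(\bigwedge_{j<N-1}\mathcal L^je=0\to\mathcal L^{N-1}e>0\Big),$$ $\mathrm{prog}_\ge(e)\equiv\mathrm{prog}_>(e)\vee\mathrm{rad}(e)$. A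 *normal form* of $P$ is a formula $\bigvee_i(\bigwedge_j e_{ij}\ge0\wedge\bigwedge_j\tilde e_{ij}>0)$ provably equivalent to $P$, and then $\mathrm{prog}_f(P)\equiv\bigvee_i(\bigwedge_j\mathrm{prog}_\ge(e_{ij})\wedge\bigwedge_j\mathrm{prog}_>(\tilde e_{ij}))$; $\mathrm{prog}_{-f}(P)$ is the same along $x'=-f$. *Statement.* For every such language, all systems $x'=f$ and all $P,Q,e$ as above: 1. $e$ has a rank along $x'=f$; every semianalytic formula has a normal form; for every analytic $P$ there is a term $e$ with $\vdash P\leftrightarrow e=0$. 2. (Analytic completeness.) If $P$ is analytic, $\vdash P\leftrightarrow e=0$, and $Q$ is semianalytic, then for every choice of ranks and of a normal form of $Q$, $$\vdash[x'=f\,\&\,Q]P\leftrightarrow\big(Q\to e=0\wedge(\mathrm{prog}_f(Q)\to\mathrm{rad}(e))\big);$$ if $Q$ is built from strict inequalities with $\wedge,\vee$, also $\vdash[x'=f\,\&\,Q]P\leftrightarrow(Q\to\mathrm{rad}(e))$. 3. (Semianalytic completeness.) If $P,Q$ are semianalytic, then for every choice of ranks along $x'=f$ and $x'=-f$ and of normal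 forms of $P$, $\neg P$, $Q$, $$\vdash\forall x(P\to[x'=f\,\&\,Q]P)\leftrightarrow\forall x(P\wedge Q\wedge\mathrm{prog}_f(Q)\to\mathrm{prog}_f(P))\wedge\forall x(\neg P\wedge Q\wedge\mathrm{prog}_{-f}(Q)\to\mathrm{prog}_{-f}(\neg P)),$$ and without domain $\vdash\forall x(P\to[x'=f]P)\leftrightarrow\forall x(P\to\mathrm{prog}_f(P))\wedge\forall x(\neg P\to\mathrm{prog}_{-f}(\neg P))$. 4. Consequently, whenever a semianalytic (in particular, an analytic) $P$ is an invariant of $x'=f\,\&\,Q$ with $Q$ semianalytic, the formula $P\to[x'=f\,\&\,Q]P$ is derivable in the calculus from valid semianalytic formulas. -/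

import Mathlib

namespace DL

/-- Variables of differential dynamic logic: base variables and, for every variable `x`, the
differential variable `x'`. -/
inductive Var : Type where
  | base : ℕ → Var
  | prime : Var → Var
  deriving DecidableEq

/-- Extended terms over `r` fixed function symbols of arity `k`, including differentials `(e)'`. -/
inductive Term (k r : ℕ) : Type where
  | var : Var → Term k r
  | const : ℚ → Term k r
  | add : Term k r → Term k r → Term k r
  | mul : Term k r → Term k r → Term k r
  | app : Fin r → (Fin k → Term k r) → Term k r
  | diff : Term k r → Term k r

/-- States assign a real number to every variable. -/
abbrev State : Type := Var → ℝ

namespace Term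

variable {k r : ℕ}

/-- The base variable with index `n`, as a term. -/
def bvar (n : ℕ) : Term k r := var (Var.base n)

/-- The term `-e`, as `(-1) · e`. -/
def neg (e : Term k r) : Term k r := mul (const (-1)) e

/-- Finite sums of terms. -/
def sum (l : List (Term k r)) : Term k r := l.foldr add (const 0)

/-- Free variables of a term; `(e)'` depends on the variables of `e` and on their differentials. -/
def fv : Term k r → Finset Var
  | var x => {x}
  | const _ => ∅
  | add e f => fv e ∪ fv f
  | mul e f => fv e ∪ fv f
  | app _ args => Finset.univ.biUnion fun i => fv (args i)
  | diff e => fv e ∪ (fv e).image Var.prime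

/-- Free variables of the maximal subterms that are function applications or differentials. -/
def opaqueFv : Term k r → Finset Var
  | var _ => ∅
  | const _ => ∅
  | add e f => opaqueFv e ∪ opaqueFv f
  | mul e f => opaqueFv e ∪ opaqueFv f
  | app j args => fv (app j args)
  | diff e => fv (diff e)

/-- Differential-free terms: neither differentials nor differential variables occur. -/
def DiffFree : Term k r → Prop
  | var (Var.base _) => True
  | var (Var.prime _) => False
  | const _ => True
  | add e f => DiffFree e ∧ DiffFree f
  | mul e f => DiffFree e ∧ DiffFree f
  | app _ args => ∀ i, DiffFree (args i)
  | diff _ => False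

/-- Simultaneous substitution of terms for variables. It does not enter differentials; see `Adm`. -/
def subst (σ : Var → Term k r) : Term k r → Term k r
  | var x => σ x
  | const c => const c
  | add e f => add (subst σ e) (subst σ f)
  | mul e f => mul (subst σ e) (subst σ f)
  | app j args => app j fun i => subst σ (args i)
  | diff e => diff e

/-- The substitution that replaces the single variable `x` by `e`. -/
def single (x : Var) (e : Term k r) : Var → Term k r :=
  fun z => if z = x then e else var z

/-- Replacing `x` in the term is admissible: `x` does not occur inside a differential. -/
def Adm (x : Var) : Term k r → Prop
  | var _ => True
  | const _ => True
  | add e f => Adm x e ∧ Adm x f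
  | mul e f => Adm x e ∧ Adm x f
  | app _ args => ∀ i, Adm x (args i)
  | diff e => x ∉ fv (diff e)

/-- Value of a term where function applications and differentials are treated like variables:
their values are given by `ρ`. -/
noncomputable def evalA (ρ : Term k r → ℝ) : Term k r → ℝ
  | var x => ρ (var x)
  | const c => (c : ℝ)
  | add e f => evalA ρ e + evalA ρ f
  | mul e f => evalA ρ e * evalA ρ f
  | app j args => ρ (app j args)
  | diff e => ρ (diff e)

/-- Value of a term in a state, for the interpretation `h` of the function symbols. The value of
`(e)'` is the total differential `∑ x, ω(x') · ∂e/∂x`. -/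
noncomputable def eval (h : Fin r → (Fin k → ℝ) → ℝ) : Term k r → State → ℝ
  | var x, ω => ω x
  | const c, _ => (c : ℝ)
  | add e f, ω => eval h e ω + eval h f ω
  | mul e f, ω => eval h e ω * eval h f ω
  | app j args, ω => h j fun i => eval h (args i) ω
  | diff e, ω =>
      ∑ x ∈ fv e, ω (Var.prime x) * deriv (fun t => eval h e (Function.update ω x t)) (ω x)

end Term

/-- Expressions for polynomials `q(y_1, …, y_k, z_1, …, z_r)`: `arg i` stands for `y_i`, `sym j`
for `z_j`, and coefficients are terms. -/
inductive PolyExpr (k r : ℕ) : Type where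
  | arg : Fin k → PolyExpr k r
  | sym : Fin r → PolyExpr k r
  | coef : Term k r → PolyExpr k r
  | add : PolyExpr k r → PolyExpr k r → PolyExpr k r
  | mul : PolyExpr k r → PolyExpr k r → PolyExpr k r

namespace PolyExpr

variable {k r : ℕ}

/-- All coefficients are closed differential-free terms, so they denote fixed real numbers. -/
def ClosedCoeffs : PolyExpr k r → Prop
  | arg _ => True
  | sym _ => True
  | coef t => t.fv = ∅ ∧ t.DiffFree
  | add p q => ClosedCoeffs p ∧ ClosedCoeffs q
  | mul p q => ClosedCoeffs p ∧ ClosedCoeffs q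

/-- The extended term `q(e_1, …, e_k, h_1(e_1, …, e_k), …, h_r(e_1, …, e_k))`. -/
def inst (args : Fin k → Term k r) : PolyExpr k r → Term k r
  | arg i => args i
  | sym j => Term.app j args
  | coef t => t
  | add p q => Term.add (inst args p) (inst args q)
  | mul p q => Term.mul (inst args p) (inst args q)

/-- The real number `q(y_1, …, y_k, h_1(y), …, h_r(y))`. -/
noncomputable def eval (h : Fin r → (Fin k → ℝ) → ℝ) (y : Fin k → ℝ) : PolyExpr k r → ℝ
  | arg i => y i
  | sym j => h j y
  | coef t => t.eval h fun _ => 0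
  | add p q => eval h y p + eval h y q
  | mul p q => eval h y p * eval h y q

end PolyExpr

/-- An extended term language: `r` fixed function symbols of arity `k`, their interpretations `h`,
and syntactic expressions `q j i` for the partial derivatives `∂h_j/∂y_i`. -/
structure Lang where
  k : ℕ
  r : ℕ
  h : Fin r → (Fin k → ℝ) → ℝ
  q : Fin r → Fin k → PolyExpr k r

/-- The functions `h_1, …, h_r` form a Noetherian chain: they are real analytic on `ℝ^k` and
`∂h_j/∂y_i (y) = q_ji(y, h_1(y), …, h_r(y))` with polynomials `q_ji`. -/
def Lang.IsNoetherian (L : Lang) : Prop :=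
  (∀ j, AnalyticOnNhd ℝ (L.h j) Set.univ) ∧
  (∀ j i, (L.q j i).ClosedCoeffs) ∧
  (∀ j i (y : Fin L.k → ℝ),
    HasDerivAt (fun t => L.h j (Function.update y i t)) ((L.q j i).eval L.h y) (y i))

/-- Comparison operators of atomic formulas. -/
inductive Cmp : Type where
  | eq : Cmp
  | ge : Cmp
  | gt : Cmp

/-- The comparison of two real numbers. -/
def Cmp.rel : Cmp → ℝ → ℝ → Prop
  | Cmp.eq, a, b => a = b
  | Cmp.ge, a, b => a ≥ b
  | Cmp.gt, a, b => a > b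

/-- Quantifier- and modality-free formulas; the semianalytic formulas are the differential-free
ones. -/
inductive QF (k r : ℕ) : Type where
  | cmp : Cmp → Term k r → Term k r → QF k r
  | and : QF k r → QF k r → QF k r
  | or : QF k r → QF k r → QF k r
  | not : QF k r → QF k r

/-- Differential equation systems `x_1' = f_1, …, x_n' = f_n`, given by the indices of the base
variables `x_i` and the right-hand sides `f_i`. -/
abbrev Sys (k r : ℕ) : Type := List (ℕ × Term k r)

/-- Hybrid programs: assignments `x := e` and differential equations `x' = f & Q`. -/
inductive Act (k r : ℕ) : Type where
  | assign : Var → Term k r → Act k r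
  | ode : Sys k r → QF k r → Act k r

/-- Formulas of differential dynamic logic. -/
inductive Fml (k r : ℕ) : Type where
  | cmp : Cmp → Term k r → Term k r → Fml k r
  | and : Fml k r → Fml k r → Fml k r
  | or : Fml k r → Fml k r → Fml k r
  | not : Fml k r → Fml k r
  | all : Var → Fml k r → Fml k r
  | ex : Var → Fml k r → Fml k r
  | box : Act k r → Fml k r → Fml k r
  | dia : Act k r → Fml k r → Fml k r

namespace Sys

variable {k r : ℕ}

/-- The indices of the variables that the system evolves. -/
def vars (s : Sys k r) : List ℕ := s.map Prod.fst

/-- Distinct variables on the left and differential-free terms on the right. -/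
def WF (s : Sys k r) : Prop := s.vars.Nodup ∧ ∀ p ∈ s, p.2.DiffFree

/-- Free variables of the right-hand sides. -/
def rhsFv (s : Sys k r) : Finset Var := s.foldr (fun p acc => p.2.fv ∪ acc) ∅

/-- The variables `x_1, …, x_n`. -/
def lhs (s : Sys k r) : Finset Var := (s.vars.map Var.base).toFinset

/-- The differential variables `x_1', …, x_n'`. -/
def primes (s : Sys k r) : Finset Var := (s.vars.map fun n => Var.prime (Var.base n)).toFinset

/-- The system `x' = -f`. -/
def neg (s : Sys k r) : Sys k r := s.map fun p => (p.1, p.2.neg)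

/-- Some equation of the system is a clock `x_i' = c` with a constant `c ≠ 0` (`c = 1` for a clock
of the forward system, `c = -1` along its negation), up to ring identities. -/
def HasClock (s : Sys k r) : Prop :=
  ∃ p ∈ s, ∃ c : ℝ, c ≠ 0 ∧ ∀ ρ : Term k r → ℝ, p.2.evalA ρ = c

end Sys

namespace QF

variable {k r : ℕ}

/-- Implication. -/
def imp (P Q : QF k r) : QF k r := or (not P) Q

/-- The formula `e = 0`. -/
def eqZ (e : Term k r) : QF k r := cmp Cmp.eq e (Term.const 0)

/-- The formula `e ≥ 0`. -/
def geZ (e : Term k r) : QF k r := cmp Cmp.ge e (Term.const 0)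

/-- The formula `e > 0`. -/
def gtZ (e : Term k r) : QF k r := cmp Cmp.gt e (Term.const 0)

/-- Truth. -/
def tru : QF k r := eqZ (Term.const 0)

/-- Falsity. -/
def fls : QF k r := gtZ (Term.const 0)

/-- Finite conjunctions. -/
def conj (l : List (QF k r)) : QF k r := l.foldr and tru

/-- Finite disjunctions. -/
def disj (l : List (QF k r)) : QF k r := l.foldr or fls

/-- Free variables. -/
def fv : QF k r → Finset Var
  | cmp _ e f => e.fv ∪ f.fv
  | and P Q => fv P ∪ fv Q
  | or P Q => fv P ∪ fv Q
  | not P => fv P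

/-- Differential-free formulas. -/
def DiffFree : QF k r → Prop
  | cmp _ e f => e.DiffFree ∧ f.DiffFree
  | and P Q => DiffFree P ∧ DiffFree Q
  | or P Q => DiffFree P ∧ DiffFree Q
  | not P => DiffFree P

/-- Analytic formulas: built from equations with conjunction and disjunction. -/
def Analytic : QF k r → Prop
  | cmp Cmp.eq _ _ => True
  | cmp Cmp.ge _ _ => False
  | cmp Cmp.gt _ _ => False
  | and P Q => Analytic P ∧ Analytic Q
  | or P Q => Analytic P ∧ Analytic Q
  | not _ => False

/-- Formulas built from strict inequalities with conjunction and disjunction. -/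
def Strict : QF k r → Prop
  | cmp Cmp.eq _ _ => False
  | cmp Cmp.ge _ _ => False
  | cmp Cmp.gt _ _ => True
  | and P Q => Strict P ∧ Strict Q
  | or P Q => Strict P ∧ Strict Q
  | not _ => False

/-- Simultaneous substitution. -/
def subst (σ : Var → Term k r) : QF k r → QF k r
  | cmp c e f => cmp c (e.subst σ) (f.subst σ)
  | and P Q => and (subst σ P) (subst σ Q)
  | or P Q => or (subst σ P) (subst σ Q)
  | not P => not (subst σ P)

/-- Replacing `x` is admissible. -/
def Adm (x : Var) : QF k r → Prop
  | cmp _ e f => e.Adm x ∧ f.Adm x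
  | and P Q => Adm x P ∧ Adm x Q
  | or P Q => Adm x P ∧ Adm x Q
  | not P => Adm x P

/-- A quantifier-free formula as a formula of the logic. -/
def toF : QF k r → Fml k r
  | cmp c e f => Fml.cmp c e f
  | and P Q => Fml.and (toF P) (toF Q)
  | or P Q => Fml.or (toF P) (toF Q)
  | not P => Fml.not (toF P)

/-- Truth of a quantifier-free formula in a state. -/
def holds (h : Fin r → (Fin k → ℝ) → ℝ) : QF k r → State → Prop
  | cmp c e f, ω => c.rel (e.eval h ω) (f.eval h ω)
  | and P Q, ω => holds h P ω ∧ holds h Q ω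
  | or P Q, ω => holds h P ω ∨ holds h Q ω
  | not P, ω => ¬ holds h P ω

/-- The vectorial equation `x = y`. -/
def eqVec (xs ys : List ℕ) : QF k r :=
  conj (List.zipWith (fun x y => cmp Cmp.eq (Term.bvar x) (Term.bvar y)) xs ys)

end QF

namespace Act

variable {k r : ℕ}

/-- Bound variables. -/
def bv : Act k r → Finset Var
  | assign x _ => {x}
  | ode s _ => s.lhs ∪ s.primes

/-- Free variables. -/
def fv : Act k r → Finset Var
  | assign _ e => e.fv
  | ode s Q => s.lhs ∪ s.rhsFv ∪ Q.fv

/-- Substitution of the term `e` for a variable `x` that is not bound by the program. -/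
def subst (x : Var) (e : Term k r) : Act k r → Act k r
  | assign z t => assign z (t.subst (Term.single x e))
  | ode s Q => ode (s.map fun p => (p.1, p.2.subst (Term.single x e))) (Q.subst (Term.single x e))

/-- Replacing `x` in the terms of the program is admissible. -/
def Adm (x : Var) : Act k r → Prop
  | assign _ t => t.Adm x
  | ode s Q => (∀ p ∈ s, p.2.Adm x) ∧ Q.Adm x

/-- Transition relation. A run of `x' = f & Q` from `ω` to `ν` follows a solution `φ` on `[0, T]`
that agrees with `ω` at time `0` except for the differential variables `x'`, changes only `x` and
`x'`, satisfies `x' = f` and `Q` at all times, gives `x'` the value of the time-derivative of `x`,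
and is in state `ν` at time `T`. -/
def rel (h : Fin r → (Fin k → ℝ) → ℝ) : Act k r → State → State → Prop
  | assign x e, ω, ν => ν = Function.update ω x (e.eval h ω)
  | ode s Q, ω, ν => ∃ (T : ℝ) (φ : ℝ → State), 0 ≤ T ∧
      (∀ z, z ∉ s.primes → φ 0 z = ω z) ∧
      φ T = ν ∧
      ∀ ζ ∈ Set.Icc 0 T,
        (∀ z, z ∉ s.lhs ∪ s.primes → φ ζ z = ω z) ∧
        (∀ p ∈ s,
          HasDerivWithinAt (fun t => φ t (Var.base p.1)) (φ ζ (Var.prime (Var.base p.1)))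
            (Set.Icc 0 T) ζ ∧
          φ ζ (Var.prime (Var.base p.1)) = p.2.eval h (φ ζ)) ∧
        Q.holds h (φ ζ)

end Act

namespace Fml

variable {k r : ℕ}

/-- Implication. -/
def imp (φ ψ : Fml k r) : Fml k r := or (not φ) ψ

/-- Equivalence. -/
def iff (φ ψ : Fml k r) : Fml k r := and (imp φ ψ) (imp ψ φ)

/-- Equation of two terms. -/
def eq (e f : Term k r) : Fml k r := cmp Cmp.eq e f

/-- Truth. -/
def tru : Fml k r := QF.tru.toF

/-- Falsity. -/
def fls : Fml k r := QF.fls.toF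

/-- Finite conjunctions. -/
def conj (l : List (Fml k r)) : Fml k r := l.foldr and tru

/-- Universal quantification over a vector of base variables. -/
def allVec (xs : List ℕ) (φ : Fml k r) : Fml k r := xs.foldr (fun x ψ => all (Var.base x) ψ) φ

/-- The vectorial assignment `[x_1' := f_1] … [x_n' := f_n] φ`. -/
def assignPrimes (s : Sys k r) (φ : Fml k r) : Fml k r :=
  s.foldr (fun p ψ => box (Act.assign (Var.prime (Var.base p.1)) p.2) ψ) φ

/-- Free variables. -/
def fv : Fml k r → Finset Var
  | cmp _ e f => e.fv ∪ f.fv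
  | and φ ψ => fv φ ∪ fv ψ
  | or φ ψ => fv φ ∪ fv ψ
  | not φ => fv φ
  | all x φ => (fv φ).erase x
  | ex x φ => (fv φ).erase x
  | box α φ => α.fv ∪ (fv φ \ α.bv)
  | dia α φ => α.fv ∪ (fv φ \ α.bv)

/-- Substitution of `e` for `x`; used together with `FreeFor`. -/
def subst (x : Var) (e : Term k r) : Fml k r → Fml k r
  | cmp c t u => cmp c (t.subst (Term.single x e)) (u.subst (Term.single x e))
  | and φ ψ => and (subst x e φ) (subst x e ψ)
  | or φ ψ => or (subst x e φ) (subst x e ψ)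
  | not φ => not (subst x e φ)
  | all z φ => if z = x then all z φ else all z (subst x e φ)
  | ex z φ => if z = x then ex z φ else ex z (subst x e φ)
  | box α φ => if x ∈ α.bv then box α φ else box (α.subst x e) (subst x e φ)
  | dia α φ => if x ∈ α.bv then dia α φ else dia (α.subst x e) (subst x e φ)

/-- The substitution of `e` for `x` is admissible: no capture, no replacement inside a
differential, and no replacement of a free variable that is also bound by a program. -/
def Adm (x : Var) (e : Term k r) : Fml k r → Prop
  | cmp _ t u => t.Adm x ∧ u.Adm x
  | and φ ψ => Adm x e φ ∧ Adm x e ψ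
  | or φ ψ => Adm x e φ ∧ Adm x e ψ
  | not φ => Adm x e φ
  | all z φ => x ∉ fv (all z φ) ∨ (z ≠ x ∧ z ∉ e.fv ∧ Adm x e φ)
  | ex z φ => x ∉ fv (ex z φ) ∨ (z ≠ x ∧ z ∉ e.fv ∧ Adm x e φ)
  | box α φ => x ∉ fv (box α φ) ∨ (x ∉ α.bv ∧ Disjoint e.fv α.bv ∧ α.Adm x ∧ Adm x e φ)
  | dia α φ => x ∉ fv (dia α φ) ∨ (x ∉ α.bv ∧ Disjoint e.fv α.bv ∧ α.Adm x ∧ Adm x e φ)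

/-- The term `e` is free for `x` in `φ`. -/
def FreeFor (x : Var) (e : Term k r) (φ : Fml k r) : Prop := e = Term.var x ∨ Adm x e φ

/-- Truth of a formula in a state. -/
def holds (h : Fin r → (Fin k → ℝ) → ℝ) : Fml k r → State → Prop
  | cmp c e f, ω => c.rel (e.eval h ω) (f.eval h ω)
  | and φ ψ, ω => holds h φ ω ∧ holds h ψ ω
  | or φ ψ, ω => holds h φ ω ∨ holds h ψ ω
  | not φ, ω => ¬ holds h φ ω
  | all x φ, ω => ∀ t : ℝ, holds h φ (Function.update ω x t)
  | ex x φ, ω => ∃ t : ℝ, holds h φ (Function.update ω x t)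
  | box α φ, ω => ∀ ν, α.rel h ω ν → holds h φ ν
  | dia α φ, ω => ∃ ν, α.rel h ω ν ∧ holds h φ ν

/-- Validity: truth in all states. -/
def Valid (h : Fin r → (Fin k → ℝ) → ℝ) (φ : Fml k r) : Prop := ∀ ω, φ.holds h ω

/-- Free variables of the function applications and differentials that occur in a formula. -/
def opaqueFv : Fml k r → Finset Var
  | cmp _ e f => e.opaqueFv ∪ f.opaqueFv
  | and φ ψ => opaqueFv φ ∪ opaqueFv ψ
  | or φ ψ => opaqueFv φ ∪ opaqueFv ψ
  | not φ => opaqueFv φ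
  | all _ φ => opaqueFv φ
  | ex _ φ => opaqueFv φ
  | box _ _ => ∅
  | dia _ _ => ∅

/-- First-order formulas in which no quantifier binds a variable of a function application or of
a differential: the substitution instances of formulas of first-order real arithmetic. -/
def IsArith : Fml k r → Prop
  | cmp _ _ _ => True
  | and φ ψ => IsArith φ ∧ IsArith ψ
  | or φ ψ => IsArith φ ∧ IsArith ψ
  | not φ => IsArith φ
  | all x φ => IsArith φ ∧ x ∉ opaqueFv φ
  | ex x φ => IsArith φ ∧ x ∉ opaqueFv φ
  | box _ _ => False
  | dia _ _ => False

open Classical in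
/-- Truth in real arithmetic, function applications and differentials being treated like variables
whose values are given by `ρ`. -/
noncomputable def holdsA : Fml k r → (Term k r → ℝ) → Prop
  | cmp c e f, ρ => c.rel (e.evalA ρ) (f.evalA ρ)
  | and φ ψ, ρ => holdsA φ ρ ∧ holdsA ψ ρ
  | or φ ψ, ρ => holdsA φ ρ ∨ holdsA ψ ρ
  | not φ, ρ => ¬ holdsA φ ρ
  | all x φ, ρ => ∀ t : ℝ, holdsA φ (Function.update ρ (Term.var x) t)
  | ex x φ, ρ => ∃ t : ℝ, holdsA φ (Function.update ρ (Term.var x) t)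
  | box _ _, _ => False
  | dia _ _, _ => False

end Fml

section Calculus

/-- The renaming of the variables `xs` to `ys`. -/
def rename {k r : ℕ} (xs ys : List ℕ) : Var → Term k r
  | Var.base n => Term.bvar (((xs.zip ys).lookup n).getD n)
  | Var.prime z => Term.var (Var.prime z)

/-- The system `y' = -f(y)`, for a system `x' = f(x)`. -/
def Sys.adjoint {k r : ℕ} (s : Sys k r) (ys : List ℕ) : Sys k r :=
  List.zipWith (fun p y => (y, (p.2.subst (rename s.vars ys)).neg)) s ys

/-- The base variables `ys` are as many as those of the system `x' = f`, pairwise distinct, and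
neither they nor their differential variables occur in the system or among the variables `V`. -/
def FreshVec {k r : ℕ} (s : Sys k r) (V : Finset Var) (ys : List ℕ) : Prop :=
  ys.length = s.length ∧ ys.Nodup ∧
  ∀ y ∈ ys, y ∉ s.vars ∧
    Var.base y ∉ s.rhsFv ∪ V ∧ Var.prime (Var.base y) ∉ s.rhsFv ∪ V

open Fml in
/-- The axioms of the calculus. -/
inductive Axm (L : Lang) : Fml L.k L.r → Prop where
  -- real arithmetic
  | arith (φ : Fml L.k L.r) : φ.IsArith → (∀ ρ, φ.holdsA ρ) → Axm L φ
  -- congruence of equality for the function symbols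
  | cong (j : Fin L.r) (a b : Fin L.k → Term L.k L.r) :
      Axm L (imp (conj ((List.finRange L.k).map fun i => eq (a i) (b i)))
        (eq (Term.app j a) (Term.app j b)))
  -- modal axioms
  | diamond (α : Act L.k L.r) (φ : Fml L.k L.r) :
      Axm L (iff (dia α φ) (not (box α (not φ))))
  | K (α : Act L.k L.r) (φ ψ : Fml L.k L.r) :
      Axm L (imp (box α (imp φ ψ)) (imp (box α φ) (box α ψ)))
  | V (α : Act L.k L.r) (φ : Fml L.k L.r) : Disjoint φ.fv α.bv → Axm L (imp φ (box α φ))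
  | assign (x : Var) (e : Term L.k L.r) (φ : Fml L.k L.r) : FreeFor x e φ →
      Axm L (iff (box (Act.assign x e) φ) (φ.subst x e))
  | barcan (s : Sys L.k L.r) (Q : QF L.k L.r) (y : Var) (φ : Fml L.k L.r) :
      s.WF → Q.DiffFree → y ∉ (Act.ode s Q).fv ∪ (Act.ode s Q).bv →
      Axm L (iff (dia (Act.ode s Q) (ex y φ)) (ex y (dia (Act.ode s Q) φ)))
  -- differential axioms
  | diffConst (c : ℚ) : Axm L (eq (Term.diff (Term.const c)) (Term.const 0))
  | diffVar (n : ℕ) :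
      Axm L (eq (Term.diff (Term.bvar n)) (Term.var (Var.prime (Var.base n))))
  | diffAdd (e f : Term L.k L.r) : e.DiffFree → f.DiffFree →
      Axm L (eq (Term.diff (Term.add e f)) (Term.add (Term.diff e) (Term.diff f)))
  | diffMul (e f : Term L.k L.r) : e.DiffFree → f.DiffFree →
      Axm L (eq (Term.diff (Term.mul e f))
        (Term.add (Term.mul (Term.diff e) f) (Term.mul e (Term.diff f))))
  | diffApp (j : Fin L.r) (a : Fin L.k → Term L.k L.r) : (∀ i, (a i).DiffFree) →
      Axm L (eq (Term.diff (Term.app j a))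
        (Term.sum ((List.finRange L.k).map fun i =>
          Term.mul ((L.q j i).inst a) (Term.diff (a i)))))
  -- differential equation axioms
  | DW (s : Sys L.k L.r) (Q : QF L.k L.r) : s.WF → Q.DiffFree →
      Axm L (box (Act.ode s Q) Q.toF)
  | DX (s : Sys L.k L.r) (Q : QF L.k L.r) (φ : Fml L.k L.r) : s.WF → Q.DiffFree →
      Disjoint φ.fv s.primes →
      Axm L (iff (box (Act.ode s Q) φ) (imp Q.toF (and φ (box (Act.ode s Q) φ))))
  | DMP (s : Sys L.k L.r) (Q R : QF L.k L.r) (φ : Fml L.k L.r) :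
      s.WF → Q.DiffFree → R.DiffFree →
      Axm L (imp (box (Act.ode s Q) (imp Q.toF R.toF))
        (imp (box (Act.ode s R) φ) (box (Act.ode s Q) φ)))
  | DE (s : Sys L.k L.r) (Q : QF L.k L.r) (φ : Fml L.k L.r) : s.WF → Q.DiffFree →
      Axm L (iff (box (Act.ode s Q) φ) (box (Act.ode s Q) (assignPrimes s φ)))
  -- differential invariants; variables of `e` that do not evolve are listed in `ys`, and their
  -- differential variables are assumed to be zero
  | DIeq (s : Sys L.k L.r) (Q : QF L.k L.r) (e : Term L.k L.r) (ys : List ℕ) :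
      s.WF → Q.DiffFree → e.DiffFree → e.fv ⊆ s.lhs ∪ (ys.map Var.base).toFinset →
      Axm L (imp (conj (ys.map fun y => eq (Term.var (Var.prime (Var.base y))) (Term.const 0)))
        (imp (box (Act.ode s Q) (QF.eqZ (Term.diff e)).toF)
          (iff (box (Act.ode s Q) (QF.eqZ e).toF) (imp Q.toF (QF.eqZ e).toF))))
  | DIge (s : Sys L.k L.r) (Q : QF L.k L.r) (e : Term L.k L.r) (ys : List ℕ) :
      s.WF → Q.DiffFree → e.DiffFree → e.fv ⊆ s.lhs ∪ (ys.map Var.base).toFinset →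
      Axm L (imp (conj (ys.map fun y => eq (Term.var (Var.prime (Var.base y))) (Term.const 0)))
        (imp (box (Act.ode s Q) (QF.geZ (Term.diff e)).toF)
          (iff (box (Act.ode s Q) (QF.geZ e).toF) (imp Q.toF (QF.geZ e).toF))))
  | DIgt (s : Sys L.k L.r) (Q : QF L.k L.r) (e : Term L.k L.r) (ys : List ℕ) :
      s.WF → Q.DiffFree → e.DiffFree → e.fv ⊆ s.lhs ∪ (ys.map Var.base).toFinset →
      Axm L (imp (conj (ys.map fun y => eq (Term.var (Var.prime (Var.base y))) (Term.const 0)))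
        (imp (box (Act.ode s Q) (QF.geZ (Term.diff e)).toF)
          (iff (box (Act.ode s Q) (QF.gtZ e).toF) (imp Q.toF (QF.gtZ e).toF))))
  -- differential cuts
  | DC (s : Sys L.k L.r) (Q R : QF L.k L.r) (φ : Fml L.k L.r) :
      s.WF → Q.DiffFree → R.DiffFree →
      Axm L (imp (box (Act.ode s Q) R.toF)
        (iff (box (Act.ode s Q) φ) (box (Act.ode s (QF.and Q R)) φ)))
  -- differential ghosts
  | DG (s : Sys L.k L.r) (Q : QF L.k L.r) (φ : Fml L.k L.r) (y : ℕ) (a b : Term L.k L.r) :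
      s.WF → Q.DiffFree → a.DiffFree → b.DiffFree → y ∉ s.vars →
      Var.base y ∉ s.rhsFv ∪ Q.fv ∪ φ.fv ∪ a.fv ∪ b.fv → Var.prime (Var.base y) ∉ φ.fv →
      Axm L (iff (box (Act.ode s Q) φ) (ex (Var.base y)
        (box (Act.ode (s ++ [(y, Term.add (Term.mul a (Term.bvar y)) b)]) Q) φ)))
  | DGall (s : Sys L.k L.r) (Q : QF L.k L.r) (φ : Fml L.k L.r) (y : ℕ) (a b : Term L.k L.r) :
      s.WF → Q.DiffFree → a.DiffFree → b.DiffFree → y ∉ s.vars →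
      Var.base y ∉ s.rhsFv ∪ Q.fv ∪ φ.fv ∪ a.fv ∪ b.fv → Var.prime (Var.base y) ∉ φ.fv →
      Axm L (iff (box (Act.ode s Q) φ) (all (Var.base y)
        (box (Act.ode (s ++ [(y, Term.add (Term.mul a (Term.bvar y)) b)]) Q) φ)))
  -- uniqueness of solutions
  | Uniq (s : Sys L.k L.r) (Q R : QF L.k L.r) (φ : Fml L.k L.r) :
      s.WF → Q.DiffFree → R.DiffFree →
      Axm L (iff (dia (Act.ode s (QF.and Q R)) φ)
        (and (dia (Act.ode s Q) φ) (dia (Act.ode s R) φ)))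
  -- continuous existence
  | Cont (s : Sys L.k L.r) (e : Term L.k L.r) (ys : List ℕ) :
      s.WF → s.HasClock → e.DiffFree → FreshVec s e.fv ys →
      Axm L (imp (QF.eqVec s.vars ys).toF
        (iff (dia (Act.ode s (QF.gtZ e)) (not (QF.eqVec s.vars ys).toF)) (QF.gtZ e).toF))
  -- differential adjoints
  | Dadj (s : Sys L.k L.r) (Q : QF L.k L.r) (ys : List ℕ) :
      s.WF → Q.DiffFree → FreshVec s Q.fv ys →
      Axm L (iff (dia (Act.ode s Q) (QF.eqVec s.vars ys).toF)
        (dia (Act.ode (s.adjoint ys) (Q.subst (rename s.vars ys))) (QF.eqVec ys s.vars).toF))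
  -- real induction
  | RI (s : Sys L.k L.r) (Q P : QF L.k L.r) (ys : List ℕ) :
      s.WF → s.HasClock → Q.DiffFree → P.DiffFree → FreshVec s (Q.fv ∪ P.fv) ys →
      Axm L (iff (box (Act.ode s Q) P.toF)
        (allVec ys (box (Act.ode s (QF.and Q (QF.or P (QF.eqVec s.vars ys))))
          (imp (QF.eqVec s.vars ys).toF
            (and P.toF
              (imp
                (dia (Act.ode s (QF.or Q (QF.eqVec s.vars ys))) (not (QF.eqVec s.vars ys).toF))
                (dia (Act.ode s (QF.or P (QF.eqVec s.vars ys)))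
                  (not (QF.eqVec s.vars ys).toF))))))))

/-- Derivability of a sequent `Γ ⊢ φ` in the calculus, from additional formulas `T`. Plain
provability is derivability for `T = ∅`. -/
inductive Deriv (L : Lang) (T : Set (Fml L.k L.r)) : List (Fml L.k L.r) → Fml L.k L.r → Prop where
  | theory {Γ : List (Fml L.k L.r)} {φ : Fml L.k L.r} : φ ∈ T → Deriv L T Γ φ
  | ax {Γ : List (Fml L.k L.r)} {φ : Fml L.k L.r} : Axm L φ → Deriv L T Γ φ
  | hyp {Γ : List (Fml L.k L.r)} {φ : Fml L.k L.r} : φ ∈ Γ → Deriv L T Γ φ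
  | weaken {Γ Δ : List (Fml L.k L.r)} {φ : Fml L.k L.r} : Γ ⊆ Δ → Deriv L T Γ φ → Deriv L T Δ φ
  | cut {Γ : List (Fml L.k L.r)} {φ ψ : Fml L.k L.r} :
      Deriv L T Γ φ → Deriv L T (φ :: Γ) ψ → Deriv L T Γ ψ
  | notL {Γ : List (Fml L.k L.r)} {φ ψ : Fml L.k L.r} : Deriv L T Γ φ → Deriv L T (φ.not :: Γ) ψ
  | notR {Γ : List (Fml L.k L.r)} {φ : Fml L.k L.r} :
      Deriv L T (φ :: Γ) Fml.fls → Deriv L T Γ φ.not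
  | classical {Γ : List (Fml L.k L.r)} {φ : Fml L.k L.r} :
      Deriv L T (φ.not :: Γ) Fml.fls → Deriv L T Γ φ
  | andL {Γ : List (Fml L.k L.r)} {φ ψ χ : Fml L.k L.r} :
      Deriv L T (φ :: ψ :: Γ) χ → Deriv L T (φ.and ψ :: Γ) χ
  | andR {Γ : List (Fml L.k L.r)} {φ ψ : Fml L.k L.r} :
      Deriv L T Γ φ → Deriv L T Γ ψ → Deriv L T Γ (φ.and ψ)
  | orL {Γ : List (Fml L.k L.r)} {φ ψ χ : Fml L.k L.r} :
      Deriv L T (φ :: Γ) χ → Deriv L T (ψ :: Γ) χ → Deriv L T (φ.or ψ :: Γ) χ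
  | orR1 {Γ : List (Fml L.k L.r)} {φ ψ : Fml L.k L.r} : Deriv L T Γ φ → Deriv L T Γ (φ.or ψ)
  | orR2 {Γ : List (Fml L.k L.r)} {φ ψ : Fml L.k L.r} : Deriv L T Γ ψ → Deriv L T Γ (φ.or ψ)
  | allL {Γ : List (Fml L.k L.r)} {x : Var} {φ ψ : Fml L.k L.r} (e : Term L.k L.r) :
      e.DiffFree → φ.FreeFor x e →
      Deriv L T (φ.subst x e :: Γ) ψ → Deriv L T (Fml.all x φ :: Γ) ψ
  | allR {Γ : List (Fml L.k L.r)} {x : Var} {φ : Fml L.k L.r} (y : Var) :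
      (∀ χ ∈ Γ, y ∉ χ.fv) → y ∉ (Fml.all x φ).fv →
      φ.FreeFor x (Term.var y) → Deriv L T Γ (φ.subst x (Term.var y)) →
      Deriv L T Γ (Fml.all x φ)
  | exL {Γ : List (Fml L.k L.r)} {x : Var} {φ ψ : Fml L.k L.r} (y : Var) :
      (∀ χ ∈ Γ, y ∉ χ.fv) → y ∉ (Fml.ex x φ).fv → y ∉ ψ.fv →
      φ.FreeFor x (Term.var y) → Deriv L T (φ.subst x (Term.var y) :: Γ) ψ →
      Deriv L T (Fml.ex x φ :: Γ) ψ
  | exR {Γ : List (Fml L.k L.r)} {x : Var} {φ : Fml L.k L.r} (e : Term L.k L.r) :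
      e.DiffFree → φ.FreeFor x e →
      Deriv L T Γ (φ.subst x e) → Deriv L T Γ (Fml.ex x φ)
  | gen {Γ : List (Fml L.k L.r)} {φ : Fml L.k L.r} (α : Act L.k L.r) :
      Deriv L T [] φ → Deriv L T Γ (Fml.box α φ)

/-- Provability in the calculus. -/
def Provable (L : Lang) (φ : Fml L.k L.r) : Prop := Deriv L ∅ [] φ

end Calculus

section Progress

/-- Syntactic Lie derivative of a differential-free term along `x' = f`. -/
def lie (L : Lang) (s : Sys L.k L.r) : Term L.k L.r → Term L.k L.r
  | Term.var (Var.base n) => (List.lookup n s).getD (Term.const 0)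
  | Term.var (Var.prime _) => Term.const 0
  | Term.const _ => Term.const 0
  | Term.add e f => Term.add (lie L s e) (lie L s f)
  | Term.mul e f => Term.add (Term.mul (lie L s e) f) (Term.mul e (lie L s f))
  | Term.app j a =>
      Term.sum ((List.finRange L.k).map fun i => Term.mul ((L.q j i).inst a) (lie L s (a i)))
  | Term.diff _ => Term.const 0

/-- Higher Lie derivatives. -/
def lieN (L : Lang) (s : Sys L.k L.r) (n : ℕ) (e : Term L.k L.r) : Term L.k L.r :=
  (lie L s)^[n] e

/-- `N` is a rank of `e` along `x' = f`: `N ≥ 1` and a differential radical identity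
`L^N e = ∑_{i<N} g_i · L^i e` is provable for some extended terms `g_i`. -/
def HasRank (L : Lang) (s : Sys L.k L.r) (e : Term L.k L.r) (N : ℕ) : Prop :=
  1 ≤ N ∧ ∃ g : ℕ → Term L.k L.r, (∀ i, (g i).DiffFree) ∧
    Provable L (Fml.eq (lieN L s N e)
      (Term.sum ((List.range N).map fun i => Term.mul (g i) (lieN L s i e))))

/-- `ρ` chooses a rank for every differential-free term. -/
def IsRankFun (L : Lang) (s : Sys L.k L.r) (ρ : Term L.k L.r → ℕ) : Prop :=
  ∀ e : Term L.k L.r, e.DiffFree → HasRank L s e (ρ e)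

/-- The formula `e = 0 ∧ L e = 0 ∧ … ∧ L^(N-1) e = 0`. -/
def radical (L : Lang) (s : Sys L.k L.r) (N : ℕ) (e : Term L.k L.r) : QF L.k L.r :=
  QF.conj ((List.range N).map fun i => QF.eqZ (lieN L s i e))

/-- Progress formula for `e > 0`: the first significant Lie derivative of `e` among the first `N`
ones is positive. -/
def progGt (L : Lang) (s : Sys L.k L.r) (N : ℕ) (e : Term L.k L.r) : QF L.k L.r :=
  QF.and
    (QF.conj ((List.range (N - 1)).map fun i => QF.imp (radical L s i e) (QF.geZ (lieN L s i e))))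
    (QF.imp (radical L s (N - 1) e) (QF.gtZ (lieN L s (N - 1) e)))

/-- Progress formula for `e ≥ 0`. -/
def progGe (L : Lang) (s : Sys L.k L.r) (N : ℕ) (e : Term L.k L.r) : QF L.k L.r :=
  QF.or (progGt L s N e) (radical L s N e)

/-- Normal forms: disjunctions of conjunctions of atomic formulas `e ≥ 0` (first component) and
`e > 0` (second component). -/
abbrev DNF (k r : ℕ) : Type := List (List (Term k r) × List (Term k r))

/-- All terms of the normal form are differential-free. -/
def DNF.DiffFree {k r : ℕ} (D : DNF k r) : Prop :=
  ∀ p ∈ D, (∀ e ∈ p.1, e.DiffFree) ∧ (∀ e ∈ p.2, e.DiffFree)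

/-- The formula that a normal form stands for. -/
def DNF.toQF {k r : ℕ} (D : DNF k r) : QF k r :=
  QF.disj (D.map fun p => QF.and (QF.conj (p.1.map QF.geZ)) (QF.conj (p.2.map QF.gtZ)))

/-- `D` is a differential-free normal form of `P`, provably equivalent to it. -/
def IsNormalForm (L : Lang) (P : QF L.k L.r) (D : DNF L.k L.r) : Prop :=
  D.DiffFree ∧ Provable L (Fml.iff P.toF D.toQF.toF)

/-- Semianalytic progress formula of a normal form, for the ranks given by `ρ`. -/
def prog (L : Lang) (s : Sys L.k L.r) (ρ : Term L.k L.r → ℕ) (D : DNF L.k L.r) : QF L.k L.r :=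
  QF.disj (D.map fun p => QF.and
    (QF.conj (p.1.map fun e => progGe L s (ρ e) e))
    (QF.conj (p.2.map fun e => progGt L s (ρ e) e)))

/-- The valid semianalytic formulas. -/
def ValidArith (L : Lang) : Set (Fml L.k L.r) :=
  {φ | ∃ A : QF L.k L.r, A.DiffFree ∧ A.toF.Valid L.h ∧ φ = A.toF}

end Progress

end DL

/-! The box modality is reduced to the local behaviour of solutions, and local behaviour is read off
from finitely many Lie derivatives.

Ranks. A differential-free term, the right-hand sides and the coefficients of the `q j i` involve
finitely many atoms (variables and function applications). After closing under all symbols applied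
to the same argument tuples, Lie derivation maps the polynomial ring over ℚ in these atoms into
itself. By Hilbert's basis theorem the ideals generated by `e, L e, …, L^n e` stabilise, which is a
rank (`exists_rank_evalA`). From `L^N e = ∑ g_i L^i e` the sum of squares `p = ∑_{i<N} (L^i e)²`
satisfies `p' ≤ G p` with `G = 2 + ∑ g_i²`. Darboux inequalities, proved with two differential
ghosts, preserve `-p ≥ 0`, so the radical is invariant (`Provable.dbx_ge`,
`HasRank.provable_radical_box`).

Local progress. `Prg s ys A` says that the system can leave the state `y` while staying in `A`,
except at `y` itself. If the first nonzero Lie derivative of `e` at `y` has order `k` and is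
positive, put `E = e - |x - y|^(2(k+1))`. It has the same derivatives at `y` up to order `k`; `Cont`
keeps `L^k E > 0` for some time, repeated differential invariants give `E ≥ 0`, hence `e > 0` off
`y`. If the first nonzero derivative is negative this applies to `-e`, and if none is nonzero the
radical keeps `e = 0`. So a progress formula `F` of `A` decides progress: `F` yields progress into
`A`, and `¬F` yields progress into `¬A` (`Decides`). Uniqueness of solutions makes this stable under
`∧` and `∨` and excludes progress into both `A` and `¬A`.

Analytic completeness. If `Q` can progress and the box holds, there is no progress into `e ≠ 0`, so
the radical holds. If `Q` cannot progress, every run within `Q` remains in its initial state and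
only `e = 0` there matters.

Semianalytic completeness. Real induction asks at each state reached through `P` that `P` holds
there and progresses whenever `Q` does. Progress is the forward condition. If `P` failed at such a
state, the reversed run would progress into `P` and `Q` from a state of `¬P`, against the backward
condition. The conditions are also necessary, since progress against them gives a run that leaves
`P` (`provable_box_of_progress`, `provable_progress_of_box`, `provable_adjoint_progress_of_box`).
The clock required by `Cont` and by real induction is added as a fresh ghost, which changes neither
the box nor any progress formula.

Derivability from valid formulas. A Picard–Lindelöf solution through a state violating a progress
condition would violate the invariant, forward or with time reversed. Hence both conditions are
valid semianalytic formulas, and the provable equivalence yields the invariant.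

All propositional and arithmetical glue is provided by `Deriv.of_val`: truth under every valuation
of opaque terms and modal atoms implies derivability. -/

namespace DL

/-! ### Identity substitutions. -/

section Subst

variable {k r : ℕ}

theorem Term.single_self (x : Var) : (Term.single x (Term.var x) : Var → Term k r) = Term.var := by
  funext z
  unfold Term.single
  split_ifs with h
  · rw [h]
  · rfl

theorem Term.subst_var (t : Term k r) : t.subst Term.var = t := by
  induction t with
  | var x => rfl
  | const c => rfl
  | add e f he hf => simp only [Term.subst, he, hf]
  | mul e f he hf => simp only [Term.subst, he, hf]
  | app j a ha => simp only [Term.subst, ha]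
  | diff e _ => rfl

theorem QF.subst_var (A : QF k r) : A.subst Term.var = A := by
  induction A with
  | cmp c e f => simp only [QF.subst, Term.subst_var]
  | and P Q hP hQ => simp only [QF.subst, hP, hQ]
  | or P Q hP hQ => simp only [QF.subst, hP, hQ]
  | not P hP => simp only [QF.subst, hP]

theorem Act.subst_self (x : Var) (α : Act k r) : α.subst x (Term.var x) = α := by
  cases α with
  | assign z t => simp only [Act.subst, Term.single_self, Term.subst_var]
  | ode s Q => simp [Act.subst, Term.single_self, Term.subst_var, QF.subst_var]

theorem Fml.subst_self (x : Var) (φ : Fml k r) : φ.subst x (Term.var x) = φ := by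
  induction φ with
  | cmp c e f => simp only [Fml.subst, Term.single_self, Term.subst_var]
  | and φ ψ hφ hψ => simp only [Fml.subst, hφ, hψ]
  | or φ ψ hφ hψ => simp only [Fml.subst, hφ, hψ]
  | not φ hφ => simp only [Fml.subst, hφ]
  | all z φ hφ => simp only [Fml.subst, hφ, ite_self]
  | ex z φ hφ => simp only [Fml.subst, hφ, ite_self]
  | box α φ hφ => simp only [Fml.subst, hφ, Act.subst_self, ite_self]
  | dia α φ hφ => simp only [Fml.subst, hφ, Act.subst_self, ite_self]

theorem Fml.freeFor_self (x : Var) (φ : Fml k r) : φ.FreeFor x (Term.var x) := Or.inl rfl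

end Subst

/-! ### Propositional and arithmetical valuations. -/

section Valuation

variable {k r : ℕ}

/-- Truth of a quantifier-free formula in real arithmetic, with function applications and
differentials as atoms. -/
def QF.val (ρ : Term k r → ℝ) : QF k r → Prop
  | cmp c e f => c.rel (e.evalA ρ) (f.evalA ρ)
  | and P Q => val ρ P ∧ val ρ Q
  | or P Q => val ρ P ∨ val ρ Q
  | not P => ¬ val ρ P

/-- Truth of a formula where comparisons are evaluated in real arithmetic and modal and quantified
formulas are propositional atoms. -/
def Fml.val (ρ : Term k r → ℝ) (v : Fml k r → Prop) : Fml k r → Prop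
  | cmp c e f => c.rel (e.evalA ρ) (f.evalA ρ)
  | and φ ψ => val ρ v φ ∧ val ρ v ψ
  | or φ ψ => val ρ v φ ∨ val ρ v ψ
  | not φ => ¬ val ρ v φ
  | all x φ => v (all x φ)
  | ex x φ => v (ex x φ)
  | box α φ => v (box α φ)
  | dia α φ => v (dia α φ)

variable (ρ : Term k r → ℝ) (v : Fml k r → Prop)

@[simp] theorem QF.val_cmp (c : Cmp) (e f : Term k r) :
    (QF.cmp c e f).val ρ ↔ c.rel (e.evalA ρ) (f.evalA ρ) := Iff.rfl
@[simp] theorem QF.val_and (P Q : QF k r) : (P.and Q).val ρ ↔ P.val ρ ∧ Q.val ρ := Iff.rfl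
@[simp] theorem QF.val_or (P Q : QF k r) : (P.or Q).val ρ ↔ P.val ρ ∨ Q.val ρ := Iff.rfl
@[simp] theorem QF.val_not (P : QF k r) : P.not.val ρ ↔ ¬ P.val ρ := Iff.rfl
@[simp] theorem QF.val_imp (P Q : QF k r) : (P.imp Q).val ρ ↔ (P.val ρ → Q.val ρ) := by
  simp only [QF.imp, QF.val_or, QF.val_not]; tauto
@[simp] theorem QF.val_eqZ (e : Term k r) : (QF.eqZ e).val ρ ↔ e.evalA ρ = 0 := by
  simp [QF.eqZ, Cmp.rel, Term.evalA]
@[simp] theorem QF.val_geZ (e : Term k r) : (QF.geZ e).val ρ ↔ 0 ≤ e.evalA ρ := by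
  simp [QF.geZ, Cmp.rel, Term.evalA]
@[simp] theorem QF.val_gtZ (e : Term k r) : (QF.gtZ e).val ρ ↔ 0 < e.evalA ρ := by
  simp [QF.gtZ, Cmp.rel, Term.evalA]
@[simp] theorem QF.val_tru : (QF.tru : QF k r).val ρ := by
  simp [QF.tru, Term.evalA]
@[simp] theorem QF.val_fls : ¬ (QF.fls : QF k r).val ρ := by
  simp [QF.fls, Term.evalA]
@[simp] theorem QF.val_conj (l : List (QF k r)) :
    (QF.conj l).val ρ ↔ ∀ A ∈ l, A.val ρ := by
  induction l with
  | nil => simp [QF.conj]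
  | cons a l ih => rw [List.forall_mem_cons, ← ih]; rfl
@[simp] theorem QF.val_disj (l : List (QF k r)) :
    (QF.disj l).val ρ ↔ ∃ A ∈ l, A.val ρ := by
  induction l with
  | nil => simp [QF.disj]
  | cons a l ih => simp only [List.mem_cons, exists_eq_or_imp]; rw [← ih]; rfl

@[simp] theorem Fml.val_cmp (c : Cmp) (e f : Term k r) :
    (Fml.cmp c e f).val ρ v ↔ c.rel (e.evalA ρ) (f.evalA ρ) := Iff.rfl
@[simp] theorem Fml.val_eq (e f : Term k r) :
    (Fml.eq e f).val ρ v ↔ e.evalA ρ = f.evalA ρ := Iff.rfl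
@[simp] theorem Fml.val_and (φ ψ : Fml k r) :
    (φ.and ψ).val ρ v ↔ φ.val ρ v ∧ ψ.val ρ v := Iff.rfl
@[simp] theorem Fml.val_or (φ ψ : Fml k r) :
    (φ.or ψ).val ρ v ↔ φ.val ρ v ∨ ψ.val ρ v := Iff.rfl
@[simp] theorem Fml.val_not (φ : Fml k r) : φ.not.val ρ v ↔ ¬ φ.val ρ v := Iff.rfl
@[simp] theorem Fml.val_imp (φ ψ : Fml k r) :
    (φ.imp ψ).val ρ v ↔ (φ.val ρ v → ψ.val ρ v) := by
  simp only [Fml.imp, Fml.val_or, Fml.val_not]; tauto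
@[simp] theorem Fml.val_iff (φ ψ : Fml k r) :
    (φ.iff ψ).val ρ v ↔ (φ.val ρ v ↔ ψ.val ρ v) := by
  simp only [Fml.iff, Fml.val_and, Fml.val_imp]; tauto
@[simp] theorem Fml.val_box (α : Act k r) (φ : Fml k r) :
    (Fml.box α φ).val ρ v ↔ v (Fml.box α φ) := Iff.rfl
@[simp] theorem Fml.val_toF (A : QF k r) : A.toF.val ρ v ↔ A.val ρ := by
  induction A with
  | cmp c e f => rfl
  | and P Q hP hQ => simp only [QF.toF, Fml.val_and, QF.val_and, hP, hQ]
  | or P Q hP hQ => simp only [QF.toF, Fml.val_or, QF.val_or, hP, hQ]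
  | not P hP => simp only [QF.toF, Fml.val_not, QF.val_not, hP]
@[simp] theorem Fml.val_tru : (Fml.tru : Fml k r).val ρ v := by simp [Fml.tru]
@[simp] theorem Fml.val_fls : ¬ (Fml.fls : Fml k r).val ρ v := by simp [Fml.fls]
@[simp] theorem Fml.val_conj (l : List (Fml k r)) :
    (Fml.conj l).val ρ v ↔ ∀ φ ∈ l, φ.val ρ v := by
  induction l with
  | nil => simp [Fml.conj]
  | cons a l ih => rw [List.forall_mem_cons, ← ih]; rfl

theorem QF.isArith_toF (A : QF k r) : A.toF.IsArith := by
  induction A with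
  | cmp c e f => trivial
  | and P Q hP hQ => exact ⟨hP, hQ⟩
  | or P Q hP hQ => exact ⟨hP, hQ⟩
  | not P hP => exact hP

theorem QF.holdsA_toF (A : QF k r) : A.toF.holdsA ρ ↔ A.val ρ := by
  induction A with
  | cmp c e f => rfl
  | and P Q hP hQ => simp only [QF.toF, Fml.holdsA, QF.val_and, hP, hQ]
  | or P Q hP hQ => simp only [QF.toF, Fml.holdsA, QF.val_or, hP, hQ]
  | not P hP => simp only [QF.toF, Fml.holdsA, QF.val_not, hP]

end Valuation

/-! ### Completeness of the sequent rules for propositional logic over real arithmetic. -/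

section Propositional

variable {L : Lang} {T : Set (Fml L.k L.r)} {Γ Δ : List (Fml L.k L.r)} {φ ψ : Fml L.k L.r}

theorem Deriv.absurd (h₁ : Deriv L T Γ φ) (h₂ : Deriv L T Γ φ.not) : Deriv L T Γ ψ :=
  Deriv.cut h₂ (Deriv.notL h₁)

theorem Deriv.by_cases (φ : Fml L.k L.r) (h₁ : Deriv L T (φ :: Γ) ψ)
    (h₂ : Deriv L T (φ.not :: Γ) ψ) : Deriv L T Γ ψ := by
  apply Deriv.classical
  have h : Deriv L T (ψ.not :: Γ) φ.not := by
    apply Deriv.notR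
    have h₃ : Deriv L T (φ :: ψ.not :: Γ) ψ := h₁.weaken (by intro; simp; tauto)
    exact h₃.absurd (Deriv.hyp (by simp))
  refine h.cut ?_
  have h₃ : Deriv L T (φ.not :: ψ.not :: Γ) ψ := h₂.weaken (by intro; simp; tauto)
  exact h₃.absurd (Deriv.hyp (by simp))

/-- The comparisons, modal and quantified formulas of which a formula is a Boolean combination. -/
def Fml.atoms {k r : ℕ} : Fml k r → List (Fml k r)
  | cmp c e f => [cmp c e f]
  | and φ ψ => atoms φ ++ atoms ψ
  | or φ ψ => atoms φ ++ atoms ψ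
  | not φ => atoms φ
  | all x φ => [all x φ]
  | ex x φ => [ex x φ]
  | box α φ => [box α φ]
  | dia α φ => [dia α φ]

/-- Kalmár's argument: a context that settles every atom of a formula settles the formula, in the
way dictated by any valuation satisfying the context. -/
theorem Deriv.decide_of_atoms {ρ : Term L.k L.r → ℝ} {v : Fml L.k L.r → Prop}
    (hv : ∀ δ ∈ Δ, δ.val ρ v) (φ : Fml L.k L.r) (hφ : ∀ a ∈ φ.atoms, a ∈ Δ ∨ a.not ∈ Δ) :
    (φ.val ρ v → Deriv L T Δ φ) ∧ (¬ φ.val ρ v → Deriv L T Δ φ.not) := by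
  have atom : ∀ a : Fml L.k L.r, (a ∈ Δ ∨ a.not ∈ Δ) →
      (a.val ρ v → Deriv L T Δ a) ∧ (¬ a.val ρ v → Deriv L T Δ a.not) := by
    rintro a (h | h)
    · exact ⟨fun _ => Deriv.hyp h, fun h' => (h' (hv _ h)).elim⟩
    · exact ⟨fun h' => (hv _ h h').elim, fun _ => Deriv.hyp h⟩
  have weak : ∀ {χ : Fml L.k L.r} {Δ' : List (Fml L.k L.r)}, Deriv L T Δ χ →
      Deriv L T (Δ' ++ Δ) χ := fun h => h.weaken (by intro; simp; tauto)
  induction φ with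
  | cmp c e f => exact atom _ (hφ _ (by simp [Fml.atoms]))
  | all x φ _ => exact atom _ (hφ _ (by simp [Fml.atoms]))
  | ex x φ _ => exact atom _ (hφ _ (by simp [Fml.atoms]))
  | box α φ _ => exact atom _ (hφ _ (by simp [Fml.atoms]))
  | dia α φ _ => exact atom _ (hφ _ (by simp [Fml.atoms]))
  | not φ ih =>
    obtain ⟨h₁, h₂⟩ := ih hφ
    refine ⟨fun h => h₂ h, fun h => ?_⟩
    rw [Fml.val_not, not_not] at h
    exact Deriv.notR ((weak (Δ' := [_]) (h₁ h)).absurd (Deriv.hyp (by simp)))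
  | and φ ψ ih₁ ih₂ =>
    obtain ⟨h₁, h₂⟩ := ih₁ fun a ha => hφ a (by simp [Fml.atoms, ha])
    obtain ⟨h₃, h₄⟩ := ih₂ fun a ha => hφ a (by simp [Fml.atoms, ha])
    refine ⟨fun h => Deriv.andR (h₁ h.1) (h₃ h.2), fun h => Deriv.notR (Deriv.andL ?_)⟩
    by_cases h' : φ.val ρ v
    · have := h₄ fun h'' => h ⟨h', h''⟩
      exact Deriv.absurd (Deriv.hyp (φ := ψ) (by simp)) (weak (Δ' := [_, _]) this)
    · exact Deriv.absurd (Deriv.hyp (φ := φ) (by simp)) (weak (Δ' := [_, _]) (h₂ h'))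
  | or φ ψ ih₁ ih₂ =>
    obtain ⟨h₁, h₂⟩ := ih₁ fun a ha => hφ a (by simp [Fml.atoms, ha])
    obtain ⟨h₃, h₄⟩ := ih₂ fun a ha => hφ a (by simp [Fml.atoms, ha])
    refine ⟨fun h => h.elim (fun h => Deriv.orR1 (h₁ h)) fun h => Deriv.orR2 (h₃ h), fun h => ?_⟩
    rw [Fml.val_or, not_or] at h
    exact Deriv.notR (Deriv.orL (Deriv.absurd (Deriv.hyp (φ := φ) (by simp)) (weak (Δ' := [_]) (h₂ h.1)))
      (Deriv.absurd (Deriv.hyp (φ := ψ) (by simp)) (weak (Δ' := [_]) (h₄ h.2))))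

theorem Deriv.conj {l : List (Fml L.k L.r)} (h : ∀ φ ∈ l, Deriv L T Γ φ) :
    Deriv L T Γ (Fml.conj l) := by
  induction l with
  | nil =>
    exact Deriv.ax (Axm.arith _ (QF.isArith_toF _) fun ρ => (QF.holdsA_toF ρ _).2 (QF.val_tru ρ))
  | cons a l ih =>
    exact Deriv.andR (h a (by simp)) (ih fun φ hφ => h φ (by simp [hφ]))

theorem Fml.isArith_conj {k r : ℕ} {l : List (Fml k r)} (h : ∀ φ ∈ l, φ.IsArith) :
    (Fml.conj l).IsArith := by
  induction l with
  | nil => exact QF.isArith_toF _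
  | cons a l ih => exact ⟨h a (by simp), ih fun φ hφ => h φ (by simp [hφ])⟩

theorem Fml.holdsA_conj {k r : ℕ} {l : List (Fml k r)} {ρ : Term k r → ℝ} :
    (Fml.conj l).holdsA ρ ↔ ∀ φ ∈ l, φ.holdsA ρ := by
  induction l with
  | nil => exact iff_of_true ((QF.holdsA_toF ρ _).2 (QF.val_tru ρ)) (by simp)
  | cons a l ih => rw [List.forall_mem_cons, ← ih]; rfl

/-- Comparisons and negations of comparisons. -/
def Fml.IsCmpLit {k r : ℕ} : Fml k r → Prop
  | cmp _ _ _ => True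
  | not (cmp _ _ _) => True
  | _ => False

theorem Fml.IsCmpLit.isArith {k r : ℕ} {φ : Fml k r} (h : φ.IsCmpLit) : φ.IsArith := by
  unfold Fml.IsCmpLit at h
  split at h <;> trivial

theorem Fml.IsCmpLit.holdsA_iff {k r : ℕ} {φ : Fml k r} (h : φ.IsCmpLit) (ρ : Term k r → ℝ)
    (v : Fml k r → Prop) : φ.holdsA ρ ↔ φ.val ρ v := by
  unfold Fml.IsCmpLit at h
  split at h <;> first | exact Iff.rfl | exact h.elim

/-- Formulas that are not propositional combinations. -/
def Fml.IsAtom {k r : ℕ} : Fml k r → Prop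
  | and _ _ => False
  | or _ _ => False
  | not _ => False
  | _ => True

/-- Atomic formulas and their negations. -/
def Fml.IsLit {k r : ℕ} (φ : Fml k r) : Prop := ∃ a : Fml k r, a.IsAtom ∧ (φ = a ∨ φ = a.not)

theorem Fml.isAtom_of_mem_atoms {k r : ℕ} {φ a : Fml k r} (h : a ∈ φ.atoms) : a.IsAtom := by
  induction φ with
  | and φ ψ h₁ h₂ => exact (List.mem_append.1 h).elim h₁ h₂
  | or φ ψ h₁ h₂ => exact (List.mem_append.1 h).elim h₁ h₂
  | not φ h₁ => exact h₁ h
  | _ =>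
    simp only [Fml.atoms, List.mem_singleton] at h
    subst h
    trivial

-- A set of literals fails to be satisfiable for two reasons only: it contains an atom together with
-- its negation, or its comparison literals have no common real solution. The first is refuted
-- propositionally, the second by an arithmetic axiom. Otherwise a real solution for the comparisons
-- and membership in `Δ` for the remaining atoms give a valuation.
open Classical in
theorem Deriv.exists_val_or_fls (hΔ : ∀ δ ∈ Δ, δ.IsLit) :
    (∃ ρ v, ∀ δ ∈ Δ, δ.val ρ v) ∨ Deriv L T Δ Fml.fls := by
  by_cases h₁ : ∃ a, a ∈ Δ ∧ a.not ∈ Δ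
  · obtain ⟨a, ha, ha'⟩ := h₁
    exact Or.inr ((Deriv.hyp ha).absurd (Deriv.hyp ha'))
  by_cases h₂ : ∃ ρ : Term L.k L.r → ℝ, ∀ δ ∈ Δ, δ.IsCmpLit → δ.holdsA ρ
  · obtain ⟨ρ, hρ⟩ := h₂
    refine Or.inl ⟨ρ, fun a => a ∈ Δ, fun δ hδ => ?_⟩
    by_cases hc : δ.IsCmpLit
    · exact (hc.holdsA_iff ρ _).1 (hρ δ hδ hc)
    obtain ⟨a, ha, h⟩ := hΔ δ hδ
    have key : (∃ c e f, a = Fml.cmp c e f) ∨ (a.val ρ (fun a => a ∈ Δ) ↔ a ∈ Δ) := by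
      cases a with
      | cmp c e f => exact Or.inl ⟨c, e, f, rfl⟩
      | and φ ψ => exact ha.elim
      | or φ ψ => exact ha.elim
      | not φ => exact ha.elim
      | _ => exact Or.inr Iff.rfl
    rcases key with ⟨c, e, f, rfl⟩ | key
    · rcases h with rfl | rfl <;> exact (hc trivial).elim
    · rcases h with rfl | rfl
      · exact key.2 hδ
      · exact fun h' => h₁ ⟨a, key.1 h', hδ⟩
  · right
    let C := Δ.filter fun δ => δ.IsCmpLit
    have hC : ∀ φ ∈ C, φ ∈ Δ ∧ φ.IsCmpLit := fun φ hφ => by simpa [C] using hφ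
    -- The negated conjunction of the comparison literals holds for every `ρ`, hence is itself an
    -- arithmetic axiom.
    have d₁ : Deriv L T Δ (Fml.conj C) := Deriv.conj fun φ hφ => Deriv.hyp (hC φ hφ).1
    refine d₁.absurd (Deriv.ax (Axm.arith _ (Fml.isArith_conj fun φ hφ => (hC φ hφ).2.isArith)
      fun ρ h => h₂ ⟨ρ, fun δ hδ hc => Fml.holdsA_conj.1 h δ (by simp [C, hδ, hc])⟩))

/-- Iterated excluded middle: it suffices to derive the goal on each branch of the full truth table
of `A`. -/
theorem Deriv.of_decided (A : List (Fml L.k L.r)) (hA : ∀ a ∈ A, a.IsAtom)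
    (h : ∀ Δ' : List (Fml L.k L.r), (∀ δ ∈ Δ', δ.IsLit) → (∀ a ∈ A, a ∈ Δ' ∨ a.not ∈ Δ') →
      Deriv L T (Δ' ++ Γ) φ) : Deriv L T Γ φ := by
  induction A generalizing Γ with
  | nil => simpa using h [] (by simp) (by simp)
  | cons a A ih =>
    have ha : a.IsAtom := hA a (by simp)
    refine Deriv.by_cases a (ih (fun b hb => hA b (by simp [hb])) fun Δ' h₁ h₂ => ?_)
      (ih (fun b hb => hA b (by simp [hb])) fun Δ' h₁ h₂ => ?_)
    · refine (h (a :: Δ') ?_ ?_).weaken (by intro; simp; tauto)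
      · intro δ hδ
        rcases List.mem_cons.1 hδ with rfl | hδ
        exacts [⟨_, ha, Or.inl rfl⟩, h₁ δ hδ]
      · intro b hb
        rcases List.mem_cons.1 hb with rfl | hb
        · simp
        · rcases h₂ b hb with h' | h' <;> simp [h']
    · refine (h (a.not :: Δ') ?_ ?_).weaken (by intro; simp; tauto)
      · intro δ hδ
        rcases List.mem_cons.1 hδ with rfl | hδ
        exacts [⟨_, ha, Or.inr rfl⟩, h₁ δ hδ]
      · intro b hb
        rcases List.mem_cons.1 hb with rfl | hb
        · simp
        · rcases h₂ b hb with h' | h' <;> simp [h']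

/-- Propositional reasoning and real arithmetic are available in the calculus. -/
theorem Deriv.of_val (H : ∀ ρ v, (∀ γ ∈ Γ, γ.val ρ v) → φ.val ρ v) : Deriv L T Γ φ := by
  refine Deriv.of_decided (φ.atoms ++ Γ.flatMap Fml.atoms) ?_ fun Δ' h₁ h₂ => ?_
  · intro a ha
    rcases List.mem_append.1 ha with ha | ha
    · exact Fml.isAtom_of_mem_atoms ha
    · obtain ⟨γ, _, hγ⟩ := List.mem_flatMap.1 ha
      exact Fml.isAtom_of_mem_atoms hγ
  have weak : ∀ {χ : Fml L.k L.r}, Deriv L T Δ' χ → Deriv L T (Δ' ++ Γ) χ :=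
    fun h => h.weaken (by intro; simp; tauto)
  -- On a satisfiable branch the valuation either makes the conclusion true, so that it is
  -- derivable, or falsifies some hypothesis, whose negation is then derivable. Unsatisfiable
  -- branches are contradictory.
  rcases Deriv.exists_val_or_fls (T := T) h₁ with ⟨ρ, v, hv⟩ | h
  · by_cases hΓ : ∀ γ ∈ Γ, γ.val ρ v
    · exact weak ((Deriv.decide_of_atoms hv φ fun a ha => h₂ a (by simp [ha])).1 (H ρ v hΓ))
    · push Not at hΓ
      obtain ⟨γ, hγ, hγ'⟩ := hΓ
      have := (Deriv.decide_of_atoms (T := T) hv γ fun a ha => h₂ a (List.mem_append_right _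
        (List.mem_flatMap.2 ⟨γ, hγ, ha⟩))).2 hγ'
      exact Deriv.absurd (Deriv.hyp (φ := γ) (by simp [hγ])) (weak this)
  · refine (weak h).absurd (Deriv.ax (Axm.arith _ (QF.isArith_toF (QF.not QF.fls)) fun ρ => ?_))
    exact (QF.holdsA_toF ρ (QF.not QF.fls)).2 (QF.val_fls ρ)

theorem Deriv.of_imp (h : Deriv L T Γ (φ.imp ψ)) : Deriv L T (φ :: Γ) ψ := by
  refine Deriv.cut (h.weaken (Δ := φ :: Γ) (by intro; simp; tauto)) (Deriv.of_val fun ρ v hv => ?_)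
  have h₁ := hv (φ.imp ψ) (by simp)
  have h₂ := hv φ (by simp)
  exact (Fml.val_imp ρ v φ ψ).1 h₁ h₂

theorem Deriv.imp (h : Deriv L T (φ :: Γ) ψ) : Deriv L T Γ (φ.imp ψ) :=
  Deriv.by_cases φ (Deriv.orR2 h) (Deriv.orR1 (Deriv.hyp (by simp)))

theorem Deriv.mono {T' : Set (Fml L.k L.r)} (hT : T ⊆ T') (h : Deriv L T Γ φ) :
    Deriv L T' Γ φ := by
  induction h with
  | theory h => exact Deriv.theory (hT h)
  | ax h => exact Deriv.ax h
  | hyp h => exact Deriv.hyp h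
  | weaken h _ ih => exact Deriv.weaken h ih
  | cut _ _ h₁ h₂ => exact Deriv.cut h₁ h₂
  | notL _ h => exact Deriv.notL h
  | notR _ h => exact Deriv.notR h
  | classical _ h => exact Deriv.classical h
  | andL _ h => exact Deriv.andL h
  | andR _ _ h₁ h₂ => exact Deriv.andR h₁ h₂
  | orL _ _ h₁ h₂ => exact Deriv.orL h₁ h₂
  | orR1 _ h => exact Deriv.orR1 h
  | orR2 _ h => exact Deriv.orR2 h
  | allL e h₁ h₂ _ h => exact Deriv.allL e h₁ h₂ h
  | allR y h₁ h₂ h₃ _ h => exact Deriv.allR y h₁ h₂ h₃ h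
  | exL y h₁ h₂ h₃ h₄ _ h => exact Deriv.exL y h₁ h₂ h₃ h₄ h
  | exR e h₁ h₂ _ h => exact Deriv.exR e h₁ h₂ h
  | gen α _ h => exact Deriv.gen α h

end Propositional

/-! ### Combining provable formulas; quantifiers and auxiliary variables. -/

section Provable

variable {L : Lang} {a b c d e f φ ψ χ : Fml L.k L.r}

/-- The workhorse for combining axioms and lemmas: box and diamond formulas are atoms for `v`, so a
step that uses only propositional logic and real arithmetic becomes a check on valuations. -/
theorem Provable.of_list {l : List (Fml L.k L.r)} (h : ∀ a ∈ l, Provable L a)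
    (H : ∀ ρ v, (∀ a ∈ l, a.val ρ v) → φ.val ρ v) : Provable L φ :=
  Deriv.cut (φ := Fml.conj l) (Deriv.conj h) (Deriv.of_val fun ρ v hv =>
    H ρ v ((Fml.val_conj ρ v l).1 (hv _ (by simp))))

theorem Provable.val₀ (H : ∀ ρ v, φ.val ρ v) : Provable L φ :=
  Provable.of_list (l := []) (by simp) fun ρ v _ => H ρ v

theorem Provable.val₁ (ha : Provable L a) (H : ∀ ρ v, a.val ρ v → φ.val ρ v) : Provable L φ :=
  Provable.of_list (l := [a]) (by simpa using ha) fun ρ v h => H ρ v (by simpa using h)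

theorem Provable.val₂ (ha : Provable L a) (hb : Provable L b)
    (H : ∀ ρ v, a.val ρ v → b.val ρ v → φ.val ρ v) : Provable L φ :=
  Provable.of_list (l := [a, b]) (by simp [ha, hb]) fun ρ v h =>
    H ρ v (h a (by simp)) (h b (by simp))

theorem Provable.val₃ (ha : Provable L a) (hb : Provable L b) (hc : Provable L c)
    (H : ∀ ρ v, a.val ρ v → b.val ρ v → c.val ρ v → φ.val ρ v) : Provable L φ :=
  Provable.of_list (l := [a, b, c]) (by simp [ha, hb, hc]) fun ρ v h =>
    H ρ v (h a (by simp)) (h b (by simp)) (h c (by simp))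

theorem Provable.val₄ (ha : Provable L a) (hb : Provable L b) (hc : Provable L c)
    (hd : Provable L d) (H : ∀ ρ v, a.val ρ v → b.val ρ v → c.val ρ v → d.val ρ v → φ.val ρ v) :
    Provable L φ :=
  Provable.of_list (l := [a, b, c, d]) (by simp [ha, hb, hc, hd]) fun ρ v h =>
    H ρ v (h a (by simp)) (h b (by simp)) (h c (by simp)) (h d (by simp))

theorem Provable.val₅ (ha : Provable L a) (hb : Provable L b) (hc : Provable L c)
    (hd : Provable L d) (he : Provable L e)
    (H : ∀ ρ v, a.val ρ v → b.val ρ v → c.val ρ v → d.val ρ v → e.val ρ v → φ.val ρ v) :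
    Provable L φ :=
  Provable.of_list (l := [a, b, c, d, e]) (by simp [ha, hb, hc, hd, he]) fun ρ v h =>
    H ρ v (h a (by simp)) (h b (by simp)) (h c (by simp)) (h d (by simp)) (h e (by simp))

theorem Axm.provable (h : Axm L φ) : Provable L φ := Deriv.ax h

theorem Provable.mp (h : Provable L (φ.imp ψ)) (h' : Provable L φ) : Provable L ψ :=
  h.val₂ h' fun ρ v h h' => (Fml.val_imp ρ v φ ψ).1 h h'

theorem Provable.trans (h : Provable L (φ.imp ψ)) (h' : Provable L (ψ.imp χ)) :
    Provable L (φ.imp χ) :=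
  h.val₂ h' fun ρ v => by simp only [Fml.val_imp]; tauto

theorem Provable.qf {A : QF L.k L.r} (h : ∀ ρ, A.val ρ) : Provable L A.toF :=
  Provable.val₀ fun ρ v => (Fml.val_toF ρ v A).2 (h ρ)

theorem Fml.fv_imp {k r : ℕ} (φ ψ : Fml k r) : (φ.imp ψ).fv = φ.fv ∪ ψ.fv := rfl

theorem provable_all_self (n : ℕ) (φ : Fml L.k L.r) :
    Provable L ((Fml.all (Var.base n) φ).imp φ) := by
  refine Deriv.imp (Deriv.allL (Term.var (Var.base n)) trivial (Fml.freeFor_self _ φ) ?_)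
  rw [Fml.subst_self]
  exact Deriv.hyp (by simp)

theorem provable_ex_self (n : ℕ) (φ : Fml L.k L.r) :
    Provable L (φ.imp (Fml.ex (Var.base n) φ)) := by
  refine Deriv.imp (Deriv.exR (Term.var (Var.base n)) trivial (Fml.freeFor_self _ φ) ?_)
  rw [Fml.subst_self]
  exact Deriv.hyp (by simp)

theorem Deriv.all_intro {T : Set (Fml L.k L.r)} {Γ : List (Fml L.k L.r)} {x : Var}
    (hx : ∀ γ ∈ Γ, x ∉ γ.fv) (h : Deriv L T Γ φ) : Deriv L T Γ (Fml.all x φ) := by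
  refine Deriv.allR x hx (by simp [Fml.fv]) (Fml.freeFor_self x φ) ?_
  rwa [Fml.subst_self]

theorem Provable.all_intro {x : Var} (hx : x ∉ χ.fv) (h : Provable L (χ.imp φ)) :
    Provable L (χ.imp (Fml.all x φ)) :=
  Deriv.imp (Deriv.all_intro (by simpa using hx) (Deriv.of_imp h))

theorem Provable.ex_elim {x : Var} (hx : x ∉ χ.fv) (h : Provable L (φ.imp χ)) :
    Provable L ((Fml.ex x φ).imp χ) := by
  refine Deriv.imp (Deriv.exL x (by simp) (by simp [Fml.fv]) hx (Fml.freeFor_self x φ) ?_)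
  rw [Fml.subst_self]
  exact Deriv.of_imp h

theorem Provable.allVec_intro {xs : List ℕ} (hx : ∀ x ∈ xs, Var.base x ∉ χ.fv)
    (h : Provable L (χ.imp φ)) : Provable L (χ.imp (Fml.allVec xs φ)) := by
  induction xs with
  | nil => exact h
  | cons x xs ih =>
    exact Provable.all_intro (hx x (by simp)) (ih fun y hy => hx y (by simp [hy]))

theorem provable_allVec_self (xs : List ℕ) (φ : Fml L.k L.r) :
    Provable L ((Fml.allVec xs φ).imp φ) := by
  induction xs with
  | nil => exact Provable.val₀ fun ρ v => by simp [Fml.allVec]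
  | cons x xs ih => exact (provable_all_self x _).trans ih

theorem Fml.fv_allVec {k r : ℕ} (xs : List ℕ) (φ : Fml k r) :
    (Fml.allVec xs φ).fv = φ.fv \ (xs.map Var.base).toFinset := by
  induction xs with
  | nil => simp [Fml.allVec]
  | cons x xs ih =>
    change (Fml.allVec xs φ).fv.erase _ = _
    rw [ih]
    ext z
    simp
    tauto

theorem Provable.allVec_mono {xs : List ℕ} (h : Provable L (φ.imp ψ)) :
    Provable L ((Fml.allVec xs φ).imp (Fml.allVec xs ψ)) :=
  Provable.allVec_intro (by simp +contextual [Fml.fv_allVec])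
    ((provable_allVec_self xs φ).trans h)

open Classical in
theorem evalA_update_of_notMem {k r : ℕ} (t : Term k r) {z : Var} (h : z ∉ t.fv) (ρ : Term k r → ℝ)
    (u : ℝ) : t.evalA (Function.update ρ (Term.var z) u) = t.evalA ρ := by
  induction t with
  | var x =>
    have : x ≠ z := by rintro rfl; simp [Term.fv] at h
    simp [Term.evalA, this]
  | const c => rfl
  | add e f he hf =>
    simp only [Term.fv, Finset.mem_union, not_or] at h
    simp only [Term.evalA, he h.1, hf h.2]
  | mul e f he hf =>
    simp only [Term.fv, Finset.mem_union, not_or] at h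
    simp only [Term.evalA, he h.1, hf h.2]
  | app j a _ => simp [Term.evalA]
  | diff e _ => simp [Term.evalA]

theorem Term.opaqueFv_subset {k r : ℕ} (t : Term k r) : t.opaqueFv ⊆ t.fv := by
  induction t with
  | var x => simp [Term.opaqueFv]
  | const c => simp [Term.opaqueFv]
  | add e f he hf => exact Finset.union_subset_union he hf
  | mul e f he hf => exact Finset.union_subset_union he hf
  | app j a _ => exact subset_rfl
  | diff e _ => exact subset_rfl

/-- A variable that occurs nowhere else may be assumed to have any given value. -/
theorem Provable.intro_eq {z : Var} {t : Term L.k L.r} (ht : z ∉ t.fv) (hφ : z ∉ φ.fv)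
    (h : Provable L ((Fml.eq (Term.var z) t).imp φ)) : Provable L φ := by
  -- That some real number equals `t` is an arithmetic axiom. The bound variable must not occur
  -- inside an opaque subterm of `t`, which follows from its not occurring in `t` at all.
  refine (Provable.ex_elim hφ h).mp (Axm.provable (Axm.arith _ ⟨trivial, ?_⟩ fun ρ => ?_))
  · simp only [Fml.eq, Fml.opaqueFv, Term.opaqueFv, Finset.empty_union]
    exact fun h => ht (t.opaqueFv_subset h)
  · refine ⟨t.evalA ρ, ?_⟩
    simp [Fml.eq, Fml.holdsA, Cmp.rel, evalA_update_of_notMem t ht, Term.evalA]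

theorem Provable.intro_conj_eq {zs : List (Var × Term L.k L.r)} (hn : (zs.map Prod.fst).Nodup)
    (ht : ∀ p ∈ zs, ∀ q ∈ zs, p.1 ∉ q.2.fv) (hφ : ∀ p ∈ zs, p.1 ∉ φ.fv)
    (h : Provable L ((Fml.conj (zs.map fun p => Fml.eq (Term.var p.1) p.2)).imp φ)) :
    Provable L φ := by
  induction zs generalizing φ with
  | nil => exact h.mp (Provable.val₀ fun ρ v => by simp)
  | cons p zs ih =>
    simp only [List.map_cons, List.nodup_cons] at hn
    refine Provable.intro_eq (z := p.1) (t := p.2) (ht p (by simp) p (by simp))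
      (hφ p (by simp)) (ih hn.2 (fun p' hp q hq => ht p' (by simp [hp]) q (by simp [hq])) ?_ ?_)
    · intro q hq hq'
      simp only [Fml.fv_imp, Fml.eq, Fml.fv, Term.fv, Finset.mem_union, Finset.mem_singleton] at hq'
      rcases hq' with (h' | h') | h'
      · exact hn.1 (List.mem_map.2 ⟨q, hq, h'⟩)
      · exact ht q (by simp [hq]) p (by simp) h'
      · exact hφ q (by simp [hq]) h'
    · exact h.val₁ fun ρ v => by
        simp only [Fml.val_imp, Fml.val_conj, List.map_cons, List.forall_mem_cons]; tauto

end Provable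

/-! ### Derived modal rules and rules for evolution domains. -/

section Modal

variable {L : Lang} {φ ψ χ θ : Fml L.k L.r} {α : Act L.k L.r}

theorem Provable.gen (α : Act L.k L.r) (h : Provable L φ) : Provable L (Fml.box α φ) :=
  Deriv.gen α h

theorem Provable.box_mono (h : Provable L (φ.imp ψ)) :
    Provable L ((Fml.box α φ).imp (Fml.box α ψ)) :=
  (Axm.provable (Axm.K α φ ψ)).mp (h.gen α)

theorem Provable.box_mono₂ (h : Provable L (φ.imp (ψ.imp χ))) :
    Provable L ((Fml.box α φ).imp ((Fml.box α ψ).imp (Fml.box α χ))) :=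
  h.box_mono.trans (Axm.provable (Axm.K α ψ χ))

theorem Provable.box_mono₃ (h : Provable L (φ.imp (ψ.imp (χ.imp θ)))) :
    Provable L ((Fml.box α φ).imp ((Fml.box α ψ).imp ((Fml.box α χ).imp (Fml.box α θ)))) :=
  (h.box_mono₂ (α := α)).val₂ (Axm.provable (Axm.K α χ θ)) fun ρ v => by
    simp only [Fml.val_imp]; tauto

theorem provable_box_const (α : Act L.k L.r) (h : Disjoint φ.fv α.bv) :
    Provable L (φ.imp (Fml.box α φ)) :=
  Axm.provable (Axm.V α φ h)

theorem provable_dia_iff (α : Act L.k L.r) (φ : Fml L.k L.r) :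
    Provable L ((Fml.dia α φ).iff (Fml.not (Fml.box α (Fml.not φ)))) :=
  Axm.provable (Axm.diamond α φ)

theorem provable_dia_not_iff (α : Act L.k L.r) (φ : Fml L.k L.r) :
    Provable L ((Fml.dia α φ.not).iff (Fml.not (Fml.box α φ))) :=
  (provable_dia_iff α φ.not).val₃
    (Provable.box_mono (α := α) (φ := φ) (ψ := φ.not.not) (Provable.val₀ fun ρ v => by simp))
    (Provable.box_mono (α := α) (φ := φ.not.not) (ψ := φ) (Provable.val₀ fun ρ v => by simp))
    fun ρ v => by simp only [Fml.val_imp, Fml.val_iff, Fml.val_not]; tauto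

theorem Provable.dia_box_mono (h : Provable L (φ.imp (ψ.imp χ))) :
    Provable L ((Fml.box α φ).imp ((Fml.dia α ψ).imp (Fml.dia α χ))) :=
  (provable_dia_iff α ψ).val₃ (provable_dia_iff α χ)
    (Provable.box_mono₂ (α := α) (φ := φ) (ψ := χ.not) (χ := ψ.not)
      (h.val₁ fun ρ v => by simp only [Fml.val_imp, Fml.val_not]; tauto))
    fun ρ v => by simp only [Fml.val_imp, Fml.val_iff, Fml.val_not]; tauto

theorem Provable.dia_mono (h : Provable L (φ.imp ψ)) :
    Provable L ((Fml.dia α φ).imp (Fml.dia α ψ)) :=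
  (Provable.gen α (Provable.val₀ (φ := Fml.tru) fun ρ v => by simp)).val₂
    (Provable.dia_box_mono (α := α) (φ := Fml.tru) (ψ := φ) (χ := ψ)
      (h.val₁ fun ρ v => by simp))
    fun ρ v => by simp only [Fml.val_imp]; tauto

theorem provable_const_of_dia (h : Disjoint φ.fv α.bv) :
    Provable L ((Fml.dia α φ).imp φ) :=
  (provable_dia_iff α φ).val₂ (provable_box_const α (φ := φ.not) h)
    fun ρ v => by simp only [Fml.val_imp, Fml.val_iff, Fml.val_not]; tauto

variable {s : Sys L.k L.r} {Q R S : QF L.k L.r}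

theorem Provable.box_dom_mono (hs : s.WF) (hQ : Q.DiffFree) (hR : R.DiffFree)
    (h : Provable L (Q.toF.imp R.toF)) :
    Provable L ((Fml.box (Act.ode s R) φ).imp (Fml.box (Act.ode s Q) φ)) :=
  (Axm.provable (Axm.DMP s Q R φ hs hQ hR)).mp (h.gen _)

theorem Provable.dia_dom_mono (hs : s.WF) (hQ : Q.DiffFree) (hR : R.DiffFree)
    (h : Provable L (Q.toF.imp R.toF)) :
    Provable L ((Fml.dia (Act.ode s Q) φ).imp (Fml.dia (Act.ode s R) φ)) :=
  (Provable.box_dom_mono (φ := φ.not) hs hQ hR h).val₃ (provable_dia_iff (Act.ode s Q) φ)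
    (provable_dia_iff (Act.ode s R) φ)
    fun ρ v => by simp only [Fml.val_imp, Fml.val_iff, Fml.val_not]; tauto

/-- A domain may be replaced by a consequence along the solutions within it. -/
theorem provable_dia_dom_of_box (hs : s.WF) (hQ : Q.DiffFree) (hR : R.DiffFree) :
    Provable L ((Fml.box (Act.ode s Q) R.toF).imp
      ((Fml.dia (Act.ode s Q) φ).imp (Fml.dia (Act.ode s R) φ))) :=
  (Axm.provable (Axm.DMP s Q R φ.not hs hQ hR)).val₄ (provable_dia_iff (Act.ode s Q) φ)
    (provable_dia_iff (Act.ode s R) φ)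
    (Provable.box_mono (α := Act.ode s Q) (φ := R.toF) (ψ := Q.toF.imp R.toF)
      (Provable.val₀ fun ρ v => by simp only [Fml.val_imp]; tauto))
    fun ρ v => by simp only [Fml.val_imp, Fml.val_iff, Fml.val_not]; tauto

theorem provable_box_cut (hs : s.WF) (hQ : Q.DiffFree) (hR : R.DiffFree) :
    Provable L ((Fml.box (Act.ode s Q) R.toF).imp
      ((Fml.box (Act.ode s (QF.and Q R)) φ).imp (Fml.box (Act.ode s Q) φ))) :=
  (Axm.provable (Axm.DC s Q R φ hs hQ hR)).val₁ fun ρ v => by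
    simp only [Fml.val_imp, Fml.val_iff]; tauto

/-- Weakening: a box holds if its postcondition follows from the domain and from a formula that
holds along the solutions. -/
theorem Provable.box_weaken (hs : s.WF) (hQ : Q.DiffFree) (h : Provable L (Q.toF.imp (ψ.imp φ))) :
    Provable L ((Fml.box (Act.ode s Q) ψ).imp (Fml.box (Act.ode s Q) φ)) :=
  ((Provable.box_mono₂ (α := Act.ode s Q) h)).mp (Axm.provable (Axm.DW s Q hs hQ))

theorem Provable.dia_weaken (hs : s.WF) (hQ : Q.DiffFree) (h : Provable L (Q.toF.imp (ψ.imp φ))) :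
    Provable L ((Fml.dia (Act.ode s Q) ψ).imp (Fml.dia (Act.ode s Q) φ)) :=
  ((Provable.dia_box_mono (α := Act.ode s Q) h)).mp (Axm.provable (Axm.DW s Q hs hQ))

theorem Provable.box_of_dom (hs : s.WF) (hQ : Q.DiffFree) (h : Provable L (Q.toF.imp φ)) :
    Provable L (Fml.box (Act.ode s Q) φ) :=
  h.box_mono.mp (Axm.provable (Axm.DW s Q hs hQ))

theorem provable_dia_uniq (hs : s.WF) (hQ : Q.DiffFree) (hR : R.DiffFree) :
    Provable L ((Fml.dia (Act.ode s Q) φ).imp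
      ((Fml.dia (Act.ode s R) φ).imp (Fml.dia (Act.ode s (QF.and Q R)) φ))) :=
  (Axm.provable (Axm.Uniq s Q R φ hs hQ hR)).val₁ fun ρ v => by
    simp only [Fml.val_imp, Fml.val_iff, Fml.val_and]; tauto

/-- If the domain fails initially there is no run at all, so the box is vacuous and may be proved
under the assumption of the domain. -/
theorem provable_box_dom_or (hs : s.WF) (hQ : Q.DiffFree) (hφ : Disjoint φ.fv s.primes) :
    Provable L ((Q.toF.imp (Fml.box (Act.ode s Q) φ)).imp (Fml.box (Act.ode s Q) φ)) :=
  (Axm.provable (Axm.DX s Q φ hs hQ hφ)).val₁ fun ρ v => by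
    simp only [Fml.val_imp, Fml.val_iff, Fml.val_and]; tauto

theorem provable_box_skip (hs : s.WF) (hQ : Q.DiffFree) (hφ : Disjoint φ.fv s.primes) :
    Provable L ((Fml.box (Act.ode s Q) φ).imp (Q.toF.imp φ)) :=
  (Axm.provable (Axm.DX s Q φ hs hQ hφ)).val₁ fun ρ v => by
    simp only [Fml.val_imp, Fml.val_iff, Fml.val_and]; tauto

/-- The domain holds initially if there is a run. -/
theorem provable_dom_of_dia (hs : s.WF) (hQ : Q.DiffFree) (hφ : Disjoint φ.fv s.primes) :
    Provable L ((Fml.dia (Act.ode s Q) φ).imp Q.toF) :=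
  (provable_box_dom_or (φ := φ.not) hs hQ hφ).val₂ (provable_dia_iff (Act.ode s Q) φ) fun ρ v => by
    simp only [Fml.val_imp, Fml.val_iff, Fml.val_not]; tauto

end Modal

end DL

namespace DL

/-! ### Fresh variables, free variables and substitution. -/

section Variables

variable {k r : ℕ}

theorem exists_fresh (V : Finset Var) (n : ℕ) : ∃ ys : List ℕ, ys.length = n ∧ ys.Nodup ∧
    ∀ y ∈ ys, Var.base y ∉ V ∧ Var.prime (Var.base y) ∉ V := by
  have hfin : {m : ℕ | Var.base m ∈ V ∨ Var.prime (Var.base m) ∈ V}.Finite := by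
    refine Set.Finite.union ?_ ?_
    · exact Set.Finite.preimage (fun a _ b _ h => Var.base.inj h) V.finite_toSet
    · exact Set.Finite.preimage (f := fun m => Var.prime (Var.base m))
        (fun a _ b _ h => Var.base.inj (Var.prime.inj h)) V.finite_toSet
  obtain ⟨M, hM⟩ := hfin.bddAbove
  refine ⟨List.range' (M + 1) n, by simp, List.nodup_range', fun y hy => ?_⟩
  rw [List.mem_range'_1] at hy
  by_contra h
  have : y ≤ M := hM (by simp only [Set.mem_ofPred_eq]; tauto)
  omega

theorem exists_fresh_one (V : Finset Var) :
    ∃ y : ℕ, Var.base y ∉ V ∧ Var.prime (Var.base y) ∉ V := by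
  obtain ⟨ys, hl, -, hy⟩ := exists_fresh V 1
  obtain ⟨y, rfl⟩ := List.length_eq_one_iff.1 hl
  exact ⟨y, hy y (by simp)⟩

theorem Term.DiffFree.prime_notMem {t : Term k r} (ht : t.DiffFree) (z : Var) :
    Var.prime z ∉ t.fv := by
  induction t with
  | var x => cases x with
    | base n => simp [Term.fv]
    | prime y => exact ht.elim
  | const c => simp [Term.fv]
  | add e f he hf => simp [Term.fv, he ht.1, hf ht.2]
  | mul e f he hf => simp [Term.fv, he ht.1, hf ht.2]
  | app j a ha => simp only [Term.fv, Finset.mem_biUnion, not_exists]; exact fun i h => ha i (ht i) h.2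
  | diff e _ => exact ht.elim

theorem QF.DiffFree.prime_notMem {A : QF k r} (hA : A.DiffFree) (z : Var) :
    Var.prime z ∉ A.fv := by
  induction A with
  | cmp c e f => simp [QF.fv, hA.1.prime_notMem, hA.2.prime_notMem]
  | and P Q hP hQ => simp [QF.fv, hP hA.1, hQ hA.2]
  | or P Q hP hQ => simp [QF.fv, hP hA.1, hQ hA.2]
  | not P hP => exact hP hA

theorem QF.fv_toF (A : QF k r) : A.toF.fv = A.fv := by
  induction A with
  | cmp c e f => rfl
  | and P Q hP hQ => simp only [QF.toF, Fml.fv, QF.fv, hP, hQ]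
  | or P Q hP hQ => simp only [QF.toF, Fml.fv, QF.fv, hP, hQ]
  | not P hP => exact hP

theorem Sys.mem_rhsFv {s : Sys k r} {z : Var} : z ∈ s.rhsFv ↔ ∃ p ∈ s, z ∈ p.2.fv := by
  induction s with
  | nil => simp [Sys.rhsFv]
  | cons p s ih =>
    rw [show Sys.rhsFv (p :: s) = p.2.fv ∪ Sys.rhsFv s from rfl, Finset.mem_union, ih]
    simp

theorem Sys.WF.prime_notMem {s : Sys k r} (hs : s.WF) (z : Var) : Var.prime z ∉ s.rhsFv := by
  rw [Sys.mem_rhsFv]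
  rintro ⟨p, hp, h⟩
  exact (hs.2 p hp).prime_notMem z h

@[simp] theorem Sys.base_mem_lhs {s : Sys k r} {n : ℕ} : Var.base n ∈ s.lhs ↔ n ∈ s.vars := by
  simp [Sys.lhs]

@[simp] theorem Sys.prime_mem_lhs {s : Sys k r} {z : Var} : Var.prime z ∉ s.lhs := by
  simp [Sys.lhs]

@[simp] theorem Sys.prime_mem_primes {s : Sys k r} {n : ℕ} :
    Var.prime (Var.base n) ∈ s.primes ↔ n ∈ s.vars := by
  simp [Sys.primes]

theorem Sys.eq_prime_of_mem_primes {s : Sys k r} {z : Var} (h : z ∈ s.primes) :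
    ∃ n ∈ s.vars, z = Var.prime (Var.base n) := by
  simp only [Sys.primes, List.mem_toFinset, List.mem_map] at h
  obtain ⟨n, hn, rfl⟩ := h
  exact ⟨n, hn, rfl⟩

theorem Sys.disjoint_primes {s : Sys k r} {V : Finset Var} (h : ∀ z, Var.prime z ∉ V) :
    Disjoint V s.primes := by
  rw [Finset.disjoint_left]
  intro z hz hz'
  obtain ⟨n, -, rfl⟩ := Sys.eq_prime_of_mem_primes hz'
  exact h _ hz

theorem QF.DiffFree.disjoint_primes {A : QF k r} (hA : A.DiffFree) (s : Sys k r) :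
    Disjoint A.toF.fv s.primes :=
  Sys.disjoint_primes fun z => by rw [QF.fv_toF]; exact hA.prime_notMem z

/-- Freedom from primes and from the variables of a system makes a formula constant. -/
theorem disjoint_bv {s : Sys k r} {Q : QF k r} {V : Finset Var} (h : ∀ z, Var.prime z ∉ V)
    (h' : ∀ x ∈ s.vars, Var.base x ∉ V) : Disjoint V (Act.ode s Q).bv := by
  rw [show (Act.ode s Q).bv = s.lhs ∪ s.primes from rfl, Finset.disjoint_union_right]
  refine ⟨?_, Sys.disjoint_primes h⟩
  rw [Finset.disjoint_left]
  intro z hz hz'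
  simp only [Sys.lhs, List.mem_toFinset, List.mem_map] at hz'
  obtain ⟨n, hn, rfl⟩ := hz'
  exact h' n hn hz

theorem Term.fv_subst {t : Term k r} (ht : t.DiffFree) (σ : Var → Term k r) :
    (t.subst σ).fv = t.fv.biUnion fun z => (σ z).fv := by
  induction t with
  | var x => simp [Term.subst, Term.fv]
  | const c => simp [Term.subst, Term.fv]
  | add e f he hf => simp only [Term.subst, Term.fv, he ht.1, hf ht.2, Finset.union_biUnion]
  | mul e f he hf => simp only [Term.subst, Term.fv, he ht.1, hf ht.2, Finset.union_biUnion]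
  | app j a ha =>
    simp only [Term.subst, Term.fv, Finset.biUnion_biUnion]
    exact Finset.biUnion_congr rfl fun i _ => ha i (ht i)
  | diff e _ => exact ht.elim

theorem QF.fv_subst {A : QF k r} (hA : A.DiffFree) (σ : Var → Term k r) :
    (A.subst σ).fv = A.fv.biUnion fun z => (σ z).fv := by
  induction A with
  | cmp c e f => simp only [QF.subst, QF.fv, Term.fv_subst hA.1, Term.fv_subst hA.2,
      Finset.union_biUnion]
  | and P Q hP hQ => simp only [QF.subst, QF.fv, hP hA.1, hQ hA.2, Finset.union_biUnion]
  | or P Q hP hQ => simp only [QF.subst, QF.fv, hP hA.1, hQ hA.2, Finset.union_biUnion]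
  | not P hP => exact hP hA

theorem Term.DiffFree.subst {t : Term k r} (ht : t.DiffFree) {σ : Var → Term k r}
    (hσ : ∀ n, (σ (Var.base n)).DiffFree) : (t.subst σ).DiffFree := by
  induction t with
  | var x => cases x with
    | base n => exact hσ n
    | prime y => exact ht.elim
  | const c => trivial
  | add e f he hf => exact ⟨he ht.1, hf ht.2⟩
  | mul e f he hf => exact ⟨he ht.1, hf ht.2⟩
  | app j a ha => exact fun i => ha i (ht i)
  | diff e _ => exact ht.elim

theorem QF.DiffFree.subst {A : QF k r} (hA : A.DiffFree) {σ : Var → Term k r}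
    (hσ : ∀ n, (σ (Var.base n)).DiffFree) : (A.subst σ).DiffFree := by
  induction A with
  | cmp c e f => exact ⟨hA.1.subst hσ, hA.2.subst hσ⟩
  | and P Q hP hQ => exact ⟨hP hA.1, hQ hA.2⟩
  | or P Q hP hQ => exact ⟨hP hA.1, hQ hA.2⟩
  | not P hP => exact hP hA

theorem Term.subst_congr {t : Term k r} (ht : t.DiffFree) {σ τ : Var → Term k r}
    (h : ∀ z ∈ t.fv, σ z = τ z) : t.subst σ = t.subst τ := by
  induction t with
  | var x => exact h x (by simp [Term.fv])
  | const c => rfl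
  | add e f he hf =>
    simp only [Term.subst, he ht.1 fun z hz => h z (by simp [Term.fv, hz]),
      hf ht.2 fun z hz => h z (by simp [Term.fv, hz])]
  | mul e f he hf =>
    simp only [Term.subst, he ht.1 fun z hz => h z (by simp [Term.fv, hz]),
      hf ht.2 fun z hz => h z (by simp [Term.fv, hz])]
  | app j a ha =>
    simp only [Term.subst, Term.app.injEq, true_and]
    funext i
    exact ha i (ht i) fun z hz => h z (by simp only [Term.fv, Finset.mem_biUnion]; exact ⟨i, by simp, hz⟩)
  | diff e _ => exact ht.elim

theorem Term.evalA_subst (ρ : Term k r → ℝ) (σ : Var → Term k r) (t : Term k r) :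
    (t.subst σ).evalA ρ = t.evalA fun u => (u.subst σ).evalA ρ := by
  induction t with
  | add e f he hf => simp only [Term.subst, Term.evalA, he, hf]
  | mul e f he hf => simp only [Term.subst, Term.evalA, he, hf]
  | _ => rfl

end Variables

/-! ### Vectorial equations and renaming of variables. -/

section Rename

variable {k r : ℕ}

theorem rename_cons (x y : ℕ) (xs ys : List ℕ) (n : ℕ) :
    (rename (x :: xs) (y :: ys) (Var.base n) : Term k r) =
      if n = x then Term.bvar y else rename xs ys (Var.base n) := by
  by_cases h : n = x
  · simp [rename, h]
  · simp [rename, h, List.lookup_cons]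
    have : (n == x) = false := by simpa using h
    simp [this]

theorem rename_spec {xs ys : List ℕ} (h : xs.length = ys.length) (n : ℕ) :
    (n ∈ xs ∧ ∃ m ∈ ys, (rename xs ys (Var.base n) : Term k r) = Term.bvar m) ∨
      (n ∉ xs ∧ (rename xs ys (Var.base n) : Term k r) = Term.bvar n) := by
  induction xs generalizing ys with
  | nil => right; simp [rename]
  | cons x xs ih =>
    obtain _ | ⟨y, ys⟩ := ys
    · simp at h
    rw [rename_cons]
    by_cases hx : n = x
    · left; simp [hx]
    · rw [if_neg hx]
      rcases ih (by simpa using h) with ⟨h₁, m, hm, h₂⟩ | ⟨h₁, h₂⟩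
      · exact Or.inl ⟨by simp [h₁], m, by simp [hm], h₂⟩
      · exact Or.inr ⟨by simp [hx, h₁], h₂⟩

theorem diffFree_rename (xs ys : List ℕ) (n : ℕ) :
    (rename xs ys (Var.base n) : Term k r).DiffFree := by
  simp [rename, Term.bvar, Term.DiffFree]

theorem base_mem_fv_rename {xs ys : List ℕ} (h : xs.length = ys.length) {n m : ℕ}
    (hm : Var.base m ∈ (rename xs ys (Var.base n) : Term k r).fv) :
    m ∈ ys ∨ (m = n ∧ n ∉ xs) := by
  rcases rename_spec (k := k) (r := r) h n with ⟨_, m', hm', he⟩ | ⟨hn, he⟩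
  · rw [he] at hm
    simp only [Term.bvar, Term.fv, Finset.mem_singleton, Var.base.injEq] at hm
    exact Or.inl (hm ▸ hm')
  · rw [he] at hm
    simp only [Term.bvar, Term.fv, Finset.mem_singleton, Var.base.injEq] at hm
    exact Or.inr ⟨hm, hn⟩

theorem Term.base_mem_fv_subst_rename {t : Term k r} (ht : t.DiffFree) {xs ys : List ℕ}
    (h : xs.length = ys.length) {m : ℕ} (hm : Var.base m ∈ (t.subst (rename xs ys)).fv) :
    m ∈ ys ∨ (Var.base m ∈ t.fv ∧ m ∉ xs) := by
  rw [Term.fv_subst ht, Finset.mem_biUnion] at hm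
  obtain ⟨z, hz, hz'⟩ := hm
  cases z with
  | base n =>
    rcases base_mem_fv_rename h hz' with h' | ⟨rfl, h'⟩
    · exact Or.inl h'
    · exact Or.inr ⟨hz, h'⟩
  | prime z => exact absurd hz (ht.prime_notMem z)

theorem QF.base_mem_fv_subst_rename {A : QF k r} (hA : A.DiffFree) {xs ys : List ℕ}
    (h : xs.length = ys.length) {m : ℕ} (hm : Var.base m ∈ (A.subst (rename xs ys)).fv) :
    m ∈ ys ∨ (Var.base m ∈ A.fv ∧ m ∉ xs) := by
  rw [QF.fv_subst hA, Finset.mem_biUnion] at hm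
  obtain ⟨z, hz, hz'⟩ := hm
  cases z with
  | base n =>
    rcases base_mem_fv_rename h hz' with h' | ⟨rfl, h'⟩
    · exact Or.inl h'
    · exact Or.inr ⟨hz, h'⟩
  | prime z => exact absurd hz (hA.prime_notMem z)

theorem QF.eqVec_cons (x y : ℕ) (xs ys : List ℕ) : (QF.eqVec (x :: xs) (y :: ys) : QF k r) =
    QF.and (QF.cmp Cmp.eq (Term.bvar x) (Term.bvar y)) (QF.eqVec xs ys) := rfl

theorem QF.diffFree_eqVec (xs ys : List ℕ) : (QF.eqVec xs ys : QF k r).DiffFree := by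
  induction xs generalizing ys with
  | nil => exact ⟨trivial, trivial⟩
  | cons x xs ih =>
    cases ys with
    | nil => exact ⟨trivial, trivial⟩
    | cons y ys => exact ⟨⟨trivial, trivial⟩, ih ys⟩

theorem QF.base_mem_fv_eqVec {xs ys : List ℕ} {n : ℕ}
    (h : Var.base n ∈ (QF.eqVec xs ys : QF k r).fv) : n ∈ xs ∨ n ∈ ys := by
  induction xs generalizing ys with
  | nil => simp [QF.eqVec, QF.conj, QF.tru, QF.eqZ, QF.fv, Term.fv] at h
  | cons x xs ih =>
    cases ys with
    | nil => simp [QF.eqVec, QF.conj, QF.tru, QF.eqZ, QF.fv, Term.fv] at h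
    | cons y ys =>
      simp only [QF.eqVec_cons, QF.fv, Term.fv, Term.bvar, Finset.mem_union,
        Finset.mem_singleton, Var.base.injEq] at h
      rcases h with (h | h) | h
      · simp [h]
      · simp [h]
      · rcases ih h with h | h <;> simp [h]

/-- Vectorial equations hold between lists of equal values. -/
theorem QF.val_eqVec {xs ys : List ℕ} (h : xs.length = ys.length) (ρ : Term k r → ℝ) :
    (QF.eqVec xs ys).val ρ ↔
      xs.map (fun n => ρ (Term.bvar n)) = ys.map (fun n => ρ (Term.bvar n)) := by
  induction xs generalizing ys with
  | nil =>
    obtain rfl : ys = [] := by simpa using h.symm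
    simp [QF.eqVec]
  | cons x xs ih =>
    obtain _ | ⟨y, ys⟩ := ys
    · simp at h
    rw [QF.eqVec_cons, QF.val_and, ih (by simpa using h), List.map_cons, List.map_cons,
      List.cons.injEq]
    rfl

theorem evalA_rename {xs ys : List ℕ} {ρ : Term k r → ℝ} (h : (QF.eqVec xs ys).val ρ) (z : Var) :
    (rename xs ys z : Term k r).evalA ρ = ρ (Term.var z) := by
  cases z with
  | prime z => rfl
  | base n =>
    induction xs generalizing ys with
    | nil => simp [rename, Term.bvar, Term.evalA]
    | cons x xs ih =>
      cases ys with
      | nil => simp [rename, Term.bvar, Term.evalA]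
      | cons y ys =>
        rw [rename_cons]
        split_ifs with hx
        · subst hx; exact h.1.symm
        · exact ih h.2

variable {L : Lang} {xs ys : List ℕ}

/-- Valuations treat function applications as independent unknowns, so equality of arguments alone
does not transfer to them; the congruence axiom supplies exactly this case. -/
theorem provable_congr_term {t : Term L.k L.r} (ht : t.DiffFree) (xs ys : List ℕ) :
    Provable L ((QF.eqVec xs ys).toF.imp (Fml.eq t (t.subst (rename xs ys)))) := by
  induction t with
  | var x =>
    exact Provable.val₀ fun ρ v => by
      simp only [Fml.val_imp, Fml.val_toF, Fml.val_eq, Term.subst]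
      exact fun h => (evalA_rename h x).symm
  | const c => exact Provable.val₀ fun ρ v => by simp [Term.subst]
  | add e f he hf =>
    exact (he ht.1).val₂ (hf ht.2) fun ρ v => by
      simp only [Fml.val_imp, Fml.val_toF, Fml.val_eq, Term.subst, Term.evalA]
      exact fun h₁ h₂ h => by rw [h₁ h, h₂ h]
  | mul e f he hf =>
    exact (he ht.1).val₂ (hf ht.2) fun ρ v => by
      simp only [Fml.val_imp, Fml.val_toF, Fml.val_eq, Term.subst, Term.evalA]
      exact fun h₁ h₂ h => by rw [h₁ h, h₂ h]
  | app j a ha =>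
    have h₁ : ∀ φ ∈ (List.finRange L.k).map fun i =>
        (QF.eqVec xs ys).toF.imp (Fml.eq (a i) ((a i).subst (rename xs ys))),
        Provable L φ := by
      intro φ hφ
      obtain ⟨i, -, rfl⟩ := List.mem_map.1 hφ
      exact ha i (ht i)
    refine (Provable.of_list (φ := (QF.eqVec xs ys).toF.imp (Fml.conj ((List.finRange L.k).map
      fun i => Fml.eq (a i) ((a i).subst (rename xs ys))))) h₁ fun ρ v h => ?_).trans
      (Axm.provable (Axm.cong j a fun i => (a i).subst (rename xs ys)))
    simp only [List.mem_map, List.mem_finRange, true_and, forall_exists_index,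
      forall_apply_eq_imp_iff, Fml.val_imp, Fml.val_conj] at h ⊢
    exact fun h' i => h i h'
  | diff e _ => exact ht.elim

theorem provable_congr {A : QF L.k L.r} (hA : A.DiffFree) (xs ys : List ℕ) :
    Provable L ((QF.eqVec xs ys).toF.imp (A.toF.iff (A.subst (rename xs ys)).toF)) := by
  induction A with
  | cmp c e f =>
    refine (provable_congr_term hA.1 xs ys).val₂ (provable_congr_term hA.2 xs ys) fun ρ v => ?_
    simp only [Fml.val_imp, Fml.val_toF, Fml.val_eq, Fml.val_iff, QF.subst, QF.val_cmp]
    exact fun h₁ h₂ h => by rw [h₁ h, h₂ h]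
  | and P Q hP hQ =>
    exact (hP hA.1).val₂ (hQ hA.2) fun ρ v => by
      simp only [Fml.val_imp, Fml.val_toF, Fml.val_iff, QF.subst, QF.val_and]; tauto
  | or P Q hP hQ =>
    exact (hP hA.1).val₂ (hQ hA.2) fun ρ v => by
      simp only [Fml.val_imp, Fml.val_toF, Fml.val_iff, QF.subst, QF.val_or]; tauto
  | not P hP =>
    exact (hP hA).val₁ fun ρ v => by
      simp only [Fml.val_imp, Fml.val_toF, Fml.val_iff, QF.subst, QF.val_not]; tauto

/-- Fresh variables may be assumed to be equal to given ones. -/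
theorem Provable.intro_eqVec {φ : Fml L.k L.r} (hl : xs.length = ys.length) (hn : ys.Nodup)
    (hd : ∀ y ∈ ys, y ∉ xs) (hφ : ∀ y ∈ ys, Var.base y ∉ φ.fv)
    (h : Provable L ((QF.eqVec xs ys).toF.imp φ)) : Provable L φ := by
  refine Provable.intro_conj_eq (zs := List.zipWith
    (fun x y => (Var.base y, Term.bvar x)) xs ys) ?_ ?_ ?_ (h.val₁ fun ρ v => ?_)
  · have : List.map Prod.fst (List.zipWith
        (fun x y => (Var.base y, (Term.bvar x : Term L.k L.r))) xs ys) = ys.map Var.base := by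
      rw [List.map_zipWith]
      clear h hφ hd hn
      induction xs generalizing ys with
      | nil => simp [List.length_eq_zero_iff.1 hl.symm]
      | cons x xs ih =>
        obtain _ | ⟨y, ys⟩ := ys
        · simp at hl
        · simp [ih (by simpa using hl)]
    rw [this]
    exact hn.map fun a b h => Var.base.inj h
  · intro p hp q hq
    rw [List.mem_iff_getElem] at hp hq
    obtain ⟨i, hi, rfl⟩ := hp
    obtain ⟨j, hj, rfl⟩ := hq
    simp only [List.getElem_zipWith, Term.bvar, Term.fv, Finset.mem_singleton, Var.base.injEq]
    intro h
    have hi' := hd _ (List.getElem_mem (l := ys) (n := i) (by simp at hi; omega))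
    rw [h] at hi'
    exact hi' (List.getElem_mem _)
  · intro p hp
    rw [List.mem_iff_getElem] at hp
    obtain ⟨i, hi, rfl⟩ := hp
    simp only [List.getElem_zipWith]
    exact hφ _ (List.getElem_mem _)
  · simp only [Fml.val_imp, Fml.val_toF, Fml.val_conj, QF.eqVec, QF.val_conj]
    refine fun h h' => h fun A hA => ?_
    rw [List.mem_iff_getElem] at hA
    obtain ⟨i, hi, rfl⟩ := hA
    have := h' _ (List.getElem_mem (l := List.map (fun p : Var × Term L.k L.r =>
      Fml.eq (Term.var p.1) p.2) (List.zipWith (fun x y => (Var.base y, Term.bvar x)) xs ys))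
      (n := i) (by simpa using hi))
    simp only [List.getElem_map, List.getElem_zipWith, Fml.val_eq] at this
    simp only [List.getElem_zipWith, QF.val_cmp]
    exact this.symm

theorem provable_eqVec_symm (hl : xs.length = ys.length) :
    Provable L ((QF.eqVec xs ys).toF.imp (QF.eqVec ys xs).toF) :=
  Provable.val₀ fun ρ v => by
    simp only [Fml.val_imp, Fml.val_toF, QF.val_eqVec hl, QF.val_eqVec hl.symm]
    exact Eq.symm

/-- Provable quantifier-free formulas can be renamed. -/
theorem Provable.rename {A : QF L.k L.r} (hA : A.DiffFree) (hl : xs.length = ys.length)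
    (hx : xs.Nodup) (hd : ∀ y ∈ ys, y ∉ xs) (h : Provable L A.toF) :
    Provable L (A.subst (rename xs ys)).toF := by
  -- After the renaming the variables `xs` have disappeared from the formula, so they may be
  -- reintroduced as copies of `ys`; congruence then carries the original formula over.
  refine Provable.intro_eqVec (xs := ys) (ys := xs) hl.symm hx (fun x hx' hy => hd x hy hx') ?_ ?_
  · intro x hx' hm
    rw [QF.fv_toF] at hm
    rcases QF.base_mem_fv_subst_rename hA hl hm with h' | h'
    · exact hd x h' hx'
    · exact h'.2 hx'
  · exact h.val₂ (provable_congr hA xs ys) fun ρ v => by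
      simp only [Fml.val_imp, Fml.val_toF, Fml.val_iff, QF.val_eqVec hl, QF.val_eqVec hl.symm]
      exact fun h h' e => (h' e.symm).1 h

/-- Constant consequences of `φ` can be renamed. -/
theorem Provable.imp_rename {χ : Fml L.k L.r} {A : QF L.k L.r} (hA : A.DiffFree)
    (hl : xs.length = ys.length) (hx : xs.Nodup) (hd : ∀ y ∈ ys, y ∉ xs)
    (hχ : ∀ x ∈ xs, Var.base x ∉ χ.fv) (h : Provable L (χ.imp A.toF)) :
    Provable L (χ.imp (A.subst (DL.rename xs ys)).toF) := by
  refine Provable.intro_eqVec (xs := ys) (ys := xs) hl.symm hx (fun x hx' hy => hd x hy hx') ?_ ?_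
  · intro x hx' hm
    rw [Fml.fv_imp, Finset.mem_union, QF.fv_toF] at hm
    rcases hm with hm | hm
    · exact hχ x hx' hm
    rcases QF.base_mem_fv_subst_rename hA hl hm with h' | h'
    · exact hd x h' hx'
    · exact h'.2 hx'
  · exact h.val₂ (provable_congr hA xs ys) fun ρ v => by
      simp only [Fml.val_imp, Fml.val_toF, Fml.val_iff, QF.val_eqVec hl, QF.val_eqVec hl.symm]
      exact fun h h' e hχ => (h' e.symm).1 (h hχ)

/-- A formula that is provable for fresh variables is provable. -/
theorem Provable.of_imp_rename {χ : Fml L.k L.r} {A : QF L.k L.r} (hA : A.DiffFree)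
    (hl : xs.length = ys.length) (hy : ys.Nodup) (hd : ∀ y ∈ ys, y ∉ xs)
    (hχ : ∀ y ∈ ys, Var.base y ∉ χ.fv) (hAy : ∀ y ∈ ys, Var.base y ∉ A.fv)
    (h : Provable L (χ.imp (A.subst (DL.rename xs ys)).toF)) : Provable L (χ.imp A.toF) := by
  refine Provable.intro_eqVec hl hy hd ?_ ?_
  · intro y hy' hm
    rw [Fml.fv_imp, Finset.mem_union, QF.fv_toF] at hm
    exact hm.elim (hχ y hy') (hAy y hy')
  · exact h.val₂ (provable_congr hA xs ys) fun ρ v => by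
      simp only [Fml.val_imp, Fml.val_toF, Fml.val_iff]
      exact fun h h' e hχ => (h' e).2 (h hχ)

end Rename

end DL

namespace DL

/-! ### Syntactic Lie derivatives. -/

section Lie

variable {k r : ℕ}

@[simp] theorem Term.evalA_sum (ρ : Term k r → ℝ) (l : List (Term k r)) :
    (Term.sum l).evalA ρ = (l.map fun t => t.evalA ρ).sum := by
  induction l with
  | nil => simp [Term.sum, Term.evalA]
  | cons t l ih => rw [List.map_cons, List.sum_cons, ← ih]; rfl

@[simp] theorem Term.evalA_neg (ρ : Term k r → ℝ) (t : Term k r) :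
    t.neg.evalA ρ = - t.evalA ρ := by
  simp [Term.neg, Term.evalA]

theorem Term.diffFree_sum {l : List (Term k r)} (h : ∀ t ∈ l, t.DiffFree) :
    (Term.sum l).DiffFree := by
  induction l with
  | nil => trivial
  | cons t l ih => exact ⟨h t (by simp), ih fun u hu => h u (by simp [hu])⟩

theorem Term.mem_fv_sum {l : List (Term k r)} {z : Var} :
    z ∈ (Term.sum l).fv ↔ ∃ t ∈ l, z ∈ t.fv := by
  induction l with
  | nil => simp [Term.sum, Term.fv]
  | cons t l ih =>
    rw [show Term.sum (t :: l) = Term.add t (Term.sum l) from rfl, Term.fv, Finset.mem_union, ih]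
    simp

theorem Term.DiffFree.neg {t : Term k r} (h : t.DiffFree) : t.neg.DiffFree := ⟨trivial, h⟩

theorem PolyExpr.diffFree_inst {p : PolyExpr k r} (hp : p.ClosedCoeffs) {a : Fin k → Term k r}
    (ha : ∀ i, (a i).DiffFree) : (p.inst a).DiffFree := by
  induction p with
  | arg i => exact ha i
  | sym j => exact ha
  | coef t => exact hp.2
  | add p q h₁ h₂ => exact ⟨h₁ hp.1, h₂ hp.2⟩
  | mul p q h₁ h₂ => exact ⟨h₁ hp.1, h₂ hp.2⟩

theorem PolyExpr.fv_inst {p : PolyExpr k r} (hp : p.ClosedCoeffs) (j : Fin r)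
    (a : Fin k → Term k r) : (p.inst a).fv ⊆ (Term.app j a).fv := by
  induction p with
  | arg i => exact Finset.subset_biUnion_of_mem (fun i => (a i).fv) (Finset.mem_univ i)
  | sym j => exact subset_rfl
  | coef t => simp [PolyExpr.inst, hp.1]
  | add p q h₁ h₂ => exact Finset.union_subset (h₁ hp.1) (h₂ hp.2)
  | mul p q h₁ h₂ => exact Finset.union_subset (h₁ hp.1) (h₂ hp.2)

theorem lookup_getD_mem {s : Sys k r} {n : ℕ} (h : n ∈ s.vars) :
    (n, (List.lookup n s).getD (Term.const 0)) ∈ s := by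
  induction s with
  | nil => simp [Sys.vars] at h
  | cons p s ih =>
    by_cases hp : n = p.1
    · subst hp
      rw [List.lookup_cons, beq_self_eq_true]
      exact List.mem_cons_self
    · have hb : (n == p.1) = false := by simpa using hp
      rw [List.lookup_cons, hb]
      exact List.mem_cons_of_mem _ (ih (by simpa [Sys.vars, hp] using h))

theorem lookup_of_notMem {s : Sys k r} {n : ℕ} (h : n ∉ s.vars) : List.lookup n s = none := by
  rw [List.lookup_eq_none_iff]
  intro p hp
  simp only [ne_eq, bne_iff_ne]
  rintro rfl
  exact h (List.mem_map.2 ⟨p, hp, rfl⟩)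

theorem lookup_of_mem {s : Sys k r} (hs : s.vars.Nodup) {p : ℕ × Term k r} (hp : p ∈ s) :
    List.lookup p.1 s = some p.2 := by
  induction s with
  | nil => simp at hp
  | cons q s ih =>
    simp only [Sys.vars, List.map_cons, List.nodup_cons] at hs
    rcases List.mem_cons.1 hp with rfl | hp
    · rw [List.lookup_cons, beq_self_eq_true]
    · have : p.1 ≠ q.1 := fun h => hs.1 (h ▸ List.mem_map.2 ⟨p, hp, rfl⟩)
      have hb : (p.1 == q.1) = false := by simpa using this
      rw [List.lookup_cons, hb]
      exact ih hs.2 hp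

variable {L : Lang} {s : Sys L.k L.r}

/-- The coefficients of the derivatives of the function symbols are closed terms. -/
def Lang.Closed (L : Lang) : Prop := ∀ j i, (L.q j i).ClosedCoeffs

theorem lie_var_diffFree (hs : s.WF) (n : ℕ) : (lie L s (Term.bvar n)).DiffFree := by
  by_cases h : n ∈ s.vars
  · exact hs.2 _ (lookup_getD_mem h)
  · simp [Term.bvar, lie, lookup_of_notMem h, Term.DiffFree]

theorem Term.DiffFree.lie (hL : L.Closed) (hs : s.WF) {e : Term L.k L.r} (he : e.DiffFree) :
    (lie L s e).DiffFree := by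
  induction e with
  | var x => cases x with
    | base n => exact lie_var_diffFree hs n
    | prime z => exact he.elim
  | const c => trivial
  | add e f h₁ h₂ => exact ⟨h₁ he.1, h₂ he.2⟩
  | mul e f h₁ h₂ => exact ⟨⟨h₁ he.1, he.2⟩, he.1, h₂ he.2⟩
  | app j a ha =>
    refine Term.diffFree_sum fun t ht => ?_
    obtain ⟨i, -, rfl⟩ := List.mem_map.1 ht
    exact ⟨PolyExpr.diffFree_inst (hL j i) he, ha i (he i)⟩
  | diff e _ => exact he.elim

theorem fv_lie (hL : L.Closed) (s : Sys L.k L.r) (e : Term L.k L.r) :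
    (lie L s e).fv ⊆ e.fv ∪ s.rhsFv := by
  induction e with
  | var x => cases x with
    | base n =>
      by_cases h : n ∈ s.vars
      · refine subset_trans (fun z hz => ?_) Finset.subset_union_right
        exact Sys.mem_rhsFv.2 ⟨_, lookup_getD_mem h, hz⟩
      · simp [lie, lookup_of_notMem h, Term.fv]
    | prime z => simp [lie, Term.fv]
  | const c => simp [lie, Term.fv]
  | add e f h₁ h₂ =>
    refine (Finset.union_subset_union h₁ h₂).trans ?_
    simp only [Term.fv]
    grind
  | mul e f h₁ h₂ =>
    simp only [Term.fv, lie]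
    grind
  | app j a ha =>
    intro z hz
    obtain ⟨t, ht, hz⟩ := Term.mem_fv_sum.1 hz
    obtain ⟨i, -, rfl⟩ := List.mem_map.1 ht
    rcases Finset.mem_union.1 hz with hz | hz
    · exact Finset.mem_union_left _ (PolyExpr.fv_inst (hL j i) j a hz)
    · rcases Finset.mem_union.1 (ha i hz) with hz | hz
      · refine Finset.mem_union_left _ ?_
        exact Finset.mem_biUnion.2 ⟨i, Finset.mem_univ i, hz⟩
      · exact Finset.mem_union_right _ hz
  | diff e _ => simp [lie, Term.fv]

theorem lieN_succ (s : Sys L.k L.r) (n : ℕ) (e : Term L.k L.r) :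
    lieN L s (n + 1) e = lie L s (lieN L s n e) :=
  Function.iterate_succ_apply' _ _ _

@[simp] theorem lieN_zero (s : Sys L.k L.r) (e : Term L.k L.r) : lieN L s 0 e = e := rfl

theorem Term.DiffFree.lieN (hL : L.Closed) (hs : s.WF) {e : Term L.k L.r} (he : e.DiffFree)
    (n : ℕ) : (lieN L s n e).DiffFree := by
  induction n with
  | zero => exact he
  | succ n ih => rw [lieN_succ]; exact ih.lie hL hs

theorem fv_lieN (hL : L.Closed) (s : Sys L.k L.r) (n : ℕ) (e : Term L.k L.r) :
    (lieN L s n e).fv ⊆ e.fv ∪ s.rhsFv := by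
  induction n with
  | zero => exact Finset.subset_union_left
  | succ n ih =>
    rw [lieN_succ]
    exact (fv_lie hL s _).trans (Finset.union_subset ih Finset.subset_union_right)

end Lie

/-! ### Ranks from Hilbert's basis theorem. -/

section Polynomials

open MvPolynomial

variable {k r : ℕ}

/-- The polynomial over the function applications, differentials and variables denoted by a
term. -/
noncomputable def Term.poly : Term k r → MvPolynomial (Term k r) ℚ
  | var x => X (var x)
  | const c => C c
  | add e f => poly e + poly f
  | mul e f => poly e * poly f
  | app j a => X (app j a)
  | diff e => X (diff e)

theorem Term.aeval_poly (ρ : Term k r → ℝ) (t : Term k r) : aeval ρ t.poly = t.evalA ρ := by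
  induction t with
  | add e f he hf => simp only [Term.poly, map_add, he, hf, Term.evalA]
  | mul e f he hf => simp only [Term.poly, map_mul, he, hf, Term.evalA]
  | _ => simp [Term.poly, Term.evalA]

theorem Term.poly_sum (l : List (Term k r)) : (Term.sum l).poly = (l.map Term.poly).sum := by
  induction l with
  | nil => simp [Term.sum, Term.poly]
  | cons t l ih => rw [List.map_cons, List.sum_cons, ← ih]; rfl

variable {L : Lang}

/-- The derivation of polynomials that corresponds to Lie derivatives of terms. -/
noncomputable def lieDer (L : Lang) (s : Sys L.k L.r) :
    Derivation ℚ (MvPolynomial (Term L.k L.r) ℚ) (MvPolynomial (Term L.k L.r) ℚ) :=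
  mkDerivation ℚ fun u => (lie L s u).poly

/-- Lie derivation respects the polynomial denoted by a term. Higher Lie derivatives can therefore
be studied with derivations of a commutative ring. -/
theorem poly_lie (s : Sys L.k L.r) (t : Term L.k L.r) : (lie L s t).poly = lieDer L s t.poly := by
  induction t with
  | var x => rw [Term.poly, lieDer, mkDerivation_X]
  | app j a => rw [Term.poly, lieDer, mkDerivation_X]
  | diff e => rw [Term.poly, lieDer, mkDerivation_X]
  | const c => simp [lie, Term.poly, lieDer]
  | add e f he hf => simp only [lie, Term.poly, map_add, he, hf]
  | mul e f he hf =>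
    simp only [lie, Term.poly, Derivation.leibniz, he, hf, smul_eq_mul]
    ring

theorem poly_lieN (s : Sys L.k L.r) (n : ℕ) (t : Term L.k L.r) :
    (lieN L s n t).poly = (lieDer L s)^[n] t.poly := by
  induction n with
  | zero => rfl
  | succ n ih => rw [lieN_succ, poly_lie, ih, Function.iterate_succ_apply']

/-- Atoms with the variables of a given term. -/
def Term.atomSet (t : Term k r) : Set (Term k r) :=
  {u | u.fv ⊆ t.fv ∧ (t.DiffFree → u.DiffFree) ∧ u.poly = X u}

theorem Term.poly_mem_supported (t : Term k r) :
    t.poly ∈ supported ℚ (t.atomSet) := by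
  have mono : ∀ {t t' : Term k r}, t.fv ⊆ t'.fv → (t'.DiffFree → t.DiffFree) →
      t.poly ∈ supported ℚ (t.atomSet) →
      t.poly ∈ supported ℚ (t'.atomSet) :=
    fun {t t'} h₁ h₂ h => supported_mono (s := t.atomSet) (t := t'.atomSet)
      (fun u hu => ⟨hu.1.trans h₁, fun h' => hu.2.1 (h₂ h'), hu.2.2⟩) h
  induction t with
  | var x => exact Algebra.subset_adjoin ⟨_, ⟨subset_rfl, id, rfl⟩, rfl⟩
  | app j a => exact Algebra.subset_adjoin ⟨_, ⟨subset_rfl, id, rfl⟩, rfl⟩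
  | diff e => exact Algebra.subset_adjoin ⟨_, ⟨subset_rfl, id, rfl⟩, rfl⟩
  | const c => exact Subalgebra.algebraMap_mem _ c
  | add e f he hf =>
    exact add_mem (mono Finset.subset_union_left (fun h => h.1) he)
      (mono Finset.subset_union_right (fun h => h.2) hf)
  | mul e f he hf =>
    exact mul_mem (mono Finset.subset_union_left (fun h => h.1) he)
      (mono Finset.subset_union_right (fun h => h.2) hf)

/-- Coefficients of the derivatives of the function symbols are closed terms and may themselves
contain function applications. Their Lie derivatives vanish as polynomials, so adding their atoms to
a set of generators creates no new ones. -/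
theorem poly_lie_of_closed (s : Sys L.k L.r) {t : Term L.k L.r} (ht : t.fv = ∅) :
    (lie L s t).poly = 0 := by
  induction t with
  | var x => simp [Term.fv] at ht
  | const c => simp [lie, Term.poly]
  | add e f he hf =>
    rw [Term.fv, Finset.union_eq_empty] at ht
    simp [lie, Term.poly, he ht.1, hf ht.2]
  | mul e f he hf =>
    rw [Term.fv, Finset.union_eq_empty] at ht
    simp [lie, Term.poly, he ht.1, hf ht.2]
  | app j a ha =>
    rw [lie, Term.poly_sum]
    refine List.sum_eq_zero fun p hp => ?_
    simp only [List.map_map, List.mem_map] at hp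
    obtain ⟨i, -, rfl⟩ := hp
    have : (a i).fv = ∅ := by
      rw [← Finset.subset_empty, ← ht]
      exact Finset.subset_biUnion_of_mem (fun i => (a i).fv) (Finset.mem_univ i)
    simp [Term.poly, ha i this]
  | diff e _ => simp [lie, Term.poly]

/-- The atoms of the coefficients of a polynomial expression. -/
noncomputable def PolyExpr.coefAtoms : PolyExpr k r → Set (Term k r)
  | arg _ => ∅
  | sym _ => ∅
  | coef t => t.poly.vars
  | add p q => coefAtoms p ∪ coefAtoms q
  | mul p q => coefAtoms p ∪ coefAtoms q

theorem PolyExpr.finite_coefAtoms (p : PolyExpr k r) : p.coefAtoms.Finite := by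
  induction p with
  | arg i => exact Set.finite_empty
  | sym j => exact Set.finite_empty
  | coef t => exact Finset.finite_toSet _
  | add p q h₁ h₂ => exact h₁.union h₂
  | mul p q h₁ h₂ => exact h₁.union h₂

theorem PolyExpr.ClosedCoeffs.coefAtoms {p : PolyExpr k r} (hp : p.ClosedCoeffs) :
    ∀ u ∈ p.coefAtoms, u.fv = ∅ ∧ u.DiffFree ∧ u.poly = X u := by
  induction p with
  | arg i => simp [PolyExpr.coefAtoms]
  | sym j => simp [PolyExpr.coefAtoms]
  | coef t =>
    intro u hu
    have := mem_supported.1 t.poly_mem_supported hu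
    exact ⟨Finset.subset_empty.1 (hp.1 ▸ this.1), this.2.1 hp.2, this.2.2⟩
  | add p q h₁ h₂ => exact fun u hu => hu.elim (h₁ hp.1 u) (h₂ hp.2 u)
  | mul p q h₁ h₂ => exact fun u hu => hu.elim (h₁ hp.1 u) (h₂ hp.2 u)

/-- The variables and function applications in a term, with all applications of function symbols
to the occurring tuples of arguments. -/
def Term.cl : Term k r → Set (Term k r)
  | var x => {var x}
  | const _ => ∅
  | add e f => cl e ∪ cl f
  | mul e f => cl e ∪ cl f
  | app _ a => (⋃ i, cl (a i)) ∪ Set.range fun j => app j a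
  | diff _ => ∅

theorem Term.finite_cl (t : Term k r) : t.cl.Finite := by
  induction t with
  | var x => exact Set.finite_singleton _
  | const c => exact Set.finite_empty
  | add e f he hf => exact he.union hf
  | mul e f he hf => exact he.union hf
  | app j a ha => exact (Set.finite_iUnion ha).union (Set.finite_range _)
  | diff e _ => exact Set.finite_empty

theorem Term.DiffFree.cl {t : Term k r} (ht : t.DiffFree) : ∀ u ∈ t.cl, u.DiffFree ∧ u.poly = X u := by
  induction t with
  | var x => rintro u rfl; exact ⟨ht, rfl⟩
  | const c => simp [Term.cl]
  | add e f he hf => exact fun u hu => hu.elim (he ht.1 u) (hf ht.2 u)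
  | mul e f he hf => exact fun u hu => hu.elim (he ht.1 u) (hf ht.2 u)
  | app j a ha =>
    rintro u (hu | ⟨j', rfl⟩)
    · obtain ⟨i, hi⟩ := Set.mem_iUnion.1 hu
      exact ha i (ht i) u hi
    · exact ⟨ht, rfl⟩
  | diff e _ => exact ht.elim

theorem Term.cl_subset_of_mem {t : Term k r} : ∀ u ∈ t.cl, u.cl ⊆ t.cl := by
  induction t with
  | var x => rintro u rfl; exact subset_rfl
  | const c => simp [Term.cl]
  | add e f he hf =>
    exact fun u hu => hu.elim
      (fun h => (he u h).trans Set.subset_union_left) fun h => (hf u h).trans Set.subset_union_right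
  | mul e f he hf =>
    exact fun u hu => hu.elim
      (fun h => (he u h).trans Set.subset_union_left) fun h => (hf u h).trans Set.subset_union_right
  | app j a ha =>
    rintro u (hu | ⟨j', rfl⟩)
    · obtain ⟨i, hi⟩ := Set.mem_iUnion.1 hu
      exact (ha i u hi).trans ((Set.subset_iUnion (fun i => (a i).cl) i).trans
        Set.subset_union_left)
    · exact subset_rfl
  | diff e _ => simp [Term.cl]

theorem X_mem_supported {σ : Type*} {S : Set σ} {u : σ} (hu : u ∈ S) :
    (X u : MvPolynomial σ ℚ) ∈ supported ℚ S :=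
  Algebra.subset_adjoin ⟨u, hu, rfl⟩

theorem Term.DiffFree.poly_mem {t : Term k r} (ht : t.DiffFree) {S : Set (Term k r)}
    (hS : t.cl ⊆ S) : t.poly ∈ supported ℚ S := by
  induction t with
  | var x => exact X_mem_supported (hS rfl)
  | const c => exact Subalgebra.algebraMap_mem _ c
  | add e f he hf =>
    exact add_mem (he ht.1 (Set.subset_union_left.trans hS))
      (hf ht.2 (Set.subset_union_right.trans hS))
  | mul e f he hf =>
    exact mul_mem (he ht.1 (Set.subset_union_left.trans hS))
      (hf ht.2 (Set.subset_union_right.trans hS))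
  | app j a _ => exact X_mem_supported (hS (Or.inr ⟨j, rfl⟩))
  | diff e _ => exact ht.elim

theorem PolyExpr.poly_inst_mem {p : PolyExpr k r} {S : Set (Term k r)} (hp : p.coefAtoms ⊆ S)
    {a : Fin k → Term k r} (ha : ∀ i, (a i).poly ∈ supported ℚ S)
    (ha' : ∀ j, Term.app j a ∈ S) : (p.inst a).poly ∈ supported ℚ S := by
  induction p with
  | arg i => exact ha i
  | sym j => exact X_mem_supported (ha' j)
  | coef t => exact mem_supported.2 hp
  | add p q h₁ h₂ =>
    exact add_mem (h₁ (Set.subset_union_left.trans hp))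
      (h₂ (Set.subset_union_right.trans hp))
  | mul p q h₁ h₂ =>
    exact mul_mem (h₁ (Set.subset_union_left.trans hp))
      (h₂ (Set.subset_union_right.trans hp))

/-- The chain condition enters here: differentiating `h_j(a)` produces only the arguments, the
symbols `h_1, …, h_r` at the same arguments, the coefficients and the derivatives of the arguments,
all of which are polynomials over `S`. -/
theorem poly_lie_mem {s : Sys L.k L.r} {S : Set (Term L.k L.r)}
    (hS : ∀ j i, (L.q j i).coefAtoms ⊆ S) (hs : ∀ p ∈ s, p.2.poly ∈ supported ℚ S)
    {t : Term L.k L.r} (ht : t.DiffFree) (htS : t.cl ⊆ S) :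
    (lie L s t).poly ∈ supported ℚ S := by
  induction t with
  | var x => cases x with
    | base n =>
      by_cases h : n ∈ s.vars
      · exact hs _ (lookup_getD_mem h)
      · simp [lie, lookup_of_notMem h, Term.poly]
    | prime z => exact ht.elim
  | const c => simp [lie, Term.poly]
  | add e f he hf =>
    exact add_mem (he ht.1 (Set.subset_union_left.trans htS))
      (hf ht.2 (Set.subset_union_right.trans htS))
  | mul e f he hf =>
    have h₁ := Set.subset_union_left.trans htS
    have h₂ := Set.subset_union_right.trans htS
    exact add_mem (mul_mem (he ht.1 h₁) (ht.2.poly_mem h₂)) (mul_mem (ht.1.poly_mem h₁) (hf ht.2 h₂))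
  | app j a ha =>
    have h₁ : ∀ i, (a i).cl ⊆ S := fun i =>
      ((Set.subset_iUnion (fun i => (a i).cl) i).trans Set.subset_union_left).trans htS
    rw [lie, Term.poly_sum]
    refine list_sum_mem fun p hp => ?_
    simp only [List.map_map, List.mem_map] at hp
    obtain ⟨i, -, rfl⟩ := hp
    exact mul_mem (PolyExpr.poly_inst_mem (hS j i) (fun i => (ht i).poly_mem (h₁ i))
      fun j => htS (Or.inr ⟨j, rfl⟩)) (ha i (ht i) (h₁ i))
  | diff e _ => exact ht.elim

/-- By the Leibniz rule it is enough to know where the derivation sends the generators. -/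
theorem lieDer_mem {s : Sys L.k L.r} {S : Set (Term L.k L.r)}
    (h : ∀ u ∈ S, (lie L s u).poly ∈ supported ℚ S) {p : MvPolynomial (Term L.k L.r) ℚ}
    (hp : p ∈ supported ℚ S) : lieDer L s p ∈ supported ℚ S := by
  induction hp using Algebra.adjoin_induction with
  | mem x hx =>
    obtain ⟨u, hu, rfl⟩ := hx
    rw [lieDer, mkDerivation_X]
    exact h u hu
  | algebraMap c => simp
  | add x y _ _ hx hy => rw [map_add]; exact add_mem hx hy
  | mul x y hx' hy' hx hy =>
    rw [Derivation.leibniz, smul_eq_mul, smul_eq_mul]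
    exact add_mem (mul_mem hx' hy) (mul_mem hy' hx)

theorem exists_term_of_mem_supported {S : Set (Term k r)} (hS : ∀ u ∈ S, u.DiffFree ∧ u.poly = X u)
    {p : MvPolynomial (Term k r) ℚ} (hp : p ∈ supported ℚ S) :
    ∃ t : Term k r, t.DiffFree ∧ t.poly = p := by
  induction hp using Algebra.adjoin_induction with
  | mem x hx =>
    obtain ⟨u, hu, rfl⟩ := hx
    exact ⟨u, hS u hu⟩
  | algebraMap c => exact ⟨Term.const c, trivial, rfl⟩
  | add x y _ _ hx hy =>
    obtain ⟨t, ht, rfl⟩ := hx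
    obtain ⟨u, hu, rfl⟩ := hy
    exact ⟨Term.add t u, ⟨ht, hu⟩, rfl⟩
  | mul x y _ _ hx hy =>
    obtain ⟨t, ht, rfl⟩ := hx
    obtain ⟨u, hu, rfl⟩ := hy
    exact ⟨Term.mul t u, ⟨ht, hu⟩, rfl⟩

theorem isNoetherianRing_supported {σ : Type*} {S : Set σ} (hS : S.Finite) :
    IsNoetherianRing (supported ℚ S) := by
  have := hS.to_subtype
  exact isNoetherianRing_of_ringEquiv (MvPolynomial S ℚ) (supportedEquivMvPolynomial S).symm.toRingEquiv

/-- The ideals spanned by initial segments of the sequence stabilise, so some member lies in the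
span of its predecessors. -/
theorem exists_mem_span_lt {R : Type*} [CommRing R] [IsNoetherianRing R] (a : ℕ → R) :
    ∃ N, 1 ≤ N ∧ ∃ g : ℕ → R, a N = ∑ i ∈ Finset.range N, g i * a i := by
  let I : ℕ →o Ideal R := ⟨fun n => Ideal.span (a '' Set.Iio n), fun m n h =>
    Ideal.span_mono (Set.image_mono fun i hi => lt_of_lt_of_le hi h)⟩
  obtain ⟨n, hn⟩ := monotone_stabilizes_iff_noetherian.2 ‹IsNoetherianRing R› I
  -- Taking the member of index `n + 1`, one past the stabilisation index, guarantees `1 ≤ N`. The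
  -- ideals of indices `n`, `n + 1` and `n + 2` coincide.
  have h : a (n + 1) ∈ I (n + 1) := by
    rw [← hn (n + 1) (by omega), hn (n + 2) (by omega)]
    exact Ideal.subset_span ⟨n + 1, by simp, rfl⟩
  refine ⟨n + 1, by omega, ?_⟩
  have h' : a (n + 1) ∈ Submodule.span R (Set.range fun i : Fin (n + 1) => a i) := by
    have hr : Set.range (fun i : Fin (n + 1) => a i) = a '' Set.Iio (n + 1) := by
      ext x
      simp only [Set.mem_range, Set.mem_image, Set.mem_Iio]
      exact ⟨fun ⟨i, hi⟩ => ⟨i, i.2, hi⟩, fun ⟨i, hi, h⟩ => ⟨⟨i, hi⟩, h⟩⟩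
    rw [hr]
    exact h
  obtain ⟨c, hc⟩ := (Submodule.mem_span_range_iff_exists_fun R).1 h'
  refine ⟨fun i => if h : i < n + 1 then c ⟨i, h⟩ else 0, ?_⟩
  rw [← hc, Finset.sum_range]
  exact Finset.sum_congr rfl fun i _ => by simp [i.2]

/-- Differential radical identities hold by polynomial arithmetic. -/
theorem exists_rank_evalA (hL : L.Closed) {s : Sys L.k L.r} (hs : s.WF) {e : Term L.k L.r}
    (he : e.DiffFree) : ∃ N, 1 ≤ N ∧ ∃ g : ℕ → Term L.k L.r, (∀ i, (g i).DiffFree) ∧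
      ∀ ρ, (lieN L s N e).evalA ρ =
        (Term.sum ((List.range N).map fun i => Term.mul (g i) (lieN L s i e))).evalA ρ := by
  -- `S` is a finite set of atoms whose polynomial ring is stable under Lie derivation and contains
  -- `e`: atoms of coefficients have derivative zero, and the closures `cl` of the right-hand sides
  -- and of `e` contain every application needed to differentiate their members.
  let S : Set (Term L.k L.r) := (⋃ j, ⋃ i, (L.q j i).coefAtoms) ∪ (⋃ p ∈ s, p.2.cl) ∪ e.cl
  have hC : ∀ j i, (L.q j i).coefAtoms ⊆ S := fun j i u hu =>
    Or.inl (Or.inl (Set.mem_iUnion.2 ⟨j, Set.mem_iUnion.2 ⟨i, hu⟩⟩))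
  have hF : ∀ p ∈ s, p.2.cl ⊆ S := fun p hp u hu => Or.inl (Or.inr (by
    simp only [Set.mem_iUnion]; exact ⟨p, hp, hu⟩))
  have hfin : S.Finite := by
    refine (Set.Finite.union ?_ ?_).union e.finite_cl
    · exact Set.finite_iUnion fun j => Set.finite_iUnion fun i => PolyExpr.finite_coefAtoms _
    · exact Set.Finite.biUnion (List.finite_toSet s) fun p _ => p.2.finite_cl
  have hsS : ∀ p ∈ s, p.2.poly ∈ supported ℚ S := fun p hp => (hs.2 p hp).poly_mem (hF p hp)
  have hS : ∀ u ∈ S, (u.DiffFree ∧ u.poly = X u) ∧ (lie L s u).poly ∈ supported ℚ S := by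
    rintro u ((hu | hu) | hu)
    · simp only [Set.mem_iUnion] at hu
      obtain ⟨j, i, hu⟩ := hu
      have := (hL j i).coefAtoms u hu
      refine ⟨this.2, ?_⟩
      rw [poly_lie_of_closed s this.1]
      exact zero_mem _
    · simp only [Set.mem_iUnion] at hu
      obtain ⟨p, hp, hu⟩ := hu
      have := (hs.2 p hp).cl u hu
      exact ⟨this, poly_lie_mem hC hsS this.1 ((Term.cl_subset_of_mem u hu).trans (hF p hp))⟩
    · have := he.cl u hu
      exact ⟨this, poly_lie_mem hC hsS this.1
        ((Term.cl_subset_of_mem u hu).trans Set.subset_union_right)⟩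
  have hmem : ∀ n, (lieN L s n e).poly ∈ supported ℚ S := by
    intro n
    induction n with
    | zero => exact he.poly_mem Set.subset_union_right
    | succ n ih =>
      rw [lieN_succ, poly_lie]
      exact lieDer_mem (fun u hu => (hS u hu).2) ih
  have := isNoetherianRing_supported hfin
  obtain ⟨N, hN, g, hg⟩ := exists_mem_span_lt
    (fun n => (⟨(lieN L s n e).poly, hmem n⟩ : supported ℚ S))
  choose t ht using fun i => exists_term_of_mem_supported (fun u hu => (hS u hu).1) (g i).2
  refine ⟨N, hN, t, fun i => (ht i).1, fun ρ => ?_⟩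
  -- Evaluating the ideal membership at `ρ` turns the polynomial identity into an identity of real
  -- numbers for every valuation.
  have h := congrArg (fun p => aeval ρ p.1) hg
  simp only [AddSubmonoidClass.coe_finsetSum, MulMemClass.coe_mul, map_sum, map_mul, ← (ht _).2,
    Term.aeval_poly] at h
  rw [h, Term.evalA_sum, Finset.sum_range, ← List.sum_ofFn]
  congr 1
  apply List.ext_getElem <;> simp [Term.evalA]

theorem hasRank_of_evalA {s : Sys L.k L.r} {e : Term L.k L.r} {N : ℕ}
    (h : 1 ≤ N ∧ ∃ g : ℕ → Term L.k L.r, (∀ i, (g i).DiffFree) ∧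
      ∀ ρ, (lieN L s N e).evalA ρ =
        (Term.sum ((List.range N).map fun i => Term.mul (g i) (lieN L s i e))).evalA ρ) :
    HasRank L s e N := by
  obtain ⟨hN, g, hg, h⟩ := h
  exact ⟨hN, g, hg, Provable.val₀ fun ρ v => h ρ⟩

end Polynomials

/-! ### Normal forms of semianalytic and analytic formulas. -/

section NormalForms

variable {k r : ℕ}

theorem DNF.val_toQF (D : DNF k r) (ρ : Term k r → ℝ) : D.toQF.val ρ ↔
    ∃ p ∈ D, (∀ e ∈ p.1, 0 ≤ e.evalA ρ) ∧ ∀ e ∈ p.2, 0 < e.evalA ρ := by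
  simp [DNF.toQF]

theorem exists_dnf_cmp (c : Cmp) {e f : Term k r} (he : e.DiffFree) (hf : f.DiffFree) :
    (∃ D : DNF k r, D.DiffFree ∧ ∀ ρ, (QF.cmp c e f).val ρ ↔ D.toQF.val ρ) ∧
    ∃ D : DNF k r, D.DiffFree ∧ ∀ ρ, ¬ (QF.cmp c e f).val ρ ↔ D.toQF.val ρ := by
  have h₁ : (Term.add e f.neg).DiffFree := ⟨he, hf.neg⟩
  have h₂ : (Term.add f e.neg).DiffFree := ⟨hf, he.neg⟩
  simp only [DNF.val_toQF]
  cases c with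
  | eq =>
    refine ⟨⟨[([Term.add e f.neg, Term.add f e.neg], [])], by simp [DNF.DiffFree, h₁, h₂],
      fun ρ => ?_⟩, ⟨[([], [Term.add e f.neg]), ([], [Term.add f e.neg])],
      by simp [DNF.DiffFree, h₁, h₂], fun ρ => ?_⟩⟩
    · simp [Cmp.rel, Term.evalA, le_antisymm_iff, and_comm]
    · simp [Cmp.rel, Term.evalA, ← lt_or_lt_iff_ne, or_comm]
  | ge =>
    refine ⟨⟨[([Term.add e f.neg], [])], by simp [DNF.DiffFree, h₁], fun ρ => ?_⟩,
      ⟨[([], [Term.add f e.neg])], by simp [DNF.DiffFree, h₂], fun ρ => ?_⟩⟩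
    · simp [Cmp.rel, Term.evalA]
    · simp [Cmp.rel, Term.evalA]
  | gt =>
    refine ⟨⟨[([], [Term.add e f.neg])], by simp [DNF.DiffFree, h₁], fun ρ => ?_⟩,
      ⟨[([Term.add f e.neg], [])], by simp [DNF.DiffFree, h₂], fun ρ => ?_⟩⟩
    · simp [Cmp.rel, Term.evalA]
    · simp [Cmp.rel, Term.evalA]

theorem exists_dnf_or {D E : DNF k r} (hD : D.DiffFree) (hE : E.DiffFree) :
    ∃ F : DNF k r, F.DiffFree ∧ ∀ ρ, F.toQF.val ρ ↔ D.toQF.val ρ ∨ E.toQF.val ρ := by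
  refine ⟨D ++ E, fun p hp => (List.mem_append.1 hp).elim (hD p) (hE p), fun ρ => ?_⟩
  simp only [DNF.val_toQF, List.mem_append, or_and_right, exists_or]

theorem exists_dnf_and {D E : DNF k r} (hD : D.DiffFree) (hE : E.DiffFree) :
    ∃ F : DNF k r, F.DiffFree ∧ ∀ ρ, F.toQF.val ρ ↔ D.toQF.val ρ ∧ E.toQF.val ρ := by
  refine ⟨D.flatMap fun p => E.map fun q => (p.1 ++ q.1, p.2 ++ q.2), ?_, fun ρ => ?_⟩
  · intro p hp
    simp only [List.mem_flatMap, List.mem_map] at hp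
    obtain ⟨p, hp, q, hq, rfl⟩ := hp
    simp only [List.mem_append]
    exact ⟨fun e he => he.elim ((hD p hp).1 e) ((hE q hq).1 e),
      fun e he => he.elim ((hD p hp).2 e) ((hE q hq).2 e)⟩
  · simp only [DNF.val_toQF, List.mem_flatMap, List.mem_map]
    constructor
    · rintro ⟨_, ⟨p, hp, q, hq, rfl⟩, h₁, h₂⟩
      simp only [List.mem_append] at h₁ h₂
      exact ⟨⟨p, hp, fun e he => h₁ e (Or.inl he), fun e he => h₂ e (Or.inl he)⟩,
        ⟨q, hq, fun e he => h₁ e (Or.inr he), fun e he => h₂ e (Or.inr he)⟩⟩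
    · rintro ⟨⟨p, hp, h₁, h₂⟩, ⟨q, hq, h₃, h₄⟩⟩
      refine ⟨_, ⟨p, hp, q, hq, rfl⟩, ?_, ?_⟩ <;> simp only [List.mem_append]
      · exact fun e he => he.elim (h₁ e) (h₃ e)
      · exact fun e he => he.elim (h₂ e) (h₄ e)

/-- The formula and its negation are treated together, so that the induction passes through
negations by exchanging the two normal forms. -/
theorem exists_dnf_and_not {P : QF k r} (hP : P.DiffFree) :
    (∃ D : DNF k r, D.DiffFree ∧ ∀ ρ, P.val ρ ↔ D.toQF.val ρ) ∧
    ∃ D : DNF k r, D.DiffFree ∧ ∀ ρ, ¬ P.val ρ ↔ D.toQF.val ρ := by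
  induction P with
  | cmp c e f => exact exists_dnf_cmp c hP.1 hP.2
  | and P Q ihP ihQ =>
    obtain ⟨⟨D, hD, hD'⟩, ⟨nD, hnD, hnD'⟩⟩ := ihP hP.1
    obtain ⟨⟨E, hE, hE'⟩, ⟨nE, hnE, hnE'⟩⟩ := ihQ hP.2
    obtain ⟨F, hF, hF'⟩ := exists_dnf_and hD hE
    obtain ⟨G, hG, hG'⟩ := exists_dnf_or hnD hnE
    exact ⟨⟨F, hF, fun ρ => by rw [QF.val_and, hF', hD', hE']⟩,
      ⟨G, hG, fun ρ => by rw [QF.val_and, hG', ← hnD', ← hnE', not_and_or]⟩⟩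
  | or P Q ihP ihQ =>
    obtain ⟨⟨D, hD, hD'⟩, ⟨nD, hnD, hnD'⟩⟩ := ihP hP.1
    obtain ⟨⟨E, hE, hE'⟩, ⟨nE, hnE, hnE'⟩⟩ := ihQ hP.2
    obtain ⟨F, hF, hF'⟩ := exists_dnf_or hD hE
    obtain ⟨G, hG, hG'⟩ := exists_dnf_and hnD hnE
    exact ⟨⟨F, hF, fun ρ => by rw [QF.val_or, hF', hD', hE']⟩,
      ⟨G, hG, fun ρ => by rw [QF.val_or, hG', ← hnD', ← hnE', not_or]⟩⟩
  | not P ih =>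
    obtain ⟨⟨D, hD, hD'⟩, ⟨nD, hnD, hnD'⟩⟩ := ih hP
    exact ⟨⟨nD, hnD, hnD'⟩, ⟨D, hD, fun ρ => by rw [QF.val_not, not_not, hD']⟩⟩

theorem exists_dnf {P : QF k r} (hP : P.DiffFree) :
    ∃ D : DNF k r, D.DiffFree ∧ ∀ ρ, P.val ρ ↔ D.toQF.val ρ :=
  (exists_dnf_and_not hP).1

theorem isNormalForm_of_val {L : Lang} {P : QF L.k L.r} {D : DNF L.k L.r}
    (h : D.DiffFree ∧ ∀ ρ, P.val ρ ↔ D.toQF.val ρ) : IsNormalForm L P D :=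
  ⟨h.1, Provable.val₀ fun ρ v => by simpa using h.2 ρ⟩

/-- Over the reals a conjunction of equations is the vanishing of a sum of squares, and a
disjunction is the vanishing of a product. -/
theorem exists_eqZ_of_analytic {P : QF k r} (hP : P.DiffFree) (hA : P.Analytic) :
    ∃ e : Term k r, e.DiffFree ∧ ∀ ρ, P.val ρ ↔ e.evalA ρ = 0 := by
  induction P with
  | cmp c e f => cases c with
    | eq =>
      refine ⟨Term.add e f.neg, ⟨hP.1, hP.2.neg⟩, fun ρ => ?_⟩
      simp [Cmp.rel, Term.evalA, ← sub_eq_add_neg, sub_eq_zero]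
    | ge => exact hA.elim
    | gt => exact hA.elim
  | and P Q ihP ihQ =>
    obtain ⟨e, he, he'⟩ := ihP hP.1 hA.1
    obtain ⟨f, hf, hf'⟩ := ihQ hP.2 hA.2
    refine ⟨Term.add (Term.mul e e) (Term.mul f f), ⟨⟨he, he⟩, hf, hf⟩, fun ρ => ?_⟩
    rw [QF.val_and, he', hf']
    simp only [Term.evalA]
    constructor
    · rintro ⟨h₁, h₂⟩; simp [h₁, h₂]
    · exact fun h => mul_self_add_mul_self_eq_zero.1 h
  | or P Q ihP ihQ =>
    obtain ⟨e, he, he'⟩ := ihP hP.1 hA.1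
    obtain ⟨f, hf, hf'⟩ := ihQ hP.2 hA.2
    refine ⟨Term.mul e f, ⟨he, hf⟩, fun ρ => ?_⟩
    rw [QF.val_or, he', hf']
    simp [Term.evalA]
  | not P _ => exact hA.elim

end NormalForms

end DL

namespace DL

/-! ### Differential ghosts and clocks. -/

section Ghosts

variable {k r : ℕ}

/-- Extension of a system by a differential ghost `y' = a * y + b`. -/
def Sys.ghost (s : Sys k r) (y : ℕ) (a b : Term k r) : Sys k r :=
  s ++ [(y, Term.add (Term.mul a (Term.bvar y)) b)]

/-- Extension of a system by a clock `y' = 1`. -/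
def Sys.clock (s : Sys k r) (y : ℕ) : Sys k r := s.ghost y (Term.const 0) (Term.const 1)

theorem Sys.vars_ghost (s : Sys k r) (y : ℕ) (a b : Term k r) :
    (s.ghost y a b).vars = s.vars ++ [y] := by
  simp [Sys.ghost, Sys.vars]

theorem Sys.mem_rhsFv_ghost {s : Sys k r} {y : ℕ} {a b : Term k r} {z : Var} :
    z ∈ (s.ghost y a b).rhsFv ↔ z ∈ s.rhsFv ∨ z ∈ a.fv ∨ z = Var.base y ∨ z ∈ b.fv := by
  simp only [Sys.mem_rhsFv, Sys.ghost, List.mem_append, List.mem_singleton, or_and_right,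
    exists_or, exists_eq_left, Term.fv, Finset.mem_union, Term.bvar, Finset.mem_singleton,
    or_assoc]

theorem Sys.WF.ghost {s : Sys k r} (hs : s.WF) {y : ℕ} {a b : Term k r} (hy : y ∉ s.vars)
    (ha : a.DiffFree) (hb : b.DiffFree) : (s.ghost y a b).WF := by
  refine ⟨?_, fun p hp => ?_⟩
  · rw [Sys.vars_ghost, List.nodup_append]
    refine ⟨hs.1, by simp, fun x hx z hz => ?_⟩
    rw [List.mem_singleton] at hz
    rintro rfl
    exact hy (hz ▸ hx)
  · rcases List.mem_append.1 hp with hp | hp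
    · exact hs.2 p hp
    · rw [List.mem_singleton] at hp
      subst hp
      exact ⟨⟨ha, trivial⟩, hb⟩

theorem Sys.WF.clock {s : Sys k r} (hs : s.WF) {y : ℕ} (hy : y ∉ s.vars) : (s.clock y).WF :=
  hs.ghost hy trivial trivial

theorem Sys.hasClock_clock (s : Sys k r) (y : ℕ) : (s.clock y).HasClock :=
  ⟨_, List.mem_append_right _ (List.mem_singleton_self _), 1, one_ne_zero,
    fun ρ => by simp [Term.evalA]⟩

theorem lookup_append_of_ne (s : Sys k r) {y n : ℕ} (h : n ≠ y) (b : Term k r) :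
    List.lookup n (s ++ [(y, b)]) = List.lookup n s := by
  have hb : (n == y) = false := by simpa using h
  rw [List.lookup_append, List.lookup_cons, hb]
  simp

variable {L : Lang} {s : Sys L.k L.r} {Q R : QF L.k L.r} {φ : Fml L.k L.r}

theorem lie_append {y : ℕ} {e : Term L.k L.r} (he : Var.base y ∉ e.fv) (b : Term L.k L.r) :
    lie L (s ++ [(y, b)]) e = lie L s e := by
  induction e with
  | var x => cases x with
    | base n =>
      rw [lie, lie, lookup_append_of_ne]
      rintro rfl
      simp [Term.fv] at he
    | prime z => rfl
  | const c => rfl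
  | add e f h₁ h₂ =>
    rw [Term.fv, Finset.mem_union, not_or] at he
    rw [lie, lie, h₁ he.1, h₂ he.2]
  | mul e f h₁ h₂ =>
    rw [Term.fv, Finset.mem_union, not_or] at he
    rw [lie, lie, h₁ he.1, h₂ he.2]
  | app j a ha =>
    rw [lie, lie]
    congr 1
    refine List.map_congr_left fun i _ => ?_
    rw [ha i fun h => he (Finset.mem_biUnion.2 ⟨i, Finset.mem_univ i, h⟩)]
  | diff e _ => rfl

/-- A ghost variable that occurs neither in `e` nor in the right-hand sides never enters an iterated
Lie derivative. -/
theorem lieN_append (hL : L.Closed) {y : ℕ} {e : Term L.k L.r} (he : Var.base y ∉ e.fv)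
    (hy : Var.base y ∉ s.rhsFv) (b : Term L.k L.r) (n : ℕ) :
    lieN L (s ++ [(y, b)]) n e = lieN L s n e := by
  induction n with
  | zero => rfl
  | succ n ih =>
    rw [lieN_succ, lieN_succ, ih, lie_append]
    exact fun h => (Finset.mem_union.1 (fv_lieN hL s n e h)).elim he hy

theorem provable_box_of_ghost (hs : s.WF) (hQ : Q.DiffFree) {y : ℕ} {a b : Term L.k L.r}
    (ha : a.DiffFree) (hb : b.DiffFree) (hy : y ∉ s.vars)
    (hf : Var.base y ∉ s.rhsFv ∪ Q.fv ∪ φ.fv ∪ a.fv ∪ b.fv)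
    (hf' : Var.prime (Var.base y) ∉ φ.fv) :
    Provable L ((Fml.box (Act.ode (s.ghost y a b) Q) φ).imp (Fml.box (Act.ode s Q) φ)) :=
  (provable_ex_self y (Fml.box (Act.ode (s.ghost y a b) Q) φ)).val₂
    (Axm.provable (Axm.DG s Q φ y a b hs hQ ha hb hy hf hf')) fun ρ v => by
      simp only [Fml.val_imp, Fml.val_iff, Sys.ghost]; tauto

theorem provable_ghost_of_box (hs : s.WF) (hQ : Q.DiffFree) {y : ℕ} {a b : Term L.k L.r}
    (ha : a.DiffFree) (hb : b.DiffFree) (hy : y ∉ s.vars)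
    (hf : Var.base y ∉ s.rhsFv ∪ Q.fv ∪ φ.fv ∪ a.fv ∪ b.fv)
    (hf' : Var.prime (Var.base y) ∉ φ.fv) :
    Provable L ((Fml.box (Act.ode s Q) φ).imp (Fml.box (Act.ode (s.ghost y a b) Q) φ)) :=
  (provable_all_self y (Fml.box (Act.ode (s.ghost y a b) Q) φ)).val₂
    (Axm.provable (Axm.DGall s Q φ y a b hs hQ ha hb hy hf hf')) fun ρ v => by
      simp only [Fml.val_imp, Fml.val_iff, Sys.ghost]; tauto

/-- With `a = 0` and `b = 1` the ghost is a clock. The two ghost axioms, instantiated at the current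
value of the ghost variable, give both directions. -/
theorem provable_box_clock (hs : s.WF) (hQ : Q.DiffFree) {y : ℕ} (hy : y ∉ s.vars)
    (hf : Var.base y ∉ s.rhsFv ∪ Q.fv ∪ φ.fv) (hf' : Var.prime (Var.base y) ∉ φ.fv) :
    Provable L ((Fml.box (Act.ode s Q) φ).iff (Fml.box (Act.ode (s.clock y) Q) φ)) :=
  (provable_box_of_ghost hs hQ (a := Term.const 0) (b := Term.const 1) trivial trivial hy
    (by simpa [Term.fv] using hf) hf').val₂
  (provable_ghost_of_box hs hQ (a := Term.const 0) (b := Term.const 1) trivial trivial hy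
    (by simpa [Term.fv] using hf) hf') fun ρ v => by
      simp only [Fml.val_imp, Fml.val_iff, Sys.clock]; tauto

end Ghosts

/-! ### Differentials as Lie derivatives, and differential invariants. -/

section DifferentialInvariants

variable {L : Lang} {s : Sys L.k L.r} {Q : QF L.k L.r} {φ χ : Fml L.k L.r}

theorem Term.DiffFree.adm {k r : ℕ} {t : Term k r} (ht : t.DiffFree) (x : Var) : t.Adm x := by
  induction t with
  | add e f he hf => exact ⟨he ht.1, hf ht.2⟩
  | mul e f he hf => exact ⟨he ht.1, hf ht.2⟩
  | app j a ha => exact fun i => ha i (ht i)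
  | diff e _ => exact ht.elim
  | _ => trivial

theorem Term.DiffFree.subst_single_prime {k r : ℕ} {t : Term k r} (ht : t.DiffFree) (z : Var)
    (e : Term k r) : t.subst (Term.single (Var.prime z) e) = t := by
  conv_rhs => rw [← Term.subst_var t]
  refine Term.subst_congr ht fun y hy => ?_
  have : y ≠ Var.prime z := fun h => ht.prime_notMem z (h ▸ hy)
  simp [Term.single, this]

theorem provable_assign_prime {n : ℕ} {f : Term L.k L.r} (hf : f.DiffFree) :
    Provable L (Fml.box (Act.assign (Var.prime (Var.base n)) f)
      (Fml.eq (Term.var (Var.prime (Var.base n))) f)) := by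
  refine (Axm.provable (Axm.assign (Var.prime (Var.base n)) f
    (Fml.eq (Term.var (Var.prime (Var.base n))) f) (Or.inr ⟨trivial, hf.adm _⟩))).val₁
    fun ρ v => ?_
  simp only [Fml.eq, Fml.subst, hf.subst_single_prime]
  simp [Term.subst, Term.single, Cmp.rel]

theorem provable_assignPrimes (hs : s.vars.Nodup) (hd : ∀ p ∈ s, p.2.DiffFree)
    {p : ℕ × Term L.k L.r} (hp : p ∈ s) :
    Provable L (Fml.assignPrimes s (Fml.eq (Term.var (Var.prime (Var.base p.1))) p.2)) := by
  induction s with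
  | nil => simp at hp
  | cons q s ih =>
    simp only [Sys.vars, List.map_cons, List.nodup_cons] at hs
    rcases List.mem_cons.1 hp with rfl | hp
    · refine (Provable.box_mono ?_).mp (provable_assign_prime (hd p (by simp)))
      -- The equation for `p.1'` survives the remaining assignments: they write different
      -- differential variables, and `p.2` contains no differential variable.
      have hconst : ∀ s' : Sys L.k L.r, p.1 ∉ s'.vars →
          Provable L ((Fml.eq (Term.var (Var.prime (Var.base p.1))) p.2).imp
            (Fml.assignPrimes s' (Fml.eq (Term.var (Var.prime (Var.base p.1))) p.2))) := by
        intro s' hs'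
        induction s' with
        | nil => exact Provable.val₀ fun ρ v => by simp [Fml.assignPrimes]
        | cons q' s' ih' =>
          simp only [Sys.vars, List.map_cons, List.mem_cons, not_or] at hs'
          refine (provable_box_const (Act.assign (Var.prime (Var.base q'.1)) q'.2) ?_).trans
            (Provable.box_mono (ih' hs'.2))
          simp only [Act.bv, Finset.disjoint_singleton_right, Fml.eq, Fml.fv, Term.fv,
            Finset.mem_union, Finset.mem_singleton, Var.prime.injEq, Var.base.injEq, not_or]
          exact ⟨fun h => hs'.1 h.symm, (hd p (by simp)).prime_notMem _⟩
      exact hconst s hs.1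
    · exact (ih hs.2 (fun p hp => hd p (by simp [hp])) hp).gen _

/-- Along solutions, the differential variables have the values of the right-hand sides. -/
theorem provable_box_prime (hs : s.WF) (hQ : Q.DiffFree) {p : ℕ × Term L.k L.r} (hp : p ∈ s) :
    Provable L (Fml.box (Act.ode s Q) (Fml.eq (Term.var (Var.prime (Var.base p.1))) p.2)) :=
  (Axm.provable (Axm.DE s Q (Fml.eq (Term.var (Var.prime (Var.base p.1))) p.2) hs hQ)).val₂
    ((provable_assignPrimes hs.1 hs.2 hp).gen (Act.ode s Q)) fun ρ v => by
      simp only [Fml.val_iff]; tauto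

/-- The syntactic total differential of a term. -/
def Term.differential (L : Lang) : Term L.k L.r → Term L.k L.r
  | var x => var (Var.prime x)
  | const _ => const 0
  | add e f => add (differential L e) (differential L f)
  | mul e f => add (mul (differential L e) f) (mul e (differential L f))
  | app j a =>
      sum ((List.finRange L.k).map fun i => mul ((L.q j i).inst a) (differential L (a i)))
  | diff _ => const 0

theorem provable_diff_eq {e : Term L.k L.r} (he : e.DiffFree) :
    Provable L (Fml.eq (Term.diff e) (e.differential L)) := by
  induction e with
  | var x => cases x with
    | base n => exact Axm.provable (Axm.diffVar n)
    | prime z => exact he.elim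
  | const c => exact Axm.provable (Axm.diffConst c)
  | add e f h₁ h₂ =>
    refine (Axm.provable (Axm.diffAdd e f he.1 he.2)).val₃ (h₁ he.1) (h₂ he.2) fun ρ v => ?_
    simp only [Fml.val_eq, Term.evalA, Term.differential]
    exact fun h h₁ h₂ => by rw [h, h₁, h₂]
  | mul e f h₁ h₂ =>
    refine (Axm.provable (Axm.diffMul e f he.1 he.2)).val₃ (h₁ he.1) (h₂ he.2) fun ρ v => ?_
    simp only [Fml.val_eq, Term.evalA, Term.differential]
    exact fun h h₁ h₂ => by rw [h, h₁, h₂]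
  | app j a ha =>
    refine Provable.of_list (l := Fml.eq (Term.diff (Term.app j a))
      (Term.sum ((List.finRange L.k).map fun i =>
          Term.mul ((L.q j i).inst a) (Term.diff (a i)))) ::
      (List.finRange L.k).map fun i => Fml.eq (Term.diff (a i)) ((a i).differential L))
      (fun φ hφ => ?_) fun ρ v h => ?_
    · rcases List.mem_cons.1 hφ with rfl | hφ
      · exact Axm.provable (Axm.diffApp j a he)
      · obtain ⟨i, -, rfl⟩ := List.mem_map.1 hφ
        exact ha i (he i)
    · have h₁ := h _ List.mem_cons_self
      have h₂ : ∀ i, (Term.diff (a i)).evalA ρ = ((a i).differential L).evalA ρ := fun i =>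
        h _ (List.mem_cons_of_mem _ (List.mem_map.2 ⟨i, List.mem_finRange i, rfl⟩))
      rw [Fml.val_eq] at h₁ ⊢
      rw [h₁, Term.differential, Term.evalA_sum, Term.evalA_sum, List.map_map, List.map_map]
      congr 1
      refine List.map_congr_left fun i _ => ?_
      simp only [Function.comp, Term.evalA]
      rw [← h₂ i, Term.evalA]
  | diff e _ => exact he.elim

/-- The total differential and the Lie derivative obey the same recursion, so agreement on variables
suffices. -/
theorem evalA_differential {ρ : Term L.k L.r → ℝ} {e : Term L.k L.r} (he : e.DiffFree)
    (h : ∀ n, Var.base n ∈ e.fv →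
      ρ (Term.var (Var.prime (Var.base n))) = (lie L s (Term.bvar n)).evalA ρ) :
    (e.differential L).evalA ρ = (lie L s e).evalA ρ := by
  induction e with
  | var x => cases x with
    | base n => exact h n (by simp [Term.fv])
    | prime z => exact he.elim
  | const c => rfl
  | add e f h₁ h₂ =>
    simp only [Term.differential, lie, Term.evalA, h₁ he.1 fun n hn => h n (by simp [Term.fv, hn]),
      h₂ he.2 fun n hn => h n (by simp [Term.fv, hn])]
  | mul e f h₁ h₂ =>
    simp only [Term.differential, lie, Term.evalA, h₁ he.1 fun n hn => h n (by simp [Term.fv, hn]),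
      h₂ he.2 fun n hn => h n (by simp [Term.fv, hn])]
  | app j a ha =>
    rw [Term.differential, lie, Term.evalA_sum, Term.evalA_sum, List.map_map, List.map_map]
    congr 1
    refine List.map_congr_left fun i _ => ?_
    simp only [Function.comp, Term.evalA]
    rw [ha i (he i) fun n hn => h n (Finset.mem_biUnion.2 ⟨i, Finset.mem_univ i, hn⟩)]
  | diff e _ => exact he.elim

theorem Provable.box_of_list {α : Act L.k L.r} {l : List (Fml L.k L.r)}
    (h : ∀ a ∈ l, Provable L (χ.imp (Fml.box α a)))
    (H : ∀ ρ v, (∀ a ∈ l, a.val ρ v) → φ.val ρ v) : Provable L (χ.imp (Fml.box α φ)) := by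
  induction l generalizing φ with
  | nil =>
    exact ((Provable.val₀ fun ρ v => H ρ v (by simp)).gen α).val₁ fun ρ v => by
      simp only [Fml.val_imp]; tauto
  | cons a l ih =>
    refine (h a (by simp)).val₃ (ih (φ := a.imp φ) (fun b hb => h b (by simp [hb])) fun ρ v hl => ?_)
      (Axm.provable (Axm.K α a φ)) fun ρ v => by simp only [Fml.val_imp]; tauto
    exact (Fml.val_imp ρ v a φ).2 fun ha => H ρ v (by simpa using ⟨ha, hl⟩)

/-- The parameters of a term, which do not evolve. -/
theorem exists_params (s : Sys L.k L.r) {e : Term L.k L.r} (he : e.DiffFree) :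
    ∃ ys : List ℕ, ys.Nodup ∧ (∀ y ∈ ys, y ∉ s.vars) ∧
      e.fv ⊆ s.lhs ∪ (ys.map Var.base).toFinset := by
  let f : Var → ℕ := fun z => match z with
    | Var.base n => n
    | Var.prime _ => 0
  refine ⟨((e.fv \ s.lhs).image f).toList, Finset.nodup_toList _, fun y hy => ?_, fun z hz => ?_⟩
  · simp only [Finset.mem_toList, Finset.mem_image, Finset.mem_sdiff] at hy
    obtain ⟨z, ⟨hz, hz'⟩, rfl⟩ := hy
    cases z with
    | base n => simpa using hz'
    | prime z => exact absurd hz (he.prime_notMem z)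
  · by_cases hz' : z ∈ s.lhs
    · exact Finset.mem_union_left _ hz'
    · refine Finset.mem_union_right _ ?_
      cases z with
      | base n =>
        simp only [List.mem_toFinset, List.mem_map, Finset.mem_toList, Finset.mem_image]
        exact ⟨n, ⟨Var.base n, by simp [hz, hz'], rfl⟩, rfl⟩
      | prime z => exact absurd hz (he.prime_notMem z)

/-- Differentials are Lie derivatives along solutions. -/
theorem provable_box_diff_eq_lie (hs : s.WF) (hQ : Q.DiffFree) {e : Term L.k L.r}
    (he : e.DiffFree) {ys : List ℕ} (hy : ∀ y ∈ ys, y ∉ s.vars)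
    (hf : e.fv ⊆ s.lhs ∪ (ys.map Var.base).toFinset) :
    Provable L ((Fml.conj (ys.map fun y =>
        Fml.eq (Term.var (Var.prime (Var.base y))) (Term.const 0))).imp
      (Fml.box (Act.ode s Q) (Fml.eq (Term.diff e) (lie L s e)))) := by
  have weak : ∀ {φ ψ : Fml L.k L.r}, Provable L φ → Provable L (ψ.imp φ) := fun h =>
    h.val₁ fun ρ v h => (Fml.val_imp ρ v _ _).2 fun _ => h
  refine Provable.box_of_list (l := [Fml.eq (Term.diff e) (e.differential L)] ++
    (s.map fun p => Fml.eq (Term.var (Var.prime (Var.base p.1))) p.2) ++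
    (ys.map fun y => Fml.eq (Term.var (Var.prime (Var.base y))) (Term.const 0)))
    (fun φ hφ => ?_) fun ρ v h => ?_
  · rcases List.mem_append.1 hφ with hφ | hφ
    · rcases List.mem_append.1 hφ with hφ | hφ
      · rw [List.mem_singleton.1 hφ]
        exact weak ((provable_diff_eq he).gen _)
      · obtain ⟨p, hp, rfl⟩ := List.mem_map.1 hφ
        exact weak (provable_box_prime hs hQ hp)
    · have h₁ : Provable L ((Fml.conj (ys.map fun y =>
          Fml.eq (Term.var (Var.prime (Var.base y))) (Term.const 0))).imp φ) :=
        Provable.val₀ fun ρ v => by rw [Fml.val_imp, Fml.val_conj]; exact fun h => h φ hφ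
      obtain ⟨y, hy', rfl⟩ := List.mem_map.1 hφ
      refine h₁.trans (provable_box_const _ ?_)
      simp only [Act.bv, Fml.eq, Fml.fv, Term.fv, Finset.union_empty,
        Finset.disjoint_singleton_left, Finset.mem_union, Sys.prime_mem_lhs, false_or,
        Sys.prime_mem_primes]
      exact hy y hy'
  · have h₁ : (Term.diff e).evalA ρ = (e.differential L).evalA ρ :=
      (Fml.val_eq ρ v _ _).1 (h _ (by simp))
    refine h₁.trans (evalA_differential he fun n hn => ?_)
    by_cases hn' : n ∈ s.vars
    · exact h _ (List.mem_append_left _ (List.mem_append_right _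
        (List.mem_map.2 ⟨_, lookup_getD_mem hn', rfl⟩)))
    · have : n ∈ ys := by
        have := hf hn
        simpa [hn'] using this
      have h₂ := h _ (List.mem_append_right _ (List.mem_map.2 ⟨n, this, rfl⟩))
      rw [Term.bvar, lie, lookup_of_notMem hn']
      exact h₂

/-- The differential invariant axioms presuppose `y' = 0` for the non-evolving variables `y`.
Formulas without differential variables do not depend on these values, so the premise can always be
arranged. -/
theorem Provable.of_params {ys : List ℕ} (hn : ys.Nodup)
    (hφ : ∀ z, Var.prime z ∉ φ.fv)
    (h : Provable L ((Fml.conj (ys.map fun y =>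
        Fml.eq (Term.var (Var.prime (Var.base y))) (Term.const 0))).imp φ)) : Provable L φ := by
  refine Provable.intro_conj_eq (zs := ys.map fun y => (Var.prime (Var.base y), Term.const 0))
    ?_ ?_ ?_ ?_
  · rw [List.map_map]
    exact hn.map fun a b h => Var.base.inj (Var.prime.inj h)
  · intro p _ q hq
    obtain ⟨y, -, rfl⟩ := List.mem_map.1 hq
    simp [Term.fv]
  · intro p hp
    obtain ⟨y, -, rfl⟩ := List.mem_map.1 hp
    exact hφ _
  · rw [List.map_map]
    exact h

theorem prime_notMem_fv_box (hs : s.WF) (hQ : Q.DiffFree) (hφ : ∀ z, Var.prime z ∉ φ.fv)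
    (z : Var) : Var.prime z ∉ (Fml.box (Act.ode s Q) φ).fv := by
  simp only [Fml.fv, Act.fv, Finset.mem_union, Finset.mem_sdiff, not_or]
  exact ⟨⟨⟨Sys.prime_mem_lhs, hs.prime_notMem z⟩, hQ.prime_notMem z⟩, fun h => hφ z h.1⟩

/-- Differential invariants for inequalities, with Lie derivatives. -/
theorem Provable.dI_ge (hs : s.WF) (hQ : Q.DiffFree) {e : Term L.k L.r}
    (he : e.DiffFree) (h : Provable L (Q.toF.imp (QF.geZ (lie L s e)).toF)) :
    Provable L ((QF.geZ e).toF.imp (Fml.box (Act.ode s Q) (QF.geZ e).toF)) := by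
  obtain ⟨ys, hn, hy, hf⟩ := exists_params s he
  have hz : ∀ z, Var.prime z ∉ ((QF.geZ e).toF : Fml L.k L.r).fv := fun z => by
    simpa [QF.fv_toF, QF.geZ, QF.fv, Term.fv] using he.prime_notMem z
  refine Provable.of_params hn (fun z => ?_) ?_
  · rw [Fml.fv_imp, Finset.mem_union, not_or]
    exact ⟨hz z, prime_notMem_fv_box hs hQ hz z⟩
  refine (provable_box_diff_eq_lie hs hQ he hy hf).val₃
    (Axm.provable (Axm.DIge s Q e ys hs hQ he hf))
    (Provable.box_weaken (ψ := Fml.eq (Term.diff e) (lie L s e))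
      (φ := (QF.geZ (Term.diff e)).toF) hs hQ (h.val₁ fun ρ v => ?_)) fun ρ v => ?_
  · simp only [Fml.val_imp, Fml.val_toF, QF.val_geZ, Fml.val_eq]
    exact fun h hQ h' => by rw [h']; exact h hQ
  · simp only [Fml.val_imp, Fml.val_iff]; tauto

/-- Differential invariants for equations, with Lie derivatives. -/
theorem Provable.dI_eq (hs : s.WF) (hQ : Q.DiffFree) {e : Term L.k L.r}
    (he : e.DiffFree) (h : Provable L (Q.toF.imp (QF.eqZ (lie L s e)).toF)) :
    Provable L ((QF.eqZ e).toF.imp (Fml.box (Act.ode s Q) (QF.eqZ e).toF)) := by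
  obtain ⟨ys, hn, hy, hf⟩ := exists_params s he
  have hz : ∀ z, Var.prime z ∉ ((QF.eqZ e).toF : Fml L.k L.r).fv := fun z => by
    simpa [QF.fv_toF, QF.eqZ, QF.fv, Term.fv] using he.prime_notMem z
  refine Provable.of_params hn (fun z => ?_) ?_
  · rw [Fml.fv_imp, Finset.mem_union, not_or]
    exact ⟨hz z, prime_notMem_fv_box hs hQ hz z⟩
  refine (provable_box_diff_eq_lie hs hQ he hy hf).val₃
    (Axm.provable (Axm.DIeq s Q e ys hs hQ he hf))
    (Provable.box_weaken (ψ := Fml.eq (Term.diff e) (lie L s e))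
      (φ := (QF.eqZ (Term.diff e)).toF) hs hQ (h.val₁ fun ρ v => ?_)) fun ρ v => ?_
  · simp only [Fml.val_imp, Fml.val_toF, QF.val_eqZ, Fml.val_eq]
    exact fun h hQ h' => by rw [h']; exact h hQ
  · simp only [Fml.val_imp, Fml.val_iff]; tauto

end DifferentialInvariants

end DL

namespace DL

/-! ### Darboux inequalities and invariance of the differential radical. -/

section Darboux

variable {L : Lang} {s : Sys L.k L.r} {Q : QF L.k L.r}

@[simp] theorem QF.fv_gtZ {k r : ℕ} (e : Term k r) : (QF.gtZ e).fv = e.fv := by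
  simp [QF.gtZ, QF.fv, Term.fv]

@[simp] theorem QF.fv_geZ {k r : ℕ} (e : Term k r) : (QF.geZ e).fv = e.fv := by
  simp [QF.geZ, QF.fv, Term.fv]

theorem Term.DiffFree.gtZ {k r : ℕ} {e : Term k r} (he : e.DiffFree) : (QF.gtZ e).DiffFree :=
  ⟨he, trivial⟩

theorem Term.DiffFree.geZ {k r : ℕ} {e : Term k r} (he : e.DiffFree) : (QF.geZ e).DiffFree :=
  ⟨he, trivial⟩

theorem Term.DiffFree.eqZ {k r : ℕ} {e : Term k r} (he : e.DiffFree) : (QF.eqZ e).DiffFree :=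
  ⟨he, trivial⟩

theorem lie_ghost_self {y : ℕ} (hy : y ∉ s.vars) {a b : Term L.k L.r} :
    lie L (s.ghost y a b) (Term.bvar y) = Term.add (Term.mul a (Term.bvar y)) b := by
  rw [Term.bvar, lie, Sys.ghost, List.lookup_append, lookup_of_notMem hy]
  simp [Term.bvar]

/-- Darboux inequalities: if `e' ≥ g * e`, then `e ≥ 0` is invariant. -/
theorem Provable.dbx_ge (hs : s.WF) (hQ : Q.DiffFree) {e g : Term L.k L.r}
    (he : e.DiffFree) (hg : g.DiffFree)
    (h : Provable L (Q.toF.imp (QF.geZ (Term.add (lie L s e) (Term.mul g e).neg)).toF)) :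
    Provable L ((QF.geZ e).toF.imp (Fml.box (Act.ode s Q) (QF.geZ e).toF)) := by
  obtain ⟨y, hy, hy'⟩ := exists_fresh_one (s.lhs ∪ s.rhsFv ∪ Q.fv ∪ e.fv ∪ g.fv)
  obtain ⟨z, hz, hz'⟩ := exists_fresh_one (s.lhs ∪ s.rhsFv ∪ Q.fv ∪ e.fv ∪ g.fv ∪ {Var.base y})
  simp only [Finset.mem_union, not_or, Sys.base_mem_lhs, Finset.mem_singleton, Var.base.injEq]
    at hy hz
  obtain ⟨⟨⟨⟨hy₁, hy₂⟩, hy₃⟩, hy₄⟩, hy₅⟩ := hy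
  obtain ⟨⟨⟨⟨⟨hz₁, hz₂⟩, hz₃⟩, hz₄⟩, hz₅⟩, hz₆⟩ := hz
  set Y : Term L.k L.r := Term.bvar y with hY
  set Z : Term L.k L.r := Term.bvar z with hZ
  -- The ghosts are `y' = -g y` and `z' = (g/2) z`. Then `(e y)' = (e' - g e) y`, while `y z²` is
  -- constant.
  set s₁ := s.ghost y g.neg (Term.const 0) with hs₁
  set s₂ := s₁.ghost z (Term.mul (Term.const (1 / 2)) g) (Term.const 0) with hs₂
  have hyd : Y.DiffFree := trivial
  have hzd : Z.DiffFree := trivial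
  have hgd : (Term.mul (Term.const (1 / 2)) g).DiffFree := ⟨trivial, hg⟩
  have w₁ : s₁.WF := hs.ghost hy₁ hg.neg trivial
  have hz₁' : z ∉ s₁.vars := by rw [hs₁, Sys.vars_ghost]; simp [hz₁, hz₆]
  have w₂ : s₂.WF := w₁.ghost hz₁' hgd trivial
  have hgp : (g.neg).fv = g.fv := by simp [Term.neg, Term.fv]
  have hgp' : (Term.mul (Term.const (1 / 2)) g).fv = g.fv := by simp [Term.fv]
  have hz₂' : Var.base z ∉ s₁.rhsFv := by
    rw [hs₁, Sys.mem_rhsFv_ghost, hgp]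
    simp [hz₂, hz₅, hz₆, Term.fv]
  have lY : lie L s₁ Y = Term.add (Term.mul g.neg Y) (Term.const 0) := lie_ghost_self hy₁
  have lZ : lie L s₂ Z = Term.add (Term.mul (Term.mul (Term.const (1 / 2)) g) Z)
      (Term.const 0) := lie_ghost_self hz₁'
  have lY' : lie L s₂ Y = lie L s₁ Y :=
    lie_append (s := s₁) (by simpa [hY, Term.bvar, Term.fv] using hz₆) _
  have le' : lie L s₁ e = lie L s e := lie_append hy₄ _
  -- The conserved equation `y z² = 1` witnesses `y > 0`, a strict inequality that is then cut into
  -- the domain.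
  have h₁ := Provable.dI_eq (s := s₂) (Q := Q)
    (e := Term.add (Term.mul Y (Term.mul Z Z)) (Term.const (-1))) w₂ hQ
    ⟨⟨hyd, hzd, hzd⟩, trivial⟩ (Provable.val₀ fun ρ v => by
      simp only [Fml.val_imp, Fml.val_toF, QF.val_eqZ, lie, lY', lY, lZ, Term.evalA,
        Term.evalA_neg]
      intro _
      push_cast
      ring)
  have h₂ := Provable.box_mono (α := Act.ode s₂ Q)
    (φ := (QF.eqZ (Term.add (Term.mul Y (Term.mul Z Z)) (Term.const (-1)))).toF)
    (ψ := (QF.gtZ Y).toF) (Provable.val₀ fun ρ v => by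
      simp only [Fml.val_imp, Fml.val_toF, QF.val_eqZ, QF.val_gtZ, Term.evalA]
      intro h
      push_cast at h
      by_contra hn
      nlinarith [mul_self_nonneg (Term.evalA ρ Z)])
  have h₃ := provable_box_of_ghost (s := s₁) (Q := Q) (φ := (QF.gtZ Y).toF) (y := z)
    (a := Term.mul (Term.const (1 / 2)) g) (b := Term.const 0) w₁ hQ hgd trivial hz₁'
    (by
      rw [QF.fv_toF, QF.fv_gtZ, hgp']
      simp [hz₂', hz₃, hz₅, hz₆, hY, Term.bvar, Term.fv])
    (by rw [QF.fv_toF, QF.fv_gtZ]; exact hyd.prime_notMem _)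
  have hd : (QF.and Q (QF.gtZ Y)).DiffFree := ⟨hQ, hyd.gtZ⟩
  -- Where `y > 0`, the product `e y` has nonnegative derivative, and its sign is that of `e`.
  have h₄ := Provable.dI_ge (s := s₁) (Q := QF.and Q (QF.gtZ Y)) (e := Term.mul e Y) w₁ hd
    ⟨he, hyd⟩ (h.val₁ fun ρ v => by
      simp only [Fml.val_imp, Fml.val_toF, QF.val_geZ, QF.val_gtZ, QF.val_and, lie, le', lY,
        Term.evalA, Term.evalA_neg]
      rintro h ⟨h₁, h₂⟩
      have := mul_nonneg (h h₁) h₂.le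
      push_cast
      linarith)
  have h₅ := Provable.box_weaken (s := s₁) (Q := QF.and Q (QF.gtZ Y))
    (ψ := (QF.geZ (Term.mul e Y)).toF) (φ := (QF.geZ e).toF) w₁ hd (Provable.val₀ fun ρ v => by
      simp only [Fml.val_imp, Fml.val_toF, QF.val_geZ, QF.val_gtZ, QF.val_and, Term.evalA]
      exact fun h h' => nonneg_of_mul_nonneg_left h' h.2)
  have h₆ := provable_box_cut (φ := (QF.geZ e).toF) w₁ hQ hyd.gtZ
  have h₇ := provable_box_of_ghost (s := s) (Q := Q) (φ := (QF.geZ e).toF) (y := y)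
    (a := g.neg) (b := Term.const 0) hs hQ hg.neg trivial hy₁
    (by
      rw [QF.fv_toF, QF.fv_geZ, hgp]
      simp [hy₂, hy₃, hy₄, hy₅, Term.fv])
    (by rw [QF.fv_toF, QF.fv_geZ]; exact he.prime_notMem _)
  have hbase : ∀ w, w ∉ s.vars → Var.base w ∉ s.rhsFv → Var.base w ∉ Q.fv → Var.base w ∉ e.fv →
      Var.base w ∉ ((QF.geZ e).toF.imp (Fml.box (Act.ode s Q) (QF.geZ e).toF)).fv := by
    intro w a b c d
    simp only [Fml.fv_imp, Fml.fv, Act.fv, QF.fv_toF, QF.fv_geZ, Finset.mem_union,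
      Finset.mem_sdiff, Sys.base_mem_lhs]
    tauto
  -- The initial values `y = z = 1` satisfy `y z² = 1` and make `e y` equal to `e`.
  refine Provable.intro_eq (z := Var.base y) (t := Term.const 1) (by simp [Term.fv])
    (hbase y hy₁ hy₂ hy₃ hy₄) ?_
  refine Provable.intro_eq (z := Var.base z) (t := Term.const 1) (by simp [Term.fv]) ?_ ?_
  · rw [Fml.fv_imp, Finset.mem_union, not_or]
    exact ⟨by simpa [Fml.eq, Fml.fv, Term.fv] using hz₆, hbase z hz₁ hz₂ hz₃ hz₄⟩
  refine ((h₁.trans h₂).trans h₃).val₅ (h₄.trans h₅) h₆ h₇ (Provable.val₀ (φ := Fml.tru)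
    fun ρ v => by simp) fun ρ v => ?_
  simp only [Fml.val_imp, Fml.val_toF, QF.val_geZ, QF.val_eqZ, Fml.val_eq, Term.evalA]
  intro h₁ h₂ h₃ h₄ _ hz hy he
  have hy₁ : Y.evalA ρ = 1 := hy.trans (by simp)
  have hz₁ : Z.evalA ρ = 1 := hz.trans (by simp)
  refine h₄ (h₃ (h₁ ?_) (h₂ ?_))
  · simp [hy₁, hz₁]
  · simpa [hy₁] using he

theorem lie_sum (L : Lang) (s : Sys L.k L.r) (l : List (Term L.k L.r)) :
    lie L s (Term.sum l) = Term.sum (l.map (lie L s)) := by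
  induction l with
  | nil => rfl
  | cons t l ih =>
    rw [List.map_cons]
    change Term.add _ (lie L s (Term.sum l)) = Term.add _ _
    rw [ih]
    rfl

theorem sum_map_range {M : Type*} [AddCommMonoid M] (f : ℕ → M) (n : ℕ) :
    ((List.range n).map f).sum = ∑ i ∈ Finset.range n, f i := by
  induction n with
  | zero => simp
  | succ n ih => simp [List.range_succ, Finset.sum_range_succ, ih]

/-- The estimate `p' ≤ G p` for `p = ∑ a_i²` with `a_i' = a_{i+1}`. Use `2 a_i a_{i+1} ≤ a_i² +
a_{i+1}²`; shifting the index leaves `2 p + a_N²` as an upper bound, and Cauchy–Schwarz bounds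
`a_N²` by `(∑ g_i²) p`. The same estimate serves the calculus and the semantic argument. -/
theorem sum_mul_succ_le (a g : ℕ → ℝ) (N : ℕ) (h : a N = ∑ i ∈ Finset.range N, g i * a i) :
    ∑ i ∈ Finset.range N, (a (i + 1) * a i + a i * a (i + 1)) ≤
      (2 + ∑ i ∈ Finset.range N, g i * g i) * ∑ i ∈ Finset.range N, a i * a i := by
  have h₁ : ∑ i ∈ Finset.range N, (a (i + 1) * a i + a i * a (i + 1)) ≤
      ∑ i ∈ Finset.range N, (a i * a i + a (i + 1) * a (i + 1)) :=
    Finset.sum_le_sum fun i _ => by nlinarith [sq_nonneg (a i - a (i + 1))]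
  have h₂ : ∑ i ∈ Finset.range N, a (i + 1) * a (i + 1) + a 0 * a 0 =
      ∑ i ∈ Finset.range N, a i * a i + a N * a N := by
    rw [← Finset.sum_range_succ (fun i => a i * a i), Finset.sum_range_succ']
  have h₃ : a N * a N ≤ (∑ i ∈ Finset.range N, g i * g i) * ∑ i ∈ Finset.range N, a i * a i := by
    have := Finset.sum_mul_sq_le_sq_mul_sq (Finset.range N) g a
    rw [← h] at this
    simpa only [sq] using this
  rw [Finset.sum_add_distrib (f := fun i => a i * a i)] at h₁
  rw [add_mul]
  linarith [mul_self_nonneg (a 0)]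

theorem val_radical (s : Sys L.k L.r) (N : ℕ) (e : Term L.k L.r) (ρ : Term L.k L.r → ℝ) :
    (radical L s N e).val ρ ↔ ∀ i < N, (lieN L s i e).evalA ρ = 0 := by
  simp [radical]

/-- The differential radical of a term is invariant. -/
theorem HasRank.provable_radical_box (hL : L.Closed) (hs : s.WF) (hQ : Q.DiffFree)
    {e : Term L.k L.r} (he : e.DiffFree) {N : ℕ} (hN : HasRank L s e N) :
    Provable L ((radical L s N e).toF.imp (Fml.box (Act.ode s Q) (QF.eqZ e).toF)) := by
  obtain ⟨hN, g, hg, h⟩ := hN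
  let p : Term L.k L.r :=
    Term.sum ((List.range N).map fun i => Term.mul (lieN L s i e) (lieN L s i e))
  let G : Term L.k L.r :=
    Term.add (Term.const 2) (Term.sum ((List.range N).map fun i => Term.mul (g i) (g i)))
  have hp : p.DiffFree := Term.diffFree_sum fun t ht => by
    obtain ⟨i, -, rfl⟩ := List.mem_map.1 ht
    exact ⟨he.lieN hL hs i, he.lieN hL hs i⟩
  have hG : G.DiffFree := ⟨trivial, Term.diffFree_sum fun t ht => by
    obtain ⟨i, -, rfl⟩ := List.mem_map.1 ht
    exact ⟨hg i, hg i⟩⟩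
  have val_p : ∀ ρ, p.evalA ρ =
      ∑ i ∈ Finset.range N, (lieN L s i e).evalA ρ * (lieN L s i e).evalA ρ := fun ρ => by
    simp only [p, Term.evalA_sum, List.map_map, ← sum_map_range]
    rfl
  have h₁ : Provable L (Q.toF.imp
      (QF.geZ (Term.add (lie L s p.neg) (Term.mul G p.neg).neg)).toF) := h.val₁ fun ρ v => by
    have e₁ : (lie L s p).evalA ρ = ∑ i ∈ Finset.range N,
        ((lieN L s (i + 1) e).evalA ρ * (lieN L s i e).evalA ρ +
          (lieN L s i e).evalA ρ * (lieN L s (i + 1) e).evalA ρ) := by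
      simp only [p, lie_sum, Term.evalA_sum, List.map_map, ← sum_map_range, lieN_succ]
      rfl
    have e₂ : G.evalA ρ = 2 + ∑ i ∈ Finset.range N, (g i).evalA ρ * (g i).evalA ρ := by
      simp only [G, Term.evalA, Term.evalA_sum, List.map_map, ← sum_map_range]
      norm_num
      rfl
    have e₃ : (Term.sum ((List.range N).map fun i => Term.mul (g i) (lieN L s i e))).evalA ρ =
        ∑ i ∈ Finset.range N, (g i).evalA ρ * (lieN L s i e).evalA ρ := by
      simp only [Term.evalA_sum, List.map_map, ← sum_map_range]
      rfl
    simp only [Fml.val_imp, Fml.val_toF, QF.val_geZ, Fml.val_eq]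
    intro h _
    have := sum_mul_succ_le (fun i => (lieN L s i e).evalA ρ) (fun i => (g i).evalA ρ) N
      (h.trans e₃)
    rw [← e₁, ← e₂, ← val_p] at this
    have e₄ : (lie L s p.neg).evalA ρ = - (lie L s p).evalA ρ := by
      simp [Term.neg, lie, Term.evalA]
    rw [Term.evalA, e₄, Term.evalA_neg, Term.evalA, Term.evalA_neg]
    linarith
  -- Since `p` is a sum of squares, `-p ≥ 0` is equivalent to the radical, so an upper bound on the
  -- growth of `p` is all that is needed.
  have h₂ := Provable.dbx_ge hs hQ hp.neg hG h₁
  refine Provable.trans (ψ := (QF.geZ p.neg).toF) (Provable.val₀ fun ρ v => ?_)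
    (h₂.trans (Provable.box_mono (Provable.val₀ fun ρ v => ?_)))
  · simp only [Fml.val_imp, Fml.val_toF, QF.val_geZ, val_radical, Term.evalA_neg, val_p]
    intro h
    rw [Finset.sum_eq_zero fun i hi => by rw [h i (Finset.mem_range.1 hi), zero_mul], neg_zero]
  · simp only [Fml.val_imp, Fml.val_toF, QF.val_geZ, QF.val_eqZ, Term.evalA_neg, val_p]
    intro h
    have h₀ : (lieN L s 0 e).evalA ρ * (lieN L s 0 e).evalA ρ ≤
        ∑ i ∈ Finset.range N, (lieN L s i e).evalA ρ * (lieN L s i e).evalA ρ :=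
      Finset.single_le_sum (f := fun i => (lieN L s i e).evalA ρ * (lieN L s i e).evalA ρ)
        (fun i _ => mul_self_nonneg _) (Finset.mem_range.2 hN)
    exact mul_self_eq_zero.1 (le_antisymm (h₀.trans (by linarith)) (mul_self_nonneg _))

end Darboux

end DL

namespace DL

/-! ### The first significant Lie derivative; perturbation by powers of the distance. -/

section FirstDerivative

/-- Either the first `N` terms of a sequence vanish or there is a first one that does not. -/
theorem forall_eq_zero_or_exists_first (a : ℕ → ℝ) (N : ℕ) :
    (∀ i < N, a i = 0) ∨ ∃ k < N, (∀ i < k, a i = 0) ∧ (0 < a k ∨ a k < 0) := by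
  by_cases h : ∃ k, k < N ∧ a k ≠ 0
  · right
    have hk := Nat.find_spec h
    refine ⟨Nat.find h, hk.1, fun i hi => ?_, (lt_or_gt_of_ne hk.2).symm⟩
    have := Nat.find_min h hi
    push Not at this
    exact this (hi.trans hk.1)
  · left
    push Not at h
    exact h

variable {L : Lang} {s : Sys L.k L.r}

/-- The nested implications say that the first nonzero entry among the first `N` exists and is
positive: the strict last clause excludes that all of them vanish. -/
theorem val_progGt (s : Sys L.k L.r) {N : ℕ} (hN : 1 ≤ N) (e : Term L.k L.r)
    (ρ : Term L.k L.r → ℝ) : (progGt L s N e).val ρ ↔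
      ∃ k < N, (∀ i < k, (lieN L s i e).evalA ρ = 0) ∧ 0 < (lieN L s k e).evalA ρ := by
  have h₀ : (progGt L s N e).val ρ ↔
      (∀ i < N - 1, (∀ j < i, (lieN L s j e).evalA ρ = 0) → 0 ≤ (lieN L s i e).evalA ρ) ∧
      ((∀ j < N - 1, (lieN L s j e).evalA ρ = 0) → 0 < (lieN L s (N - 1) e).evalA ρ) := by
    simp [progGt, val_radical]
  rw [h₀]
  generalize ha : (fun i => (lieN L s i e).evalA ρ) = a
  have ha' : ∀ i, (lieN L s i e).evalA ρ = a i := fun i => by rw [← ha]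
  simp only [ha']
  constructor
  · rintro ⟨h₁, h₂⟩
    rcases forall_eq_zero_or_exists_first a N with h | ⟨k, hk, h, h' | h'⟩
    · have := h₂ fun j hj => h j (by omega)
      rw [h (N - 1) (by omega)] at this
      exact absurd this (lt_irrefl _)
    · exact ⟨k, hk, h, h'⟩
    · rcases Nat.lt_or_ge k (N - 1) with hk' | hk'
      · exact absurd (h₁ k hk' h) (not_le.2 h')
      · obtain rfl : k = N - 1 := by omega
        exact absurd (h₂ h) (not_lt.2 h'.le)
  · rintro ⟨k, hk, h, h'⟩
    refine ⟨fun i hi h₁ => ?_, fun h₁ => ?_⟩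
    · rcases lt_trichotomy i k with hik | rfl | hik
      · exact (h i hik).ge
      · exact h'.le
      · exact absurd (h₁ k hik) h'.ne'
    · rcases Nat.lt_or_ge k (N - 1) with hk' | hk'
      · exact absurd (h₁ k hk') h'.ne'
      · obtain rfl : k = N - 1 := by omega
        exact h'

/-- Each differentiation lowers the exponent of `p` by at most one, so fewer than `n` derivatives of
`p^n` still vanish wherever `p` does. -/
theorem lieDer_iterate_pow (s : Sys L.k L.r) (p : MvPolynomial (Term L.k L.r) ℚ) {i n : ℕ}
    (h : i ≤ n) : ∃ q, (lieDer L s)^[i] (p ^ n) = q * p ^ (n - i) := by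
  induction i with
  | zero => exact ⟨1, by simp⟩
  | succ i ih =>
    obtain ⟨q, hq⟩ := ih (by omega)
    obtain ⟨m, hm⟩ : ∃ m, n - i = m + 1 := ⟨n - i - 1, by omega⟩
    rw [Function.iterate_succ_apply', hq, hm, show n - (i + 1) = m by omega]
    refine ⟨lieDer L s q * p + q * ((m + 1 : ℕ) * lieDer L s p), ?_⟩
    rw [Derivation.leibniz, Derivation.leibniz_pow]
    simp only [smul_eq_mul, nsmul_eq_mul, Nat.add_sub_cancel]
    ring

/-- Powers of terms. -/
def Term.pow {k r : ℕ} (t : Term k r) : ℕ → Term k r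
  | 0 => const 1
  | n + 1 => mul (pow t n) t

theorem Term.poly_pow {k r : ℕ} (t : Term k r) (n : ℕ) : (t.pow n).poly = t.poly ^ n := by
  induction n with
  | zero => simp [Term.pow, Term.poly]
  | succ n ih => rw [Term.pow, Term.poly, ih, pow_succ]

theorem Term.evalA_pow {k r : ℕ} (ρ : Term k r → ℝ) (t : Term k r) (n : ℕ) :
    (t.pow n).evalA ρ = t.evalA ρ ^ n := by
  rw [← Term.aeval_poly, Term.poly_pow, map_pow, Term.aeval_poly]

theorem Term.DiffFree.pow {k r : ℕ} {t : Term k r} (ht : t.DiffFree) (n : ℕ) :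
    (t.pow n).DiffFree := by
  induction n with
  | zero => trivial
  | succ n ih => exact ⟨ih, ht⟩

theorem Term.poly_neg {k r : ℕ} (t : Term k r) : t.neg.poly = - t.poly := by
  simp [Term.neg, Term.poly]

theorem evalA_lieN_neg (s : Sys L.k L.r) (n : ℕ) (e : Term L.k L.r) (ρ : Term L.k L.r → ℝ) :
    (lieN L s n e.neg).evalA ρ = - (lieN L s n e).evalA ρ := by
  rw [← Term.aeval_poly, ← Term.aeval_poly, poly_lieN, poly_lieN, Term.poly_neg,
    iterate_map_neg, map_neg]

/-- Subtracting a high power of a term that vanishes at the point does not disturb the low-order Lie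
derivatives there. -/
theorem evalA_lieN_add_neg_pow (s : Sys L.k L.r) (e u : Term L.k L.r) {ρ : Term L.k L.r → ℝ}
    (hu : u.evalA ρ = 0) {i n : ℕ} (h : i < n) :
    (lieN L s i (Term.add e (u.pow n).neg)).evalA ρ = (lieN L s i e).evalA ρ := by
  obtain ⟨q, hq⟩ := lieDer_iterate_pow s u.poly h.le
  rw [← Term.aeval_poly, ← Term.aeval_poly, poly_lieN, poly_lieN, Term.poly, Term.poly_neg,
    ← sub_eq_add_neg, iterate_map_sub, map_sub, Term.poly_pow, hq, map_mul, map_pow,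
    Term.aeval_poly, hu, zero_pow (by omega), mul_zero, sub_zero]

/-- The squared distance of two vectors of variables. -/
def distSq {k r : ℕ} (xs ys : List ℕ) : Term k r :=
  Term.sum (List.zipWith (fun x y => Term.mul (Term.add (Term.bvar x) (Term.bvar y).neg)
    (Term.add (Term.bvar x) (Term.bvar y).neg)) xs ys)

theorem diffFree_distSq {k r : ℕ} (xs ys : List ℕ) : (distSq xs ys : Term k r).DiffFree := by
  induction xs generalizing ys with
  | nil => trivial
  | cons x xs ih =>
    cases ys with
    | nil => trivial
    | cons y ys => exact ⟨⟨⟨trivial, trivial, trivial⟩, trivial, trivial, trivial⟩, ih ys⟩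

theorem evalA_distSq {k r : ℕ} (xs ys : List ℕ) (ρ : Term k r → ℝ) :
    0 ≤ (distSq xs ys : Term k r).evalA ρ ∧
      ((distSq xs ys : Term k r).evalA ρ = 0 ↔ (QF.eqVec xs ys).val ρ) := by
  induction xs generalizing ys with
  | nil => simp [distSq, QF.eqVec]
  | cons x xs ih =>
    cases ys with
    | nil => simp [distSq, QF.eqVec]
    | cons y ys =>
      obtain ⟨h₁, h₂⟩ := ih ys
      have e₁ : (distSq (x :: xs) (y :: ys) : Term k r).evalA ρ =
          (ρ (Term.bvar x) - ρ (Term.bvar y)) * (ρ (Term.bvar x) - ρ (Term.bvar y)) +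
            (distSq xs ys : Term k r).evalA ρ := by
        simp [distSq, Term.evalA, Term.bvar, sub_eq_add_neg]
      have h₃ := mul_self_nonneg (ρ (Term.bvar x) - ρ (Term.bvar y))
      rw [e₁, QF.eqVec_cons, QF.val_and, ← h₂]
      refine ⟨by linarith, ?_⟩
      have e₂ : (QF.cmp Cmp.eq (Term.bvar x) (Term.bvar y)).val ρ ↔
          (ρ (Term.bvar x) - ρ (Term.bvar y)) * (ρ (Term.bvar x) - ρ (Term.bvar y)) = 0 := by
        rw [mul_self_eq_zero, sub_eq_zero]
        rfl
      rw [e₂]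
      constructor
      · intro h
        constructor <;> linarith
      · rintro ⟨h, h'⟩
        rw [h, h', add_zero]

end FirstDerivative

/-! ### Local progress within the calculus. -/

section Progress

variable {L : Lang} {s : Sys L.k L.r} {ys : List ℕ} {A B P Q R F G : QF L.k L.r}

theorem exists_freshVec (s : Sys L.k L.r) (V : Finset Var) : ∃ ys, FreshVec s V ys := by
  obtain ⟨ys, h₁, h₂, h₃⟩ := exists_fresh (s.rhsFv ∪ V ∪ s.lhs) s.length
  refine ⟨ys, h₁, h₂, fun y hy => ?_⟩
  obtain ⟨h, h'⟩ := h₃ y hy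
  simp only [Finset.mem_union, not_or, Sys.base_mem_lhs] at h h' ⊢
  exact ⟨h.2, h.1, h'.1⟩

theorem FreshVec.mono {V W : Finset Var} (h : FreshVec s W ys) (hV : V ⊆ W) :
    FreshVec s V ys := by
  refine ⟨h.1, h.2.1, fun y hy => ?_⟩
  obtain ⟨h₁, h₂, h₃⟩ := h.2.2 y hy
  exact ⟨h₁, fun h => h₂ (Finset.union_subset_union_right hV h),
    fun h => h₃ (Finset.union_subset_union_right hV h)⟩

theorem FreshVec.length_eq {V : Finset Var} (h : FreshVec s V ys) : s.vars.length = ys.length := by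
  rw [h.1, Sys.vars, List.length_map]

theorem FreshVec.notMem_vars {V : Finset Var} (h : FreshVec s V ys) : ∀ y ∈ ys, y ∉ s.vars :=
  fun y hy => (h.2.2 y hy).1

theorem FreshVec.notMem_rhsFv {V : Finset Var} (h : FreshVec s V ys) :
    ∀ y ∈ ys, Var.base y ∉ s.rhsFv :=
  fun y hy h' => (h.2.2 y hy).2.1 (Finset.mem_union_left _ h')

theorem FreshVec.notMem {V : Finset Var} (h : FreshVec s V ys) : ∀ y ∈ ys, Var.base y ∉ V :=
  fun y hy h' => (h.2.2 y hy).2.1 (Finset.mem_union_right _ h')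

theorem base_notMem_fv_box {φ : Fml L.k L.r} {n : ℕ} (h₁ : n ∉ s.vars) (h₂ : Var.base n ∉ s.rhsFv)
    (h₃ : Var.base n ∉ Q.fv) (h₄ : Var.base n ∉ φ.fv) :
    Var.base n ∉ (Fml.box (Act.ode s Q) φ).fv := by
  simp [Fml.fv, Act.fv, h₁, h₂, h₃, h₄]

theorem base_notMem_fv_dia {φ : Fml L.k L.r} {n : ℕ} (h₁ : n ∉ s.vars) (h₂ : Var.base n ∉ s.rhsFv)
    (h₃ : Var.base n ∉ Q.fv) (h₄ : Var.base n ∉ φ.fv) :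
    Var.base n ∉ (Fml.dia (Act.ode s Q) φ).fv := by
  simp [Fml.fv, Act.fv, h₁, h₂, h₃, h₄]

theorem base_notMem_fv_eqVec {k r : ℕ} {xs ys : List ℕ} {n : ℕ} (h₁ : n ∉ xs) (h₂ : n ∉ ys) :
    Var.base n ∉ (QF.eqVec xs ys : QF k r).fv :=
  fun h => (QF.base_mem_fv_eqVec h).elim h₁ h₂

/-- The system can evolve for some time within `A`, after a start in the state `x = y`. -/
def Prg (s : Sys L.k L.r) (ys : List ℕ) (A : QF L.k L.r) : Fml L.k L.r :=
  Fml.dia (Act.ode s (QF.or A (QF.eqVec s.vars ys))) (Fml.not (QF.eqVec s.vars ys).toF)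

theorem diffFree_or_eqVec (hA : A.DiffFree) (xs ys : List ℕ) :
    (QF.or A (QF.eqVec xs ys)).DiffFree := ⟨hA, QF.diffFree_eqVec _ _⟩

/-- The disjunct `x = y` in the domain of `Prg` absorbs the initial state, so the implication
between domains matters only away from `y`. -/
theorem Provable.prg_mono_or (hs : s.WF) (hA : A.DiffFree) (hB : B.DiffFree)
    (h : Provable L (A.toF.imp (QF.or B (QF.eqVec s.vars ys)).toF)) :
    Provable L ((Prg s ys A).imp (Prg s ys B)) :=
  Provable.dia_dom_mono hs (diffFree_or_eqVec hA _ _) (diffFree_or_eqVec hB _ _)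
    (h.val₁ fun ρ v => by simp only [Fml.val_imp, Fml.val_toF, QF.val_or]; tauto)

theorem Provable.prg_mono (hs : s.WF) (hA : A.DiffFree) (hB : B.DiffFree)
    (h : Provable L (A.toF.imp B.toF)) : Provable L ((Prg s ys A).imp (Prg s ys B)) :=
  Provable.prg_mono_or hs hA hB
    (h.val₁ fun ρ v => by simp only [Fml.val_imp, Fml.val_toF, QF.val_or]; tauto)

/-- By uniqueness of solutions, two runs that leave `y` within `A` and within `B` have a common
initial piece on which both conditions hold. -/
theorem provable_prg_and (hs : s.WF) (hA : A.DiffFree) (hB : B.DiffFree) :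
    Provable L ((Prg s ys A).imp ((Prg s ys B).imp (Prg s ys (A.and B)))) := by
  have hA' := diffFree_or_eqVec hA s.vars ys
  have hB' := diffFree_or_eqVec hB s.vars ys
  refine (provable_dia_uniq (φ := Fml.not (QF.eqVec s.vars ys).toF) hs hA' hB').val₂
    (Provable.dia_dom_mono (φ := Fml.not (QF.eqVec s.vars ys).toF) hs
      (Q := QF.and (QF.or A (QF.eqVec s.vars ys)) (QF.or B (QF.eqVec s.vars ys)))
      (R := QF.or (A.and B) (QF.eqVec s.vars ys)) ⟨hA', hB'⟩
      (diffFree_or_eqVec (A := A.and B) ⟨hA, hB⟩ _ _) (Provable.val₀ fun ρ v => ?_)) fun ρ v => ?_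
  · simp only [Fml.val_imp, Fml.val_toF, QF.val_or, QF.val_and]; tauto
  · simp only [Fml.val_imp, Prg]; tauto

/-- Progress into both would give progress into `A ∧ ¬A`, whose domain reduces to `x = y` and so
cannot be left. -/
theorem provable_prg_contra (hs : s.WF) (hA : A.DiffFree) :
    Provable L ((Prg s ys A).imp (Fml.not (Prg s ys A.not))) := by
  have hf : (QF.or (A.and A.not) (QF.eqVec s.vars ys)).DiffFree :=
    diffFree_or_eqVec (A := A.and A.not) ⟨hA, hA⟩ _ _
  refine (provable_prg_and (ys := ys) hs hA (B := A.not) hA).val₂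
    ((provable_dia_not_iff (Act.ode s (QF.or (A.and A.not) (QF.eqVec s.vars ys)))
      (QF.eqVec s.vars ys).toF).val₂ (Provable.box_of_dom (φ := (QF.eqVec s.vars ys).toF) hs hf
        (Provable.val₀ fun ρ v => ?_)) (φ := Fml.not (Prg s ys (A.and A.not)))
      fun ρ v => ?_) fun ρ v => ?_
  · simp only [Fml.val_imp, Fml.val_toF, QF.val_or, QF.val_and, QF.val_not]; tauto
  · simp only [Fml.val_iff, Fml.val_not, Prg]; tauto
  · simp only [Fml.val_imp, Fml.val_not]; tauto

theorem provable_box_eqVec_const {xs ys : List ℕ} (hx : ∀ x ∈ xs, x ∉ s.vars)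
    (hy : ∀ y ∈ ys, y ∉ s.vars) : Provable L ((QF.eqVec xs ys).toF.imp
      (Fml.box (Act.ode s Q) (QF.eqVec xs ys).toF)) := by
  refine provable_box_const _ (disjoint_bv (fun z => ?_) fun x hxs hx' => ?_)
  · rw [QF.fv_toF]
    exact (QF.diffFree_eqVec _ _).prime_notMem z
  · rw [QF.fv_toF] at hx'
    exact (QF.base_mem_fv_eqVec hx').elim (fun h => hx x h hxs) fun h => hy x h hxs

/-- Continuous existence, for terms that may mention the initial values. -/
theorem provable_cont (hs : s.WF) (hc : s.HasClock) (hy : FreshVec s ∅ ys) {e : Term L.k L.r}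
    (he : e.DiffFree) : Provable L ((QF.eqVec s.vars ys).toF.imp ((QF.gtZ e).toF.imp
      (Fml.dia (Act.ode s (QF.gtZ e)) (Fml.not (QF.eqVec s.vars ys).toF)))) := by
  -- The axiom wants initial values that do not occur in `e`. A second fresh copy `z` of the initial
  -- state is used for it; since `y = z` is constant along the run, `x ≠ z` at the end gives `x ≠
  -- y`.
  obtain ⟨zs, hz⟩ := exists_freshVec s (e.fv ∪ (ys.map Var.base).toFinset)
  have hzy : ∀ z ∈ zs, z ∉ ys := fun z hz' hzy => hz.notMem z hz' (by simp [hzy])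
  have hze : ∀ z ∈ zs, Var.base z ∉ e.fv := fun z hz' h => hz.notMem z hz' (by simp [h])
  refine Provable.intro_eqVec hz.length_eq hz.2.1 hz.notMem_vars (fun z hz' => ?_) ?_
  · have h₁ : Var.base z ∉ ((QF.eqVec s.vars ys).toF : Fml L.k L.r).fv := by
      rw [QF.fv_toF]
      exact base_notMem_fv_eqVec (hz.notMem_vars z hz') (hzy z hz')
    have h₂ : Var.base z ∉ ((QF.gtZ e).toF : Fml L.k L.r).fv := by
      rw [QF.fv_toF, QF.fv_gtZ]
      exact hze z hz'
    simp only [Fml.fv_imp, Finset.mem_union, not_or]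
    refine ⟨h₁, h₂, base_notMem_fv_dia (hz.notMem_vars z hz') (hz.notMem_rhsFv z hz') ?_ h₁⟩
    rw [QF.fv_gtZ]
    exact hze z hz'
  have hl : ys.length = zs.length := by rw [hy.1, hz.1]
  refine (Axm.provable (Axm.Cont s e zs hs hc he (hz.mono Finset.subset_union_left))).val₃
    (provable_box_eqVec_const (s := s) (Q := QF.gtZ e) hy.notMem_vars hz.notMem_vars)
    (Provable.dia_box_mono (α := Act.ode s (QF.gtZ e)) (φ := (QF.eqVec ys zs).toF)
      (ψ := Fml.not (QF.eqVec s.vars zs).toF) (χ := Fml.not (QF.eqVec s.vars ys).toF)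
      (Provable.val₀ fun ρ v => ?_)) fun ρ v => ?_
  · simp only [Fml.val_imp, Fml.val_not, Fml.val_toF, QF.val_eqVec hl, QF.val_eqVec hz.length_eq,
      QF.val_eqVec hy.length_eq]
    exact fun h h' h'' => h' (h''.trans h)
  · simp only [Fml.val_imp, Fml.val_iff, Fml.val_toF, QF.val_eqVec hl, QF.val_eqVec hz.length_eq,
      QF.val_eqVec hy.length_eq]
    exact fun h₁ h₂ h₃ h₄ h₅ h₆ => h₃ (h₂ (h₅.symm.trans h₄)) ((h₁ h₄).2 h₆)

/-- The formula `e ≥ 0 ∧ L e ≥ 0 ∧ … ∧ L^(k-1) e ≥ 0`. -/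
def lieNonneg (L : Lang) (s : Sys L.k L.r) (k : ℕ) (e : Term L.k L.r) : QF L.k L.r :=
  QF.conj ((List.range k).map fun i => QF.geZ (lieN L s i e))

theorem val_lieNonneg (s : Sys L.k L.r) (k : ℕ) (e : Term L.k L.r) (ρ : Term L.k L.r → ℝ) :
    (lieNonneg L s k e).val ρ ↔ ∀ i < k, 0 ≤ (lieN L s i e).evalA ρ := by
  simp [lieNonneg]

/-- Downward induction on the order: nonnegativity of `L^(i+1) e` along the run is cut into the
domain and makes `L^i e ≥ 0` a differential invariant. -/
theorem provable_box_lieN_nonneg (hL : L.Closed) (hs : s.WF) {e : Term L.k L.r} (he : e.DiffFree)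
    (k j : ℕ) (hj : j ≤ k) : Provable L ((lieNonneg L s k e).toF.imp
      (Fml.box (Act.ode s (QF.gtZ (lieN L s k e))) (QF.geZ (lieN L s (k - j) e)).toF)) := by
  have hd : ∀ i, (lieN L s i e).DiffFree := fun i => he.lieN hL hs i
  induction j with
  | zero =>
    refine (Provable.box_of_dom (φ := (QF.geZ (lieN L s k e)).toF) hs (hd k).gtZ
      (Provable.val₀ fun ρ v => ?_)).val₁ fun ρ v => ?_
    · simp only [Fml.val_imp, Fml.val_toF, QF.val_gtZ, QF.val_geZ]
      exact le_of_lt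
    · rw [Fml.val_imp]
      exact fun h _ => h
  | succ j ih =>
    obtain ⟨i, hi⟩ : ∃ i, k - j = i + 1 := ⟨k - j - 1, by omega⟩
    have hi' : k - (j + 1) = i := by omega
    have ih := ih (by omega)
    rw [hi] at ih
    rw [hi']
    refine ih.val₄ (Provable.dI_ge (Q := QF.and (QF.gtZ (lieN L s k e))
        (QF.geZ (lieN L s (i + 1) e))) hs ⟨(hd k).gtZ, (hd _).geZ⟩ (hd i)
        (Provable.val₀ fun ρ v => ?_))
      (provable_box_cut (φ := (QF.geZ (lieN L s i e)).toF) hs (hd k).gtZ (hd (i + 1)).geZ)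
      (Provable.val₀ (φ := (lieNonneg L s k e).toF.imp (QF.geZ (lieN L s i e)).toF)
        fun ρ v => ?_) fun ρ v => ?_
    · simp only [Fml.val_imp, Fml.val_toF, QF.val_and, QF.val_geZ, lieN_succ]
      exact fun h => h.2
    · simp only [Fml.val_imp, Fml.val_toF, QF.val_geZ, val_lieNonneg]
      exact fun h => h i (by omega)
    · simp only [Fml.val_imp]; tauto

/-- Continuous existence provides a run that moves within `e > 0`; whatever holds on all such runs
becomes a target of progress. -/
theorem provable_prg_of_box (hs : s.WF) (hc : s.HasClock) (hy : FreshVec s ∅ ys)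
    {e : Term L.k L.r} (he : e.DiffFree) (hA : A.DiffFree) :
    Provable L ((QF.eqVec s.vars ys).toF.imp ((QF.gtZ e).toF.imp
      ((Fml.box (Act.ode s (QF.gtZ e)) A.toF).imp (Prg s ys A)))) := by
  refine (provable_cont hs hc hy he).val₃
    (provable_dia_dom_of_box (φ := Fml.not (QF.eqVec s.vars ys).toF) hs he.gtZ
      (R := QF.or A (QF.eqVec s.vars ys)) (diffFree_or_eqVec hA _ _))
    (Provable.box_mono (α := Act.ode s (QF.gtZ e)) (φ := A.toF)
      (ψ := (QF.or A (QF.eqVec s.vars ys)).toF) (Provable.val₀ fun ρ v => ?_)) fun ρ v => ?_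
  · simp only [Fml.val_imp, Fml.val_toF, QF.val_or]; tauto
  · simp only [Fml.val_imp, Prg]; tauto

/-- The first significant Lie derivative is the one of order `k`, and it is positive. -/
def firstPos (L : Lang) (s : Sys L.k L.r) (e : Term L.k L.r) (k : ℕ) : QF L.k L.r :=
  QF.and (radical L s k e) (QF.gtZ (lieN L s k e))

/-- Local progress from the sign of the first significant Lie derivative. -/
theorem provable_prg_of_firstPos (hL : L.Closed) (hs : s.WF) (hc : s.HasClock)
    (hy : FreshVec s ∅ ys) {e : Term L.k L.r} (he : e.DiffFree) (k : ℕ) :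
    Provable L ((QF.eqVec s.vars ys).toF.imp
      ((firstPos L s e k).toF.imp (Prg s ys (QF.gtZ e)))) := by
  set u : Term L.k L.r := distSq s.vars ys with hu
  -- At `x = y` the exponent `k + 1` leaves all Lie derivatives up to order `k` unchanged. Away from
  -- `y` the nonstrict bound `E ≥ 0` already forces `e ≥ u^(k+1) > 0`, which recovers strictness.
  set E := Term.add e (u.pow (k + 1)).neg with hE
  have hEd : E.DiffFree := ⟨he, ((diffFree_distSq _ _).pow _).neg⟩
  have hu' := fun ρ : Term L.k L.r → ℝ => evalA_distSq s.vars ys ρ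
  have h₁ : Provable L ((QF.eqVec s.vars ys).toF.imp ((firstPos L s e k).toF.imp
      (QF.and (lieNonneg L s k E) (QF.gtZ (lieN L s k E))).toF)) := Provable.val₀ fun ρ v => by
    simp only [Fml.val_imp, Fml.val_toF, QF.val_and, firstPos, val_radical, val_lieNonneg,
      QF.val_gtZ]
    intro hxy h
    have h₀ := (hu' ρ).2.2 hxy
    refine ⟨fun i hi => ?_, ?_⟩
    · rw [hE, evalA_lieN_add_neg_pow s e u h₀ (by omega), h.1 i hi]
    · rw [hE, evalA_lieN_add_neg_pow s e u h₀ (by omega)]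
      exact h.2
  have h₂ := provable_box_lieN_nonneg hL hs hEd k k le_rfl
  rw [Nat.sub_self, lieN_zero] at h₂
  have h₃ := provable_prg_of_box hs hc hy (hEd.lieN hL hs k) hEd.geZ
  have h₄ := Provable.prg_mono_or (ys := ys) hs hEd.geZ he.gtZ (Provable.val₀ fun ρ v => by
    simp only [Fml.val_imp, Fml.val_toF, QF.val_or, QF.val_geZ, QF.val_gtZ, hE, Term.evalA,
      Term.evalA_neg, Term.evalA_pow]
    intro h
    by_cases h₀ : u.evalA ρ = 0
    · exact Or.inr ((hu' ρ).2.1 h₀)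
    · left
      have : 0 < u.evalA ρ ^ (k + 1) := pow_pos (lt_of_le_of_ne (hu' ρ).1 (Ne.symm h₀)) _
      linarith)
  refine h₁.val₄ h₂ h₃ h₄ fun ρ v => ?_
  simp only [Fml.val_imp, Fml.val_toF, QF.val_and]; tauto

theorem provable_prg_of_progGt (hL : L.Closed) (hs : s.WF) (hc : s.HasClock)
    (hy : FreshVec s ∅ ys) {e : Term L.k L.r} (he : e.DiffFree) {N : ℕ} (hN : 1 ≤ N) :
    Provable L ((QF.eqVec s.vars ys).toF.imp
      ((progGt L s N e).toF.imp (Prg s ys (QF.gtZ e)))) := by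
  refine Provable.of_list (l := (List.range N).map fun k => (QF.eqVec s.vars ys).toF.imp
      ((firstPos L s e k).toF.imp (Prg s ys (QF.gtZ e)))) (fun φ hφ => ?_) fun ρ v h => ?_
  · obtain ⟨k, -, rfl⟩ := List.mem_map.1 hφ
    exact provable_prg_of_firstPos hL hs hc hy he k
  · simp only [List.mem_map, List.mem_range, forall_exists_index, and_imp,
      forall_apply_eq_imp_iff₂, Fml.val_imp, Fml.val_toF, firstPos, QF.val_and, val_radical,
      QF.val_gtZ, val_progGt s hN] at h ⊢
    exact fun hxy k hk h₁ h₂ => h k hk hxy h₁ h₂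

theorem HasRank.provable_prg_of_radical (hL : L.Closed) (hs : s.WF) (hc : s.HasClock)
    (hy : FreshVec s ∅ ys) {e : Term L.k L.r} (he : e.DiffFree) {N : ℕ} (hN : HasRank L s e N) :
    Provable L ((QF.eqVec s.vars ys).toF.imp
      ((radical L s N e).toF.imp (Prg s ys (QF.eqZ e)))) := by
  -- The domain `1 > 0` is always true, so continuous existence provides motion without any
  -- constraint.
  have hone : (Term.const 1 : Term L.k L.r).DiffFree := trivial
  refine (hN.provable_radical_box hL hs (Q := QF.gtZ (Term.const 1)) hone.gtZ he).val₂
    (provable_prg_of_box hs hc hy hone he.eqZ) fun ρ v => ?_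
  have : (QF.gtZ (Term.const 1 : Term L.k L.r)).val ρ := by
    rw [QF.val_gtZ, Term.evalA]
    norm_num
  simp only [Fml.val_imp, Fml.val_toF]; tauto

/-- The formula `F` decides local progress into `A`. -/
structure Decides (L : Lang) (s : Sys L.k L.r) (ys : List ℕ) (F A : QF L.k L.r) : Prop where
  diffFree : A.DiffFree
  pos : Provable L ((QF.eqVec s.vars ys).toF.imp (F.toF.imp (Prg s ys A)))
  neg : Provable L ((QF.eqVec s.vars ys).toF.imp (F.not.toF.imp (Prg s ys A.not)))

/-- If the first nonzero Lie derivative exists and is not positive, it is negative, so `-e`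
progresses into positive values. -/
theorem provable_prg_of_lt (hL : L.Closed) (hs : s.WF) (hc : s.HasClock)
    (hy : FreshVec s ∅ ys) {e : Term L.k L.r} (he : e.DiffFree) {N : ℕ} (hN : 1 ≤ N)
    (hA : A.DiffFree) (h : Provable L ((QF.gtZ e.neg).toF.imp A.toF)) :
    Provable L ((QF.eqVec s.vars ys).toF.imp
      ((QF.and (progGt L s N e).not (radical L s N e).not).toF.imp (Prg s ys A))) := by
  refine (provable_prg_of_progGt hL hs hc hy he.neg hN).val₂
    (Provable.prg_mono (ys := ys) hs he.neg.gtZ hA h) fun ρ v => ?_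
  have : (QF.and (progGt L s N e).not (radical L s N e).not).val ρ →
      (progGt L s N e.neg).val ρ := by
    simp only [QF.val_and, QF.val_not, val_progGt s hN, val_radical, evalA_lieN_neg]
    rintro ⟨h₁, h₂⟩
    rcases forall_eq_zero_or_exists_first (fun i => (lieN L s i e).evalA ρ) N with
      h | ⟨k, hk, h, h' | h'⟩
    · exact absurd h h₂
    · exact absurd ⟨k, hk, h, h'⟩ h₁
    · exact ⟨k, hk, fun i hi => by rw [h i hi, neg_zero], by linarith⟩
  simp only [Fml.val_imp, Fml.val_toF]; tauto

theorem HasRank.decides_geZ (hL : L.Closed) (hs : s.WF) (hc : s.HasClock)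
    (hy : FreshVec s ∅ ys) {e : Term L.k L.r} (he : e.DiffFree) {N : ℕ} (hN : HasRank L s e N) :
    Decides L s ys (progGe L s N e) (QF.geZ e) := by
  refine ⟨he.geZ, ?_, ?_⟩
  · refine (provable_prg_of_progGt hL hs hc hy he hN.1).val₄
      (hN.provable_prg_of_radical hL hs hc hy he)
      (Provable.prg_mono (ys := ys) (A := QF.gtZ e) (B := QF.geZ e) hs he.gtZ he.geZ
        (Provable.val₀ fun ρ v => ?_))
      (Provable.prg_mono (ys := ys) (A := QF.eqZ e) (B := QF.geZ e) hs he.eqZ he.geZ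
        (Provable.val₀ fun ρ v => ?_)) fun ρ v => ?_
    · simp only [Fml.val_imp, Fml.val_toF, QF.val_gtZ, QF.val_geZ]; exact le_of_lt
    · simp only [Fml.val_imp, Fml.val_toF, QF.val_eqZ, QF.val_geZ]; exact ge_of_eq
    · simp only [Fml.val_imp, Fml.val_toF, progGe, QF.val_or]; tauto
  · refine (provable_prg_of_lt hL hs hc hy he hN.1 (A := (QF.geZ e).not) he.geZ
      (Provable.val₀ fun ρ v => ?_)).val₁ fun ρ v => ?_
    · simp [Fml.val_imp, Fml.val_toF]
    · simp only [Fml.val_imp, Fml.val_toF, progGe, QF.val_or, QF.val_not, QF.val_and]; tauto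

/-- Failure of the progress formula has two causes: the radical, along which `e` stays zero, or a
negative first significant derivative. Both lead to progress into `e ≤ 0`. -/
theorem HasRank.decides_gtZ (hL : L.Closed) (hs : s.WF) (hc : s.HasClock)
    (hy : FreshVec s ∅ ys) {e : Term L.k L.r} (he : e.DiffFree) {N : ℕ} (hN : HasRank L s e N) :
    Decides L s ys (progGt L s N e) (QF.gtZ e) := by
  refine ⟨he.gtZ, provable_prg_of_progGt hL hs hc hy he hN.1, ?_⟩
  refine (provable_prg_of_lt hL hs hc hy he hN.1 (A := (QF.gtZ e).not) he.gtZ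
      (Provable.val₀ fun ρ v => ?_)).val₃ (hN.provable_prg_of_radical hL hs hc hy he)
      (Provable.prg_mono (ys := ys) (A := QF.eqZ e) (B := (QF.gtZ e).not) hs he.eqZ he.gtZ
        (Provable.val₀ fun ρ v => ?_)) fun ρ v => ?_
  · simp only [Fml.val_imp, Fml.val_toF, QF.val_gtZ, QF.val_not, Term.evalA_neg]
    intro h
    linarith
  · simp only [Fml.val_imp, Fml.val_toF, QF.val_eqZ, QF.val_gtZ, QF.val_not]
    intro h
    linarith
  · simp only [Fml.val_imp, Fml.val_toF, QF.val_not, QF.val_and]; tauto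

/-- The positive part combines two progress statements by uniqueness; for the negative part, failure
of one conjunct already gives progress into the negated conjunction. Disjunctions are dual. -/
theorem Decides.and (hs : s.WF) (h₁ : Decides L s ys F A) (h₂ : Decides L s ys G B) :
    Decides L s ys (F.and G) (A.and B) := by
  have hd : (A.and B).DiffFree := ⟨h₁.diffFree, h₂.diffFree⟩
  refine ⟨hd, ?_, ?_⟩
  · refine h₁.pos.val₃ h₂.pos (provable_prg_and (ys := ys) hs h₁.diffFree h₂.diffFree) fun ρ v => ?_
    simp only [Fml.val_imp, Fml.val_toF, QF.val_and]; tauto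
  · refine h₁.neg.val₄ h₂.neg
      (Provable.prg_mono (ys := ys) (A := A.not) (B := (A.and B).not) hs h₁.diffFree hd
        (Provable.val₀ fun ρ v => ?_))
      (Provable.prg_mono (ys := ys) (A := B.not) (B := (A.and B).not) hs h₂.diffFree hd
        (Provable.val₀ fun ρ v => ?_)) fun ρ v => ?_
    all_goals simp only [Fml.val_imp, Fml.val_toF, QF.val_and, QF.val_not]; tauto

theorem Decides.or (hs : s.WF) (h₁ : Decides L s ys F A) (h₂ : Decides L s ys G B) :
    Decides L s ys (F.or G) (A.or B) := by
  have hd : (A.or B).DiffFree := ⟨h₁.diffFree, h₂.diffFree⟩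
  refine ⟨hd, ?_, ?_⟩
  · refine h₁.pos.val₄ h₂.pos
      (Provable.prg_mono (ys := ys) (A := A) (B := A.or B) hs h₁.diffFree hd
        (Provable.val₀ fun ρ v => ?_))
      (Provable.prg_mono (ys := ys) (A := B) (B := A.or B) hs h₂.diffFree hd
        (Provable.val₀ fun ρ v => ?_)) fun ρ v => ?_
    all_goals simp only [Fml.val_imp, Fml.val_toF, QF.val_or]; tauto
  · refine h₁.neg.val₄ h₂.neg (provable_prg_and (ys := ys) (A := A.not) (B := B.not) hs
        h₁.diffFree h₂.diffFree)
      (Provable.prg_mono (ys := ys) (A := A.not.and B.not) (B := (A.or B).not) hs hd hd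
        (Provable.val₀ fun ρ v => ?_)) fun ρ v => ?_
    all_goals simp only [Fml.val_imp, Fml.val_toF, QF.val_and, QF.val_or, QF.val_not]; tauto

theorem provable_prg_of_valid (hs : s.WF) (hc : s.HasClock) (hy : FreshVec s ∅ ys)
    (hA : A.DiffFree) (h : Provable L A.toF) :
    Provable L ((QF.eqVec s.vars ys).toF.imp (Prg s ys A)) := by
  have hone : (Term.const 1 : Term L.k L.r).DiffFree := trivial
  refine (h.gen (Act.ode s (QF.gtZ (Term.const 1)))).val₂
    (provable_prg_of_box hs hc hy hone hA) fun ρ v => ?_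
  have : (QF.gtZ (Term.const 1 : Term L.k L.r)).val ρ := by
    rw [QF.val_gtZ, Term.evalA]
    norm_num
  simp only [Fml.val_imp, Fml.val_toF]; tauto

theorem Decides.tru (hs : s.WF) (hc : s.HasClock) (hy : FreshVec s ∅ ys) :
    Decides L s ys QF.tru QF.tru := by
  have hd : (QF.tru : QF L.k L.r).DiffFree := ⟨trivial, trivial⟩
  refine ⟨hd, ?_, Provable.val₀ fun ρ v => by simp⟩
  exact (provable_prg_of_valid hs hc hy hd (Provable.qf QF.val_tru)).val₁ fun ρ v => by
    simp only [Fml.val_imp]; tauto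

theorem Decides.fls (hs : s.WF) (hc : s.HasClock) (hy : FreshVec s ∅ ys) :
    Decides L s ys QF.fls QF.fls := by
  have hd : (QF.fls : QF L.k L.r).DiffFree := ⟨trivial, trivial⟩
  refine ⟨hd, Provable.val₀ fun ρ v => by simp, ?_⟩
  exact (provable_prg_of_valid hs hc hy (A := QF.fls.not) hd
    (Provable.qf (A := QF.fls.not) QF.val_fls)).val₁ fun ρ v => by
      simp only [Fml.val_imp]; tauto

theorem Decides.conj (hs : s.WF) (hc : s.HasClock) (hy : FreshVec s ∅ ys) {ι : Type*}
    {l : List ι} {F A : ι → QF L.k L.r} (h : ∀ i ∈ l, Decides L s ys (F i) (A i)) :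
    Decides L s ys (QF.conj (l.map F)) (QF.conj (l.map A)) := by
  induction l with
  | nil => exact Decides.tru hs hc hy
  | cons i l ih => exact (h i (by simp)).and hs (ih fun j hj => h j (by simp [hj]))

theorem Decides.disj (hs : s.WF) (hc : s.HasClock) (hy : FreshVec s ∅ ys) {ι : Type*}
    {l : List ι} {F A : ι → QF L.k L.r} (h : ∀ i ∈ l, Decides L s ys (F i) (A i)) :
    Decides L s ys (QF.disj (l.map F)) (QF.disj (l.map A)) := by
  induction l with
  | nil => exact Decides.fls hs hc hy
  | cons i l ih => exact (h i (by simp)).or hs (ih fun j hj => h j (by simp [hj]))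

theorem Decides.congr (hs : s.WF) (hB : B.DiffFree) (h : Decides L s ys F A)
    (hAB : Provable L (B.toF.iff A.toF)) : Decides L s ys F B := by
  refine ⟨hB, h.pos.trans ?_, h.neg.trans ?_⟩
  · refine (Provable.prg_mono (ys := ys) (A := A) (B := B) hs h.diffFree hB
      (hAB.val₁ fun ρ v => ?_)).val₁ fun ρ v => ?_
    · simp only [Fml.val_imp, Fml.val_iff]; tauto
    · simp only [Fml.val_imp]; tauto
  · refine (Provable.prg_mono (ys := ys) (A := A.not) (B := B.not) hs h.diffFree hB
      (hAB.val₁ fun ρ v => ?_)).val₁ fun ρ v => ?_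
    · simp only [Fml.val_imp, Fml.val_iff, Fml.val_toF, QF.val_not]; tauto
    · simp only [Fml.val_imp]; tauto

/-- Progress into `A` excludes progress into its negation, hence excludes the negation of `F`.
Together with `pos` this makes `F` equivalent to local progress at `x = y`. -/
theorem Decides.of_prg (hs : s.WF) (h : Decides L s ys F A) :
    Provable L ((QF.eqVec s.vars ys).toF.imp ((Prg s ys A).imp F.toF)) :=
  h.neg.val₂ (provable_prg_contra (ys := ys) hs h.diffFree) fun ρ v => by
    simp only [Fml.val_imp, Fml.val_not, Fml.val_toF, QF.val_not]; tauto

/-- The progress formula of a normal form whose terms are replaced by `τ`. -/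
def progWith (L : Lang) (s : Sys L.k L.r) (τ : Term L.k L.r → Term L.k L.r)
    (ρ : Term L.k L.r → ℕ) (D : DNF L.k L.r) : QF L.k L.r :=
  QF.disj (D.map fun p => QF.and
    (QF.conj (p.1.map fun e => progGe L s (ρ e) (τ e)))
    (QF.conj (p.2.map fun e => progGt L s (ρ e) (τ e))))

/-- The formula of a normal form whose terms are replaced by `τ`. -/
def DNF.toQFWith {k r : ℕ} (τ : Term k r → Term k r) (D : DNF k r) : QF k r :=
  QF.disj (D.map fun p => QF.and (QF.conj (p.1.map fun e => QF.geZ (τ e)))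
    (QF.conj (p.2.map fun e => QF.gtZ (τ e))))

/-- The terms of a normal form. -/
def DNF.Mem {k r : ℕ} (D : DNF k r) (e : Term k r) : Prop := ∃ p ∈ D, e ∈ p.1 ∨ e ∈ p.2

/-- The map `τ` is the identity for the given system and a renaming for its adjoint, where ranks
remain indexed by the original terms. -/
theorem decides_progWith (hL : L.Closed) (hs : s.WF) (hc : s.HasClock) (hy : FreshVec s ∅ ys)
    {τ : Term L.k L.r → Term L.k L.r} {ρ : Term L.k L.r → ℕ} {D : DNF L.k L.r}
    (hD : ∀ e, D.Mem e → (τ e).DiffFree ∧ HasRank L s (τ e) (ρ e)) :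
    Decides L s ys (progWith L s τ ρ D) (D.toQFWith τ) := by
  refine Decides.disj hs hc hy fun p hp => Decides.and hs
    (Decides.conj hs hc hy fun e he => ?_) (Decides.conj hs hc hy fun e he => ?_)
  · have := hD e ⟨p, hp, Or.inl he⟩
    exact this.2.decides_geZ hL hs hc hy this.1
  · have := hD e ⟨p, hp, Or.inr he⟩
    exact this.2.decides_gtZ hL hs hc hy this.1

/-- Such a domain is open, so truth at the initial state already suffices for progress; no Lie
derivatives are needed. -/
theorem Strict.provable_prg (hs : s.WF) (hc : s.HasClock) (hy : FreshVec s ∅ ys)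
    (hQ : Q.DiffFree) (hQ' : Q.Strict) :
    Provable L ((QF.eqVec s.vars ys).toF.imp (Q.toF.imp (Prg s ys Q))) := by
  induction Q with
  | cmp c e f => cases c with
    | eq => exact hQ'.elim
    | ge => exact hQ'.elim
    | gt =>
      have hd : (Term.add e f.neg).DiffFree := ⟨hQ.1, hQ.2.neg⟩
      have hi : ∀ ρ, (QF.gtZ (Term.add e f.neg)).val ρ ↔ (QF.cmp Cmp.gt e f).val ρ := fun ρ => by
        simp [Term.evalA, Cmp.rel]
      refine (provable_prg_of_box hs hc hy hd hQ).val₂ (Provable.box_of_dom (s := s)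
        (Q := QF.gtZ (Term.add e f.neg)) (φ := (QF.cmp Cmp.gt e f).toF) hs hd.gtZ
        (Provable.val₀ fun ρ v => ?_)) fun ρ v => ?_
      · simp only [Fml.val_imp, Fml.val_toF, hi]; exact id
      · simp only [Fml.val_imp, Fml.val_toF, hi]; tauto
  | and P Q ihP ihQ =>
    refine (ihP hQ.1 hQ'.1).val₃ (ihQ hQ.2 hQ'.2)
      (provable_prg_and (ys := ys) hs hQ.1 hQ.2) fun ρ v => ?_
    simp only [Fml.val_imp, Fml.val_toF, QF.val_and]; tauto
  | or P Q ihP ihQ =>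
    refine (ihP hQ.1 hQ'.1).val₄ (ihQ hQ.2 hQ'.2)
      (Provable.prg_mono (ys := ys) (A := P) (B := P.or Q) hs hQ.1 hQ
        (Provable.val₀ fun ρ v => ?_))
      (Provable.prg_mono (ys := ys) (A := Q) (B := P.or Q) hs hQ.2 hQ
        (Provable.val₀ fun ρ v => ?_)) fun ρ v => ?_
    all_goals
      clear ihP ihQ hQ hQ'
      simp only [Fml.val_imp, Fml.val_toF, QF.val_or]
      tauto
  | not P _ => exact hQ'.elim

end Progress

end DL

namespace DL

/-! ### The ingredients of analytic completeness. -/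

section AnalyticCompleteness

variable {L : Lang} {s : Sys L.k L.r} {ys zs : List ℕ} {A P Q R F G : QF L.k L.r}
  {φ ψ χ : Fml L.k L.r}

theorem notMem_vars_of_mem_subst (hA : A.DiffFree) {xs : List ℕ} (hl : xs.length = ys.length)
    (hd : ∀ y ∈ ys, y ∉ xs) : ∀ x ∈ xs, Var.base x ∉ (A.subst (rename xs ys)).toF.fv := by
  intro x hx hx'
  rw [QF.fv_toF] at hx'
  rcases QF.base_mem_fv_subst_rename hA hl hx' with h | h
  · exact hd x h hx
  · exact h.2 hx

theorem provable_box_subst_const (hA : A.DiffFree) (hl : s.vars.length = ys.length)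
    (hd : ∀ y ∈ ys, y ∉ s.vars) : Provable L ((A.subst (rename s.vars ys)).toF.imp
      (Fml.box (Act.ode s Q) (A.subst (rename s.vars ys)).toF)) := by
  refine provable_box_const _ (disjoint_bv (fun z => ?_) (notMem_vars_of_mem_subst hA hl hd))
  rw [QF.fv_toF]
  exact (hA.subst (diffFree_rename _ _)).prime_notMem z

/-- Initial truth persists in the initial state. -/
theorem provable_box_initial (hA : A.DiffFree) (hy : FreshVec s ∅ ys) :
    Provable L ((QF.eqVec s.vars ys).toF.imp (A.toF.imp
      (Fml.box (Act.ode s Q) ((QF.eqVec s.vars ys).toF.imp A.toF)))) := by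
  refine (provable_congr hA s.vars ys).val₃
    (provable_box_subst_const (Q := Q) hA hy.length_eq hy.notMem_vars)
    (Provable.box_mono (α := Act.ode s Q) (φ := (A.subst (rename s.vars ys)).toF)
      (ψ := (QF.eqVec s.vars ys).toF.imp A.toF)
      ((provable_congr hA s.vars ys).val₁ fun ρ v => ?_)) fun ρ v => ?_
  · simp only [Fml.val_imp, Fml.val_iff]; tauto
  · simp only [Fml.val_imp, Fml.val_iff]; tauto

/-- The exceptional point `x = y` in the domain of `Prg` is harmless for `Q`, which holds initially.
The end state is different from `y`, so it satisfies `R`. -/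
theorem provable_dia_of_prg_and (hs : s.WF) (hy : FreshVec s ∅ ys) (hQ : Q.DiffFree)
    (hR : R.DiffFree) : Provable L ((QF.eqVec s.vars ys).toF.imp (Q.toF.imp
      ((Prg s ys (Q.and R)).imp (Fml.dia (Act.ode s Q) R.toF)))) := by
  have hD : (QF.or (Q.and R) (QF.eqVec s.vars ys)).DiffFree :=
    diffFree_or_eqVec (A := Q.and R) ⟨hQ, hR⟩ _ _
  refine (provable_box_initial (Q := QF.or (Q.and R) (QF.eqVec s.vars ys)) hQ hy).val₄
    (Provable.box_weaken (ψ := (QF.eqVec s.vars ys).toF.imp Q.toF) (φ := Q.toF) hs hD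
      (Provable.val₀ fun ρ v => ?_))
    (provable_dia_dom_of_box (φ := R.toF) hs hD hQ)
    (Provable.dia_weaken (ψ := Fml.not (QF.eqVec s.vars ys).toF) (φ := R.toF) hs hD
      (Provable.val₀ fun ρ v => ?_)) fun ρ v => ?_
  · simp only [Fml.val_imp, Fml.val_toF, QF.val_or, QF.val_and]; tauto
  · simp only [Fml.val_imp, Fml.val_toF, QF.val_or, QF.val_and, Fml.val_not]; tauto
  · simp only [Fml.val_imp, Prg]; tauto

/-- Progress into `Q` and into `¬P` would combine to a run within `Q` that ends in `¬P`. -/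
theorem provable_not_prg_of_box (hs : s.WF) (hy : FreshVec s ∅ ys) (hQ : Q.DiffFree)
    (hP : P.DiffFree) : Provable L ((QF.eqVec s.vars ys).toF.imp (Q.toF.imp
      ((Fml.box (Act.ode s Q) P.toF).imp ((Prg s ys Q).imp (Fml.not (Prg s ys P.not)))))) := by
  refine (provable_dia_of_prg_and hs hy hQ (R := P.not) hP).val₃
    (provable_prg_and (ys := ys) hs hQ (B := P.not) hP)
    (provable_dia_not_iff (Act.ode s Q) P.toF) fun ρ v => ?_
  simp only [Fml.val_imp, Fml.val_iff, Fml.val_not, QF.toF]; tauto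

/-- Outside the radical there is a first nonzero Lie derivative, and either sign of it drives `e`
away from zero. -/
theorem HasRank.decides_eqZ (hL : L.Closed) (hs : s.WF) (hc : s.HasClock)
    (hy : FreshVec s ∅ ys) {e : Term L.k L.r} (he : e.DiffFree) {N : ℕ} (hN : HasRank L s e N) :
    Decides L s ys (radical L s N e) (QF.eqZ e) := by
  refine ⟨he.eqZ, hN.provable_prg_of_radical hL hs hc hy he, ?_⟩
  refine (provable_prg_of_lt hL hs hc hy he hN.1 (A := (QF.eqZ e).not) he.eqZ
      (Provable.val₀ fun ρ v => ?_)).val₃ (provable_prg_of_progGt hL hs hc hy he hN.1)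
      (Provable.prg_mono (ys := ys) (A := QF.gtZ e) (B := (QF.eqZ e).not) hs he.gtZ he.eqZ
        (Provable.val₀ fun ρ v => ?_)) fun ρ v => ?_
  · simp only [Fml.val_imp, Fml.val_toF, QF.val_gtZ, QF.val_eqZ, QF.val_not, Term.evalA_neg]
    intro h h'
    linarith
  · simp only [Fml.val_imp, Fml.val_toF, QF.val_eqZ, QF.val_gtZ, QF.val_not]
    exact fun h => h.ne'
  · simp only [Fml.val_imp, Fml.val_toF, QF.val_not, QF.val_and]; tauto

/-- Necessity of the differential radical, if the system can progress within the domain. -/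
theorem provable_radical_of_box (hL : L.Closed) (hs : s.WF) (hc : s.HasClock)
    (hQ : Q.DiffFree) {e : Term L.k L.r} (he : e.DiffFree)
    (hPe : Provable L (P.toF.iff (QF.eqZ e).toF)) {N : ℕ} (hN : HasRank L s e N)
    (hF : ∀ ys, FreshVec s ∅ ys → Provable L ((QF.eqVec s.vars ys).toF.imp
      (F.toF.imp (Prg s ys Q)))) :
    Provable L ((Fml.box (Act.ode s Q) P.toF).imp
      (Q.toF.imp (F.toF.imp (radical L s N e).toF))) := by
  obtain ⟨ys, hy⟩ := exists_freshVec s (P.fv ∪ Q.fv ∪ F.fv ∪ (radical L s N e).fv)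
  have hy₀ := hy.mono (Finset.empty_subset _)
  -- The fresh variables `y` record the initial state, which is the reference point of every `Prg`
  -- statement.
  refine Provable.intro_eqVec hy.length_eq hy.2.1 hy.notMem_vars (fun y hy' => ?_) ?_
  · have h := hy.notMem y hy'
    simp only [Finset.mem_union, not_or] at h
    simp only [Fml.fv_imp, Finset.mem_union, not_or, QF.fv_toF]
    refine ⟨base_notMem_fv_box (hy.notMem_vars y hy') (hy.notMem_rhsFv y hy') h.1.1.2 ?_,
      h.1.1.2, h.1.2, h.2⟩
    rw [QF.fv_toF]
    exact h.1.1.1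
  · refine (provable_not_prg_of_box hs hy₀ hQ he.eqZ).val₄ (hF ys hy₀)
      (hN.decides_eqZ hL hs hc hy₀ he).neg
      (Provable.box_mono (α := Act.ode s Q) (φ := P.toF) (ψ := (QF.eqZ e).toF)
        (hPe.val₁ fun ρ v => ?_)) fun ρ v => ?_
    · simp only [Fml.val_imp, Fml.val_iff]; tauto
    · simp only [Fml.val_imp, Fml.val_not, QF.toF]; tauto

theorem HasRank.provable_box_of_radical (hL : L.Closed) (hs : s.WF) (hQ : Q.DiffFree)
    {e : Term L.k L.r} (he : e.DiffFree) (hPe : Provable L (P.toF.iff (QF.eqZ e).toF)) {N : ℕ}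
    (hN : HasRank L s e N) :
    Provable L ((radical L s N e).toF.imp (Fml.box (Act.ode s Q) P.toF)) :=
  (hN.provable_radical_box hL hs hQ he).trans (Provable.box_mono (hPe.val₁ fun ρ v => by
    simp only [Fml.val_imp, Fml.val_iff]; tauto))

/-- Without progress into `Q`, no run within `Q` leaves the initial state, so the postcondition is
needed only there. -/
theorem provable_box_of_not_progress (hs : s.WF) (hP : P.DiffFree) (hQ : Q.DiffFree)
    (hF : ∀ ys, FreshVec s ∅ ys → Decides L s ys F Q) :
    Provable L (P.toF.imp (F.not.toF.imp (Fml.box (Act.ode s Q) P.toF))) := by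
  obtain ⟨ys, hy⟩ := exists_freshVec s (P.fv ∪ Q.fv ∪ F.fv)
  have hy₀ := hy.mono (Finset.empty_subset _)
  have hD : (QF.or Q (QF.eqVec s.vars ys)).DiffFree := diffFree_or_eqVec hQ _ _
  refine Provable.intro_eqVec hy.length_eq hy.2.1 hy.notMem_vars (fun y hy' => ?_) ?_
  · have h := hy.notMem y hy'
    simp only [Finset.mem_union, not_or] at h
    simp only [Fml.fv_imp, Finset.mem_union, not_or, QF.fv_toF]
    refine ⟨h.1.1, h.2, base_notMem_fv_box (hy.notMem_vars y hy') (hy.notMem_rhsFv y hy')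
      h.1.2 ?_⟩
    rw [QF.fv_toF]
    exact h.1.1
  · have h₁ : Provable L ((QF.eqVec s.vars ys).toF.imp (F.not.toF.imp
        (Fml.box (Act.ode s Q) (QF.eqVec s.vars ys).toF))) := by
      refine (hF ys hy₀).neg.val₄ (provable_prg_contra (ys := ys) hs hQ)
        (provable_dia_not_iff (Act.ode s Q) (QF.eqVec s.vars ys).toF)
        (Provable.dia_dom_mono (φ := Fml.not (QF.eqVec s.vars ys).toF) hs hQ hD
          (Provable.val₀ fun ρ v => ?_)) fun ρ v => ?_
      · simp only [Fml.val_imp, Fml.val_toF, QF.val_or]; tauto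
      · simp only [Fml.val_imp, Fml.val_iff, Fml.val_not, Prg]; tauto
    refine h₁.val₃ (provable_box_initial (Q := Q) hP hy₀)
      (Axm.provable (Axm.K (Act.ode s Q) (QF.eqVec s.vars ys).toF P.toF)) fun ρ v => ?_
    simp only [Fml.val_imp]; tauto

end AnalyticCompleteness

/-! ### The adjoint system. -/

section Adjoint

variable {k r : ℕ}

theorem Sys.vars_adjoint {s : Sys k r} {zs : List ℕ} (h : s.length = zs.length) :
    (s.adjoint zs).vars = zs := by
  rw [Sys.vars, Sys.adjoint, List.map_zipWith]
  generalize rename s.vars zs = τ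
  induction s generalizing zs with
  | nil => simp [List.length_eq_zero_iff.1 h.symm]
  | cons p s ih =>
    obtain _ | ⟨z, zs⟩ := zs
    · simp at h
    · simp [ih (by simpa using h)]

theorem Sys.mem_adjoint {s : Sys k r} {zs : List ℕ} {q : ℕ × Term k r} (h : q ∈ s.adjoint zs) :
    ∃ p ∈ s, q.2 = (p.2.subst (rename s.vars zs)).neg := by
  rw [Sys.adjoint] at h
  rw [List.mem_iff_getElem] at h
  obtain ⟨i, hi, rfl⟩ := h
  simp only [List.getElem_zipWith]
  exact ⟨_, List.getElem_mem _, rfl⟩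

theorem Sys.WF.adjoint {s : Sys k r} (hs : s.WF) {V : Finset Var} {zs : List ℕ}
    (hz : FreshVec s V zs) : (s.adjoint zs).WF := by
  refine ⟨by rw [Sys.vars_adjoint hz.1.symm]; exact hz.2.1, fun q hq => ?_⟩
  obtain ⟨p, hp, h⟩ := Sys.mem_adjoint hq
  rw [h]
  exact ((hs.2 p hp).subst (diffFree_rename _ _)).neg

/-- A clock `x' = c` becomes `z' = -c`. This is why clocks may have any nonzero rate, and why the
rate is judged by evaluation, which commutes with renaming. -/
theorem Sys.HasClock.adjoint {s : Sys k r} (hc : s.HasClock) {V : Finset Var} {zs : List ℕ}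
    (hz : FreshVec s V zs) : (s.adjoint zs).HasClock := by
  obtain ⟨p, hp, c, hc, h⟩ := hc
  obtain ⟨i, hi, rfl⟩ := List.mem_iff_getElem.1 hp
  refine ⟨_, List.getElem_mem (n := i) (by simp [Sys.adjoint, hz.1, hi]), -c, neg_ne_zero.2 hc,
    fun ρ => ?_⟩
  simp only [Sys.adjoint, List.getElem_zipWith]
  rw [Term.evalA_neg, Term.evalA_subst, h]

theorem freshVec_adjoint {L : Lang} {s : Sys L.k L.r} (hs : s.WF) {V W : Finset Var} {ys zs : List ℕ}
    (hz : FreshVec s V zs) (hy : FreshVec s W ys) (h : ∀ y ∈ ys, y ∉ zs) :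
    FreshVec (s.adjoint zs) ∅ ys := by
  refine ⟨hy.1.trans (by simp [Sys.adjoint, hz.1]),
    hy.2.1, fun y hy' => ?_⟩
  rw [Finset.union_empty, Sys.vars_adjoint hz.1.symm]
  refine ⟨h y hy', fun h' => ?_, (hs.adjoint hz).prime_notMem _⟩
  obtain ⟨q, hq, h'⟩ := Sys.mem_rhsFv.1 h'
  obtain ⟨p, hp, hq'⟩ := Sys.mem_adjoint hq
  rw [hq', Term.neg, Term.fv, Finset.mem_union] at h'
  rcases h' with h' | h'
  · exact absurd h' (by simp [Term.fv])
  · rcases Term.base_mem_fv_subst_rename (hs.2 p hp) hz.length_eq h' with h' | h'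
    · exact h y hy' h'
    · exact hy.notMem_rhsFv y hy' (Sys.mem_rhsFv.2 ⟨p, hp, h'.1⟩)

theorem QF.subst_conj (σ : Var → Term k r) (l : List (QF k r)) :
    (QF.conj l).subst σ = QF.conj (l.map fun A => A.subst σ) := by
  induction l with
  | nil => rfl
  | cons a l ih => exact congrArg (QF.and (a.subst σ)) ih

theorem QF.subst_disj (σ : Var → Term k r) (l : List (QF k r)) :
    (QF.disj l).subst σ = QF.disj (l.map fun A => A.subst σ) := by
  induction l with
  | nil => rfl
  | cons a l ih => exact congrArg (QF.or (a.subst σ)) ih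

theorem QF.subst_eqVec {xs ys zs : List ℕ} (hx : xs.Nodup) (hl : xs.length = zs.length)
    (hy : ∀ y ∈ ys, y ∉ xs) :
    (QF.eqVec xs ys : QF k r).subst (rename xs zs) = QF.eqVec zs ys := by
  have key : ∀ (σ : Var → Term k r) (xs zs ys : List ℕ), xs.length = zs.length →
      xs.map (fun x => σ (Var.base x)) = zs.map Term.bvar →
      (∀ y ∈ ys, σ (Var.base y) = Term.bvar y) →
      (QF.eqVec xs ys : QF k r).subst σ = QF.eqVec zs ys := by
    intro σ xs zs ys hl h₁ h₂
    induction xs generalizing zs ys with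
    | nil => rw [List.length_eq_zero_iff.1 hl.symm]; rfl
    | cons x xs ih =>
      obtain _ | ⟨z, zs⟩ := zs
      · simp at hl
      cases ys with
      | nil => rfl
      | cons y ys =>
        simp only [List.map_cons, List.cons.injEq] at h₁
        rw [QF.eqVec_cons, QF.eqVec_cons, QF.subst, ih zs ys (by simpa using hl) h₁.2
          fun y hy => h₂ y (by simp [hy]), QF.subst]
        congr 2
        · exact h₁.1
        · exact h₂ y (by simp)
  refine key _ xs zs ys hl ?_ fun y hy' => ?_
  · clear key hy
    induction xs generalizing zs with
    | nil => rw [List.length_eq_zero_iff.1 hl.symm]; rfl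
    | cons x xs ih =>
      obtain _ | ⟨z, zs⟩ := zs
      · simp at hl
      rw [List.nodup_cons] at hx
      rw [List.map_cons, List.map_cons, rename_cons, if_pos rfl, ← ih hx.2 (by simpa using hl)]
      congr 1
      refine List.map_congr_left fun n hn => ?_
      rw [rename_cons, if_neg]
      rintro rfl
      exact hx.1 hn
  · rcases rename_spec (k := k) (r := r) hl y with h | h
    · exact absurd h.1 (hy y hy')
    · exact h.2

end Adjoint

/-! ### Sufficiency and necessity of progress, forward and backward. -/

section SemianalyticCompleteness

variable {L : Lang} {s : Sys L.k L.r} {ys zs : List ℕ} {P Q FP FQ GQ GN : QF L.k L.r}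
  {φ ψ χ : Fml L.k L.r}

/-- Both renamings start from `x`. Since neither result mentions `x`, the two may be compared
through an auxiliary copy `x = y`. -/
theorem provable_congr_subst {A : QF L.k L.r} (hA : A.DiffFree) (hs : s.WF) {V W : Finset Var}
    (hy : FreshVec s V ys) (hz : FreshVec s W zs) : Provable L ((QF.eqVec ys zs).toF.imp
      ((A.subst (rename s.vars ys)).toF.iff (A.subst (rename s.vars zs)).toF)) := by
  have hl : ys.length = zs.length := by rw [hy.1, hz.1]
  refine Provable.intro_eqVec (xs := ys) (ys := s.vars) hy.length_eq.symm hs.1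
    (fun x hx hx' => hy.notMem_vars x hx' hx) (fun x hx => ?_) ?_
  · have h₁ := notMem_vars_of_mem_subst hA hy.length_eq hy.notMem_vars x hx
    have h₂ := notMem_vars_of_mem_subst hA hz.length_eq hz.notMem_vars x hx
    simp only [Fml.iff, Fml.fv_imp, Fml.fv, Finset.mem_union, not_or]
    refine ⟨?_, ⟨h₁, h₂⟩, h₂, h₁⟩
    rw [QF.fv_toF]
    exact base_notMem_fv_eqVec (fun h => hy.notMem_vars x h hx) fun h => hz.notMem_vars x h hx
  · refine (provable_congr hA s.vars ys).val₂ (provable_congr hA s.vars zs) fun ρ v => ?_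
    simp only [Fml.val_imp, Fml.val_iff, Fml.val_toF, QF.val_eqVec hl, QF.val_eqVec hy.length_eq,
      QF.val_eqVec hy.length_eq.symm, QF.val_eqVec hz.length_eq]
    exact fun h₁ h₂ h₃ h₄ => (h₁ h₃.symm).symm.trans (h₂ (h₃.symm.trans h₄))

/-- A run cannot reach a first violation of `P`, by progress along the adjoint system. -/
theorem provable_box_initial_of_adjoint (hs : s.WF) (hP : P.DiffFree)
    (hQ : Q.DiffFree) (hχz : ∀ z ∈ zs, Var.base z ∉ χ.fv)
    (hy : FreshVec s ∅ ys) (hz : FreshVec s (P.fv ∪ Q.fv ∪ (ys.map Var.base).toFinset) zs)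
    (dQ : Decides L (s.adjoint zs) ys GQ (Q.subst (rename s.vars zs)))
    (dN : Decides L (s.adjoint zs) ys GN (P.not.subst (rename s.vars zs)))
    (h : Provable L (χ.imp ((P.not.subst (rename s.vars zs)).toF.imp
      ((Q.subst (rename s.vars zs)).toF.imp (GQ.toF.imp GN.toF))))) :
    Provable L (χ.imp (P.toF.imp (Fml.box (Act.ode s (QF.and Q (QF.or P (QF.eqVec s.vars ys))))
      ((QF.eqVec s.vars ys).toF.imp P.toF)))) := by
  set R := QF.and Q (QF.or P (QF.eqVec s.vars ys)) with hR
  set P' := P.subst (rename s.vars ys) with hP'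
  set Pz := P.subst (rename s.vars zs) with hPz
  set Qz := Q.subst (rename s.vars zs) with hQz
  have hRd : R.DiffFree := ⟨hQ, diffFree_or_eqVec hP _ _⟩
  have hP'd : P'.DiffFree := hP.subst (diffFree_rename _ _)
  have hPzd : Pz.DiffFree := hP.subst (diffFree_rename _ _)
  have hQzd : Qz.DiffFree := hQ.subst (diffFree_rename _ _)
  have hzf : ∀ z ∈ zs, Var.base z ∉ P.fv ∧ Var.base z ∉ Q.fv ∧ z ∉ ys := fun z hz' => by
    have := hz.notMem z hz'
    simpa [not_or, and_assoc] using this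
  have hl : ys.length = zs.length := by rw [hy.1, hz.1]
  have hva : (s.adjoint zs).vars = zs := Sys.vars_adjoint hz.1.symm
  have hRz : R.subst (rename s.vars zs) = QF.and Qz (QF.or Pz (QF.eqVec zs ys)) := by
    rw [hR, QF.subst, QF.subst, QF.subst_eqVec hs.1 hz.length_eq hy.notMem_vars]
  have hzR : FreshVec s R.fv zs := by
    refine ⟨hz.1, hz.2.1, fun z hz' => ⟨hz.notMem_vars z hz', ?_, ?_⟩⟩
    · simp only [hR, QF.fv, Finset.mem_union, not_or]
      refine ⟨hz.notMem_rhsFv z hz', (hzf z hz').2.1, (hzf z hz').1, ?_⟩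
      exact base_notMem_fv_eqVec (hz.notMem_vars z hz') (hzf z hz').2.2
    · rw [Finset.mem_union, not_or]
      exact ⟨hs.prime_notMem _, hRd.prime_notMem _⟩
  have hadj : (s.adjoint zs).WF := hs.adjoint hz
  have hRzd : (R.subst (rename s.vars zs)).DiffFree := hRd.subst (diffFree_rename _ _)
  -- The variables `z` of the adjoint system start at `y`, the candidate for a first violation.
  refine Provable.intro_eqVec (xs := ys) (ys := zs) hl hz.2.1 (fun z hz' => (hzf z hz').2.2)
    (fun z hz' => ?_) ?_
  · simp only [Fml.fv_imp, Finset.mem_union, not_or, QF.fv_toF]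
    refine ⟨hχz z hz', (hzf z hz').1, base_notMem_fv_box (hz.notMem_vars z hz')
      (hz.notMem_rhsFv z hz') (hzR.notMem z hz') ?_⟩
    simp only [Fml.fv_imp, Finset.mem_union, not_or, QF.fv_toF]
    exact ⟨base_notMem_fv_eqVec (hz.notMem_vars z hz') (hzf z hz').2.2, (hzf z hz').1⟩
  -- A run violating the claim ends at `x = y = z`, and `P` fails for the values `y`. This failure
  -- is then a property of parameters, hence true already at the start.
  have k₁ : Provable L ((QF.eqVec ys zs).toF.imp ((Fml.dia (Act.ode s R)
      (Fml.not ((QF.eqVec s.vars ys).toF.imp P.toF))).imp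
      (Fml.dia (Act.ode s R) (QF.and (QF.eqVec s.vars zs) P'.not).toF))) := by
    refine (provable_box_eqVec_const (s := s) (Q := R) hy.notMem_vars hz.notMem_vars).trans
      (Provable.dia_box_mono ((provable_congr hP s.vars ys).val₁ fun ρ v => ?_))
    simp only [Fml.val_imp, Fml.val_iff, Fml.val_not, Fml.val_toF, QF.val_and, QF.val_not,
      QF.val_eqVec hl, QF.val_eqVec hy.length_eq, QF.val_eqVec hz.length_eq]
    intro h₁ h₂ h₃
    push Not at h₃
    exact ⟨h₃.1.trans h₂, fun h₄ => h₃.2 ((h₁ h₃.1).2 h₄)⟩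
  have k₂ : Provable L ((Fml.dia (Act.ode s R) (QF.and (QF.eqVec s.vars zs) P'.not).toF).imp
      P'.not.toF) :=
    (Provable.dia_mono (φ := (QF.and (QF.eqVec s.vars zs) P'.not).toF) (ψ := P'.not.toF)
      (Provable.val₀ fun ρ v => by
      simp only [Fml.val_imp, Fml.val_toF, QF.val_and]; exact fun h => h.2)).trans
      (provable_const_of_dia (disjoint_bv (fun z => by
        rw [QF.fv_toF]
        exact QF.DiffFree.prime_notMem (A := P'.not) hP'd z)
        (notMem_vars_of_mem_subst (A := P.not) hP hy.length_eq hy.notMem_vars)))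
  -- Reversal: the adjoint runs from `z` back to `x` within the renamed domain.
  have k₃ : Provable L ((Fml.dia (Act.ode s R) (QF.and (QF.eqVec s.vars zs) P'.not).toF).imp
      (Fml.dia (Act.ode (s.adjoint zs) (R.subst (rename s.vars zs)))
        (QF.eqVec zs s.vars).toF)) :=
    (Provable.dia_mono (φ := (QF.and (QF.eqVec s.vars zs) P'.not).toF)
      (ψ := (QF.eqVec s.vars zs).toF) (Provable.val₀ fun ρ v => by
      simp only [Fml.val_imp, Fml.val_toF, QF.val_and]; exact fun h => h.1)).val₂
      (Axm.provable (Axm.Dadj s R zs hs hRd hzR)) fun ρ v => by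
        simp only [Fml.val_imp, Fml.val_iff]
        exact fun h₁ h₂ h₃ => h₂.1 (h₁ h₃)
  -- `P` holds at `x` but not at `y`, so the reversed run ends away from its starting point `y`: it
  -- makes progress.
  have k₄ : Provable L ((QF.and P P'.not).toF.imp ((Fml.dia
      (Act.ode (s.adjoint zs) (R.subst (rename s.vars zs))) (QF.eqVec zs s.vars).toF).imp
      (Fml.dia (Act.ode (s.adjoint zs) (R.subst (rename s.vars zs)))
        (Fml.not (QF.eqVec (s.adjoint zs).vars ys).toF)))) := by
    have hd : Disjoint (QF.and P P'.not).toF.fv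
        (Act.ode (s.adjoint zs) (R.subst (rename s.vars zs))).bv := by
      refine disjoint_bv (fun z => ?_) (fun z hz' => ?_)
      · rw [QF.fv_toF]
        exact QF.DiffFree.prime_notMem (A := QF.and P P'.not) ⟨hP, hP'd⟩ z
      · rw [hva] at hz'
        rw [QF.fv_toF, QF.fv, QF.fv, Finset.mem_union, not_or]
        refine ⟨(hzf z hz').1, fun h' => ?_⟩
        rcases QF.base_mem_fv_subst_rename hP hy.length_eq h' with h' | h'
        · exact (hzf z hz').2.2 h'
        · exact (hzf z hz').1 h'.1
    refine (provable_box_const _ hd).trans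
      (Provable.dia_box_mono ((provable_congr hP s.vars ys).val₁ fun ρ v => ?_))
    rw [hva]
    simp only [Fml.val_imp, Fml.val_iff, Fml.val_not, Fml.val_toF, QF.val_and, QF.val_not,
      QF.val_eqVec hl.symm, QF.val_eqVec hy.length_eq, QF.val_eqVec hz.length_eq.symm]
    exact fun h₁ h₂ h₃ h₄ => h₂.2 ((h₁ (h₃.symm.trans h₄)).1 h₂.1)
  -- The renamed domain is `Q ∧ (P ∨ z = y)`. It gives progress into `Q` here and progress into `P`
  -- in the next step.
  have k₅ : Provable L ((Fml.dia (Act.ode (s.adjoint zs) (R.subst (rename s.vars zs)))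
      (Fml.not (QF.eqVec (s.adjoint zs).vars ys).toF)).imp (Prg (s.adjoint zs) ys Qz)) :=
    Provable.dia_dom_mono hadj hRzd (diffFree_or_eqVec hQzd _ _) (Provable.val₀ fun ρ v => by
      rw [hRz, hva]
      simp only [Fml.val_imp, Fml.val_toF, QF.val_and, QF.val_or]
      exact fun h => Or.inl h.1)
  have k₆ : Provable L ((Fml.dia (Act.ode (s.adjoint zs) (R.subst (rename s.vars zs)))
      (Fml.not (QF.eqVec (s.adjoint zs).vars ys).toF)).imp (Prg (s.adjoint zs) ys Pz)) :=
    Provable.dia_dom_mono hadj hRzd (diffFree_or_eqVec hPzd _ _) (Provable.val₀ fun ρ v => by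
      rw [hRz, hva]
      simp only [Fml.val_imp, Fml.val_toF, QF.val_and, QF.val_or]
      exact fun h => h.2)
  have k₇ : Provable L ((Fml.dia (Act.ode (s.adjoint zs) (R.subst (rename s.vars zs)))
      (Fml.not (QF.eqVec (s.adjoint zs).vars ys).toF)).imp Qz.toF) :=
    (provable_dom_of_dia (φ := Fml.not (QF.eqVec (s.adjoint zs).vars ys).toF) hadj hRzd
      ((QF.diffFree_eqVec (k := L.k) (r := L.r) _ _).disjoint_primes _)).trans
      (ψ := (R.subst (rename s.vars zs)).toF) (Provable.val₀ fun ρ v => by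
        rw [hRz]
        simp only [Fml.val_imp, Fml.val_toF, QF.val_and]
        exact fun h => h.1)
  -- Progress into `Q` gives `GQ`, the backward condition gives `GN`, and so the adjoint system
  -- progresses into `¬P`, contradicting progress into `P`.
  have k₈ : Provable L ((QF.eqVec ys zs).toF.imp ((Prg (s.adjoint zs) ys Qz).imp
      ((Prg (s.adjoint zs) ys Pz).imp (χ.imp (Pz.not.toF.imp (Qz.toF.imp Fml.fls)))))) := by
    refine (provable_eqVec_symm (L := L) hl).val₅ (dQ.of_prg hadj) h dN.pos
      (provable_prg_contra (ys := ys) hadj hPzd) fun ρ v => ?_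
    rw [hva]
    simp only [Fml.val_imp, Fml.val_not]
    intro h₁ h₂ h₃ h₄ h₅ h₆ h₇ h₈ h₉ h₁₀ h₁₁
    exact absurd (h₄ (h₁ h₆) (h₃ h₉ h₁₀ h₁₁ (h₂ (h₁ h₆) h₇))) (h₅ h₈)
  have k₉ := provable_dia_not_iff (Act.ode s R) ((QF.eqVec s.vars ys).toF.imp P.toF)
  refine Provable.of_list (l := [_, _, _, _, _, _, _, _, _, _]) (List.forall_mem_cons.2 ⟨k₁,
    List.forall_mem_cons.2 ⟨k₂, List.forall_mem_cons.2 ⟨k₃, List.forall_mem_cons.2 ⟨k₄,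
    List.forall_mem_cons.2 ⟨k₅, List.forall_mem_cons.2 ⟨k₆, List.forall_mem_cons.2 ⟨k₇,
    List.forall_mem_cons.2 ⟨k₈, List.forall_mem_cons.2 ⟨k₉, List.forall_mem_singleton.2
    (provable_congr_subst hP hs hy hz)⟩⟩⟩⟩⟩⟩⟩⟩⟩) fun ρ v H => ?_
  simp only [List.forall_mem_cons] at H
  obtain ⟨h₁, h₂, h₃, h₄, h₅, h₆, h₇, h₈, h₉, h₁₀, -⟩ := H
  simp only [Fml.val_imp, Fml.val_iff, Fml.val_fls] at *
  rw [Fml.val_not] at h₉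
  simp only [Fml.val_toF, QF.val_and, QF.val_not] at *
  intro hyz hχ hP'
  by_contra hb
  have a₁ := h₁ hyz (h₉.2 hb)
  have a₂ := h₂ a₁
  have a₃ := h₄ ⟨hP', a₂⟩ (h₃ a₁)
  exact h₈ hyz (h₅ a₃) (h₆ a₃) hχ (fun hp => a₂ ((h₁₀ hyz).2 hp)) (h₇ a₃)

/-- Sufficiency of local progress of `P` forward and of its negation backward. -/
theorem provable_box_of_progress (hs : s.WF) (hc : s.HasClock) (hP : P.DiffFree)
    (hQ : Q.DiffFree) (hχx : ∀ x ∈ s.vars, Var.base x ∉ χ.fv) (hχp : ∀ z, Var.prime z ∉ χ.fv)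
    (hz : FreshVec s (P.fv ∪ Q.fv) zs) (hχz : ∀ z ∈ zs, Var.base z ∉ χ.fv)
    (dP : ∀ ys, FreshVec s ∅ ys → Decides L s ys FP P)
    (dQ : ∀ ys, FreshVec s ∅ ys → Decides L s ys FQ Q)
    (dQz : ∀ ys, FreshVec (s.adjoint zs) ∅ ys →
      Decides L (s.adjoint zs) ys GQ (Q.subst (rename s.vars zs)))
    (dNz : ∀ ys, FreshVec (s.adjoint zs) ∅ ys →
      Decides L (s.adjoint zs) ys GN (P.not.subst (rename s.vars zs)))
    (h₁ : Provable L (χ.imp (P.toF.imp (Q.toF.imp (FQ.toF.imp FP.toF)))))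
    (h₂ : Provable L (χ.imp ((P.not.subst (rename s.vars zs)).toF.imp
      ((Q.subst (rename s.vars zs)).toF.imp (GQ.toF.imp GN.toF))))) :
    Provable L (χ.imp (P.toF.imp (Fml.box (Act.ode s Q) P.toF))) := by
  obtain ⟨ys, hy⟩ := exists_freshVec s (Q.fv ∪ P.fv ∪ χ.fv ∪ (zs.map Var.base).toFinset)
  have hy₀ := hy.mono (Finset.empty_subset _)
  have hyQP : FreshVec s (Q.fv ∪ P.fv) ys := hy.mono fun v hv => by
    simp only [Finset.mem_union] at hv ⊢; tauto
  have hyf : ∀ y ∈ ys, Var.base y ∉ Q.fv ∧ Var.base y ∉ P.fv ∧ Var.base y ∉ χ.fv ∧ y ∉ zs :=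
    fun y hy' => by
      have := hy.notMem y hy'
      simpa [not_or, and_assoc] using this
  have hz' : FreshVec s (P.fv ∪ Q.fv ∪ (ys.map Var.base).toFinset) zs := by
    refine ⟨hz.1, hz.2.1, fun z hz' => ?_⟩
    have := hz.2.2 z hz'
    simp only [Finset.mem_union, not_or, List.mem_toFinset, List.mem_map, not_exists, not_and,
      Var.base.injEq] at this ⊢
    exact ⟨this.1, ⟨this.2.1.1, this.2.1.2, fun y hy' h => (hyf y hy').2.2.2 (h ▸ hz')⟩,
      this.2.2.1, this.2.2.2, fun y _ h => by cases h⟩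
  have hya : FreshVec (s.adjoint zs) ∅ ys :=
    freshVec_adjoint hs hz hy fun y hy' => (hyf y hy').2.2.2
  set R := QF.and Q (QF.or P (QF.eqVec s.vars ys)) with hR
  have hRd : R.DiffFree := ⟨hQ, diffFree_or_eqVec hP _ _⟩
  -- First half of the real induction step: `P` holds on reaching `y`, by the backward condition.
  have k₁ := provable_box_initial_of_adjoint hs hP hQ hχz hy₀ hz' (dQz ys hya) (dNz ys hya) h₂
  -- `χ` depends on nothing that evolves, so the forward condition is available at every state of
  -- the run and not just initially.
  have k₂ : Provable L (χ.imp (Fml.box (Act.ode s R) χ)) :=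
    provable_box_const _ (disjoint_bv hχp hχx)
  have k₃ : Provable L (Fml.box (Act.ode s R) Q.toF) :=
    Provable.box_of_dom hs hRd (Provable.val₀ fun ρ v => by
      simp only [hR, Fml.val_imp, Fml.val_toF, QF.val_and]; exact fun h => h.1)
  -- Second half: at `y`, progress of the domain gives `FQ`, the forward condition gives `FP`, and
  -- hence `P` progresses.
  have k₄ : Provable L ((Fml.box (Act.ode s R) ((QF.eqVec s.vars ys).toF.imp P.toF)).imp
      ((Fml.box (Act.ode s R) χ).imp ((Fml.box (Act.ode s R) Q.toF).imp
        (Fml.box (Act.ode s R) ((QF.eqVec s.vars ys).toF.imp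
          (Fml.and P.toF ((Prg s ys Q).imp (Prg s ys P)))))))) := by
    refine Provable.box_mono₃ (((dQ ys hy₀).of_prg hs).val₃ h₁ (dP ys hy₀).pos fun ρ v => ?_)
    simp only [Fml.val_imp, Fml.val_and]
    exact fun a₁ a₂ a₃ a₄ a₅ a₆ a₇ => ⟨a₄ a₇, fun a₈ => a₃ a₇ (a₂ a₅ (a₄ a₇) a₆ (a₁ a₇ a₈))⟩
  have k₅ : Provable L ((Fml.and χ P.toF).imp (Fml.allVec ys
      (Fml.box (Act.ode s R) ((QF.eqVec s.vars ys).toF.imp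
        (Fml.and P.toF ((Prg s ys Q).imp (Prg s ys P))))))) := by
    refine Provable.allVec_intro (fun y hy' => ?_) (k₁.val₄ k₂ k₃ k₄ fun ρ v => ?_)
    · simp only [Fml.fv, Finset.mem_union, not_or, QF.fv_toF]
      exact ⟨(hyf y hy').2.2.1, (hyf y hy').2.1⟩
    · simp only [Fml.val_imp, Fml.val_and]; tauto
  refine k₅.val₂ (Axm.provable (Axm.RI s Q P ys hs hc hQ hP hyQP)) fun ρ v => ?_
  simp only [Fml.val_imp, Fml.val_and, Fml.val_iff]
  exact fun a₁ a₂ a₃ a₄ => a₂.2 (a₁ ⟨a₃, a₄⟩)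

/-- Necessity of forward progress. -/
theorem provable_progress_of_box (hs : s.WF) (hP : P.DiffFree) (hQ : Q.DiffFree)
    (dP : ∀ ys, FreshVec s ∅ ys → Decides L s ys FP P)
    (dQ : ∀ ys, FreshVec s ∅ ys → Decides L s ys FQ Q) :
    Provable L ((Fml.box (Act.ode s Q) P.toF).imp (Q.toF.imp (FQ.toF.imp FP.toF))) := by
  obtain ⟨ys, hy⟩ := exists_freshVec s (P.fv ∪ Q.fv ∪ FP.fv ∪ FQ.fv)
  have hy₀ := hy.mono (Finset.empty_subset _)
  refine Provable.intro_eqVec hy.length_eq hy.2.1 hy.notMem_vars (fun y hy' => ?_) ?_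
  · have h := hy.notMem y hy'
    simp only [Finset.mem_union, not_or] at h
    simp only [Fml.fv_imp, Finset.mem_union, not_or, QF.fv_toF]
    refine ⟨base_notMem_fv_box (hy.notMem_vars y hy') (hy.notMem_rhsFv y hy') h.1.1.2 ?_,
      h.1.1.2, h.2, h.1.2⟩
    rw [QF.fv_toF]
    exact h.1.1.1
  · refine (provable_not_prg_of_box hs hy₀ hQ hP).val₃ (dQ ys hy₀).pos (dP ys hy₀).neg
      fun ρ v => ?_
    simp only [Fml.val_imp, Fml.val_not, QF.toF]; tauto

/-- The end state of a run can be named: extend `φ` by the existence of values equal to the final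
ones and move the quantifiers out of the diamond, as the Barcan axiom allows, one variable at a
time. -/
theorem Provable.dia_witness {α : Act L.k L.r} {xs : List ℕ}
    (hB : ∀ x ∈ xs, ∀ φ : Fml L.k L.r, Provable L ((Fml.dia α (Fml.ex (Var.base x) φ)).imp
      (Fml.ex (Var.base x) (Fml.dia α φ))))
    (hx : xs.Nodup) (hl : zs.length = xs.length) (hd : ∀ z ∈ zs, z ∉ xs)
    (hψ : ∀ x ∈ xs, Var.base x ∉ ψ.fv) (hφ : ∀ x ∈ xs, Var.base x ∉ φ.fv)
    (h : Provable L ((Fml.dia α (Fml.and φ (QF.eqVec zs xs).toF)).imp ψ)) :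
    Provable L ((Fml.dia α φ).imp ψ) := by
  induction xs generalizing zs φ with
  | nil =>
    refine (Provable.dia_mono (Provable.val₀ fun ρ v => ?_)).trans h
    rw [List.length_eq_zero_iff.1 hl]
    simp only [Fml.val_imp, Fml.val_and, Fml.val_toF]
    exact fun h => ⟨h, by simp [QF.eqVec, QF.conj]⟩
  | cons x xs ih =>
    obtain _ | ⟨z, zs⟩ := zs
    · simp at hl
    rw [List.nodup_cons] at hx
    rw [List.forall_mem_cons] at hd hB hψ hφ
    simp only [List.mem_cons, not_or] at hd
    refine ih hB.2 hx.2 (by simpa using hl) (fun z' h' => (hd.2 z' h').2) hψ.2 hφ.2 ?_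
    have hE : Provable L ((Fml.and φ (QF.eqVec zs xs).toF).imp (Fml.ex (Var.base x)
        (Fml.and φ (QF.eqVec (z :: zs) (x :: xs)).toF))) := by
      refine Provable.intro_eq (z := Var.base x) (t := Term.bvar z) ?_ ?_ ?_
      · simpa [Term.fv, Term.bvar] using fun h => hd.1.1 h.symm
      · simp only [Fml.fv_imp, Fml.fv, Finset.mem_union, not_or, QF.fv_toF]
        exact ⟨⟨hφ.1, base_notMem_fv_eqVec (fun h' => (hd.2 x h').1 rfl) hx.1⟩, by simp⟩
      · refine (provable_ex_self x (Fml.and φ (QF.eqVec (z :: zs) (x :: xs)).toF)).val₁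
          fun ρ v => ?_
        rw [QF.eqVec_cons]
        simp only [Fml.val_imp, Fml.val_toF, QF.val_and, QF.val_cmp, Fml.eq, Fml.val,
          Cmp.rel, Term.evalA, Term.bvar]
        exact fun h₁ h₂ h₃ => h₁ ⟨h₃.1, h₂.symm, h₃.2⟩
    exact ((Provable.dia_mono hE).trans (hB.1 _)).trans (Provable.ex_elim hψ.1 h)

/-- Necessity of progress along the adjoint system. -/
theorem provable_adjoint_progress_of_box (hs : s.WF) (hP : P.DiffFree)
    (hQ : Q.DiffFree) (hχx : ∀ x ∈ s.vars, Var.base x ∉ χ.fv)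
    (hz : FreshVec s (P.fv ∪ Q.fv) zs)
    (dQz : ∀ ys, FreshVec (s.adjoint zs) ∅ ys →
      Decides L (s.adjoint zs) ys GQ (Q.subst (rename s.vars zs)))
    (dNz : ∀ ys, FreshVec (s.adjoint zs) ∅ ys →
      Decides L (s.adjoint zs) ys GN (P.not.subst (rename s.vars zs)))
    (h : Provable L (χ.imp (P.toF.imp (Fml.box (Act.ode s Q) P.toF)))) :
    Provable L (χ.imp ((P.not.subst (rename s.vars zs)).toF.imp
      ((Q.subst (rename s.vars zs)).toF.imp (GQ.toF.imp GN.toF)))) := by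
  obtain ⟨ys, hy⟩ := exists_freshVec s (Q.fv ∪ P.fv ∪ χ.fv ∪ GQ.fv ∪ GN.fv ∪
    (zs.map Var.base).toFinset)
  have hy₀ := hy.mono (Finset.empty_subset _)
  have hyf : ∀ y ∈ ys, Var.base y ∉ Q.fv ∧ Var.base y ∉ P.fv ∧ Var.base y ∉ χ.fv ∧
      Var.base y ∉ GQ.fv ∧ Var.base y ∉ GN.fv ∧ y ∉ zs :=
    fun y hy' => by
      have := hy.notMem y hy'
      simpa [not_or, and_assoc] using this
  have hya : FreshVec (s.adjoint zs) ∅ ys :=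
    freshVec_adjoint hs hz hy fun y hy' => (hyf y hy').2.2.2.2.2
  have hadj : (s.adjoint zs).WF := hs.adjoint hz
  have hva : (s.adjoint zs).vars = zs := Sys.vars_adjoint hz.1.symm
  have hxa : ∀ x ∈ s.vars, x ∉ zs := fun x hx hz' => hz.notMem_vars x hz' hx
  have hfsub : ∀ A : QF L.k L.r, A.DiffFree → ∀ x ∈ s.vars,
      Var.base x ∉ (A.subst (rename s.vars zs)).fv := fun A hA x hx h' => by
    rcases QF.base_mem_fv_subst_rename hA hz.length_eq h' with h' | h'
    · exact hxa x hx h'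
    · exact h'.2 hx
  set Pz := P.subst (rename s.vars zs) with hPz
  set Qz := Q.subst (rename s.vars zs) with hQz
  have hPzd : Pz.DiffFree := hP.subst (diffFree_rename _ _)
  have hQzd : Qz.DiffFree := hQ.subst (diffFree_rename _ _)
  -- the end state of a run of the adjoint system is reached backward
  have k₁ : Provable L ((Fml.dia (Act.ode (s.adjoint zs) Qz) Pz.toF).imp
      (χ.imp Pz.toF)) := by
    -- The original variables `x`, unused by the adjoint system, serve as names for its end state.
    -- Neither the renamed postcondition nor `χ` mentions them.
    refine Provable.dia_witness (xs := s.vars) (zs := zs) (fun x hx φ => ?_) hs.1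
      hz.length_eq.symm hz.notMem_vars ?_ ?_ ?_
    · refine (Axm.provable (Axm.barcan (s.adjoint zs) Qz (Var.base x) φ hadj hQzd ?_)).val₁
        fun ρ v => ?_
      · simp only [Act.fv, Act.bv, Finset.mem_union, not_or]
        have hb : Var.base x ∉ (s.adjoint zs).lhs := by
          rw [Sys.base_mem_lhs, hva]; exact hxa x hx
        have hp : Var.base x ∉ (s.adjoint zs).primes := fun h' => by
          obtain ⟨n, -, h'⟩ := Sys.eq_prime_of_mem_primes h'
          cases h'
        refine ⟨⟨⟨hb, fun h' => ?_⟩, hfsub Q hQ x hx⟩, hb, hp⟩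
        obtain ⟨q, hq, h'⟩ := Sys.mem_rhsFv.1 h'
        obtain ⟨p, hp, hq'⟩ := Sys.mem_adjoint hq
        rw [hq', Term.neg, Term.fv, Finset.mem_union] at h'
        rcases h' with h' | h'
        · exact absurd h' (by simp [Term.fv])
        · rcases Term.base_mem_fv_subst_rename (hs.2 p hp) hz.length_eq h' with h' | h'
          · exact hxa x hx h'
          · exact h'.2 hx
      · simp only [Fml.val_imp, Fml.val_iff]; exact fun h => h.1
    · intro x hx
      rw [Fml.fv_imp, Finset.mem_union, not_or, QF.fv_toF]
      exact ⟨hχx x hx, hfsub P hP x hx⟩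
    · intro x hx
      rw [QF.fv_toF]
      exact hfsub P hP x hx
    · have hd : Disjoint P.toF.fv (Act.ode (s.adjoint zs) Qz).bv := by
        refine disjoint_bv (fun z => by rw [QF.fv_toF]; exact hP.prime_notMem z) fun z hz' => ?_
        rw [hva] at hz'
        rw [QF.fv_toF]
        exact fun h' => hz.notMem z hz' (Finset.mem_union_left _ h')
      -- At the end `P` holds for `z = x`, hence for `x`. As `x` does not evolve along the adjoint
      -- system, `P` holds for it from the start.
      have a₁ : Provable L ((Fml.dia (Act.ode (s.adjoint zs) Qz)
          (Fml.and Pz.toF (QF.eqVec zs s.vars).toF)).imp P.toF) := by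
        refine (Provable.dia_mono ((provable_congr hP s.vars zs).val₁ fun ρ v => ?_)).trans
          (provable_const_of_dia hd)
        simp only [Fml.val_imp, Fml.val_iff, Fml.val_and, Fml.val_toF,
          QF.val_eqVec hz.length_eq, QF.val_eqVec hz.length_eq.symm]
        exact fun h₁ h₂ => (h₁ h₂.2.symm).2 h₂.1
      have a₂ : Provable L ((Fml.dia (Act.ode (s.adjoint zs) Qz)
          (Fml.and Pz.toF (QF.eqVec zs s.vars).toF)).imp
          (Fml.dia (Act.ode s Q) (QF.eqVec s.vars zs).toF)) := by
        refine (Provable.dia_mono (α := Act.ode (s.adjoint zs) Qz)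
          (φ := Fml.and Pz.toF (QF.eqVec zs s.vars).toF) (ψ := (QF.eqVec zs s.vars).toF)
          (Provable.val₀ fun ρ v => ?_)).val₂
          (Axm.provable (Axm.Dadj s Q zs hs hQ (hz.mono Finset.subset_union_right))) fun ρ v => ?_
        · simp only [Fml.val_imp, Fml.val_and]; exact fun h => h.2
        · simp only [Fml.val_imp, Fml.val_iff]; exact fun h₁ h₂ h₃ => h₂.2 (h₁ h₃)
      -- Reversing the adjoint run gives a forward run from `x` to `z`; the box makes `P` true at
      -- its end, that is, for the values `z`.
      have a₃ : Provable L ((Fml.box (Act.ode s Q) P.toF).imp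
          ((Fml.dia (Act.ode s Q) (QF.eqVec s.vars zs).toF).imp Pz.toF)) := by
        refine (Provable.dia_box_mono (α := Act.ode s Q) (φ := P.toF)
          (ψ := (QF.eqVec s.vars zs).toF) (χ := Pz.toF)
          ((provable_congr hP s.vars zs).val₁ fun ρ v => ?_)).val₂
          (provable_const_of_dia (φ := Pz.toF) (α := Act.ode s Q) ?_) fun ρ v => ?_
        · simp only [Fml.val_imp, Fml.val_iff]; exact fun h₁ h₂ h₃ => (h₁ h₃).1 h₂
        · refine disjoint_bv (fun z => by rw [QF.fv_toF]; exact hPzd.prime_notMem z)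
            fun x hx => ?_
          rw [QF.fv_toF]
          exact hfsub P hP x hx
        · simp only [Fml.val_imp]; exact fun h₁ h₂ h₃ h₄ => h₂ (h₁ h₃ h₄)
      refine a₁.val₄ a₂ a₃ h fun ρ v => ?_
      simp only [Fml.val_imp]
      exact fun b₁ b₂ b₃ b₄ b₅ b₆ => b₃ (b₄ b₆ (b₁ b₅)) (b₂ b₅)
  refine Provable.intro_eqVec (xs := zs) (ys := ys) (by rw [hy.1, hz.1]) hy.2.1
    (fun y hy' => (hyf y hy').2.2.2.2.2) (fun y hy' => ?_) ?_
  · have hsub : ∀ A : QF L.k L.r, A.DiffFree → Var.base y ∉ A.fv →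
        Var.base y ∉ (A.subst (rename s.vars zs)).fv := fun A hA hf h' => by
      rcases QF.base_mem_fv_subst_rename hA hz.length_eq h' with h' | h'
      · exact (hyf y hy').2.2.2.2.2 h'
      · exact hf h'.1
    simp only [Fml.fv_imp, Finset.mem_union, not_or, QF.fv_toF]
    exact ⟨(hyf y hy').2.2.1, hsub P hP (hyf y hy').2.1, hsub Q hQ (hyf y hy').1,
      (hyf y hy').2.2.2.1, (hyf y hy').2.2.2.2.1⟩
  · have k₂ := provable_dia_of_prg_and (R := Pz) hadj hya hQzd hPzd
    have k₃ : Provable L ((Prg (s.adjoint zs) ys Qz).imp ((Prg (s.adjoint zs) ys Pz.not.not).imp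
        (Prg (s.adjoint zs) ys (Qz.and Pz)))) :=
      (provable_prg_and (ys := ys) hadj hQzd (B := Pz.not.not) hPzd).val₂
        (Provable.prg_mono (ys := ys) (A := Qz.and Pz.not.not) (B := Qz.and Pz) hadj
          ⟨hQzd, hPzd⟩ ⟨hQzd, hPzd⟩ (Provable.val₀ fun ρ v => by
            simp only [Fml.val_imp, Fml.val_toF, QF.val_and, QF.val_not, not_not]
            exact fun h => h)) fun ρ v => by
          simp only [Fml.val_imp]; exact fun h₁ h₂ h₃ h₄ => h₂ (h₁ h₃ h₄)
    refine k₁.val₅ k₂ k₃ (dQz ys hya).pos (dNz ys hya).neg fun ρ v => ?_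
    rw [hva]
    simp only [Fml.val_imp]
    intro a₁ a₂ a₃ a₄ a₅ a₆ a₇ a₈ a₉ a₁₀
    -- If `GN` fails, the adjoint system progresses into `Q` and `P`, so it reaches a `P`-state. The
    -- forward invariance of `P` then gives `P` at `z`, against the assumption.
    by_contra hG
    exact a₈ (a₁ (a₂ a₆ a₉ (a₃ (a₄ a₆ a₁₀) (a₅ a₆ hG))) a₇)

end SemianalyticCompleteness

end DL

namespace DL

/-! ### Lie derivatives and progress formulas along the adjoint system. -/

section LieRename

variable {L : Lang} {s : Sys L.k L.r} {zs : List ℕ}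

theorem Term.subst_sum {k r : ℕ} (σ : Var → Term k r) (l : List (Term k r)) :
    (Term.sum l).subst σ = Term.sum (l.map fun t => t.subst σ) := by
  induction l with
  | nil => rfl
  | cons a l ih => exact congrArg (Term.add (a.subst σ)) ih

theorem PolyExpr.subst_inst {k r : ℕ} {p : PolyExpr k r} (hp : p.ClosedCoeffs)
    (σ : Var → Term k r) (a : Fin k → Term k r) :
    (p.inst a).subst σ = p.inst fun i => (a i).subst σ := by
  induction p with
  | arg i => rfl
  | sym j => rfl
  | coef t =>
    refine (Term.subst_congr hp.2 (τ := Term.var) fun z hz => ?_).trans (Term.subst_var t)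
    rw [hp.1] at hz
    simp at hz
  | add p q h₁ h₂ => simp only [PolyExpr.inst, Term.subst, h₁ hp.1, h₂ hp.2]
  | mul p q h₁ h₂ => simp only [PolyExpr.inst, Term.subst, h₁ hp.1, h₂ hp.2]

theorem Sys.vars_neg {k r : ℕ} (s : Sys k r) : s.neg.vars = s.vars := by
  simp [Sys.neg, Sys.vars, Function.comp_def]

theorem Sys.rhsFv_neg {k r : ℕ} (s : Sys k r) : s.neg.rhsFv = s.rhsFv := by
  ext z
  simp [Sys.mem_rhsFv, Sys.neg, Term.neg, Term.fv]

theorem Sys.WF.neg {k r : ℕ} {s : Sys k r} (hs : s.WF) : s.neg.WF := by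
  refine ⟨by rw [Sys.vars_neg]; exact hs.1, fun q hq => ?_⟩
  obtain ⟨p, hp, rfl⟩ := List.mem_map.1 hq
  exact (hs.2 p hp).neg

/-- The adjoint system is `x' = -f` written in the variables `z`, so differentiation commutes with
renaming. A parameter has derivative zero on both sides, provided that it is not one of the `z`. -/
theorem lie_rename_bvar (hs : s.WF) (hl : s.length = zs.length) (hz : zs.Nodup) {n : ℕ}
    (hn : n ∉ zs) : (lie L s.neg (Term.bvar n)).subst (rename s.vars zs) =
      lie L (s.adjoint zs) (rename s.vars zs (Var.base n)) := by
  have hl' : s.vars.length = zs.length := by rw [← hl]; simp [Sys.vars]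
  by_cases hn' : n ∈ s.vars
  · have key : ∀ (τ : Var → Term L.k L.r) (s : Sys L.k L.r) (zs : List ℕ),
        s.length = zs.length → zs.Nodup → s.vars.Nodup → n ∈ s.vars →
        ∃ m, (rename s.vars zs (Var.base n) : Term L.k L.r) = Term.bvar m ∧
        m ∈ zs ∧ (List.lookup m (List.zipWith (fun p y => (y, (p.2.subst τ).neg)) s zs)).getD
          (Term.const 0) = ((List.lookup n s.neg).getD (Term.const 0)).subst τ := by
      intro τ s zs hl hz hv hn
      induction s generalizing zs with
      | nil => simp [Sys.vars] at hn
      | cons p s ih =>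
        obtain _ | ⟨z, zs⟩ := zs
        · simp at hl
        rw [List.nodup_cons] at hz
        simp only [Sys.vars, List.map_cons, List.nodup_cons, List.mem_cons] at hv hn
        by_cases hnp : n = p.1
        · refine ⟨z, ?_, by simp, ?_⟩
          · rw [Sys.vars, List.map_cons, rename_cons, if_pos hnp]
          · simp [Sys.neg, hnp, Term.neg, Term.subst]
        · obtain ⟨m, h₁, h₂, h₃⟩ := ih zs (by simpa using hl) hz.2 hv.2 (hn.resolve_left hnp)
          refine ⟨m, ?_, by simp [h₂], ?_⟩
          · rw [Sys.vars, List.map_cons, rename_cons, if_neg hnp]; exact h₁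
          · have hmz : m ≠ z := fun h => hz.1 (h ▸ h₂)
            have e₁ : (m == z) = false := by simpa using hmz
            have e₂ : (n == p.1) = false := by simpa using hnp
            simp only [Sys.neg, List.map_cons, List.zipWith_cons_cons, List.lookup_cons, e₁, e₂]
            exact h₃
    obtain ⟨m, h₁, -, h₃⟩ := key (rename s.vars zs) s zs hl hz hs.1 hn'
    rw [h₁]
    exact h₃.symm
  · rcases rename_spec (k := L.k) (r := L.r) hl' n with h | h
    · exact absurd h.1 hn'
    · rw [h.2]
      simp only [Term.bvar, lie]
      rw [lookup_of_notMem (s := s.neg) (by rwa [Sys.vars_neg]),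
        lookup_of_notMem (s := s.adjoint zs) (by rwa [Sys.vars_adjoint hl])]
      rfl

theorem lie_rename (hL : L.Closed) (hs : s.WF) (hl : s.length = zs.length) (hz : zs.Nodup)
    {e : Term L.k L.r} (he : ∀ z ∈ zs, Var.base z ∉ e.fv) :
    (lie L s.neg e).subst (rename s.vars zs) =
      lie L (s.adjoint zs) (e.subst (rename s.vars zs)) := by
  induction e with
  | var x => cases x with
    | base n => exact lie_rename_bvar hs hl hz fun h => he n h (by simp [Term.fv])
    | prime z => rfl
  | const c => rfl
  | add e f h₁ h₂ =>
    simp only [lie, Term.subst]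
    rw [h₁ fun z hz h => he z hz (Finset.mem_union_left _ h),
      h₂ fun z hz h => he z hz (Finset.mem_union_right _ h)]
  | mul e f h₁ h₂ =>
    simp only [lie, Term.subst]
    rw [h₁ fun z hz h => he z hz (Finset.mem_union_left _ h),
      h₂ fun z hz h => he z hz (Finset.mem_union_right _ h)]
  | app j a ha =>
    simp only [lie, Term.subst, Term.subst_sum, List.map_map]
    congr 1
    refine List.map_congr_left fun i _ => ?_
    simp only [Function.comp_apply, Term.subst, PolyExpr.subst_inst (hL j i)]
    rw [ha i fun z hz h => he z hz (by
      simp only [Term.fv, Finset.mem_biUnion]; exact ⟨i, Finset.mem_univ _, h⟩)]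
  | diff e _ => rfl

theorem lieN_rename (hL : L.Closed) (hs : s.WF) {V : Finset Var} (hz : FreshVec s V zs)
    {e : Term L.k L.r} (he : ∀ z ∈ zs, Var.base z ∉ e.fv) (n : ℕ) :
    (lieN L s.neg n e).subst (rename s.vars zs) =
      lieN L (s.adjoint zs) n (e.subst (rename s.vars zs)) := by
  induction n with
  | zero => rfl
  | succ n ih =>
    rw [lieN_succ, lieN_succ, ← ih]
    refine lie_rename hL hs hz.1.symm hz.2.1 fun z hz' h => ?_
    rcases Finset.mem_union.1 (fv_lieN hL _ _ _ h) with h | h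
    · exact he z hz' h
    · rw [Sys.rhsFv_neg] at h
      exact hz.notMem_rhsFv z hz' h

/-- Provable identities can be renamed, and the renamed identity for `x' = -f` is an identity for
the adjoint system. Hence ranks chosen along `x' = -f` are usable there. -/
theorem HasRank.rename (hL : L.Closed) (hs : s.WF) {V : Finset Var} (hz : FreshVec s V zs)
    {e : Term L.k L.r} (hed : e.DiffFree) (he : ∀ z ∈ zs, Var.base z ∉ e.fv) {N : ℕ}
    (h : HasRank L s.neg e N) :
    HasRank L (s.adjoint zs) (e.subst (DL.rename s.vars zs)) N := by
  obtain ⟨hN, g, hg, h⟩ := h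
  refine ⟨hN, fun i => (g i).subst (DL.rename s.vars zs), fun i => (hg i).subst
    (diffFree_rename _ _), ?_⟩
  have := Provable.rename (A := QF.cmp Cmp.eq (lieN L s.neg N e)
      (Term.sum ((List.range N).map fun i => Term.mul (g i) (lieN L s.neg i e))))
    ⟨hed.lieN hL hs.neg N, Term.diffFree_sum fun t ht => ?_⟩ hz.length_eq hs.1 hz.notMem_vars h
  · simp only [QF.subst, Term.subst_sum, List.map_map, lieN_rename hL hs hz he] at this
    refine Eq.mp ?_ this
    simp only [QF.toF, Fml.eq, Function.comp_def, Term.subst, lieN_rename hL hs hz he]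
  · obtain ⟨i, -, rfl⟩ := List.mem_map.1 ht
    exact ⟨hg i, hed.lieN hL hs.neg i⟩

theorem radical_rename (hL : L.Closed) (hs : s.WF) {V : Finset Var} (hz : FreshVec s V zs)
    {e : Term L.k L.r} (he : ∀ z ∈ zs, Var.base z ∉ e.fv) (N : ℕ) :
    (radical L s.neg N e).subst (rename s.vars zs) =
      radical L (s.adjoint zs) N (e.subst (rename s.vars zs)) := by
  simp only [radical, QF.subst_conj, List.map_map, Function.comp_def, QF.eqZ, QF.subst,
    lieN_rename hL hs hz he, Term.subst]

theorem progGt_rename (hL : L.Closed) (hs : s.WF) {V : Finset Var} (hz : FreshVec s V zs)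
    {e : Term L.k L.r} (he : ∀ z ∈ zs, Var.base z ∉ e.fv) (N : ℕ) :
    (progGt L s.neg N e).subst (rename s.vars zs) =
      progGt L (s.adjoint zs) N (e.subst (rename s.vars zs)) := by
  simp only [progGt, QF.subst_conj, List.map_map, Function.comp_def, QF.geZ, QF.gtZ, QF.imp,
    QF.subst, lieN_rename hL hs hz he, Term.subst, radical_rename hL hs hz he]

theorem prog_rename (hL : L.Closed) (hs : s.WF) {V : Finset Var} (hz : FreshVec s V zs)
    {D : DNF L.k L.r} (he : ∀ e, D.Mem e → ∀ z ∈ zs, Var.base z ∉ e.fv)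
    (ρ : Term L.k L.r → ℕ) : (prog L s.neg ρ D).subst (rename s.vars zs) =
      progWith L (s.adjoint zs) (fun e => e.subst (rename s.vars zs)) ρ D := by
  simp only [prog, progWith, QF.subst_disj, List.map_map, Function.comp_def, QF.subst,
    QF.subst_conj]
  congr 1
  refine List.map_congr_left fun p hp => ?_
  congr 2
  · refine List.map_congr_left fun e h => ?_
    have := he e ⟨p, hp, Or.inl h⟩
    rw [progGe, progGe, QF.subst, progGt_rename hL hs hz this, radical_rename hL hs hz this]
  · refine List.map_congr_left fun e h => ?_
    exact progGt_rename hL hs hz (he e ⟨p, hp, Or.inr h⟩) _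

theorem DNF.subst_toQF {k r : ℕ} (D : DNF k r) (σ : Var → Term k r) :
    D.toQF.subst σ = D.toQFWith fun e => e.subst σ := by
  simp only [DNF.toQF, DNF.toQFWith, QF.subst_disj, List.map_map, Function.comp_def, QF.subst,
    QF.subst_conj, QF.geZ, QF.gtZ, Term.subst]

theorem QF.fv_subset_conj {k r : ℕ} {l : List (QF k r)} {A : QF k r} (h : A ∈ l) :
    A.fv ⊆ (QF.conj l).fv := by
  induction l with
  | nil => simp at h
  | cons B l ih =>
    rcases List.mem_cons.1 h with rfl | h
    · exact Finset.subset_union_left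
    · exact (ih h).trans Finset.subset_union_right

theorem QF.fv_subset_disj {k r : ℕ} {l : List (QF k r)} {A : QF k r} (h : A ∈ l) :
    A.fv ⊆ (QF.disj l).fv := by
  induction l with
  | nil => simp at h
  | cons B l ih =>
    rcases List.mem_cons.1 h with rfl | h
    · exact Finset.subset_union_left
    · exact (ih h).trans Finset.subset_union_right

theorem DNF.Mem.fv_subset {k r : ℕ} {D : DNF k r} {e : Term k r} (h : D.Mem e) :
    e.fv ⊆ D.toQF.fv := by
  obtain ⟨p, hp, h⟩ := h
  refine subset_trans ?_ (QF.fv_subset_disj (List.mem_map_of_mem hp))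
  rcases h with h | h
  · refine subset_trans ?_ Finset.subset_union_left
    refine subset_trans ?_ (QF.fv_subset_conj (List.mem_map_of_mem h))
    exact Finset.subset_union_left
  · refine subset_trans ?_ Finset.subset_union_right
    refine subset_trans ?_ (QF.fv_subset_conj (List.mem_map_of_mem h))
    exact Finset.subset_union_left

theorem DNF.DiffFree.of_mem {k r : ℕ} {D : DNF k r} (hD : D.DiffFree) {e : Term k r}
    (h : D.Mem e) : e.DiffFree := by
  obtain ⟨p, hp, h⟩ := h
  exact h.elim ((hD p hp).1 e) ((hD p hp).2 e)

theorem QF.diffFree_conj {k r : ℕ} {l : List (QF k r)} (h : ∀ A ∈ l, A.DiffFree) :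
    (QF.conj l).DiffFree := by
  induction l with
  | nil => exact ⟨trivial, trivial⟩
  | cons B l ih => exact ⟨h B (by simp), ih fun A hA => h A (by simp [hA])⟩

theorem QF.diffFree_disj {k r : ℕ} {l : List (QF k r)} (h : ∀ A ∈ l, A.DiffFree) :
    (QF.disj l).DiffFree := by
  induction l with
  | nil => exact ⟨trivial, trivial⟩
  | cons B l ih => exact ⟨h B (by simp), ih fun A hA => h A (by simp [hA])⟩

theorem DNF.DiffFree.toQF {k r : ℕ} {D : DNF k r} (hD : D.DiffFree) : D.toQF.DiffFree := by
  refine QF.diffFree_disj fun A hA => ?_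
  obtain ⟨p, hp, rfl⟩ := List.mem_map.1 hA
  refine ⟨QF.diffFree_conj fun B hB => ?_, QF.diffFree_conj fun B hB => ?_⟩
  · obtain ⟨e, he, rfl⟩ := List.mem_map.1 hB
    exact ((hD p hp).1 e he).geZ
  · obtain ⟨e, he, rfl⟩ := List.mem_map.1 hB
    exact ((hD p hp).2 e he).gtZ

theorem diffFree_radical (hL : L.Closed) (hs : s.WF) {e : Term L.k L.r} (he : e.DiffFree)
    (N : ℕ) : (radical L s N e).DiffFree := by
  refine QF.diffFree_conj fun A hA => ?_
  obtain ⟨i, -, rfl⟩ := List.mem_map.1 hA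
  exact (he.lieN hL hs i).eqZ

theorem diffFree_progGt (hL : L.Closed) (hs : s.WF) {e : Term L.k L.r} (he : e.DiffFree)
    (N : ℕ) : (progGt L s N e).DiffFree := by
  refine ⟨QF.diffFree_conj fun A hA => ?_, diffFree_radical hL hs he _,
    (he.lieN hL hs _).gtZ⟩
  obtain ⟨i, -, rfl⟩ := List.mem_map.1 hA
  exact ⟨diffFree_radical hL hs he _, (he.lieN hL hs _).geZ⟩

theorem diffFree_prog (hL : L.Closed) (hs : s.WF) {D : DNF L.k L.r} (hD : D.DiffFree)
    (ρ : Term L.k L.r → ℕ) : (prog L s ρ D).DiffFree := by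
  refine QF.diffFree_disj fun A hA => ?_
  obtain ⟨p, hp, rfl⟩ := List.mem_map.1 hA
  refine ⟨QF.diffFree_conj fun B hB => ?_, QF.diffFree_conj fun B hB => ?_⟩
  · obtain ⟨e, he, rfl⟩ := List.mem_map.1 hB
    exact ⟨diffFree_progGt hL hs ((hD p hp).1 e he) _,
      diffFree_radical hL hs ((hD p hp).1 e he) _⟩
  · obtain ⟨e, he, rfl⟩ := List.mem_map.1 hB
    exact diffFree_progGt hL hs ((hD p hp).2 e he) _

end LieRename

/-! ### Progress conditions in the original variables, for systems with a clock. -/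

section ClockFree

variable {L : Lang} {s : Sys L.k L.r} {ys zs : List ℕ} {P Q : QF L.k L.r} {χ : Fml L.k L.r}
  {D DP DN DQ : DNF L.k L.r} {ρ ρ' : Term L.k L.r → ℕ}

theorem IsNormalForm.decides_prog (hL : L.Closed) (hs : s.WF) (hc : s.HasClock)
    (hy : FreshVec s ∅ ys) (hP : P.DiffFree) (hD : IsNormalForm L P D)
    (hρ : ∀ e, D.Mem e → HasRank L s e (ρ e)) : Decides L s ys (prog L s ρ D) P :=
  (decides_progWith (τ := id) hL hs hc hy fun e he => ⟨hD.1.of_mem he, hρ e he⟩).congr hs hP hD.2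

theorem IsNormalForm.decides_prog_rename (hL : L.Closed) (hs : s.WF) (hc : s.HasClock)
    {V : Finset Var} (hz : FreshVec s V zs) (hV : D.toQF.fv ⊆ V)
    (hy : FreshVec (s.adjoint zs) ∅ ys) (hP : P.DiffFree) (hD : IsNormalForm L P D)
    (hρ : ∀ e, D.Mem e → HasRank L s.neg e (ρ e)) :
    Decides L (s.adjoint zs) ys ((prog L s.neg ρ D).subst (rename s.vars zs))
      (P.subst (rename s.vars zs)) := by
  have hf : ∀ e, D.Mem e → ∀ z ∈ zs, Var.base z ∉ e.fv := fun e he z hz' h =>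
    hz.notMem z hz' (hV (he.fv_subset h))
  rw [prog_rename hL hs hz hf]
  refine (decides_progWith hL (hs.adjoint hz) (hc.adjoint hz) hy fun e he =>
    ⟨(hD.1.of_mem he).subst (diffFree_rename _ _),
      (hρ e he).rename hL hs hz (hD.1.of_mem he) (hf e he)⟩).congr (hs.adjoint hz)
      (hP.subst (diffFree_rename _ _)) ?_
  rw [← DNF.subst_toQF]
  exact Provable.rename (A := QF.and (QF.imp P D.toQF) (QF.imp D.toQF P))
    ⟨⟨hP, hD.1.toQF⟩, hD.1.toQF, hP⟩ hz.length_eq hs.1 hz.notMem_vars hD.2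

theorem provable_box_of_progress_of_clock (hL : L.Closed) (hs : s.WF) (hc : s.HasClock)
    (hP : P.DiffFree) (hQ : Q.DiffFree) (hDP : IsNormalForm L P DP)
    (hDN : IsNormalForm L P.not DN) (hDQ : IsNormalForm L Q DQ)
    (hρP : ∀ e, DP.Mem e → HasRank L s e (ρ e)) (hρQ : ∀ e, DQ.Mem e → HasRank L s e (ρ e))
    (hρN : ∀ e, DN.Mem e → HasRank L s.neg e (ρ' e))
    (hρQ' : ∀ e, DQ.Mem e → HasRank L s.neg e (ρ' e))
    (hχx : ∀ x ∈ s.vars, Var.base x ∉ χ.fv) (hχp : ∀ z, Var.prime z ∉ χ.fv)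
    (h₁ : Provable L (χ.imp
      (QF.imp (QF.and P (QF.and Q (prog L s ρ DQ))) (prog L s ρ DP)).toF))
    (h₂ : Provable L (χ.imp
      (QF.imp (QF.and P.not (QF.and Q (prog L s.neg ρ' DQ))) (prog L s.neg ρ' DN)).toF)) :
    Provable L (χ.imp (P.toF.imp (Fml.box (Act.ode s Q) P.toF))) := by
  obtain ⟨zs, hz⟩ := exists_freshVec s (P.fv ∪ Q.fv ∪ DQ.toQF.fv ∪ DN.toQF.fv ∪ χ.fv)
  refine provable_box_of_progress hs hc hP hQ hχx hχp (hz.mono fun v hv => ?_)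
    (fun z hz' h => hz.notMem z hz' (Finset.mem_union_right _ h))
    (fun ys hy => hDP.decides_prog hL hs hc hy hP hρP)
    (fun ys hy => hDQ.decides_prog hL hs hc hy hQ hρQ)
    (fun ys hy => hDQ.decides_prog_rename hL hs hc hz (fun v hv => ?_) hy hQ hρQ')
    (fun ys hy => hDN.decides_prog_rename hL hs hc hz (fun v hv => ?_) hy hP hρN)
    -- The backward condition is given in the variables `x` and needed in the variables `z`. Since
    -- `χ` does not mention `x`, it can be renamed.
    (h₁.val₁ fun ρ v => ?_) ((Provable.imp_rename (A := QF.imp (QF.and P.not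
      (QF.and Q (prog L s.neg ρ' DQ))) (prog L s.neg ρ' DN)) ⟨⟨hP, hQ, ?_⟩, ?_⟩ hz.length_eq hs.1
      hz.notMem_vars hχx h₂).val₁ fun ρ v => ?_)
  · simp only [Finset.mem_union] at hv ⊢; tauto
  · simp only [Finset.mem_union] at hv ⊢; tauto
  · simp only [Finset.mem_union] at hv ⊢; tauto
  · simp only [Fml.val_imp, Fml.val_toF, QF.val_imp, QF.val_and]; tauto
  · exact diffFree_prog hL hs.neg hDQ.1 _
  · exact diffFree_prog hL hs.neg hDN.1 _
  · simp only [Fml.val_imp, Fml.val_toF, QF.val_or, QF.val_and, QF.subst, QF.imp, QF.val_not]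
    tauto

theorem provable_progress_of_box_of_clock (hL : L.Closed) (hs : s.WF) (hc : s.HasClock)
    (hP : P.DiffFree) (hQ : Q.DiffFree) (hDP : IsNormalForm L P DP)
    (hDN : IsNormalForm L P.not DN) (hDQ : IsNormalForm L Q DQ)
    (hρP : ∀ e, DP.Mem e → HasRank L s e (ρ e)) (hρQ : ∀ e, DQ.Mem e → HasRank L s e (ρ e))
    (hρN : ∀ e, DN.Mem e → HasRank L s.neg e (ρ' e))
    (hρQ' : ∀ e, DQ.Mem e → HasRank L s.neg e (ρ' e))
    (hχx : ∀ x ∈ s.vars, Var.base x ∉ χ.fv)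
    (h : Provable L (χ.imp (P.toF.imp (Fml.box (Act.ode s Q) P.toF)))) :
    Provable L (χ.imp
      (QF.imp (QF.and P (QF.and Q (prog L s ρ DQ))) (prog L s ρ DP)).toF) ∧
    Provable L (χ.imp
      (QF.imp (QF.and P.not (QF.and Q (prog L s.neg ρ' DQ))) (prog L s.neg ρ' DN)).toF) := by
  constructor
  · refine h.val₂ (provable_progress_of_box hs hP hQ
      (fun ys hy => hDP.decides_prog hL hs hc hy hP hρP)
      (fun ys hy => hDQ.decides_prog hL hs hc hy hQ hρQ)) fun ρ v => ?_
    simp only [Fml.val_imp, Fml.val_toF, QF.val_imp, QF.val_and]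
    exact fun a₁ a₂ a₃ a₄ => a₂ (a₁ a₃ a₄.1) a₄.2.1 a₄.2.2
  -- The copies avoid the progress formulas as well, so that the condition obtained for `z` can be
  -- renamed back to `x`.
  · obtain ⟨zs, hz⟩ := exists_freshVec s (P.fv ∪ Q.fv ∪ DQ.toQF.fv ∪ DN.toQF.fv ∪ χ.fv ∪
      (prog L s.neg ρ' DQ).fv ∪ (prog L s.neg ρ' DN).fv)
    have hPN : (prog L s.neg ρ' DN).DiffFree := diffFree_prog hL hs.neg hDN.1 _
    have hPQ : (prog L s.neg ρ' DQ).DiffFree := diffFree_prog hL hs.neg hDQ.1 _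
    refine Provable.of_imp_rename (xs := s.vars) (ys := zs) ⟨⟨hP, hQ, hPQ⟩, hPN⟩ hz.length_eq
      hz.2.1 hz.notMem_vars (fun z hz' h' => hz.notMem z hz' ?_)
      (fun z hz' h' => hz.notMem z hz' ?_)
      ((provable_adjoint_progress_of_box hs hP hQ hχx (hz.mono fun v hv => ?_)
      (fun ys hy => hDQ.decides_prog_rename hL hs hc hz (fun v hv => ?_) hy hQ hρQ')
      (fun ys hy => hDN.decides_prog_rename hL hs hc hz (fun v hv => ?_) hy hP hρN) h).val₁
        fun ρ v => ?_)
    · simp only [Finset.mem_union]; tauto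
    · simp only [QF.imp, QF.fv, Finset.mem_union] at h' ⊢; tauto
    · simp only [Finset.mem_union] at hv ⊢; tauto
    · simp only [Finset.mem_union] at hv ⊢; tauto
    · simp only [Finset.mem_union] at hv ⊢; tauto
    · simp only [Fml.val_imp, Fml.val_toF, QF.val_or, QF.val_and, QF.subst, QF.imp, QF.val_not]
      tauto

end ClockFree

end DL

namespace DL

/-! ### Progress formulas do not see a fresh clock. -/

section Append

variable {L : Lang} {s : Sys L.k L.r} {y : ℕ}

theorem hasRank_append (hL : L.Closed) {e : Term L.k L.r} (he : Var.base y ∉ e.fv)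
    (hy : Var.base y ∉ s.rhsFv) (b : Term L.k L.r) (N : ℕ) :
    HasRank L (s ++ [(y, b)]) e N ↔ HasRank L s e N := by
  simp only [HasRank, lieN_append hL he hy]

theorem radical_append (hL : L.Closed) {e : Term L.k L.r} (he : Var.base y ∉ e.fv)
    (hy : Var.base y ∉ s.rhsFv) (b : Term L.k L.r) (N : ℕ) :
    radical L (s ++ [(y, b)]) N e = radical L s N e := by
  simp only [radical, lieN_append hL he hy]

theorem progGt_append (hL : L.Closed) {e : Term L.k L.r} (he : Var.base y ∉ e.fv)
    (hy : Var.base y ∉ s.rhsFv) (b : Term L.k L.r) (N : ℕ) :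
    progGt L (s ++ [(y, b)]) N e = progGt L s N e := by
  simp only [progGt, radical_append hL he hy, lieN_append hL he hy]

theorem prog_append (hL : L.Closed) {D : DNF L.k L.r} (hD : Var.base y ∉ D.toQF.fv)
    (hy : Var.base y ∉ s.rhsFv) (b : Term L.k L.r) (ρ : Term L.k L.r → ℕ) :
    prog L (s ++ [(y, b)]) ρ D = prog L s ρ D := by
  have he : ∀ e, D.Mem e → Var.base y ∉ e.fv := fun e he h => hD (he.fv_subset h)
  simp only [prog]
  congr 1
  refine List.map_congr_left fun p hp => ?_
  congr 2
  · refine List.map_congr_left fun e h => ?_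
    have := he e ⟨p, hp, Or.inl h⟩
    rw [progGe, progGe, progGt_append hL this hy, radical_append hL this hy]
  · exact List.map_congr_left fun e h => progGt_append hL (he e ⟨p, hp, Or.inr h⟩) hy _ _

theorem Sys.neg_append {k r : ℕ} (s : Sys k r) (y : ℕ) (b : Term k r) :
    Sys.neg (s ++ [(y, b)]) = s.neg ++ [(y, b.neg)] := by
  simp [Sys.neg]

theorem exists_fresh_clock (s : Sys L.k L.r) (V : Finset Var) : ∃ y : ℕ, y ∉ s.vars ∧
    Var.base y ∉ s.rhsFv ∧ Var.base y ∉ V ∧ Var.prime (Var.base y) ∉ V := by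
  obtain ⟨y, h, h'⟩ := exists_fresh_one (s.lhs ∪ s.rhsFv ∪ V)
  simp only [Finset.mem_union, not_or, Sys.base_mem_lhs] at h h'
  exact ⟨y, h.1.1, h.1.2, h.2, h'.2⟩

end Append

/-! ### The provable equivalences for arbitrary systems. -/

section Main

variable {L : Lang} {s : Sys L.k L.r} {P Q : QF L.k L.r} {χ : Fml L.k L.r}
  {D DP DN DQ : DNF L.k L.r} {ρ ρ' : Term L.k L.r → ℕ}

theorem IsRankFun.hasRank_append (hL : L.Closed) (hρ : IsRankFun L s ρ) {y : ℕ}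
    (hy : Var.base y ∉ s.rhsFv) (b : Term L.k L.r) (hD : D.DiffFree)
    (hDy : Var.base y ∉ D.toQF.fv) (e : Term L.k L.r) (he : D.Mem e) :
    HasRank L (s ++ [(y, b)]) e (ρ e) :=
  (DL.hasRank_append hL (fun h => hDy (he.fv_subset h)) hy b _).2 (hρ e (hD.of_mem he))

/-- Provable completeness of the progress conditions for invariance, below a formula that does not
depend on the evolving variables. -/
theorem provable_box_iff_progress (hL : L.Closed) (hs : s.WF)
    (hP : P.DiffFree) (hQ : Q.DiffFree) (hDP : IsNormalForm L P DP)
    (hDN : IsNormalForm L P.not DN) (hDQ : IsNormalForm L Q DQ) (hρ : IsRankFun L s ρ)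
    (hρ' : IsRankFun L s.neg ρ')
    (hχx : ∀ x ∈ s.vars, Var.base x ∉ χ.fv) (hχp : ∀ z, Var.prime z ∉ χ.fv) :
    Provable L (χ.imp (P.toF.imp (Fml.box (Act.ode s Q) P.toF))) ↔
    Provable L (χ.imp
      (QF.imp (QF.and P (QF.and Q (prog L s ρ DQ))) (prog L s ρ DP)).toF) ∧
    Provable L (χ.imp
      (QF.imp (QF.and P.not (QF.and Q (prog L s.neg ρ' DQ))) (prog L s.neg ρ' DN)).toF) := by
  obtain ⟨y, hy, hyr, hyV, -⟩ := exists_fresh_clock s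
    (P.fv ∪ Q.fv ∪ DP.toQF.fv ∪ DN.toQF.fv ∪ DQ.toQF.fv ∪ χ.fv)
  simp only [Finset.mem_union, not_or] at hyV
  obtain ⟨⟨⟨⟨⟨hyP, hyQ⟩, hyDP⟩, hyDN⟩, hyDQ⟩, hyχ⟩ := hyV
  have hyr' : Var.base y ∉ s.neg.rhsFv := by rwa [Sys.rhsFv_neg]
  -- The clock changes neither the box nor the ranks and progress formulas, in either direction of
  -- time, so the equivalence for the clocked system is the one for `s`.
  have hb := provable_box_clock (φ := P.toF) hs hQ hy
    (by simp only [Finset.mem_union, not_or, QF.fv_toF]; exact ⟨⟨hyr, hyQ⟩, hyP⟩)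
    (by rw [QF.fv_toF]; exact hP.prime_notMem _)
  have hχ : ∀ x ∈ (s.clock y).vars, Var.base x ∉ χ.fv := by
    intro x hx
    rw [Sys.clock, Sys.vars_ghost, List.mem_append, List.mem_singleton] at hx
    rcases hx with hx | rfl
    · exact hχx x hx
    · exact hyχ
  have e₁ : ∀ D : DNF L.k L.r, Var.base y ∉ D.toQF.fv →
      prog L (s.clock y) ρ D = prog L s ρ D := fun D hD => prog_append hL hD hyr _ _
  have hn : (s.clock y).neg = s.neg ++ [(y, Term.neg _)] := Sys.neg_append _ _ _
  have e₂ : ∀ D : DNF L.k L.r, Var.base y ∉ D.toQF.fv →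
      prog L (s.clock y).neg ρ' D = prog L s.neg ρ' D := fun D hD => by
    rw [hn]; exact prog_append hL hD hyr' _ _
  have r₁ : ∀ D : DNF L.k L.r, D.DiffFree → Var.base y ∉ D.toQF.fv →
      ∀ e, D.Mem e → HasRank L (s.clock y) e (ρ e) := fun D hD hDy =>
    hρ.hasRank_append hL hyr _ hD hDy
  have r₂ : ∀ D : DNF L.k L.r, D.DiffFree → Var.base y ∉ D.toQF.fv →
      ∀ e, D.Mem e → HasRank L (s.clock y).neg e (ρ' e) := fun D hD hDy => by
    rw [hn]; exact hρ'.hasRank_append hL hyr' _ hD hDy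
  rw [← e₁ DQ hyDQ, ← e₁ DP hyDP, ← e₂ DQ hyDQ, ← e₂ DN hyDN]
  constructor
  · intro h
    refine provable_progress_of_box_of_clock hL (hs.clock hy) (s.hasClock_clock y) hP hQ hDP hDN
      hDQ (r₁ DP hDP.1 hyDP) (r₁ DQ hDQ.1 hyDQ) (r₂ DN hDN.1 hyDN) (r₂ DQ hDQ.1 hyDQ) hχ
      (h.val₂ hb fun ρ v => ?_)
    simp only [Fml.val_imp, Fml.val_iff]; exact fun a₁ a₂ a₃ a₄ => a₂.1 (a₁ a₃ a₄)
  · rintro ⟨h₁, h₂⟩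
    refine (provable_box_of_progress_of_clock hL (hs.clock hy) (s.hasClock_clock y) hP hQ hDP hDN
      hDQ (r₁ DP hDP.1 hyDP) (r₁ DQ hDQ.1 hyDQ) (r₂ DN hDN.1 hyDN) (r₂ DQ hDQ.1 hyDQ) hχ hχp
      h₁ h₂).val₂ hb fun ρ v => ?_
    simp only [Fml.val_imp, Fml.val_iff]; exact fun a₁ a₂ a₃ a₄ => a₂.2 (a₁ a₃ a₄)

/-- The preceding result only relates provability under a hypothesis `χ` that is constant along the
system. Choosing for `χ` each side of the equivalence in turn, closed under quantifiers over `x`,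
makes its premise trivial and gives the equivalence inside the calculus. -/
theorem provable_invariant_iff_progress (hL : L.Closed) (hs : s.WF)
    (hP : P.DiffFree) (hQ : Q.DiffFree) (hDP : IsNormalForm L P DP)
    (hDN : IsNormalForm L P.not DN) (hDQ : IsNormalForm L Q DQ) (hρ : IsRankFun L s ρ)
    (hρ' : IsRankFun L s.neg ρ') :
    Provable L (Fml.iff
      (Fml.allVec s.vars (Fml.imp P.toF (Fml.box (Act.ode s Q) P.toF)))
      (Fml.and
        (Fml.allVec s.vars
          (QF.imp (QF.and P (QF.and Q (prog L s ρ DQ))) (prog L s ρ DP)).toF)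
        (Fml.allVec s.vars
          (QF.imp (QF.and P.not (QF.and Q (prog L s.neg ρ' DQ))) (prog L s.neg ρ' DN)).toF))) := by
  set B₁ := QF.imp (QF.and P (QF.and Q (prog L s ρ DQ))) (prog L s ρ DP) with hB₁
  set B₂ := QF.imp (QF.and P.not (QF.and Q (prog L s.neg ρ' DQ))) (prog L s.neg ρ' DN) with hB₂
  have d₁ : B₁.DiffFree := ⟨⟨hP, hQ, diffFree_prog hL hs hDQ.1 _⟩, diffFree_prog hL hs hDP.1 _⟩
  have d₂ : B₂.DiffFree :=
    ⟨⟨hP, hQ, diffFree_prog hL hs.neg hDQ.1 _⟩, diffFree_prog hL hs.neg hDN.1 _⟩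
  have hvx : ∀ φ : Fml L.k L.r, ∀ x ∈ s.vars, Var.base x ∉ (Fml.allVec s.vars φ).fv :=
    fun φ x hx h => by
      rw [Fml.fv_allVec, Finset.mem_sdiff] at h
      exact h.2 (by simp [hx])
  have hvp : ∀ φ : Fml L.k L.r, (∀ z, Var.prime z ∉ φ.fv) →
      ∀ z, Var.prime z ∉ (Fml.allVec s.vars φ).fv := fun φ hφ z h => by
    rw [Fml.fv_allVec, Finset.mem_sdiff] at h
    exact hφ z h.1
  have m₁ := (provable_box_iff_progress (χ := Fml.allVec s.vars
    (Fml.imp P.toF (Fml.box (Act.ode s Q) P.toF))) hL hs hP hQ hDP hDN hDQ hρ hρ' (hvx _)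
    (hvp _ fun z => by
      rw [Fml.fv_imp, Finset.mem_union, not_or]
      have : ∀ z, Var.prime z ∉ P.toF.fv := fun z => by rw [QF.fv_toF]; exact hP.prime_notMem z
      exact ⟨this z, prime_notMem_fv_box hs hQ this z⟩)).1
    (provable_allVec_self s.vars _)
  have m₂ := (provable_box_iff_progress (χ := Fml.and (Fml.allVec s.vars B₁.toF)
    (Fml.allVec s.vars B₂.toF)) hL hs hP hQ hDP hDN hDQ hρ hρ'
    (fun x hx => by
      rw [Fml.fv, Finset.mem_union, not_or]; exact ⟨hvx _ x hx, hvx _ x hx⟩)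
    (fun z => by
      rw [Fml.fv, Finset.mem_union, not_or]
      exact ⟨hvp _ (fun z => by rw [QF.fv_toF]; exact d₁.prime_notMem z) z,
        hvp _ (fun z => by rw [QF.fv_toF]; exact d₂.prime_notMem z) z⟩)).2
    ⟨(provable_allVec_self s.vars B₁.toF).val₁ fun ρ v => by
      simp only [Fml.val_imp, Fml.val_and]; exact fun a₁ a₂ => a₁ a₂.1,
    (provable_allVec_self s.vars B₂.toF).val₁ fun ρ v => by
      simp only [Fml.val_imp, Fml.val_and]; exact fun a₁ a₂ => a₁ a₂.2⟩
  refine (Provable.allVec_intro (hvx _) m₁.1).val₃ (Provable.allVec_intro (hvx _) m₁.2)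
    (Provable.allVec_intro (xs := s.vars) (fun x hx => ?_) m₂) fun ρ v => ?_
  · rw [Fml.fv, Finset.mem_union, not_or]; exact ⟨hvx _ x hx, hvx _ x hx⟩
  · simp only [Fml.val_imp, Fml.val_and, Fml.val_iff]
    exact fun a₁ a₂ a₃ => ⟨fun h => ⟨a₁ h, a₂ h⟩, a₃⟩

theorem provable_invariant_iff_progress_tru (hL : L.Closed) (hs : s.WF)
    (hP : P.DiffFree) (hDP : IsNormalForm L P DP) (hDN : IsNormalForm L P.not DN)
    (hρ : IsRankFun L s ρ) (hρ' : IsRankFun L s.neg ρ') :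
    Provable L (Fml.iff
      (Fml.allVec s.vars (Fml.imp P.toF (Fml.box (Act.ode s QF.tru) P.toF)))
      (Fml.and
        (Fml.allVec s.vars (QF.imp P (prog L s ρ DP)).toF)
        (Fml.allVec s.vars (QF.imp P.not (prog L s.neg ρ' DN)).toF))) := by
  -- A single empty conjunction is a normal form of truth, and its progress formula is true, so the
  -- domain conditions disappear.
  have ht : IsNormalForm L QF.tru [([], [])] := isNormalForm_of_val
    ⟨fun p hp => by simp only [List.mem_singleton] at hp; subst hp; simp, fun ρ => by
      simp [DNF.val_toQF]⟩
  have hv : ∀ (s : Sys L.k L.r) (ρ : Term L.k L.r → ℕ) (ρ₀ : Term L.k L.r → ℝ),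
      (prog L s ρ [([], [])]).val ρ₀ := fun s ρ ρ₀ => by
    simp [prog, QF.disj, QF.conj]
  have hm : ∀ A T F : QF L.k L.r, (∀ ρ₀, T.val ρ₀) → Provable L (Fml.iff
      (Fml.allVec s.vars (QF.imp (QF.and A (QF.and QF.tru T)) F).toF)
      (Fml.allVec s.vars (QF.imp A F).toF)) := fun A T F hT => by
    refine (Provable.allVec_mono (xs := s.vars)
      (φ := (QF.imp (QF.and A (QF.and QF.tru T)) F).toF) (ψ := (QF.imp A F).toF)
      (Provable.val₀ fun ρ₀ v => ?_)).val₂ (Provable.allVec_mono (xs := s.vars)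
      (φ := (QF.imp A F).toF) (ψ := (QF.imp (QF.and A (QF.and QF.tru T)) F).toF)
      (Provable.val₀ fun ρ₀ v => ?_)) fun ρ₀ v a₁ a₂ => ⟨a₁, a₂⟩
    · simp only [Fml.val_imp, Fml.val_toF, QF.val_imp, QF.val_and]
      exact fun h h' => h ⟨h', QF.val_tru _, hT _⟩
    · simp only [Fml.val_imp, Fml.val_toF, QF.val_imp, QF.val_and]
      exact fun h h' => h h'.1
  refine (provable_invariant_iff_progress hL hs hP (Q := QF.tru) ⟨trivial, trivial⟩ hDP hDN ht hρ
    hρ').val₃ (hm P _ (prog L s ρ DP) (hv s ρ)) (hm P.not _ (prog L s.neg ρ' DN) (hv s.neg ρ'))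
    fun ρ₀ v a₁ a₂ a₃ => ?_
  simp only [Fml.val_and, Fml.val_iff] at a₁ a₂ a₃ ⊢
  rw [a₁, a₂, a₃]

theorem provable_analytic_iff_of_strict (hL : L.Closed) (hs : s.WF) {e : Term L.k L.r} {N : ℕ}
    (hP : P.DiffFree) (he : e.DiffFree) (hPe : Provable L (Fml.iff P.toF (QF.eqZ e).toF))
    (hN : HasRank L s e N) (hQ : Q.DiffFree) (hQs : Q.Strict) :
    Provable L (Fml.iff (Fml.box (Act.ode s Q) P.toF) (QF.imp Q (radical L s N e)).toF) := by
  obtain ⟨y, hy, hyr, hyV, -⟩ := exists_fresh_clock s (P.fv ∪ Q.fv ∪ e.fv)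
  simp only [Finset.mem_union, not_or] at hyV
  obtain ⟨⟨hyP, hyQ⟩, hye⟩ := hyV
  have hb := provable_box_clock (φ := P.toF) hs hQ hy
    (by simp only [Finset.mem_union, not_or, QF.fv_toF]; exact ⟨⟨hyr, hyQ⟩, hyP⟩)
    (by rw [QF.fv_toF]; exact hP.prime_notMem _)
  -- For an open domain `Q` itself can play the role of the progress formula.
  have h₁ := provable_radical_of_box (F := Q) hL (hs.clock hy) (s.hasClock_clock y) hQ he hPe
    ((hasRank_append hL hye hyr _ N).2 hN) fun ys hys =>
      Strict.provable_prg (hs.clock hy) (s.hasClock_clock y) hys hQ hQs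
  rw [show radical L (s.clock y) N e = radical L s N e from radical_append hL hye hyr _ N] at h₁
  refine h₁.val₄ hb (hN.provable_box_of_radical (Q := Q) hL hs hQ he hPe)
    (provable_box_dom_or (φ := P.toF) hs hQ (hP.disjoint_primes s)) fun ρ v => ?_
  simp only [Fml.val_imp, Fml.val_iff, Fml.val_toF, QF.val_imp]
  exact fun a₁ a₂ a₃ a₄ => ⟨fun h h' => a₁ (a₂.1 h) h' h', fun h => a₄ fun h' => a₃ (h h')⟩

/-- Three cases: outside `Q` the box is vacuous; inside `Q` with progress it amounts to the radical;
inside `Q` without progress it amounts to `e = 0` now. -/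
theorem provable_analytic_iff (hL : L.Closed) (hs : s.WF) {e : Term L.k L.r} {N : ℕ}
    (hP : P.DiffFree) (he : e.DiffFree) (hPe : Provable L (Fml.iff P.toF (QF.eqZ e).toF))
    (hN : HasRank L s e N) (hQ : Q.DiffFree) (hDQ : IsNormalForm L Q DQ)
    (hρ : IsRankFun L s ρ) :
    Provable L (Fml.iff (Fml.box (Act.ode s Q) P.toF)
      (QF.imp Q (QF.and (QF.eqZ e) (QF.imp (prog L s ρ DQ) (radical L s N e)))).toF) := by
  obtain ⟨y, hy, hyr, hyV, -⟩ := exists_fresh_clock s (P.fv ∪ Q.fv ∪ e.fv ∪ DQ.toQF.fv)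
  simp only [Finset.mem_union, not_or] at hyV
  obtain ⟨⟨⟨hyP, hyQ⟩, hye⟩, hyD⟩ := hyV
  have hb := provable_box_clock (φ := P.toF) hs hQ hy
    (by simp only [Finset.mem_union, not_or, QF.fv_toF]; exact ⟨⟨hyr, hyQ⟩, hyP⟩)
    (by rw [QF.fv_toF]; exact hP.prime_notMem _)
  have hd : ∀ ys, FreshVec (s.clock y) ∅ ys → Decides L (s.clock y) ys (prog L s ρ DQ) Q := by
    intro ys hys
    have := hDQ.decides_prog hL (hs.clock hy) (s.hasClock_clock y) hys hQ
      (hρ.hasRank_append hL hyr _ hDQ.1 hyD)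
    rwa [show prog L (s.clock y) ρ DQ = prog L s ρ DQ from prog_append hL hyD hyr _ _] at this
  have h₁ := provable_radical_of_box hL (hs.clock hy) (s.hasClock_clock y) hQ he hPe
    ((hasRank_append hL hye hyr _ N).2 hN) fun ys hys => (hd ys hys).pos
  rw [show radical L (s.clock y) N e = radical L s N e from radical_append hL hye hyr _ N] at h₁
  have h₂ := provable_box_of_not_progress (hs.clock hy) hP hQ hd
  refine Provable.of_list (l := [_, _, _, _, _, _, _]) (List.forall_mem_cons.2 ⟨h₁,
    List.forall_mem_cons.2 ⟨h₂, List.forall_mem_cons.2 ⟨hb, List.forall_mem_cons.2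
    ⟨hN.provable_box_of_radical (Q := Q) hL hs hQ he hPe, List.forall_mem_cons.2
    ⟨provable_box_dom_or (φ := P.toF) hs hQ (hP.disjoint_primes s), List.forall_mem_cons.2
    ⟨provable_box_skip (φ := P.toF) hs hQ (hP.disjoint_primes s),
      List.forall_mem_singleton.2 hPe⟩⟩⟩⟩⟩⟩) fun ρ₀ v H => ?_
  simp only [List.forall_mem_cons] at H
  obtain ⟨a₁, a₂, a₃, a₄, a₅, a₆, a₇, -⟩ := H
  simp only [Fml.val_imp, Fml.val_iff, Fml.val_toF, QF.val_imp, QF.val_and, QF.val_not] at *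
  refine ⟨fun h h' => ⟨a₇.1 (a₆ h h'), a₁ (a₃.1 h) h'⟩, fun h => a₅ fun h' => ?_⟩
  by_cases hp : (prog L s ρ DQ).val ρ₀
  · exact a₄ ((h h').2 hp)
  · exact a₃.2 (a₂ (a₇.2 (h h').1) hp)

end Main

end DL

namespace DL

open Filter Topology

/-! ### Real analysis: the sign of a function after time zero. -/

section FirstDerivative

variable {a : ℕ → ℝ → ℝ}

/-- Induction on the order: applied to the shifted sequence, it makes the derivative positive just
after zero, so the function increases strictly from its value zero. -/
theorem eventually_pos_of_first_pos (ha : ∀ i, ∀ᶠ t in 𝓝 0, HasDerivAt (a i) (a (i + 1) t) t)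
    (k : ℕ) (h₀ : ∀ i < k, a i 0 = 0) (hk : 0 < a k 0) : ∀ᶠ t in 𝓝[>] 0, 0 < a 0 t := by
  induction k generalizing a with
  | zero =>
    exact ((ha 0).self_of_nhds.continuousAt.eventually (lt_mem_nhds hk)).filter_mono
      nhdsWithin_le_nhds
  | succ k ih =>
    have h₁ : ∀ᶠ t in 𝓝[>] 0, 0 < a 1 t :=
      ih (a := fun i => a (i + 1)) (fun i => ha (i + 1)) (fun i hi => h₀ (i + 1) (by omega)) hk
    obtain ⟨δ, hδ, hsub⟩ := mem_nhdsGT_iff_exists_Ioc_subset.1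
      (h₁.and ((ha 0).filter_mono nhdsWithin_le_nhds))
    have hmono : StrictMonoOn (a 0) (Set.Icc 0 δ) := by
      refine strictMonoOn_of_deriv_pos (convex_Icc 0 δ) (fun t ht => ?_) fun t ht => ?_
      · rcases ht.1.eq_or_lt with rfl | h
        · exact (ha 0).self_of_nhds.continuousAt.continuousWithinAt
        · exact (hsub ⟨h, ht.2⟩).2.continuousAt.continuousWithinAt
      · rw [interior_Icc] at ht
        have := hsub ⟨ht.1, ht.2.le⟩
        rw [this.2.deriv]
        exact this.1
    refine mem_of_superset (mem_nhdsGT_iff_exists_Ioc_subset.2 ⟨δ, hδ, subset_rfl⟩) fun t ht => ?_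
    have := hmono ⟨le_rfl, hδ.le⟩ ⟨ht.1.le, ht.2⟩ ht.1
    rwa [h₀ 0 (by omega)] at this

/-- A Grönwall argument: `u = ∑ a_i²` satisfies `u' ≤ K u` near zero, so `u exp(-K t)` is
nonincreasing; it starts at zero and is nonnegative. -/
theorem eventually_eq_zero_of_linear_relation
    (ha : ∀ i, ∀ᶠ t in 𝓝 0, HasDerivAt (a i) (a (i + 1) t) t) {g : ℕ → ℝ → ℝ}
    (hg : ∀ i, ContinuousAt (g i) 0) {N : ℕ} (hN : 1 ≤ N)
    (h : ∀ t, a N t = ∑ i ∈ Finset.range N, g i t * a i t) (h₀ : ∀ i < N, a i 0 = 0) :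
    ∀ᶠ t in 𝓝[>] 0, a 0 t = 0 := by
  set u : ℝ → ℝ := fun t => ∑ i ∈ Finset.range N, a i t * a i t with hu
  -- The last summand `1` is slack: by continuity the coefficient of the estimate stays below `K`
  -- near zero.
  set K : ℝ := 2 + ∑ i ∈ Finset.range N, g i 0 * g i 0 + 1 with hK
  have hc : ContinuousAt (fun t => 2 + ∑ i ∈ Finset.range N, g i t * g i t) 0 :=
    continuousAt_const.add (tendsto_finsetSum _ fun i _ => (hg i).mul (hg i))
  have hle : ∀ᶠ t in 𝓝 0, 2 + ∑ i ∈ Finset.range N, g i t * g i t < K :=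
    hc.eventually (gt_mem_nhds (by simp [hK]))
  have hder : ∀ᶠ t in 𝓝 0, ∀ i ∈ Finset.range N, HasDerivAt (a i) (a (i + 1) t) t :=
    (Finset.eventually_all _).2 fun i _ => ha i
  have hv : ∀ᶠ t in 𝓝 0, ∃ d ≤ 0, HasDerivAt (fun t => u t * Real.exp (-K * t)) d t := by
    filter_upwards [hle, hder] with t h₁ h₂
    have hu' : HasDerivAt u
        (∑ i ∈ Finset.range N, (a (i + 1) t * a i t + a i t * a (i + 1) t)) t :=
      HasDerivAt.fun_sum fun i hi => (h₂ i hi).mul (h₂ i hi)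
    have he : HasDerivAt (fun t => Real.exp (-K * t)) (Real.exp (-K * t) * (-K)) t := by
      simpa using ((hasDerivAt_id t).const_mul (-K)).exp
    refine ⟨_, ?_, hu'.mul he⟩
    have h₃ := sum_mul_succ_le (fun i => a i t) (fun i => g i t) N (h t)
    have h₄ : 0 ≤ u t := Finset.sum_nonneg fun i _ => mul_self_nonneg _
    have h₅ : (2 + ∑ i ∈ Finset.range N, g i t * g i t) * u t ≤ K * u t :=
      mul_le_mul_of_nonneg_right h₁.le h₄
    have h₆ := mul_le_mul_of_nonneg_right (h₃.trans h₅) (Real.exp_pos (-K * t)).le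
    linarith
  obtain ⟨δ, hδ, hsub⟩ := mem_nhdsGT_iff_exists_Ioc_subset.1 (hv.filter_mono nhdsWithin_le_nhds)
  have hanti : AntitoneOn (fun t => u t * Real.exp (-K * t)) (Set.Icc 0 δ) := by
    refine antitoneOn_of_deriv_nonpos (convex_Icc 0 δ) (fun t ht => ?_) (fun t ht => ?_)
      fun t ht => ?_
    · rcases ht.1.eq_or_lt with rfl | h
      · obtain ⟨d, -, hd⟩ := hv.self_of_nhds
        exact hd.continuousAt.continuousWithinAt
      · obtain ⟨d, -, hd⟩ := hsub ⟨h, ht.2⟩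
        exact hd.continuousAt.continuousWithinAt
    · rw [interior_Icc] at ht
      obtain ⟨d, -, hd⟩ := hsub ⟨ht.1, ht.2.le⟩
      exact hd.differentiableAt.differentiableWithinAt
    · rw [interior_Icc] at ht
      obtain ⟨d, hd₀, hd⟩ := hsub ⟨ht.1, ht.2.le⟩
      rwa [hd.deriv]
  refine mem_of_superset (mem_nhdsGT_iff_exists_Ioc_subset.2 ⟨δ, hδ, subset_rfl⟩) fun t ht => ?_
  have h₁ := hanti ⟨le_rfl, hδ.le⟩ ⟨ht.1.le, ht.2⟩ ht.1.le
  have h₂ : u 0 = 0 := Finset.sum_eq_zero fun i hi => by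
    rw [h₀ i (Finset.mem_range.1 hi), mul_zero]
  simp only [h₂, zero_mul] at h₁
  have h₃ : u t ≤ 0 := nonpos_of_mul_nonpos_left h₁ (Real.exp_pos _)
  have h₄ : a 0 t * a 0 t ≤ u t := Finset.single_le_sum (f := fun i => a i t * a i t)
    (fun i _ => mul_self_nonneg _) (Finset.mem_range.2 hN)
  exact mul_self_eq_zero.1 (le_antisymm (h₄.trans h₃) (mul_self_nonneg _))

end FirstDerivative

/-! ### Semantics of terms and existence of solutions. -/

section Semantics

variable {k r : ℕ} {h : Fin r → (Fin k → ℝ) → ℝ}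

theorem Term.eval_eq_evalA (t : Term k r) (ω : State) :
    t.eval h ω = t.evalA fun u => u.eval h ω := by
  induction t with
  | add e f he hf => simp only [Term.eval, Term.evalA, he, hf]
  | mul e f he hf => simp only [Term.eval, Term.evalA, he, hf]
  | _ => rfl

theorem QF.holds_iff_val (A : QF k r) (ω : State) :
    A.holds h ω ↔ A.val fun u => u.eval h ω := by
  induction A with
  | cmp c e f => simp only [QF.holds, QF.val, ← Term.eval_eq_evalA]
  | and P Q hP hQ => simp only [QF.holds, QF.val, hP, hQ]
  | or P Q hP hQ => simp only [QF.holds, QF.val, hP, hQ]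
  | not P hP => simp only [QF.holds, QF.val, hP]

theorem QF.holds_toF (A : QF k r) (ω : State) : A.toF.holds h ω ↔ A.holds h ω := by
  induction A with
  | cmp c e f => rfl
  | and P Q hP hQ => simp only [QF.toF, Fml.holds, QF.holds, hP, hQ]
  | or P Q hP hQ => simp only [QF.toF, Fml.holds, QF.holds, hP, hQ]
  | not P hP => simp only [QF.toF, Fml.holds, QF.holds, hP]

theorem Term.eval_congr {t : Term k r} (ht : t.DiffFree) {ω ν : State}
    (hων : ∀ z ∈ t.fv, ω z = ν z) : t.eval h ω = t.eval h ν := by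
  induction t with
  | var x => exact hων x (by simp [Term.fv])
  | const c => rfl
  | add e f he hf =>
    simp only [Term.eval]
    rw [he ht.1 fun z hz => hων z (Finset.mem_union_left _ hz),
      hf ht.2 fun z hz => hων z (Finset.mem_union_right _ hz)]
  | mul e f he hf =>
    simp only [Term.eval]
    rw [he ht.1 fun z hz => hων z (Finset.mem_union_left _ hz),
      hf ht.2 fun z hz => hων z (Finset.mem_union_right _ hz)]
  | app j a ha =>
    simp only [Term.eval]
    congr 1
    funext i
    exact ha i (ht i) fun z hz => hων z (Finset.mem_biUnion.2 ⟨i, Finset.mem_univ _, hz⟩)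
  | diff e _ => exact ht.elim

theorem Term.DiffFree.eval_congr {t : Term k r} (ht : t.DiffFree) {ω ν : State}
    (hων : ∀ n, ω (Var.base n) = ν (Var.base n)) : t.eval h ω = t.eval h ν :=
  Term.eval_congr ht fun z hz => match z with
    | Var.base n => hων n
    | Var.prime z => (ht.prime_notMem z hz).elim

theorem QF.DiffFree.holds_congr {A : QF k r} (hA : A.DiffFree) {ω ν : State}
    (hων : ∀ n, ω (Var.base n) = ν (Var.base n)) : A.holds h ω ↔ A.holds h ν := by
  induction A with
  | cmp c e f => simp only [QF.holds, hA.1.eval_congr hων, hA.2.eval_congr hων]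
  | and P Q hP hQ => simp only [QF.holds, hP hA.1, hQ hA.2]
  | or P Q hP hQ => simp only [QF.holds, hP hA.1, hQ hA.2]
  | not P hP => simp only [QF.holds, hP hA]

theorem PolyExpr.eval_inst {p : PolyExpr k r} (hp : p.ClosedCoeffs) (a : Fin k → Term k r)
    (ω : State) : (p.inst a).eval h ω = p.eval h fun i => (a i).eval h ω := by
  induction p with
  | arg i => rfl
  | sym j => rfl
  | coef t => exact Term.eval_congr hp.2 fun z hz => by rw [hp.1] at hz; simp at hz
  | add p q h₁ h₂ => simp only [PolyExpr.inst, PolyExpr.eval, Term.eval, h₁ hp.1, h₂ hp.2]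
  | mul p q h₁ h₂ => simp only [PolyExpr.inst, PolyExpr.eval, Term.eval, h₁ hp.1, h₂ hp.2]

theorem Term.eval_sum (l : List (Term k r)) (ω : State) :
    (Term.sum l).eval h ω = (l.map fun t => t.eval h ω).sum := by
  induction l with
  | nil => simp [Term.sum, Term.eval]
  | cons a l ih => exact congrArg (a.eval h ω + ·) ih

theorem contDiff_eval (hh : ∀ j, AnalyticOnNhd ℝ (h j) Set.univ) {E : Type*}
    [NormedAddCommGroup E] [NormedSpace ℝ E] {f : E → State}
    (hf : ∀ z, ContDiff ℝ 1 fun x => f x z) {e : Term k r} (he : e.DiffFree) :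
    ContDiff ℝ 1 fun x => e.eval h (f x) := by
  induction e with
  | var x => exact hf x
  | const c => exact contDiff_const
  | add e g h₁ h₂ => exact (h₁ he.1).add (h₂ he.2)
  | mul e g h₁ h₂ => exact (h₁ he.1).mul (h₂ he.2)
  | app j a ha => exact (hh j).contDiff.comp (contDiff_pi.2 fun i => ha i (he i))
  | diff e _ => exact he.elim

/-- The curve `b` solves the system near time `0`. -/
structure Sys.IsCurve (h : Fin r → (Fin k → ℝ) → ℝ) (s : Sys k r) (b : ℝ → State) : Prop where
  hasDerivAt : ∀ᶠ t in 𝓝 0, ∀ p ∈ s,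
    HasDerivAt (fun t => b t (Var.base p.1)) (p.2.eval h (b t)) t
  const : ∀ t z, z ∉ s.lhs → b t z = b 0 z

/-- Freezing all other variables at their values in `ω` leaves a vector field on a
finite-dimensional space. It is of class C¹ because the function symbols are analytic, so the
Picard–Lindelöf theorem applies on both sides of time zero. -/
theorem Sys.exists_isCurve (hh : ∀ j, AnalyticOnNhd ℝ (h j) Set.univ) {s : Sys k r} (hs : s.WF)
    (ω : State) : ∃ b, s.IsCurve h b ∧ b 0 = ω := by
  classical
  let st : (({z // z ∈ s.lhs}) → ℝ) → State := fun x z => if hz : z ∈ s.lhs then x ⟨z, hz⟩ else ω z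
  let F : (({z // z ∈ s.lhs}) → ℝ) → ({z // z ∈ s.lhs} → ℝ) := fun x z => match z.1 with
    | Var.base n => ((List.lookup n s).getD (Term.const 0)).eval h (st x)
    | Var.prime _ => 0
  have hst : ∀ z, ContDiff ℝ 1 fun x => st x z := fun z => by
    by_cases hz : z ∈ s.lhs
    · simp only [st, dif_pos hz]
      exact contDiff_apply ℝ ℝ _
    · simp only [st, dif_neg hz]
      exact contDiff_const
  have hF : ContDiff ℝ 1 F := by
    refine contDiff_pi.2 fun z => ?_
    obtain ⟨z, hz⟩ := z
    cases z with
    | base n =>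
      exact contDiff_eval hh hst (hs.2 _ (lookup_getD_mem (Sys.base_mem_lhs.1 hz)))
    | prime z => exact contDiff_const
  obtain ⟨α, h₀, ε, hε, hα⟩ := (hF.contDiffAt (x := fun z => ω z.1)
    ).exists_forall_mem_closedBall_exists_eq_forall_mem_Ioo_hasDerivAt₀ 0
  have h₁ : st (α 0) = ω := by
    funext z
    rw [h₀]
    by_cases hz : z ∈ s.lhs
    · simp only [st, dif_pos hz]
    · simp only [st, dif_neg hz]
  refine ⟨fun t => st (α t), ⟨?_, fun t z hz => ?_⟩, h₁⟩
  · filter_upwards [Ioo_mem_nhds (show (0 : ℝ) - ε < 0 by linarith)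
      (show 0 < (0 : ℝ) + ε by linarith)] with t ht p hp
    have hz : Var.base p.1 ∈ s.lhs := Sys.base_mem_lhs.2 (List.mem_map_of_mem hp)
    have h₂ := hasDerivAt_pi.1 (hα t ht) ⟨Var.base p.1, hz⟩
    simp only [F, lookup_of_mem hs.1 hp, Option.getD_some] at h₂
    simpa only [st, dif_pos hz] using h₂
  · simp only [st, dif_neg hz]

/-- A curve gives a run of the system. -/
theorem Sys.exists_rel_of_curve {s : Sys k r} (hs : s.WF) {Q : QF k r} (hQ : Q.DiffFree)
    {b : ℝ → State} {T : ℝ} (hT : 0 ≤ T)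
    (hb : ∀ t ∈ Set.Icc 0 T, ∀ p ∈ s,
      HasDerivAt (fun t => b t (Var.base p.1)) (p.2.eval h (b t)) t)
    (hc : ∀ t ∈ Set.Icc 0 T, ∀ z, z ∉ s.lhs → b t z = b 0 z)
    (hbQ : ∀ t ∈ Set.Icc 0 T, Q.holds h (b t)) :
    ∃ ν, (Act.ode s Q).rel h (b 0) ν ∧ ∀ n, ν (Var.base n) = b T (Var.base n) := by
  -- A run must also give each `x_i'` the value of its right-hand side. The curve is overwritten
  -- there; differential-free terms and formulas do not notice.
  let φ : ℝ → State := fun t z => match z with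
    | Var.base n => b t (Var.base n)
    | Var.prime z => if Var.prime z ∈ s.primes then match z with
      | Var.base n => ((List.lookup n s).getD (Term.const 0)).eval h (b t)
      | Var.prime _ => 0
      else b t (Var.prime z)
  have hφ : ∀ t n, φ t (Var.base n) = b t (Var.base n) := fun t n => rfl
  have hφ' : ∀ t z, z ∉ s.primes → φ t z = b t z := fun t z hz => by
    cases z with
    | base n => rfl
    | prime z => exact if_neg hz
  refine ⟨φ T, ⟨T, φ, hT, fun z hz => hφ' 0 z hz, rfl, fun t ht => ⟨fun z hz => ?_,
    fun p hp => ?_, (hQ.holds_congr (hφ t)).2 (hbQ t ht)⟩⟩, hφ T⟩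
  · rw [Finset.mem_union, not_or] at hz
    rw [hφ' t z hz.2]
    exact hc t ht z hz.1
  · have hp' : Var.prime (Var.base p.1) ∈ s.primes := by
      simp only [Sys.primes, Sys.vars, List.mem_toFinset, List.mem_map]
      exact ⟨p.1, ⟨p, hp, rfl⟩, rfl⟩
    have h₁ : φ t (Var.prime (Var.base p.1)) = p.2.eval h (b t) := by
      simp only [φ, if_pos hp', lookup_of_mem hs.1 hp, Option.getD_some]
    rw [h₁, (hs.2 p hp).eval_congr (hφ t)]
    exact ⟨(hb t ht p hp).hasDerivWithinAt, rfl⟩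

end Semantics

/-! ### Semantics of progress formulas along curves. -/

section Progress

variable {L : Lang} {s : Sys L.k L.r} {b : ℝ → State}

/-- Analyticity gives total differentiability, so the chain rule applies, and the chain condition
identifies the partial derivatives. -/
theorem hasDerivAt_app (hL : L.IsNoetherian) (j : Fin L.r) {u : ℝ → Fin L.k → ℝ}
    {u' : Fin L.k → ℝ} {t : ℝ} (hu : ∀ i, HasDerivAt (fun t => u t i) (u' i) t) :
    HasDerivAt (fun t => L.h j (u t)) (∑ i, (L.q j i).eval L.h (u t) * u' i) t := by
  have hd : HasFDerivAt (L.h j) (fderiv ℝ (L.h j) (u t)) (u t) :=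
    (hL.1 j (u t) (Set.mem_univ _)).differentiableAt.hasFDerivAt
  have hp : ∀ i, fderiv ℝ (L.h j) (u t) (Pi.single i 1) = (L.q j i).eval L.h (u t) := fun i => by
    refine HasDerivAt.unique ?_ (hL.2.2 j i (u t))
    refine HasFDerivAt.comp_hasDerivAt (f := fun x => Function.update (u t) i x) (u t i) ?_
      (hasDerivAt_update (u t) i (u t i))
    rwa [Function.update_eq_self]
  refine (hd.comp_hasDerivAt t (hasDerivAt_pi.2 hu)).congr_deriv ?_
  have := (fderiv ℝ (L.h j) (u t)).toLinearMap.pi_apply_eq_sum_univ u'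
  rw [ContinuousLinearMap.coe_coe] at this
  rw [this]
  refine Finset.sum_congr rfl fun i _ => ?_
  rw [← hp i, smul_eq_mul, mul_comm]
  congr 2
  funext x
  simp [Pi.single_apply, eq_comm]

theorem hasDerivAt_eval (hL : L.IsNoetherian) {t : ℝ}
    (hb : ∀ p ∈ s, HasDerivAt (fun t => b t (Var.base p.1)) (p.2.eval L.h (b t)) t)
    (hc : ∀ t z, z ∉ s.lhs → b t z = b 0 z) {e : Term L.k L.r} (he : e.DiffFree) :
    HasDerivAt (fun t => e.eval L.h (b t)) ((lie L s e).eval L.h (b t)) t := by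
  induction e with
  | var x => cases x with
    | base n =>
      by_cases hn : n ∈ s.vars
      · exact hb _ (lookup_getD_mem hn)
      · simp only [Term.eval, lie, lookup_of_notMem hn, Option.getD_none]
        refine HasDerivAt.congr_deriv (f' := 0) ?_ (by simp)
        have : (fun t => b t (Var.base n)) = fun _ => b 0 (Var.base n) :=
          funext fun t => hc t _ fun h => hn (Sys.base_mem_lhs.1 h)
        rw [this]
        exact hasDerivAt_const _ _
    | prime z => exact he.elim
  | const c =>
    refine HasDerivAt.congr_deriv (hasDerivAt_const t (c : ℝ)) ?_
    simp [lie, Term.eval]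
  | add e f h₁ h₂ => exact (h₁ he.1).add (h₂ he.2)
  | mul e f h₁ h₂ => exact (h₁ he.1).mul (h₂ he.2)
  | app j a ha =>
    refine (hasDerivAt_app hL j fun i => ha i (he i)).congr_deriv ?_
    simp only [lie, Term.eval_sum, List.map_map, Fin.sum_univ_def]
    congr 1
    refine List.map_congr_left fun i _ => ?_
    simp only [Function.comp_apply, Term.eval, PolyExpr.eval_inst (hL.2.1 j i)]
  | diff e _ => exact he.elim

/-- A differential radical identity that holds in real arithmetic. -/
def IsArithRank (L : Lang) (s : Sys L.k L.r) (e : Term L.k L.r) (N : ℕ) : Prop :=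
  1 ≤ N ∧ ∃ g : ℕ → Term L.k L.r, (∀ i, (g i).DiffFree) ∧
    ∀ ρ, (lieN L s N e).evalA ρ =
      (Term.sum ((List.range N).map fun i => Term.mul (g i) (lieN L s i e))).evalA ρ

theorem Sys.IsCurve.hasDerivAt_lieN (hL : L.IsNoetherian) (hs : s.WF) (hb : s.IsCurve L.h b)
    {e : Term L.k L.r} (he : e.DiffFree) (i : ℕ) : ∀ᶠ t in 𝓝 0,
      HasDerivAt (fun t => (lieN L s i e).eval L.h (b t))
        ((lieN L s (i + 1) e).eval L.h (b t)) t := by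
  filter_upwards [hb.hasDerivAt] with t ht
  rw [lieN_succ]
  exact hasDerivAt_eval hL ht hb.const (he.lieN hL.2.1 hs i)

/-- The semantic trichotomy: the first significant Lie derivative fixes the sign just after time
zero, and if the first `N` all vanish, the radical identity keeps the term at zero. -/
theorem Sys.IsCurve.eventually_sign (hL : L.IsNoetherian) (hs : s.WF) (hb : s.IsCurve L.h b)
    {e : Term L.k L.r} (he : e.DiffFree) {N : ℕ} (hN : IsArithRank L s e N) :
    ((progGt L s N e).holds L.h (b 0) ∧ ∀ᶠ t in 𝓝[>] 0, 0 < e.eval L.h (b t)) ∨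
    ((radical L s N e).holds L.h (b 0) ∧ ¬ (progGt L s N e).holds L.h (b 0) ∧
      ∀ᶠ t in 𝓝[>] 0, e.eval L.h (b t) = 0) ∨
    (¬ (progGe L s N e).holds L.h (b 0) ∧ ¬ (progGt L s N e).holds L.h (b 0) ∧
      ∀ᶠ t in 𝓝[>] 0, e.eval L.h (b t) < 0) := by
  obtain ⟨hN₁, g, hg, hN⟩ := hN
  have hd := hb.hasDerivAt_lieN hL hs he
  have hgt : (progGt L s N e).holds L.h (b 0) ↔ ∃ k < N,
      (∀ i < k, (lieN L s i e).eval L.h (b 0) = 0) ∧ 0 < (lieN L s k e).eval L.h (b 0) := by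
    rw [QF.holds_iff_val, val_progGt s hN₁]
    simp only [← Term.eval_eq_evalA]
  have hrad : (radical L s N e).holds L.h (b 0) ↔
      ∀ i < N, (lieN L s i e).eval L.h (b 0) = 0 := by
    rw [QF.holds_iff_val, val_radical]
    simp only [← Term.eval_eq_evalA]
  rcases forall_eq_zero_or_exists_first (fun i => (lieN L s i e).eval L.h (b 0)) N with
    h₀ | ⟨k, hk, h₀, hpos | hneg⟩
  · refine Or.inr (Or.inl ⟨hrad.2 h₀, fun h => ?_, ?_⟩)
    · obtain ⟨k, hk, -, h⟩ := hgt.1 h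
      exact h.ne' (h₀ k hk)
    · refine eventually_eq_zero_of_linear_relation hd (g := fun i t => (g i).eval L.h (b t))
        (fun i => ?_) hN₁ (fun t => ?_) h₀
      · exact (hasDerivAt_eval hL hb.hasDerivAt.self_of_nhds hb.const (hg i)).continuousAt
      · rw [Term.eval_eq_evalA, hN, ← Term.eval_eq_evalA, Term.eval_sum, List.map_map,
          ← sum_map_range]
        rfl
  · exact Or.inl ⟨hgt.2 ⟨k, hk, h₀, hpos⟩, eventually_pos_of_first_pos hd k h₀ hpos⟩
  · have hn : ¬ (progGt L s N e).holds L.h (b 0) := fun h => by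
      obtain ⟨m, hm, h₁, h₂⟩ := hgt.1 h
      rcases lt_trichotomy m k with hlt | rfl | hlt
      · exact h₂.ne' (h₀ m hlt)
      · exact lt_asymm h₂ hneg
      · exact hneg.ne (h₁ k hlt)
    refine Or.inr (Or.inr ⟨fun h => ?_, hn, ?_⟩)
    · exact h.elim hn fun h => hneg.ne (hrad.1 h k hk)
    · have := eventually_pos_of_first_pos (a := fun i t => -(lieN L s i e).eval L.h (b t))
        (fun i => (hd i).mono fun t ht => ht.neg) k (fun i hi => by simp [h₀ i hi]) (by linarith)
      filter_upwards [this] with t ht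
      exact neg_pos.1 ht

/-- Along a curve, the formula `A` is true immediately after time `0` if `F` is true at time `0`,
and false otherwise. -/
def Foretells (h : Fin L.r → (Fin L.k → ℝ) → ℝ) (b : ℝ → State) (F A : QF L.k L.r) : Prop :=
  (F.holds h (b 0) ∧ ∀ᶠ t in 𝓝[>] 0, A.holds h (b t)) ∨
    (¬ F.holds h (b 0) ∧ ∀ᶠ t in 𝓝[>] 0, ¬ A.holds h (b t))

variable {F G A B : QF L.k L.r}

theorem Foretells.and (h₁ : Foretells L.h b F A) (h₂ : Foretells L.h b G B) :
    Foretells L.h b (F.and G) (A.and B) := by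
  rcases h₁ with h₁ | h₁
  · rcases h₂ with h₂ | h₂
    · exact Or.inl ⟨⟨h₁.1, h₂.1⟩, h₁.2.and h₂.2⟩
    · exact Or.inr ⟨fun h => h₂.1 h.2, h₂.2.mono fun t ht h => ht h.2⟩
  · exact Or.inr ⟨fun h => h₁.1 h.1, h₁.2.mono fun t ht h => ht h.1⟩

theorem Foretells.or (h₁ : Foretells L.h b F A) (h₂ : Foretells L.h b G B) :
    Foretells L.h b (F.or G) (A.or B) := by
  rcases h₁ with h₁ | h₁
  · exact Or.inl ⟨Or.inl h₁.1, h₁.2.mono fun t ht => Or.inl ht⟩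
  · rcases h₂ with h₂ | h₂
    · exact Or.inl ⟨Or.inr h₂.1, h₂.2.mono fun t ht => Or.inr ht⟩
    · exact Or.inr ⟨fun h => h.elim h₁.1 h₂.1,
        (h₁.2.and h₂.2).mono fun t ht h => h.elim ht.1 ht.2⟩

theorem Foretells.conj {ι : Type*} {l : List ι} {F A : ι → QF L.k L.r}
    (h : ∀ i ∈ l, Foretells L.h b (F i) (A i)) :
    Foretells L.h b (QF.conj (l.map F)) (QF.conj (l.map A)) := by
  induction l with
  | nil =>
    refine Or.inl ⟨?_, Eventually.of_forall fun t => ?_⟩ <;>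
    exact (QF.holds_iff_val QF.tru _).2 (QF.val_tru _)
  | cons i l ih => exact (h i (by simp)).and (ih fun j hj => h j (by simp [hj]))

theorem Foretells.disj {ι : Type*} {l : List ι} {F A : ι → QF L.k L.r}
    (h : ∀ i ∈ l, Foretells L.h b (F i) (A i)) :
    Foretells L.h b (QF.disj (l.map F)) (QF.disj (l.map A)) := by
  induction l with
  | nil =>
    refine Or.inr ⟨?_, Eventually.of_forall fun t => ?_⟩ <;>
    exact fun h => QF.val_fls _ ((QF.holds_iff_val QF.fls _).1 h)
  | cons i l ih => exact (h i (by simp)).or (ih fun j hj => h j (by simp [hj]))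

theorem Foretells.congr (h : Foretells L.h b F A) (hAB : ∀ ω, B.holds L.h ω ↔ A.holds L.h ω) :
    Foretells L.h b F B := by
  simpa only [Foretells, hAB] using h

theorem foretells_prog (hL : L.IsNoetherian) (hs : s.WF) (hb : s.IsCurve L.h b)
    {D : DNF L.k L.r} (hD : D.DiffFree) {ρ : Term L.k L.r → ℕ}
    (hρ : ∀ e : Term L.k L.r, e.DiffFree → IsArithRank L s e (ρ e)) :
    Foretells L.h b (prog L s ρ D) D.toQF := by
  refine Foretells.disj fun p hp => Foretells.and (Foretells.conj fun e he => ?_)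
    (Foretells.conj fun e he => ?_)
  · have he := (hD p hp).1 e he
    rcases hb.eventually_sign hL hs he (hρ e he) with h | h | h
    · exact Or.inl ⟨Or.inl h.1, h.2.mono fun t ht => by
        simpa [QF.holds, QF.geZ, Cmp.rel, Term.eval] using ht.le⟩
    · exact Or.inl ⟨Or.inr h.1, h.2.2.mono fun t ht => by
        simp [QF.holds, QF.geZ, Cmp.rel, Term.eval, ht]⟩
    · exact Or.inr ⟨h.1, h.2.2.mono fun t ht => by
        simpa [QF.holds, QF.geZ, Cmp.rel, Term.eval] using ht⟩
  · have he := (hD p hp).2 e he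
    rcases hb.eventually_sign hL hs he (hρ e he) with h | h | h
    · exact Or.inl ⟨h.1, h.2.mono fun t ht => by
        simpa [QF.holds, QF.gtZ, Cmp.rel, Term.eval] using ht⟩
    · exact Or.inr ⟨h.2.1, h.2.2.mono fun t ht => by
        simp [QF.holds, QF.gtZ, Cmp.rel, Term.eval, ht]⟩
    · exact Or.inr ⟨h.2.1, h.2.2.mono fun t ht => by
        simpa [QF.holds, QF.gtZ, Cmp.rel, Term.eval] using ht.le⟩

end Progress

end DL

namespace DL

open Filter Topology

/-! ### Validity of the progress conditions and derivability of invariants. -/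

section Invariants

variable {L : Lang} {s : Sys L.k L.r} {P Q : QF L.k L.r} {DP DN DQ : DNF L.k L.r}
  {ρ ρ' : Term L.k L.r → ℕ}

theorem exists_Ioc_of_eventually {p : ℝ → Prop} (h : ∀ᶠ t in 𝓝[>] 0, p t) :
    ∃ T > 0, ∀ t ∈ Set.Ioc 0 T, p t := by
  obtain ⟨T, hT, hsub⟩ := mem_nhdsGT_iff_exists_Ioc_subset.1 h
  exact ⟨T, hT, fun t ht => hsub ht⟩

/-- A short piece of the curve is a run within `Q` from a state of `P`; invariance forbids that it
ends outside `P`. -/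
theorem not_eventually_of_invariant (hs : s.WF) (hP : P.DiffFree) (hQ : Q.DiffFree)
    (hinv : (Fml.imp P.toF (Fml.box (Act.ode s Q) P.toF)).Valid L.h) {b : ℝ → State}
    (hb : s.IsCurve L.h b) (h₀ : P.holds L.h (b 0)) (hQ₀ : Q.holds L.h (b 0))
    (hQ' : ∀ᶠ t in 𝓝[>] 0, Q.holds L.h (b t)) :
    ¬ ∀ᶠ t in 𝓝[>] 0, ¬ P.holds L.h (b t) := by
  intro hP'
  obtain ⟨T, hT, hall⟩ := exists_Ioc_of_eventually
    ((hb.hasDerivAt.filter_mono nhdsWithin_le_nhds).and (hQ'.and hP'))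
  have hcl : ∀ t ∈ Set.Icc 0 T, (∀ p ∈ s,
      HasDerivAt (fun t => b t (Var.base p.1)) (p.2.eval L.h (b t)) t) ∧ Q.holds L.h (b t) :=
    fun t ht => by
      rcases ht.1.eq_or_lt with rfl | h
      · exact ⟨hb.hasDerivAt.self_of_nhds, hQ₀⟩
      · exact ⟨(hall t ⟨h, ht.2⟩).1, (hall t ⟨h, ht.2⟩).2.1⟩
  obtain ⟨ν, hν, hν'⟩ := Sys.exists_rel_of_curve hs hQ hT.le (fun t ht => (hcl t ht).1)
    (fun t _ => hb.const t) fun t ht => (hcl t ht).2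
  have := (hinv (b 0)).resolve_left (not_not.2 ((QF.holds_toF P _).2 h₀)) ν hν
  rw [QF.holds_toF, hP.holds_congr hν'] at this
  exact (hall T ⟨hT, le_rfl⟩).2.2 this

/-- Reading the curve of `x' = -f` backward in time gives a run of `x' = f` from a state of `P` to a
state outside `P`. -/
theorem not_eventually_neg_of_invariant (hs : s.WF) (hP : P.DiffFree) (hQ : Q.DiffFree)
    (hinv : (Fml.imp P.toF (Fml.box (Act.ode s Q) P.toF)).Valid L.h) {b : ℝ → State}
    (hb : s.neg.IsCurve L.h b) (h₀ : ¬ P.holds L.h (b 0)) (hQ₀ : Q.holds L.h (b 0))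
    (hQ' : ∀ᶠ t in 𝓝[>] 0, Q.holds L.h (b t)) :
    ¬ ∀ᶠ t in 𝓝[>] 0, P.holds L.h (b t) := by
  intro hP'
  obtain ⟨T, hT, hall⟩ := exists_Ioc_of_eventually
    ((hb.hasDerivAt.filter_mono nhdsWithin_le_nhds).and (hQ'.and hP'))
  have hcl : ∀ t ∈ Set.Icc 0 T, (∀ p ∈ s.neg,
      HasDerivAt (fun t => b t (Var.base p.1)) (p.2.eval L.h (b t)) t) ∧ Q.holds L.h (b t) :=
    fun t ht => by
      rcases ht.1.eq_or_lt with rfl | h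
      · exact ⟨hb.hasDerivAt.self_of_nhds, hQ₀⟩
      · exact ⟨(hall t ⟨h, ht.2⟩).1, (hall t ⟨h, ht.2⟩).2.1⟩
  -- The substitution `t ↦ T - t` changes the sign of the derivative and exchanges the end points.
  have hrev : ∀ t ∈ Set.Icc 0 T, T - t ∈ Set.Icc 0 T := fun t ht =>
    ⟨by linarith [ht.2], by linarith [ht.1]⟩
  have hlhs : s.neg.lhs = s.lhs := by rw [Sys.lhs, Sys.lhs, Sys.vars_neg]
  have hc : ∀ t z, z ∉ s.lhs → b t z = b 0 z := fun t z hz => hb.const t z (by rwa [hlhs])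
  have hd : ∀ t ∈ Set.Icc 0 T, ∀ p ∈ s, HasDerivAt (fun t => b (T - t) (Var.base p.1))
      (p.2.eval L.h (b (T - t))) t := fun t ht p hp => by
    have h₁ := (hcl _ (hrev t ht)).1 (p.1, p.2.neg) (List.mem_map_of_mem hp)
    refine (HasDerivAt.comp t h₁ ((hasDerivAt_id t).const_sub T)).congr_deriv ?_
    simp [Term.neg, Term.eval]
  obtain ⟨ν, hν, hν'⟩ := Sys.exists_rel_of_curve (b := fun t => b (T - t)) hs hQ hT.le hd
    (fun t _ z hz => (hc _ z hz).trans (hc _ z hz).symm) fun t ht => (hcl _ (hrev t ht)).2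
  have hPT : P.holds L.h (b (T - 0)) := by
    rw [sub_zero]
    exact (hall T ⟨hT, le_rfl⟩).2.2
  have := (hinv (b (T - 0))).resolve_left (not_not.2 ((QF.holds_toF P _).2 hPT)) ν hν
  rw [QF.holds_toF, hP.holds_congr hν', sub_self] at this
  exact h₀ this

theorem IsNormalForm.exists_of_diffFree (L : Lang) {A : QF L.k L.r} (hA : A.DiffFree) :
    ∃ D : DNF L.k L.r, IsNormalForm L A D ∧ ∀ ω, A.holds L.h ω ↔ D.toQF.holds L.h ω := by
  obtain ⟨D, hD⟩ := exists_dnf hA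
  refine ⟨D, isNormalForm_of_val hD, fun ω => ?_⟩
  rw [QF.holds_iff_val, QF.holds_iff_val]
  exact hD.2 _

theorem exists_isArithRank (hL : L.Closed) (hs : s.WF) : ∃ ρ : Term L.k L.r → ℕ,
    ∀ e : Term L.k L.r, e.DiffFree → IsArithRank L s e (ρ e) := by
  have : ∀ e : Term L.k L.r, ∃ N, e.DiffFree → IsArithRank L s e N := fun e => by
    by_cases he : e.DiffFree
    · obtain ⟨N, hN⟩ := exists_rank_evalA hL hs he
      exact ⟨N, fun _ => hN⟩
    · exact ⟨0, fun h => absurd h he⟩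
  choose ρ hρ using this
  exact ⟨ρ, hρ⟩

theorem QF.holds_imp {k r : ℕ} {h : Fin r → (Fin k → ℝ) → ℝ} {A B : QF k r} {ω : State} :
    (QF.imp A B).holds h ω ↔ (A.holds h ω → B.holds h ω) := imp_iff_not_or.symm

/-- If the conclusion failed at some state, the progress formulas would foretell along the solution
through it that `Q` holds and `P` fails immediately afterwards. -/
theorem valid_progress_of_invariant (hL : L.IsNoetherian) (hs : s.WF) (hP : P.DiffFree)
    (hQ : Q.DiffFree) (hinv : (Fml.imp P.toF (Fml.box (Act.ode s Q) P.toF)).Valid L.h)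
    (hDP : DP.DiffFree) (hDQ : DQ.DiffFree) (eP : ∀ ω, P.holds L.h ω ↔ DP.toQF.holds L.h ω)
    (eQ : ∀ ω, Q.holds L.h ω ↔ DQ.toQF.holds L.h ω)
    (hρ : ∀ e : Term L.k L.r, e.DiffFree → IsArithRank L s e (ρ e)) (ω : State) :
    (QF.imp (QF.and P (QF.and Q (prog L s ρ DQ))) (prog L s ρ DP)).holds L.h ω := by
  rw [QF.holds_imp]
  rintro ⟨h₁, h₂, h₃⟩
  by_contra hn
  obtain ⟨b, hb, rfl⟩ := Sys.exists_isCurve hL.1 hs ω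
  have fP := (foretells_prog hL hs hb hDP hρ).congr eP
  have fQ := (foretells_prog hL hs hb hDQ hρ).congr eQ
  exact not_eventually_of_invariant hs hP hQ hinv hb h₁ h₂ (fQ.resolve_right fun h => h.1 h₃).2
    (fP.resolve_left fun h => hn h.1).2

theorem valid_neg_progress_of_invariant (hL : L.IsNoetherian) (hs : s.WF) (hP : P.DiffFree)
    (hQ : Q.DiffFree) (hinv : (Fml.imp P.toF (Fml.box (Act.ode s Q) P.toF)).Valid L.h)
    (hDN : DN.DiffFree) (hDQ : DQ.DiffFree) (eN : ∀ ω, P.not.holds L.h ω ↔ DN.toQF.holds L.h ω)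
    (eQ : ∀ ω, Q.holds L.h ω ↔ DQ.toQF.holds L.h ω)
    (hρ : ∀ e : Term L.k L.r, e.DiffFree → IsArithRank L s.neg e (ρ e)) (ω : State) :
    (QF.imp (QF.and P.not (QF.and Q (prog L s.neg ρ DQ))) (prog L s.neg ρ DN)).holds L.h ω := by
  rw [QF.holds_imp]
  rintro ⟨h₁, h₂, h₃⟩
  by_contra hn
  obtain ⟨b, hb, rfl⟩ := Sys.exists_isCurve hL.1 hs.neg ω
  have fN := (foretells_prog hL hs.neg hb hDN hρ).congr eN
  have fQ := (foretells_prog hL hs.neg hb hDQ hρ).congr eQ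
  exact not_eventually_neg_of_invariant hs hP hQ hinv hb h₁ h₂
    (fQ.resolve_right fun h => h.1 h₃).2
    ((fN.resolve_left fun h => hn h.1).2.mono fun t ht => not_not.1 ht)

theorem Deriv.allVec {T : Set (Fml L.k L.r)} (xs : List ℕ) {φ : Fml L.k L.r}
    (h : Deriv L T [] φ) : Deriv L T [] (Fml.allVec xs φ) := by
  induction xs with
  | nil => exact h
  | cons x xs ih => exact Deriv.all_intro (by simp) ih

/-- Normal forms and ranks are chosen by polynomial arithmetic, so they are known to be correct
semantically as well as provably. Soundness of the calculus is therefore never needed. -/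
theorem deriv_invariant (hL : L.IsNoetherian) (hs : s.WF) (hP : P.DiffFree) (hQ : Q.DiffFree)
    (hinv : (Fml.imp P.toF (Fml.box (Act.ode s Q) P.toF)).Valid L.h) :
    Deriv L (ValidArith L) [] (Fml.imp P.toF (Fml.box (Act.ode s Q) P.toF)) := by
  have hLc : L.Closed := hL.2.1
  obtain ⟨DP, hDP, eP⟩ := IsNormalForm.exists_of_diffFree L hP
  obtain ⟨DN, hDN, eN⟩ := IsNormalForm.exists_of_diffFree L (A := P.not) hP
  obtain ⟨DQ, hDQ, eQ⟩ := IsNormalForm.exists_of_diffFree L hQ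
  obtain ⟨ρ, hρ⟩ := exists_isArithRank hLc hs
  obtain ⟨ρ', hρ'⟩ := exists_isArithRank hLc hs.neg
  have hr : IsRankFun L s ρ := fun e he => hasRank_of_evalA (hρ e he)
  have hr' : IsRankFun L s.neg ρ' := fun e he => hasRank_of_evalA (hρ' e he)
  have h₁ : Deriv L (ValidArith L) [] (QF.imp (QF.and P (QF.and Q (prog L s ρ DQ)))
      (prog L s ρ DP)).toF := Deriv.theory ⟨QF.imp (QF.and P (QF.and Q _)) _, ⟨⟨hP, hQ, diffFree_prog hLc hs hDQ.1 _⟩,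
    diffFree_prog hLc hs hDP.1 _⟩, fun ω => (QF.holds_toF _ ω).2
      (valid_progress_of_invariant hL hs hP hQ hinv hDP.1 hDQ.1 eP eQ hρ ω), rfl⟩
  have h₂ : Deriv L (ValidArith L) [] (QF.imp (QF.and P.not (QF.and Q (prog L s.neg ρ' DQ)))
      (prog L s.neg ρ' DN)).toF := Deriv.theory ⟨QF.imp (QF.and P.not (QF.and Q _)) _, ⟨⟨hP, hQ, diffFree_prog hLc hs.neg hDQ.1 _⟩,
    diffFree_prog hLc hs.neg hDN.1 _⟩, fun ω => (QF.holds_toF _ ω).2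
      (valid_neg_progress_of_invariant hL hs hP hQ hinv hDN.1 hDQ.1 eN eQ hρ' ω), rfl⟩
  have h₃ := (provable_invariant_iff_progress hLc hs hP hQ hDP hDN hDQ hr hr').val₂
    (provable_allVec_self s.vars (Fml.imp P.toF (Fml.box (Act.ode s Q) P.toF)))
    (φ := Fml.imp (Fml.and (Fml.allVec s.vars _) (Fml.allVec s.vars _)) _) fun ρ₀ v a₁ a₂ => by
      rw [Fml.val_iff] at a₁
      rw [Fml.val_imp] at a₂ ⊢
      exact fun h => a₂ (a₁.2 h)
  exact Deriv.cut (Deriv.andR (h₁.allVec s.vars) (h₂.allVec s.vars))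
    (Deriv.of_imp (Deriv.mono (Set.empty_subset _) h₃))

end Invariants

end DL
theorem mainTheorem10 (L : DL.Lang) (hL : L.IsNoetherian) :
    -- every term has a provable differential radical identity along every system
    (∀ s : DL.Sys L.k L.r, s.WF → ∀ e : DL.Term L.k L.r, e.DiffFree → ∃ N, DL.HasRank L s e N) ∧
    -- every semianalytic formula has a provably equivalent normal form
    (∀ P : DL.QF L.k L.r, P.DiffFree → ∃ D, DL.IsNormalForm L P D) ∧
    -- every analytic formula is provably equivalent to a single equation
    (∀ P : DL.QF L.k L.r, P.DiffFree → P.Analytic →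
      ∃ e : DL.Term L.k L.r, e.DiffFree ∧ DL.Provable L (DL.Fml.iff P.toF (DL.QF.eqZ e).toF)) ∧
    -- analytic postconditions, domains formed from strict inequalities
    (∀ s : DL.Sys L.k L.r, s.WF → ∀ (P Q : DL.QF L.k L.r) (e : DL.Term L.k L.r) (N : ℕ),
      P.DiffFree → P.Analytic → e.DiffFree →
      DL.Provable L (DL.Fml.iff P.toF (DL.QF.eqZ e).toF) → DL.HasRank L s e N →
      Q.DiffFree → Q.Strict →
      DL.Provable L (DL.Fml.iff (DL.Fml.box (DL.Act.ode s Q) P.toF)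
        (DL.QF.imp Q (DL.radical L s N e)).toF)) ∧
    -- analytic postconditions, semianalytic domains
    (∀ s : DL.Sys L.k L.r, s.WF → ∀ (P Q : DL.QF L.k L.r) (e : DL.Term L.k L.r) (N : ℕ)
      (DQ : DL.DNF L.k L.r) (ρ : DL.Term L.k L.r → ℕ),
      P.DiffFree → P.Analytic → e.DiffFree →
      DL.Provable L (DL.Fml.iff P.toF (DL.QF.eqZ e).toF) → DL.HasRank L s e N →
      Q.DiffFree → DL.IsNormalForm L Q DQ → DL.IsRankFun L s ρ →
      DL.Provable L (DL.Fml.iff (DL.Fml.box (DL.Act.ode s Q) P.toF)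
        (DL.QF.imp Q (DL.QF.and (DL.QF.eqZ e)
          (DL.QF.imp (DL.prog L s ρ DQ) (DL.radical L s N e)))).toF)) ∧
    -- semianalytic invariants without domain
    (∀ s : DL.Sys L.k L.r, s.WF → ∀ (P : DL.QF L.k L.r) (DP DnP : DL.DNF L.k L.r)
      (ρ ρ' : DL.Term L.k L.r → ℕ),
      P.DiffFree → DL.IsNormalForm L P DP → DL.IsNormalForm L P.not DnP →
      DL.IsRankFun L s ρ → DL.IsRankFun L s.neg ρ' →
      DL.Provable L (DL.Fml.iff
        (DL.Fml.allVec s.vars (DL.Fml.imp P.toF (DL.Fml.box (DL.Act.ode s DL.QF.tru) P.toF)))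
        (DL.Fml.and
          (DL.Fml.allVec s.vars (DL.QF.imp P (DL.prog L s ρ DP)).toF)
          (DL.Fml.allVec s.vars (DL.QF.imp P.not (DL.prog L s.neg ρ' DnP)).toF)))) ∧
    -- semianalytic invariants with semianalytic domains
    (∀ s : DL.Sys L.k L.r, s.WF → ∀ (P Q : DL.QF L.k L.r) (DP DnP DQ : DL.DNF L.k L.r)
      (ρ ρ' : DL.Term L.k L.r → ℕ),
      P.DiffFree → Q.DiffFree → DL.IsNormalForm L P DP → DL.IsNormalForm L P.not DnP →
      DL.IsNormalForm L Q DQ → DL.IsRankFun L s ρ → DL.IsRankFun L s.neg ρ' →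
      DL.Provable L (DL.Fml.iff
        (DL.Fml.allVec s.vars (DL.Fml.imp P.toF (DL.Fml.box (DL.Act.ode s Q) P.toF)))
        (DL.Fml.and
          (DL.Fml.allVec s.vars
            (DL.QF.imp (DL.QF.and P (DL.QF.and Q (DL.prog L s ρ DQ))) (DL.prog L s ρ DP)).toF)
          (DL.Fml.allVec s.vars
            (DL.QF.imp (DL.QF.and P.not (DL.QF.and Q (DL.prog L s.neg ρ' DQ)))
              (DL.prog L s.neg ρ' DnP)).toF)))) ∧
    -- every semianalytic (in particular, every analytic) invariant is derivable from valid
    -- semianalytic formulas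
    (∀ s : DL.Sys L.k L.r, s.WF → ∀ P Q : DL.QF L.k L.r, P.DiffFree → Q.DiffFree →
      (DL.Fml.imp P.toF (DL.Fml.box (DL.Act.ode s Q) P.toF)).Valid L.h →
      DL.Deriv L (DL.ValidArith L) [] (DL.Fml.imp P.toF (DL.Fml.box (DL.Act.ode s Q) P.toF))) := by
  have hLc : L.Closed := hL.2.1
  refine ⟨fun s hs e he => ?_, fun P hP => ?_, fun P hP hA => ?_,
    fun s hs P Q e N hP _ he hPe hN hQ hQs => ?_,
    fun s hs P Q e N DQ ρ hP _ he hPe hN hQ hDQ hρ => ?_,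
    fun s hs P DP DN ρ ρ' hP hDP hDN hρ hρ' => ?_,
    fun s hs P Q DP DN DQ ρ ρ' hP hQ hDP hDN hDQ hρ hρ' => ?_,
    fun s hs P Q hP hQ hinv => ?_⟩
  · obtain ⟨N, hN⟩ := DL.exists_rank_evalA hLc hs he
    exact ⟨N, DL.hasRank_of_evalA hN⟩
  · obtain ⟨D, hD⟩ := DL.exists_dnf hP
    exact ⟨D, DL.isNormalForm_of_val hD⟩
  · obtain ⟨e, he, h⟩ := DL.exists_eqZ_of_analytic hP hA
    refine ⟨e, he, DL.Provable.val₀ fun ρ v => ?_⟩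
    simp only [DL.Fml.val_iff, DL.Fml.val_toF, DL.QF.val_eqZ, h]
  · exact DL.provable_analytic_iff_of_strict hLc hs hP he hPe hN hQ hQs
  · exact DL.provable_analytic_iff hLc hs hP he hPe hN hQ hDQ hρ
  · exact DL.provable_invariant_iff_progress_tru hLc hs hP hDP hDN hρ hρ'
  · exact DL.provable_invariant_iff_progress hLc hs hP hQ hDP hDN hDQ hρ hρ'
  · exact DL.deriv_invariant hL hs hP hQ hinv
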